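/- Conventions. A \emph{descent category} is a category $\mathcal D$ with finite products, a class $\mathrm E$ of morphisms (\emph{equivalences}), a functor $\mathbf s:\Delta\mathcal D\to\mathcal D$ on cosimplicial objects (the \emph{simple} functor) and natural transformations $\mu:\mathbf s\mathbf s\to\mathbf s\mathrm D$ ($\mathrm D$ the diagonal of bicosimplicial objects) and $\lambda:\mathrm{id}\to\mathbf s c$ ($c$ the constant cosimplicial object) such that: $\mathrm E$ is saturated (a morphism that becomes invertible in $\mathcal D[\mathrm E^{-1}]$ is in $\mathrm E$) and closed under finite products; $\mathbf s(X\times Y)\to\mathbf sX\times\mathbf sY$ is in $\mathrm E$; $\mu_Z,\lambda_A\in\mathrm E$ for all $Z,A$; $\lambda$ and $\mu$ are compatible (the composites $\mathbf sX\to\mathbf s(c\,\mathbf sX)\to\mathbf sX$ and $\mathbf sX\to\mathbf s(n\mapsto\mathbf s(cX^n))\to\mathbf sX$ made from $\lambda$ and $\mu$ are identities); $\mathbf s$ sends degree-wise equivalences to equivalences; and $\mathbf s(A^{\Delta[1]})\to\mathbf s(A^{\Delta[0]})$ is in $\mathrm E$ for every $A$. It is a \emph{monoidal} descent category if $\mathcal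 D$ is symmetric monoidal, $\mathbf s$ is a lax symmetric monoidal functor (for the degree-wise tensor product of cosimplicial objects), and $\lambda,\mu$ are monoidal transformations. Let $\mathcal X$ be a small Grothendieck site with a set $X$ of points, and let $\mathcal D$ be a descent category with filtered colimits and products. Put $\mathcal F_x=\varinjlim_{(U,u)}\mathcal F(U)$, $p^*\mathcal F=(\mathcal F_x)_{x\in X}$, $(p_*M)(U)=\prod_{x\in X}\prod_{u\in x^*U}M_x$; let $G^\bullet\mathcal F$, $G^p\mathcal F=T^{p+1}\mathcal F$, be the cosimplicial resolution by the monad $T=p_*p^*$, put $\mathbb H_{\mathcal X}(\mathcal F)=\mathbf sG^\bullet\mathcal F$ (with $\mathbf s$ applied object-wise), and let $\rho_{\mathcal F}:\mathcal F\to\mathbb H_{\mathcal X}(\mathcal F)$ be the morphism given by $\lambda$ and the coaugmentation of $G^\bullet\mathcal F$. Let $\mathcal S$ and $\mathcal W$ be the classes of morphisms of sheaves $f$ with $f(U)\in\mathrm E$ for all objects $U$, resp. $f_x\in\mathrm E$ for all $x\in X$. A sheaf $\mathcal M$ is \emph{CE-fibrant} if each $w:\mathcal Y\to\mathcal Z$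 in $\mathcal W$ induces a bijection $w^*:\mathrm{Sh}[\mathcal S^{-1}](\mathcal Z,\mathcal M)\to\mathrm{Sh}[\mathcal S^{-1}](\mathcal Y,\mathcal M)$; a \emph{CE-fibrant model} of $\mathcal F$ is a morphism $\mathcal F\to\mathcal M$ of $\mathrm{Sh}[\mathcal S^{-1}]$, with $\mathcal M$ CE-fibrant, that becomes invertible in $\mathrm{Sh}[\mathcal W^{-1}]$; $(\mathrm{Sh},\mathcal S,\mathcal W)$ is a \emph{right Cartan--Eilenberg category} if morphisms of $\mathcal S$ become invertible in $\mathrm{Sh}[\mathcal W^{-1}]$ and every sheaf has a CE-fibrant model. We call $(\mathcal X,\mathcal D)$ \emph{compatible} if (G0) $X$ is a set of enough points for $\mathcal X$; (G1) $\mathcal D$ has filtered colimits and arbitrary products; (G2) filtered colimits and arbitrary products in $\mathcal D$ preserve equivalences; and $\mathbb H_{\mathcal X}(\mathcal F)$ is a sheaf (for every presheaf $\mathcal F$), $(\mathrm{Sh}(\mathcal X,\mathcal D),\mathcal S,\mathcal W)$ is a right Cartan--Eilenberg category, and $\rho_{\mathcal F}:\mathcal F\to\mathbb H_{\mathcal X}(\mathcal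 F)$ is a CE-fibrant model for every sheaf $\mathcal F$. Theorem. Let $\mathcal D$ be a monoidal descent category such that $(\mathcal X,\mathcal D)$ is compatible, and assume moreover (G3) for every object $A$ of $\mathcal D$ the functor $A\otimes-$ preserves filtered colimits. Let $\mathrm{Op}^{\mathcal D}$ be the category of symmetric unital operads in $\mathcal D$ (with arities $l\ge1$), $\mathrm{Alg}^{\mathcal D}$ the category of pairs of an operad and an algebra over it, and $\mathrm{Alg}^{\mathcal D}_P$ the category of algebras over a fixed operad $P$. Then each of $\mathrm{Op}^{\mathcal D}$, $\mathrm{Alg}^{\mathcal D}$ and, for every operad $P$, $\mathrm{Alg}^{\mathcal D}_P$ has a descent structure which is induced by that of $\mathcal D$: products and filtered colimits, equivalences, $\mathbf s$, $\mu$ and $\lambda$ are computed on underlying objects (arity-wise for operads; on the operad and the underlying object for $\mathrm{Alg}^{\mathcal D}$; on the underlying object for $\mathrm{Alg}^{\mathcal D}_P$), and the operad or algebra structure of a simple object is induced through the Künneth morphisms of $\mathbf s$ (and, for $\mathrm{Alg}^{\mathcal D}_P$, through $\lambda_{P(l)}:P(l)\to\mathbf s(cP(l))$). With these structures $(\mathcal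 X,\mathrm{Op}^{\mathcal D})$, $(\mathcal X,\mathrm{Alg}^{\mathcal D})$ and $(\mathcal X,\mathrm{Alg}^{\mathcal D}_P)$ are compatible. In particular $\rho_{\mathcal F}:\mathcal F\to\mathbb H_{\mathcal X}(\mathcal F)$ is a CE-fibrant model for every sheaf $\mathcal F$ of operads, of algebras over variable operads, and of $P$-algebras. -/

import Mathlib

open CategoryTheory MonoidalCategory Limits Opposite

universe w v u v₁ u₁ v₂ u₂

namespace GodementOperads

theorem finRange_perm_map {l m : ℕ} (σ : Fin l ≃ Fin m) :
    (List.finRange m).Perm ((List.finRange l).map σ) := by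
  refine (List.perm_ext_iff_of_nodup (List.nodup_finRange m)
    ((List.nodup_map_iff σ.injective).2 (List.nodup_finRange l))).2 fun a => ?_
  exact ⟨fun _ => List.mem_map.2 ⟨σ.symm a, List.mem_finRange _, σ.apply_symm_apply a⟩,
    fun _ => List.mem_finRange _⟩

theorem flatMap_perm_map {l : ℕ} (m : Fin l → ℕ) :
    ((List.finRange l).flatMap fun i => (List.finRange (m i)).map (Sigma.mk i)).Perm
      ((List.finRange (∑ i, m i)).map (finSigmaFinEquiv (n := m)).symm) := by
  refine (List.perm_ext_iff_of_nodup (List.nodup_flatMap.2 ⟨fun i _ => ?_, ?_⟩) ?_).2 ?_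
  · exact (List.nodup_map_iff sigma_mk_injective).2 (List.nodup_finRange _)
  · refine List.Pairwise.imp ?_ (List.nodup_finRange l)
    intro i j hij
    simp only [Function.onFun, List.disjoint_left, List.mem_map]
    rintro _ ⟨a, -, rfl⟩ ⟨b, -, hb⟩
    exact hij (congrArg Sigma.fst hb).symm
  · exact (List.nodup_map_iff (Equiv.injective _)).2 (List.nodup_finRange _)
  · rintro ⟨i, j⟩
    exact ⟨fun _ => List.mem_map.2 ⟨finSigmaFinEquiv ⟨i, j⟩, List.mem_finRange _, by simp⟩,
      fun _ => List.mem_flatMap.2 ⟨i, List.mem_finRange _,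
        List.mem_map.2 ⟨j, List.mem_finRange _, rfl⟩⟩⟩

section ListTensor
variable {D : Type u} [Category.{v} D] [MonoidalCategory D]

/-- The tensor product of the objects `X i`, for `i` running through a list, in this order. -/
def tensorList {ι : Type w} (X : ι → D) : List ι → D
  | [] => 𝟙_ D
  | a :: L => X a ⊗ tensorList X L

/-- The functoriality of `tensorList` in the family of objects. -/
def tensorListMap {ι : Type w} {X Y : ι → D} (f : ∀ i, X i ⟶ Y i) :
    (L : List ι) → (tensorList X L ⟶ tensorList Y L)
  | [] => 𝟙 _
  | a :: L => f a ⊗ₘ tensorListMap f L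

/-- The tensor product `X 0 ⊗ ⋯ ⊗ X (n - 1)`. -/
def tensorFin {n : ℕ} (X : Fin n → D) : D := tensorList X (List.finRange n)

/-- The functoriality of `tensorFin`. -/
def tensorFinMap {n : ℕ} {X Y : Fin n → D} (f : ∀ i, X i ⟶ Y i) : tensorFin X ⟶ tensorFin Y :=
  tensorListMap f _

/-- The identification of a tensor product over the image of a list with a tensor product over
the list. -/
def tensorListOfMap {ι κ : Type w} (e : κ → ι) (X : ι → D) :
    (L : List κ) → (tensorList X (L.map e) ⟶ tensorList (fun k => X (e k)) L)
  | [] => 𝟙 _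
  | a :: L => X (e a) ◁ tensorListOfMap e X L

/-- The inverse of `tensorListOfMap`. -/
def tensorListToMap {ι κ : Type w} (e : κ → ι) (X : ι → D) :
    (L : List κ) → (tensorList (fun k => X (e k)) L ⟶ tensorList X (L.map e))
  | [] => 𝟙 _
  | a :: L => X (e a) ◁ tensorListToMap e X L

/-- The associativity isomorphism for the concatenation of two lists. -/
def tensorListAppend {ι : Type w} (X : ι → D) (M : List ι) :
    (L : List ι) → (tensorList X L ⊗ tensorList X M ⟶ tensorList X (L ++ M))
  | [] => (λ_ _).hom
  | a :: L => (α_ _ _ _).hom ≫ (X a ◁ tensorListAppend X M L)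

/-- The associativity isomorphism for the concatenation of a list of lists. -/
def tensorListJoin {ι κ : Type w} (X : κ → D) (f : ι → List κ) :
    (L : List ι) → (tensorList (fun i => tensorList X (f i)) L ⟶ tensorList X (L.flatMap f))
  | [] => 𝟙 _
  | a :: L => (tensorList X (f a) ◁ tensorListJoin X f L) ≫
      tensorListAppend X (L.flatMap f) (f a)

/-- The map `𝟙 ⟶ X a₁ ⊗ ⋯ ⊗ X aₙ` given by maps `𝟙 ⟶ X i`. -/
def tensorListUnit {ι : Type w} (X : ι → D) (u : ∀ i, 𝟙_ D ⟶ X i) :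
    (L : List ι) → (𝟙_ D ⟶ tensorList X L)
  | [] => 𝟙 _
  | a :: L => (λ_ _).inv ≫ (u a ⊗ₘ tensorListUnit X u L)

theorem tensorListMap_id {ι : Type w} (X : ι → D) (L : List ι) :
    tensorListMap (fun i => 𝟙 (X i)) L = 𝟙 (tensorList X L) := by
  induction L with
  | nil => rfl
  | cons a L ih => simp only [tensorListMap, ih]; exact id_tensorHom_id _ _

theorem tensorListMap_comp {ι : Type w} {X Y Z : ι → D} (f : ∀ i, X i ⟶ Y i)
    (g : ∀ i, Y i ⟶ Z i) (L : List ι) :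
    tensorListMap (fun i => f i ≫ g i) L = tensorListMap f L ≫ tensorListMap g L := by
  induction L with
  | nil => exact (Category.comp_id _).symm
  | cons a L ih => simp only [tensorListMap, ih]; exact (tensorHom_comp_tensorHom _ _ _ _).symm

theorem tensorFinMap_id {n : ℕ} (X : Fin n → D) : tensorFinMap (fun i => 𝟙 (X i)) = 𝟙 _ :=
  tensorListMap_id X _

theorem tensorFinMap_comp {n : ℕ} {X Y Z : Fin n → D} (f : ∀ i, X i ⟶ Y i)
    (g : ∀ i, Y i ⟶ Z i) :
    tensorFinMap (fun i => f i ≫ g i) = tensorFinMap f ≫ tensorFinMap g :=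
  tensorListMap_comp f g _

theorem id_tensorFinMap_id_comp (A : D) {n : ℕ} (X : Fin n → D) {B : D}
    (f : A ⊗ tensorFin X ⟶ B) :
    (𝟙 A ⊗ₘ tensorFinMap fun i => 𝟙 (X i)) ≫ f = f := by
  rw [tensorFinMap_id, id_tensorHom_id, Category.id_comp]

theorem tensorFinMap_square {A A' A'' B B' B'' : D} {n : ℕ} {X Y Z : Fin n → D}
    {c : A ⊗ tensorFin X ⟶ B} {c' : A' ⊗ tensorFin Y ⟶ B'} {c'' : A'' ⊗ tensorFin Z ⟶ B''}
    {a : A ⟶ A'} {a' : A' ⟶ A''} {b : B ⟶ B'} {b' : B' ⟶ B''}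
    {f : ∀ i, X i ⟶ Y i} {g : ∀ i, Y i ⟶ Z i} (h : c ≫ b = (a ⊗ₘ tensorFinMap f) ≫ c')
    (h' : c' ≫ b' = (a' ⊗ₘ tensorFinMap g) ≫ c'') :
    c ≫ b ≫ b' = ((a ≫ a') ⊗ₘ tensorFinMap fun i => f i ≫ g i) ≫ c'' := by
  rw [← Category.assoc, h, Category.assoc, h', ← Category.assoc, tensorHom_comp_tensorHom,
    tensorFinMap_comp]

variable [BraidedCategory D]

/-- The symmetry which moves the factor `X a` to the front. -/
def tensorListPull {ι : Type w} [DecidableEq ι] (X : ι → D) (a : ι) :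
    (L : List ι) → a ∈ L → (tensorList X L ⟶ X a ⊗ tensorList X (L.erase a))
  | [], h => absurd h List.not_mem_nil
  | b :: L, h =>
    if e : b = a then
      eqToHom (by subst e; rw [List.erase_cons_head]; rfl)
    else
      (X b ◁ tensorListPull X a L ((List.mem_cons.1 h).resolve_left (Ne.symm e))) ≫
        (α_ _ _ _).inv ≫ ((β_ (X b) (X a)).hom ▷ _) ≫ (α_ _ _ _).hom ≫
        eqToHom (by rw [List.erase_cons_tail (by simpa using e)]; rfl)

/-- The symmetry from the tensor product over a list to the tensor product over a permuted list. -/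
def tensorListReorder {ι : Type w} [DecidableEq ι] (X : ι → D) :
    (L' L : List ι) → L.Perm L' → (tensorList X L ⟶ tensorList X L')
  | [], L, h => eqToHom (by rw [h.eq_nil])
  | a :: L', L, h =>
    tensorListPull X a L (h.symm.subset List.mem_cons_self) ≫
      (X a ◁ tensorListReorder X L' (L.erase a)
      ((List.perm_cons a).1
        ((List.perm_cons_erase (h.symm.subset List.mem_cons_self)).symm.trans h)))

/-- The symmetry `(⨂ X i) ⊗ (⨂ Y i) ⟶ ⨂ (X i ⊗ Y i)`. -/
def tensorListShuffle {ι : Type w} (X Y : ι → D) :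
    (L : List ι) → (tensorList X L ⊗ tensorList Y L ⟶ tensorList (fun i => X i ⊗ Y i) L)
  | [] => (λ_ _).hom
  | a :: L => tensorμ (X a) (tensorList X L) (Y a) (tensorList Y L) ≫
      ((X a ⊗ Y a) ◁ tensorListShuffle X Y L)

/-- The symmetry `X 0 ⊗ ⋯ ⊗ X (m - 1) ⟶ X (σ 0) ⊗ ⋯ ⊗ X (σ (l - 1))`, permuting the factors. -/
def tensorFinPerm {l m : ℕ} (σ : Fin l ≃ Fin m) (X : Fin m → D) :
    tensorFin X ⟶ tensorFin (fun i => X (σ i)) :=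
  tensorListReorder X ((List.finRange l).map σ) (List.finRange m)
    (finRange_perm_map σ) ≫
  tensorListOfMap σ X (List.finRange l)

/-- The associativity isomorphism from an iterated tensor product to the tensor product of all the
factors in lexicographic order, which is the order of `finSigmaFinEquiv`. -/
def tensorFinFlatten {l : ℕ} (m : Fin l → ℕ) (X : (Σ i, Fin (m i)) → D) :
    tensorFin (fun i => tensorFin (fun j => X ⟨i, j⟩)) ⟶
      tensorFin (fun k : Fin (∑ i, m i) => X (finSigmaFinEquiv.symm k)) :=
  tensorFinMap (fun i => tensorListToMap (Sigma.mk i) X (List.finRange (m i))) ≫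
    tensorListJoin X (fun i => (List.finRange (m i)).map (Sigma.mk i)) (List.finRange l) ≫
    tensorListReorder X ((List.finRange (∑ i, m i)).map (finSigmaFinEquiv (n := m)).symm) _
      (flatMap_perm_map m) ≫
    tensorListOfMap (finSigmaFinEquiv (n := m)).symm X (List.finRange (∑ i, m i))
/-- The symmetry `(⨂ X i) ⊗ (⨂ Y i) ⟶ ⨂ (X i ⊗ Y i)`. -/
def tensorFinShuffle {l : ℕ} (X Y : Fin l → D) :
    tensorFin X ⊗ tensorFin Y ⟶ tensorFin (fun i => X i ⊗ Y i) :=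
  tensorListShuffle X Y _

end ListTensor

/-- The arity `m₁ + ⋯ + mₗ`. -/
def sumArity {l : ℕ+} (m : Fin l → ℕ+) : ℕ+ :=
  ⟨∑ i, (m i : ℕ), Finset.sum_pos (fun i _ => (m i).pos) ⟨⟨0, l.pos⟩, Finset.mem_univ _⟩⟩

/-- The block sum `τ₁ ⊕ ⋯ ⊕ τₗ` of permutations. -/
def sumPerm {l : ℕ+} {m m' : Fin l → ℕ+} (τ : ∀ i, Fin (m i) ≃ Fin (m' i)) :
    Fin (sumArity m) ≃ Fin (sumArity m') :=
  finSigmaFinEquiv.symm.trans ((Equiv.sigmaCongrRight τ).trans finSigmaFinEquiv)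

/-- The permutation which permutes blocks of sizes `m i` as `σ` permutes their indices. -/
def blockPerm {l l' : ℕ+} (σ : Fin l ≃ Fin l') (m : Fin l' → ℕ+) :
    Fin (sumArity (fun i => m (σ i))) ≃ Fin (sumArity m) :=
  finSigmaFinEquiv.symm.trans ((Equiv.sigmaCongrLeft (β := fun j => Fin (m j)) σ).trans
    finSigmaFinEquiv)

/-- A doubly indexed family of arities, listed in lexicographic order. -/
def flattenArity {l : ℕ+} {m : Fin l → ℕ+} (n : (i : Fin l) → Fin (m i) → ℕ+) :
    Fin (sumArity m) → ℕ+ :=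
  fun k => n (finSigmaFinEquiv.symm k).1 (finSigmaFinEquiv.symm k).2

theorem sumArity_flattenArity {l : ℕ+} {m : Fin l → ℕ+} (n : (i : Fin l) → Fin (m i) → ℕ+) :
    sumArity (flattenArity n) = sumArity (fun i => sumArity (n i)) := by
  apply PNat.eq
  change ∑ k : Fin (∑ i, (m i : ℕ)), (n (finSigmaFinEquiv.symm k).1 (finSigmaFinEquiv.symm k).2 : ℕ)
    = ∑ i, ∑ j, (n i j : ℕ)
  rw [Equiv.sum_comp finSigmaFinEquiv.symm (fun s : Σ i, Fin (m i) => (n s.1 s.2 : ℕ)),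
    Fintype.sum_sigma]

theorem sumArity_const_one (l : ℕ+) : sumArity (fun _ : Fin l => 1) = l := by
  apply PNat.eq; simp [sumArity]

theorem sumArity_one (n : ℕ+) : sumArity (l := 1) (fun _ => n) = n := by
  apply PNat.eq; change ∑ i : Fin 1, (n : ℕ) = n; simp

/-- The order preserving bijection between two equal finite ordinals. -/
def arityCast {a b : ℕ+} (h : a = b) : Fin a ≃ Fin b := finCongr (congrArg PNat.val h)

section OperadDefs
variable (D : Type u) [Category.{v} D] [MonoidalCategory D] [SymmetricCategory D]

/-- Symmetric unital operads: the objects `obj l`, `l ≥ 1`, form a contravariant functor on the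
groupoid of the finite sets `Fin l`, that is, `obj l` carries a right action of the symmetric group;
`comp` is the composition `P l ⊗ P m₁ ⊗ ⋯ ⊗ P mₗ ⟶ P (m₁ + ⋯ + mₗ)`, which is equivariant, unital and
associative. -/
structure Operad where
  obj : ℕ+ → D
  act {l m : ℕ+} (σ : Fin l ≃ Fin m) : obj m ⟶ obj l
  act_refl (l : ℕ+) : act (Equiv.refl (Fin l)) = 𝟙 (obj l)
  act_trans {l m n : ℕ+} (σ : Fin l ≃ Fin m) (τ : Fin m ≃ Fin n) :
    act (σ.trans τ) = act τ ≫ act σ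
  unit : 𝟙_ D ⟶ obj 1
  comp {l : ℕ+} (m : Fin l → ℕ+) : obj l ⊗ tensorFin (fun i => obj (m i)) ⟶ obj (sumArity m)
  comp_perm {l l' : ℕ+} (σ : Fin l ≃ Fin l') (m : Fin l' → ℕ+) :
    (act σ ⊗ₘ tensorFinPerm σ (fun j => obj (m j))) ≫ comp (fun i => m (σ i)) =
      comp m ≫ act (blockPerm σ m)
  comp_act {l : ℕ+} {m m' : Fin l → ℕ+} (τ : ∀ i, Fin (m i) ≃ Fin (m' i)) :
    (obj l ◁ tensorFinMap (fun i => act (τ i))) ≫ comp m = comp m' ≫ act (sumPerm τ)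
  unit_comp (n : ℕ+) :
    (unit ⊗ₘ (ρ_ (obj n)).inv) ≫ comp (l := 1) (fun _ => n) =
      (λ_ (obj n)).hom ≫ act (arityCast (sumArity_one n))
  comp_unit (l : ℕ+) :
    (obj l ◁ tensorListUnit (fun _ => obj 1) (fun _ => unit) (List.finRange l)) ≫
        comp (fun _ : Fin l => 1) =
      (ρ_ (obj l)).hom ≫ act (arityCast (sumArity_const_one l))
  assoc {l : ℕ+} (m : Fin l → ℕ+) (n : (i : Fin l) → Fin (m i) → ℕ+) :
    (α_ (obj l) (tensorFin fun i => obj (m i))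
        (tensorFin fun i => tensorFin fun j => obj (n i j))).hom ≫
      (obj l ◁ (tensorFinShuffle _ _ ≫ tensorFinMap fun i => comp (n i))) ≫
        comp (fun i => sumArity (n i)) ≫ act (arityCast (sumArity_flattenArity n)) =
    (comp m ▷ _) ≫
      (obj (sumArity m) ◁ tensorFinFlatten (fun i => (m i : ℕ)) (fun s => obj (n s.1 s.2))) ≫
        comp (flattenArity n)

variable {D}

namespace Operad

/-- Morphisms of operads. -/
@[ext]
structure Hom (P Q : Operad D) where
  app (l : ℕ+) : P.obj l ⟶ Q.obj l
  act {l m : ℕ+} (σ : Fin l ≃ Fin m) : P.act σ ≫ app l = app m ≫ Q.act σ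
  unit : P.unit ≫ app 1 = Q.unit
  comp {l : ℕ+} (m : Fin l → ℕ+) :
    P.comp m ≫ app (sumArity m) = (app l ⊗ₘ tensorFinMap fun i => app (m i)) ≫ Q.comp m

end Operad

/-- The category of operads. -/
instance : Category (Operad D) where
  Hom := Operad.Hom
  id P :=
    { app := fun l => 𝟙 (P.obj l)
      act := fun σ => (Category.comp_id (P.act σ)).trans (Category.id_comp (P.act σ)).symm
      unit := Category.comp_id P.unit
      comp := fun m => (Category.comp_id (P.comp m)).trans
        (id_tensorFinMap_id_comp (P.obj _) (fun i => P.obj (m i)) (P.comp m)).symm }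
  comp {P Q R} f g :=
    { app := fun l => f.app l ≫ g.app l
      act := fun σ => by rw [← Category.assoc, f.act, Category.assoc, g.act, Category.assoc]
      unit := by rw [← Category.assoc, f.unit, g.unit]
      comp := fun m => tensorFinMap_square (f.comp m) (g.comp m) }
  id_comp f := Operad.Hom.ext (funext fun l => Category.id_comp (f.app l))
  comp_id f := Operad.Hom.ext (funext fun l => Category.comp_id (f.app l))
  assoc f g h := Operad.Hom.ext (funext fun l => Category.assoc (f.app l) (g.app l) (h.app l))

/-- The functor sending an operad to its object of arity `l`. -/
def Operad.eval (l : ℕ+) : Operad D ⥤ D where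
  obj P := P.obj l
  map f := Operad.Hom.app f l

/-- Algebras over an operad `P`: objects `A` with operations `P l ⊗ A ⊗ ⋯ ⊗ A ⟶ A` which are
equivariant, unital and compatible with the composition of `P`. -/
structure OperadAlgebra (P : Operad D) where
  obj : D
  act (l : ℕ+) : P.obj l ⊗ tensorFin (fun _ : Fin l => obj) ⟶ obj
  act_perm {l l' : ℕ+} (σ : Fin l ≃ Fin l') :
    (P.act σ ⊗ₘ tensorFinPerm σ (fun _ => obj)) ≫ act l = act l'
  unit_act : (P.unit ⊗ₘ (ρ_ obj).inv) ≫ act 1 = (λ_ obj).hom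
  comp_act {l : ℕ+} (m : Fin l → ℕ+) :
    (α_ (P.obj l) (tensorFin fun i => P.obj (m i))
        (tensorFin fun i => tensorFin fun _ : Fin (m i) => obj)).hom ≫
      (P.obj l ◁ (tensorFinShuffle _ _ ≫ tensorFinMap fun i => act (m i))) ≫ act l =
    (P.comp m ▷ _) ≫
      (P.obj (sumArity m) ◁ tensorFinFlatten (fun i => (m i : ℕ)) (fun _ => obj)) ≫
        act (sumArity m)

/-- Morphisms of algebras over a fixed operad. -/
@[ext]
structure OperadAlgebra.Hom {P : Operad D} (A B : OperadAlgebra P) where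
  hom : A.obj ⟶ B.obj
  act (l : ℕ+) : A.act l ≫ hom = (𝟙 (P.obj l) ⊗ₘ tensorFinMap fun _ => hom) ≫ B.act l

/-- The category of algebras over a fixed operad. -/
instance (P : Operad D) : Category (OperadAlgebra P) where
  Hom := OperadAlgebra.Hom
  id A :=
    { hom := 𝟙 A.obj
      act := fun l => (Category.comp_id (A.act l)).trans
        (id_tensorFinMap_id_comp (P.obj l) (fun _ => A.obj) (A.act l)).symm }
  comp f g :=
    { hom := f.hom ≫ g.hom
      act := fun l => (tensorFinMap_square (f.act l) (g.act l)).trans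
        (by rw [Category.comp_id]) }
  id_comp f := OperadAlgebra.Hom.ext (Category.id_comp f.hom)
  comp_id f := OperadAlgebra.Hom.ext (Category.comp_id f.hom)
  assoc f g h := OperadAlgebra.Hom.ext (Category.assoc f.hom g.hom h.hom)

/-- The functor forgetting the algebra structure. -/
def OperadAlgebra.forget (P : Operad D) : OperadAlgebra P ⥤ D where
  obj A := A.obj
  map f := OperadAlgebra.Hom.hom f

variable (D) in
/-- Algebras over variable operads: pairs of an operad and an algebra over it. -/
structure Alg where
  operad : Operad D
  alg : OperadAlgebra operad

/-- Morphisms of algebras over variable operads: a morphism of operads and a compatible morphism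
of the underlying objects. -/
@[ext]
structure Alg.Hom (A B : Alg D) where
  operad : A.operad ⟶ B.operad
  hom : A.alg.obj ⟶ B.alg.obj
  act (l : ℕ+) : A.alg.act l ≫ hom =
    ((Operad.eval l).map operad ⊗ₘ tensorFinMap fun _ => hom) ≫ B.alg.act l

/-- The category of algebras over variable operads. -/
instance : Category (Alg D) where
  Hom := Alg.Hom
  id A :=
    { operad := 𝟙 A.operad
      hom := 𝟙 A.alg.obj
      act := fun l => (Category.comp_id (A.alg.act l)).trans
        (id_tensorFinMap_id_comp (A.operad.obj l) (fun _ => A.alg.obj) (A.alg.act l)).symm }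
  comp f g :=
    { operad := f.operad ≫ g.operad
      hom := f.hom ≫ g.hom
      act := fun l => tensorFinMap_square (f.act l) (g.act l) }
  id_comp f := Alg.Hom.ext (Category.id_comp f.operad) (Category.id_comp f.hom)
  comp_id f := Alg.Hom.ext (Category.comp_id f.operad) (Category.comp_id f.hom)
  assoc f g h := Alg.Hom.ext (Category.assoc f.operad g.operad h.operad)
    (Category.assoc f.hom g.hom h.hom)

/-- The functor sending an algebra over a variable operad to its operad. -/
def Alg.toOperad : Alg D ⥤ Operad D where
  obj A := A.operad
  map f := Alg.Hom.operad f

/-- The functor sending an algebra over a variable operad to its underlying object. -/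
def Alg.forget : Alg D ⥤ D where
  obj A := A.alg.obj
  map f := Alg.Hom.hom f

end OperadDefs

section Localizing
variable {A : Type u} [Category.{v} A] (S W : MorphismProperty A)

/-- An object is Cartan-Eilenberg fibrant, for strong equivalences `S` and weak equivalences `W`,
if in the localization at `S` the morphisms into it do not see the weak equivalences. -/
def IsCEFibrant (M : A) : Prop :=
  ∀ ⦃X Y : A⦄ (w : X ⟶ Y), W w →
    Function.Bijective fun g : S.Q.obj Y ⟶ S.Q.obj M => S.Q.map w ≫ g

variable {S W} in
/-- A morphism `ε` of the localization at `S` is a Cartan-Eilenberg fibrant model of `X` if its target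
is fibrant and it becomes an isomorphism in the localization at `W`. -/
structure IsCEFibrantModel (h : S.IsInvertedBy W.Q) {X M : A} (ε : S.Q.obj X ⟶ S.Q.obj M) :
    Prop where
  fibrant : IsCEFibrant S W M
  isIso : IsIso ((Localization.Construction.lift W.Q h).map ε)

/-- Right Cartan-Eilenberg categories: strong equivalences are weak equivalences, up to saturation,
and every object has a fibrant model. -/
structure IsRightCartanEilenberg : Prop where
  inverted : S.IsInvertedBy W.Q
  enough (X : A) : ∃ (M : A) (ε : S.Q.obj X ⟶ S.Q.obj M), IsCEFibrantModel inverted ε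

end Localizing

section Descent
variable (D : Type u) [Category.{v} D]

/-- Cosimplicial objects. -/
abbrev Cosimp := SimplexCategory ⥤ D

variable {D} in
/-- The diagonal of a bicosimplicial object. -/
@[simps]
def diagonal : Cosimp (Cosimp D) ⥤ Cosimp D where
  obj Z :=
    { obj := fun n => (Z.obj n).obj n
      map := fun {n m} f => (Z.map f).app n ≫ (Z.obj m).map f
      map_comp := fun f g => by simp }
  map φ :=
    { app := fun n => (φ.app n).app n
      naturality := fun n m f => by
        have := congrArg (fun t => t.app n) (φ.naturality f)
        simp only [NatTrans.comp_app] at this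
        simp [reassoc_of% this] }

variable {D}

/-- The identity map from the constant object `c (s X)` to the object which is `s X` in every
degree. -/
def constSimpleTo (s : Cosimp D ⥤ D) (X : Cosimp D) :
    (Functor.const SimplexCategory).obj (s.obj X) ⟶
      ((Functor.whiskeringRight SimplexCategory _ _).obj s).obj
        ((Functor.const SimplexCategory).obj X) where
  app _ := 𝟙 _

/-- The diagonal of the bicosimplicial object which is `X` in every first degree is `X`. -/
def diagonalConst (X : Cosimp D) :
    diagonal.obj ((Functor.const SimplexCategory).obj X) ⟶ X where
  app n := 𝟙 (X.obj n)
  naturality n m f := by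
    change (𝟙 _ ≫ X.map f) ≫ 𝟙 _ = 𝟙 _ ≫ X.map f
    rw [Category.comp_id]

/-- The diagonal of the bicosimplicial object which is constant in the second degree with values
`X` is `X`. -/
def diagonalLevelConst (X : Cosimp D) :
    diagonal.obj (X ⋙ Functor.const SimplexCategory) ⟶ X where
  app n := 𝟙 (X.obj n)
  naturality n m f := by
    change (X.map f ≫ 𝟙 _) ≫ 𝟙 _ = 𝟙 _ ≫ X.map f
    rw [Category.comp_id, Category.comp_id, Category.id_comp]

/-- The cosimplicial object `A^{Δ[1]}`. -/
noncomputable def pathObject [HasFiniteProducts D] (A : D) : Cosimp D where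
  obj n := ∏ᶜ fun _ : n ⟶ SimplexCategory.mk 1 => A
  map f := Pi.lift fun α => Pi.π _ (f ≫ α)

/-- The map `A^{Δ[1]} ⟶ A^{Δ[0]} = c A` induced by a vertex of `Δ[1]`. -/
noncomputable def pathObjectEval [HasFiniteProducts D] (A : D) :
    pathObject A ⟶ (Functor.const SimplexCategory).obj A where
  app n := Pi.π _ (SimplexCategory.const n (SimplexCategory.mk 1) 1)
  naturality n m f := by
    have h : f ≫ SimplexCategory.const m (SimplexCategory.mk 1) 1 =
        SimplexCategory.const n (SimplexCategory.mk 1) 1 := rfl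
    simp [pathObject, h]

variable (D) in
/-- Descent structures on a category `D`, with finite products: a class `E` of equivalences, which is
saturated and closed under finite products, a simple functor, commuting with finite products up
to equivalence, and natural transformations `μ : 𝐬𝐬 ⟶ 𝐬 diag` and `λ : id ⟶ 𝐬 c` which are pointwise
equivalences and compatible with each other (on the two bicosimplicial objects which are constant
in one direction), such that the simple functor preserves degree-wise equivalences and sends
`A^{Δ[1]} ⟶ A^{Δ[0]}` to an equivalence. -/
structure DescentStructure where
  [hasFiniteProducts : HasFiniteProducts D]
  E : MorphismProperty D
  E_saturated ⦃X Y : D⦄ (f : X ⟶ Y) : IsIso (E.Q.map f) → E f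
  E_prod ⦃X Y X' Y' : D⦄ (f : X ⟶ Y) (g : X' ⟶ Y') : E f → E g → E (prod.map f g)
  simple : Cosimp D ⥤ D
  simple_prod (X Y : Cosimp D) : E (prodComparison simple X Y)
  mu : (Functor.whiskeringRight SimplexCategory _ _).obj simple ⋙ simple ⟶ diagonal ⋙ simple
  E_mu (Z : Cosimp (Cosimp D)) : E (mu.app Z)
  lam : 𝟭 D ⟶ Functor.const SimplexCategory ⋙ simple
  E_lam (A : D) : E (lam.app A)
  lam_mu (X : Cosimp D) :
    lam.app (simple.obj X) ≫ simple.map (constSimpleTo simple X) ≫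
      mu.app ((Functor.const SimplexCategory).obj X) ≫ simple.map (diagonalConst X) = 𝟙 _
  map_lam_mu (X : Cosimp D) :
    simple.map (X.whiskerLeft lam) ≫ mu.app (X ⋙ Functor.const SimplexCategory) ≫
      simple.map (diagonalLevelConst X) = 𝟙 _
  E_simple ⦃X Y : Cosimp D⦄ (f : X ⟶ Y) : (∀ n, E (f.app n)) → E (simple.map f)
  E_path (A : D) : E (simple.map (pathObjectEval A))

end Descent

section MonoidalDescent
variable {D : Type u} [Category.{v} D] [MonoidalCategory D]

/-- The constant cosimplicial object functor is (strictly) monoidal. -/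
instance constLaxMonoidal : (Functor.const SimplexCategory : D ⥤ Cosimp D).LaxMonoidal where
  ε := 𝟙 _
  μ A B := { app := fun _ => 𝟙 _ }

/-- The diagonal commutes with the degree-wise tensor product. -/
def diagonalTensor (A B : Cosimp (Cosimp D)) :
    diagonal.obj A ⊗ diagonal.obj B ⟶ diagonal.obj (A ⊗ B) where
  app n := 𝟙 ((A.obj n).obj n ⊗ (B.obj n).obj n)
  naturality n m f := by
    change (((A.map f).app n ≫ (A.obj m).map f) ⊗ₘ ((B.map f).app n ≫ (B.obj m).map f)) ≫ 𝟙 _ =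
      𝟙 _ ≫ (((A.map f).app n ⊗ₘ (B.map f).app n) ≫ ((A.obj m).map f ⊗ₘ (B.obj m).map f))
    rw [Category.comp_id, Category.id_comp, tensorHom_comp_tensorHom]

/-- The diagonal functor is (strictly) monoidal. -/
instance diagonalLaxMonoidal : (diagonal : Cosimp (Cosimp D) ⥤ Cosimp D).LaxMonoidal where
  ε := { app := fun _ => 𝟙 (𝟙_ D) }
  μ A B := diagonalTensor A B
  μ_natural_left {X Y} f X' := by
    apply NatTrans.ext; funext n
    change ((f.app n).app n ▷ (X'.obj n).obj n) ≫ 𝟙 _ = 𝟙 _ ≫ ((f.app n).app n ▷ (X'.obj n).obj n)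
    rw [Category.comp_id, Category.id_comp]
  μ_natural_right {X Y} X' f := by
    apply NatTrans.ext; funext n
    change ((X'.obj n).obj n ◁ (f.app n).app n) ≫ 𝟙 _ = 𝟙 _ ≫ ((X'.obj n).obj n ◁ (f.app n).app n)
    rw [Category.comp_id, Category.id_comp]
  associativity X Y Z := by
    apply NatTrans.ext; funext n
    change (𝟙 ((X.obj n).obj n ⊗ (Y.obj n).obj n) ▷ (Z.obj n).obj n) ≫ 𝟙 _ ≫
        (α_ ((X.obj n).obj n) ((Y.obj n).obj n) ((Z.obj n).obj n)).hom =
      (α_ ((X.obj n).obj n) ((Y.obj n).obj n) ((Z.obj n).obj n)).hom ≫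
        ((X.obj n).obj n ◁ 𝟙 ((Y.obj n).obj n ⊗ (Z.obj n).obj n)) ≫ 𝟙 _
    rw [Category.comp_id, Category.id_comp, id_whiskerRight, whiskerLeft_id, Category.comp_id,
      Category.id_comp]
  left_unitality X := by
    apply NatTrans.ext; funext n
    change (λ_ ((X.obj n).obj n)).hom =
      (𝟙 (𝟙_ D) ▷ (X.obj n).obj n) ≫ 𝟙 _ ≫ (λ_ ((X.obj n).obj n)).hom
    rw [id_whiskerRight, Category.id_comp, Category.id_comp]
  right_unitality X := by
    apply NatTrans.ext; funext n
    change (ρ_ ((X.obj n).obj n)).hom =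
      ((X.obj n).obj n ◁ 𝟙 (𝟙_ D)) ≫ 𝟙 _ ≫ (ρ_ ((X.obj n).obj n)).hom
    rw [whiskerLeft_id, Category.id_comp, Category.id_comp]

variable (D) in
/-- Monoidal descent structures on a symmetric monoidal category: the simple functor is lax symmetric
monoidal, cosimplicial objects having the degree-wise tensor product, and `λ` and `μ` are monoidal
transformations. -/
structure MonoidalDescentStructure [SymmetricCategory D] extends DescentStructure D where
  [simpleLax : simple.LaxBraided]
  lam_monoidal : NatTrans.IsMonoidal lam
  mu_monoidal : NatTrans.IsMonoidal mu

end MonoidalDescent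

section Cobar
variable {A : Type u} [Category.{v} A] (T : CategoryTheory.Monad A)

/-- The iterates `X, T X, T (T X), …`. -/
def monadPow (X : A) : ℕ → A
  | 0 => X
  | n + 1 => T.obj (monadPow X n)

/-- The unit of the monad at an iterate. -/
def monadPowUnit (X : A) (n : ℕ) : monadPow T X n ⟶ monadPow T X (n + 1) :=
  T.η.app (monadPow T X n)

/-- The Kleisli extension of a morphism `Tᵐ X ⟶ T (Tⁿ X)` to `T (Tᵐ X) ⟶ T (Tⁿ X)`. -/
def monadPowExt (X : A) {m n : ℕ} (h : monadPow T X m ⟶ monadPow T X (n + 1)) :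
    monadPow T X (m + 1) ⟶ monadPow T X (n + 1) :=
  T.map h ≫ T.μ.app (monadPow T X n)

/-- The functoriality of the iterates. -/
def monadPowFunctorMap {X Y : A} (f : X ⟶ Y) : (n : ℕ) → (monadPow T X n ⟶ monadPow T Y n)
  | 0 => f
  | n + 1 => T.map (monadPowFunctorMap f n)

theorem monadPowUnit_ext (X : A) {m n : ℕ} (h : monadPow T X m ⟶ monadPow T X (n + 1)) :
    monadPowUnit T X m ≫ monadPowExt T X h = h := by
  have key {Y Z : A} (h : Y ⟶ T.obj Z) : T.η.app Y ≫ T.map h ≫ T.μ.app Z = h := by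
    have e := T.η.naturality h
    simp only [Functor.id_map] at e
    rw [← Category.assoc, ← e, Category.assoc, T.left_unit, Category.comp_id]
  exact key h

theorem monadPowExt_ext (X : A) {m n p : ℕ} (f : monadPow T X m ⟶ monadPow T X (n + 1))
    (g : monadPow T X n ⟶ monadPow T X (p + 1)) :
    monadPowExt T X f ≫ monadPowExt T X g = monadPowExt T X (f ≫ monadPowExt T X g) := by
  have key {Y Z W : A} (f : Y ⟶ T.obj Z) (g : Z ⟶ T.obj W) :
      (T.map f ≫ T.μ.app Z) ≫ T.map g ≫ T.μ.app W =
        T.map (f ≫ T.map g ≫ T.μ.app W) ≫ T.μ.app W := by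
    have h := T.μ.naturality g
    simp only [Functor.comp_map] at h
    simp only [Functor.map_comp, Category.assoc, T.assoc]
    rw [reassoc_of% h]
  exact key f g

theorem monadPowExt_unit (X : A) (n : ℕ) :
    monadPowExt T X (monadPowUnit T X n) = 𝟙 (monadPow T X (n + 1)) :=
  T.right_unit _

theorem monadPowUnit_naturality {X Y : A} (f : X ⟶ Y) (n : ℕ) :
    monadPowUnit T X n ≫ monadPowFunctorMap T f (n + 1) =
      monadPowFunctorMap T f n ≫ monadPowUnit T Y n :=
  (T.η.naturality (monadPowFunctorMap T f n)).symm

theorem monadPowExt_naturality {X Y : A} (f : X ⟶ Y) {m n : ℕ}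
    (h : monadPow T X m ⟶ monadPow T X (n + 1)) (h' : monadPow T Y m ⟶ monadPow T Y (n + 1))
    (w : h ≫ monadPowFunctorMap T f (n + 1) = monadPowFunctorMap T f m ≫ h') :
    monadPowExt T X h ≫ monadPowFunctorMap T f (n + 1) =
      monadPowFunctorMap T f (m + 1) ≫ monadPowExt T Y h' := by
  have key {Y Z Y' Z' : A} (a : Y ⟶ Y') (b : Z ⟶ Z') (h : Y ⟶ T.obj Z) (h' : Y' ⟶ T.obj Z')
      (w : h ≫ T.map b = a ≫ h') :
      (T.map h ≫ T.μ.app Z) ≫ T.map b = T.map a ≫ T.map h' ≫ T.μ.app Z' := by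
    have e := T.μ.naturality b
    simp only [Functor.comp_map] at e
    rw [Category.assoc, ← e, ← Category.assoc, ← T.map_comp, w, T.map_comp, Category.assoc]
  exact key _ _ h h' w

/-- A monotone map which does not take the value `0`, with values lowered by one. -/
def predHom {m n : ℕ} (f : Fin (m + 1) →o Fin (n + 1)) (h : f 0 ≠ 0) : Fin (m + 1) →o Fin n where
  toFun i := (f i).pred fun h' => h (le_antisymm (h' ▸ f.monotone (Fin.zero_le i)) (Fin.zero_le _))
  monotone' _ _ hij := Fin.pred_le_pred_iff.2 (f.monotone hij)

theorem succ_predHom {m n : ℕ} (f : Fin (m + 1) →o Fin (n + 1)) (h : f 0 ≠ 0) (i : Fin (m + 1)) :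
    (predHom f h i).succ = f i :=
  Fin.succ_pred (f i) fun h' => h (le_antisymm (h' ▸ f.monotone (Fin.zero_le i)) (Fin.zero_le _))

/-- A monotone map without its first value. -/
def tailHom {m n : ℕ} (f : Fin (m + 1) →o Fin n) : Fin m →o Fin n where
  toFun i := f i.succ
  monotone' _ _ hij := f.monotone (Fin.succ_le_succ_iff.2 hij)

/-- The monotone map from the empty ordinal. -/
def emptyHom (n : ℕ) : Fin 0 →o Fin n where
  toFun i := i.elim0
  monotone' i := i.elim0

theorem eq_emptyHom {n : ℕ} (f : Fin 0 →o Fin n) : f = emptyHom n :=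
  OrderHom.ext _ _ (funext fun i => i.elim0)

/-- One step in the construction of `monadPowMap`. -/
def monadPowStep (X : A) {n : ℕ}
    (r : (m : ℕ) → (Fin m →o Fin n) → (monadPow T X m ⟶ monadPow T X n)) :
    (m : ℕ) → (Fin m →o Fin (n + 1)) → (monadPow T X m ⟶ monadPow T X (n + 1))
  | 0, _ => r 0 (emptyHom n) ≫ monadPowUnit T X n
  | m + 1, f =>
    if h : f 0 = 0 then monadPowExt T X (monadPowStep X r m (tailHom f))
    else r (m + 1) (predHom f h) ≫ monadPowUnit T X n

/-- The action `Tᵐ X ⟶ Tⁿ X` of a monotone map between finite ordinals: the first factor `T` of `Tⁿ`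
receives, through the multiplication of the monad, all factors which the monotone map sends to it,
and is inserted by the unit of the monad if there are none. -/
def monadPowMap (X : A) : (n m : ℕ) → (Fin m →o Fin n) → (monadPow T X m ⟶ monadPow T X n)
  | 0, 0, _ => 𝟙 X
  | 0, _ + 1, f => (f 0).elim0
  | n + 1, m, f => monadPowStep T X (monadPowMap X n) m f

theorem monadPowMap_zero_zero (X : A) (f : Fin 0 →o Fin 0) :
    monadPowMap T X 0 0 f = 𝟙 (monadPow T X 0) := rfl

theorem monadPowMap_zero_succ (X : A) (n : ℕ) (f : Fin 0 →o Fin (n + 1)) :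
    monadPowMap T X (n + 1) 0 f = monadPowMap T X n 0 (emptyHom n) ≫ monadPowUnit T X n :=
  rfl

theorem monadPowMap_succ_pos (X : A) {m n : ℕ} (f : Fin (m + 1) →o Fin (n + 1)) (h : f 0 = 0) :
    monadPowMap T X (n + 1) (m + 1) f =
      monadPowExt T X (monadPowMap T X (n + 1) m (tailHom f)) :=
  dif_pos h

theorem monadPowMap_succ_neg (X : A) {m n : ℕ} (f : Fin (m + 1) →o Fin (n + 1)) (h : f 0 ≠ 0) :
    monadPowMap T X (n + 1) (m + 1) f =
      monadPowMap T X n (m + 1) (predHom f h) ≫ monadPowUnit T X n :=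
  dif_neg h

theorem monadPowMap_comp (X : A) (k : ℕ) : ∀ m n p : ℕ, m + n + p = k → ∀ (f : Fin m →o Fin n)
    (g : Fin n →o Fin p),
    monadPowMap T X p m (g.comp f) = monadPowMap T X n m f ≫ monadPowMap T X p n g := by
  induction k using Nat.strong_induction_on with
  | _ k ih =>
  intro m n p hk f g
  match m, n, p, hk, f, g with
  | 0, 0, p, _, f, g =>
    rw [monadPowMap_zero_zero, Category.id_comp, eq_emptyHom g, eq_emptyHom (OrderHom.comp _ _)]
  | _ + 1, 0, _, _, f, g => exact (f 0).elim0
  | _, _ + 1, 0, _, f, g => exact (g 0).elim0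
  | 0, n + 1, p + 1, hk, f, g =>
    by_cases hg : g 0 = 0
    · have h := ih (0 + n + (p + 1)) (by omega) 0 n (p + 1) rfl (emptyHom n) (tailHom g)
      rw [monadPowMap_zero_succ T X n, monadPowMap_succ_pos T X g hg, Category.assoc,
        monadPowUnit_ext, ← h]
      rfl
    · have h := ih (0 + (n + 1) + p) (by omega) 0 (n + 1) p rfl f (predHom g hg)
      rw [monadPowMap_succ_neg T X g hg, ← Category.assoc, ← h, monadPowMap_zero_succ,
        eq_emptyHom (OrderHom.comp _ _)]
  | m + 1, n + 1, p + 1, hk, f, g =>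
    by_cases hg : g 0 = 0
    · by_cases hf : f 0 = 0
      · have h := ih (m + (n + 1) + (p + 1)) (by omega) m (n + 1) (p + 1) rfl (tailHom f) g
        have hgf : (g.comp f) 0 = 0 := by simp [hf, hg]
        rw [monadPowMap_succ_pos T X _ hgf, monadPowMap_succ_pos T X f hf,
          monadPowMap_succ_pos T X g hg, monadPowExt_ext, ← monadPowMap_succ_pos T X g hg, ← h]
        rfl
      · have h := ih (m + 1 + n + (p + 1)) (by omega) (m + 1) n (p + 1) rfl (predHom f hf)
          (tailHom g)
        rw [monadPowMap_succ_neg T X f hf, monadPowMap_succ_pos T X g hg, Category.assoc,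
          monadPowUnit_ext, ← h]
        congr 1
        exact OrderHom.ext _ _ (funext fun i => congrArg g (succ_predHom f hf i).symm)
    · have hgf : (g.comp f) 0 ≠ 0 := fun h0 =>
        hg (le_antisymm (h0 ▸ g.monotone (Fin.zero_le (f 0))) (Fin.zero_le _))
      have h := ih (m + 1 + (n + 1) + p) (by omega) (m + 1) (n + 1) p rfl f (predHom g hg)
      rw [monadPowMap_succ_neg T X g hg, monadPowMap_succ_neg T X _ hgf, ← Category.assoc, ← h]
      rfl

theorem monadPowMap_id (X : A) : (n : ℕ) → monadPowMap T X n n OrderHom.id = 𝟙 _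
  | 0 => rfl
  | n + 1 => by
    have key : monadPowMap T X (n + 1) n (tailHom OrderHom.id) = monadPowUnit T X n := by
      match n with
      | 0 => exact Category.id_comp (monadPowUnit T X 0)
      | n + 1 =>
        have h0 : tailHom (OrderHom.id : Fin (n + 1 + 1) →o Fin (n + 1 + 1)) 0 ≠ 0 := by
          simp [tailHom]
        have h1 : predHom (tailHom OrderHom.id) h0 =
            (OrderHom.id : Fin (n + 1) →o Fin (n + 1)) := by
          ext i; simp [tailHom, predHom]
        rw [monadPowMap_succ_neg T X _ h0, h1, monadPowMap_id X (n + 1), Category.id_comp]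
    rw [monadPowMap_succ_pos T X _ rfl, key, monadPowExt_unit]

theorem monadPowFunctorMap_id (X : A) : (n : ℕ) → monadPowFunctorMap T (𝟙 X) n = 𝟙 _
  | 0 => rfl
  | n + 1 => (congrArg (fun t => T.map t) (monadPowFunctorMap_id X n)).trans (T.map_id _)

theorem monadPowFunctorMap_comp {X Y Z : A} (f : X ⟶ Y) (g : Y ⟶ Z) : (n : ℕ) →
    monadPowFunctorMap T (f ≫ g) n = monadPowFunctorMap T f n ≫ monadPowFunctorMap T g n
  | 0 => rfl
  | n + 1 => (congrArg (fun t => T.map t) (monadPowFunctorMap_comp f g n)).trans (T.map_comp _ _)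

theorem monadPowMap_naturality {X Y : A} (f : X ⟶ Y) : (n m : ℕ) → (θ : Fin m →o Fin n) →
    monadPowMap T X n m θ ≫ monadPowFunctorMap T f n =
      monadPowFunctorMap T f m ≫ monadPowMap T Y n m θ
  | 0, 0, _ => (Category.id_comp f).trans (Category.comp_id f).symm
  | 0, _ + 1, θ => (θ 0).elim0
  | n + 1, 0, _ => by
    rw [monadPowMap_zero_succ, monadPowMap_zero_succ, Category.assoc, monadPowUnit_naturality,
      ← Category.assoc, monadPowMap_naturality f n 0, Category.assoc]
  | n + 1, m + 1, θ => by
    by_cases h0 : θ 0 = 0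
    · rw [monadPowMap_succ_pos T X θ h0, monadPowMap_succ_pos T Y θ h0]
      exact monadPowExt_naturality T f _ _ (monadPowMap_naturality f (n + 1) m (tailHom θ))
    · rw [monadPowMap_succ_neg T X θ h0, monadPowMap_succ_neg T Y θ h0, Category.assoc,
        monadPowUnit_naturality, ← Category.assoc, monadPowMap_naturality f n (m + 1),
        Category.assoc]

/-- The cosimplicial resolution of a monad: `T^{n+1} X` in degree `n`, with cofaces given by the unit
and codegeneracies given by the multiplication of the monad. -/
def cobar : A ⥤ Cosimp A where
  obj X :=
    { obj := fun n => monadPow T X (n.len + 1)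
      map := fun {n m} f => monadPowMap T X (m.len + 1) (n.len + 1) f.toOrderHom
      map_id := fun n => monadPowMap_id T X (n.len + 1)
      map_comp := fun {n m p} f g => monadPowMap_comp T X _ _ _ _ rfl f.toOrderHom g.toOrderHom }
  map f :=
    { app := fun n => monadPowFunctorMap T f (n.len + 1)
      naturality := fun n m θ => monadPowMap_naturality T f _ _ θ.toOrderHom }
  map_id X := by apply NatTrans.ext; funext n; exact monadPowFunctorMap_id T X _
  map_comp f g := by apply NatTrans.ext; funext n; exact monadPowFunctorMap_comp T f g _

/-- The coaugmentation of the resolution, given by the unit of the monad. -/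
def cobarAugmentation : Functor.const SimplexCategory ⟶ cobar T where
  app X :=
    { app := fun n => monadPowMap T X (n.len + 1) 0 (emptyHom _)
      naturality := fun n m θ => (Category.id_comp _).trans
        ((congrArg (monadPowMap T X _ 0) (eq_emptyHom _).symm).trans
          (monadPowMap_comp T X _ _ _ _ rfl (emptyHom _) θ.toOrderHom)) }
  naturality X Y f := by
    apply NatTrans.ext; funext n
    exact (monadPowMap_naturality T f (n.len + 1) 0 (emptyHom _)).symm

end Cobar

theorem comp_comp_eq_comp {A : Type u} [Category.{v} A] {X Y Z W : A} {a : X ⟶ Y} {b : Y ⟶ Z}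
    {c : X ⟶ Z} (h : a ≫ b = c) (d : Z ⟶ W) : a ≫ b ≫ d = c ≫ d := by
  rw [← h, Category.assoc]

section Site
variable {C : Type w} [SmallCategory C] {J : GrothendieckTopology C}
variable {E : Type u} [Category.{v} E] [HasFilteredColimitsOfSize.{w, w} E]

instance hasColimitsOfShapeElements (x : GrothendieckTopology.Point.{w} J) :
    HasColimitsOfShape x.fiber.Elementsᵒᵖ E :=
  HasFilteredColimitsOfSize.HasColimitsOfShape _

variable (E) in
/-- The fibre `F ↦ F_x` at a point `x` of the site: the filtered colimit of the `F U` over the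
pairs of an object `U` and an element of the fibre of `U` at `x`. -/
noncomputable def stalk (x : GrothendieckTopology.Point.{w} J) : (Cᵒᵖ ⥤ E) ⥤ E :=
  (Functor.whiskeringLeft _ _ _).obj (CategoryOfElements.π x.fiber).op ⋙ colim

/-- The canonical map `F U ⟶ F_x` of an element `s` of the fibre of `U` at `x`. -/
noncomputable def germ (x : GrothendieckTopology.Point.{w} J) {U : C} (s : x.fiber.obj U)
    (F : Cᵒᵖ ⥤ E) : F.obj (op U) ⟶ (stalk E x).obj F :=
  colimit.ι ((CategoryOfElements.π x.fiber).op ⋙ F) (op ⟨U, s⟩)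

theorem germ_res (x : GrothendieckTopology.Point.{w} J) {U V : C} (f : U ⟶ V)
    (s : x.fiber.obj U) (F : Cᵒᵖ ⥤ E) :
    F.map f.op ≫ germ x s F = germ x (x.fiber.map f s) F :=
  colimit.w ((CategoryOfElements.π x.fiber).op ⋙ F)
    (CategoryOfElements.homMk ⟨U, s⟩ ⟨V, x.fiber.map f s⟩ f rfl).op

theorem germ_naturality (x : GrothendieckTopology.Point.{w} J) {U : C} (s : x.fiber.obj U)
    {F G : Cᵒᵖ ⥤ E} (φ : F ⟶ G) :
    germ x s F ≫ (stalk E x).map φ = φ.app (op U) ≫ germ x s G :=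
  ι_colimMap (Functor.whiskerLeft (CategoryOfElements.π x.fiber).op φ) (op ⟨U, s⟩)

theorem stalk_hom_ext (x : GrothendieckTopology.Point.{w} J) {F : Cᵒᵖ ⥤ E} {M : E}
    {f g : (stalk E x).obj F ⟶ M}
    (h : ∀ (U : C) (s : x.fiber.obj U), germ x s F ≫ f = germ x s F ≫ g) : f = g :=
  colimit.hom_ext fun ⟨⟨U, s⟩⟩ => h U s

/-- A morphism out of the fibre, given by a compatible family of morphisms out of the `F U`. -/
noncomputable def stalkDesc (x : GrothendieckTopology.Point.{w} J) {F : Cᵒᵖ ⥤ E} {M : E}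
    (φ : ∀ (U : C), x.fiber.obj U → (F.obj (op U) ⟶ M))
    (hφ : ∀ ⦃U V : C⦄ (f : U ⟶ V) (s : x.fiber.obj U), F.map f.op ≫ φ U s = φ V (x.fiber.map f s)) :
    (stalk E x).obj F ⟶ M :=
  colimit.desc ((CategoryOfElements.π x.fiber).op ⋙ F) (Cocone.mk M
    { app := fun e => φ e.unop.1 e.unop.2
      naturality := fun e e' f => by
        have h := hφ f.unop.1 e'.unop.2
        have h' : x.fiber.map f.unop.1 e'.unop.2 = e.unop.2 := f.unop.2
        rw [h'] at h
        exact h.trans (Category.comp_id _).symm })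

theorem germ_stalkDesc (x : GrothendieckTopology.Point.{w} J) {F : Cᵒᵖ ⥤ E} {M : E}
    (φ : ∀ (U : C), x.fiber.obj U → (F.obj (op U) ⟶ M))
    (hφ : ∀ ⦃U V : C⦄ (f : U ⟶ V) (s : x.fiber.obj U), F.map f.op ≫ φ U s = φ V (x.fiber.map f s))
    {U : C} (s : x.fiber.obj U) : germ x s F ≫ stalkDesc x φ hφ = φ U s :=
  colimit.ι_desc _ _

variable [HasProducts.{w} E] {ι : Type w} (pts : ι → GrothendieckTopology.Point.{w} J)

variable (E) in
/-- The functor `p^*`, sending a presheaf to the family of its fibres. -/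
noncomputable def stalks : (Cᵒᵖ ⥤ E) ⥤ (ι → E) :=
  Functor.pi' fun i => stalk E (pts i)

variable (E) in
/-- The functor `p_*`: its value at `U` is the product of the `M i`, over all points `i` and all
elements of the fibre of `U` at the point `i`. -/
noncomputable def skyscrapers : (ι → E) ⥤ (Cᵒᵖ ⥤ E) where
  obj M :=
    { obj := fun U => ∏ᶜ fun q : (Σ i, (pts i).fiber.obj U.unop) => M q.1
      map := fun {U V} f => Pi.lift fun q =>
        Pi.π (fun q : (Σ i, (pts i).fiber.obj U.unop) => M q.1)
          ⟨q.1, (pts q.1).fiber.map f.unop q.2⟩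
      map_id := fun U => by
        refine Pi.hom_ext _ _ fun q => ?_
        rw [Pi.lift_π, Category.id_comp]
        congr 1
        exact Sigma.ext rfl (heq_of_eq (by simp))
      map_comp := fun {U V W} f g => by
        refine Pi.hom_ext _ _ fun q => ?_
        rw [Pi.lift_π, Category.assoc, Pi.lift_π, Pi.lift_π]
        congr 1
        exact Sigma.ext rfl (heq_of_eq (by simp)) }
  map φ :=
    { app := fun U => Limits.Pi.map fun q => φ q.1
      naturality := fun U V f => by
        refine Pi.hom_ext _ _ fun q => ?_
        change (Pi.lift _ ≫ Limits.Pi.map _) ≫ _ = (Limits.Pi.map _ ≫ Pi.lift _) ≫ _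
        rw [Category.assoc, Category.assoc, Pi.map_π, Pi.lift_π, ← Category.assoc, Pi.lift_π,
          Pi.map_π] }
  map_id M := by
    apply NatTrans.ext; funext U
    refine Pi.hom_ext _ _ fun q => ?_
    have h : Limits.Pi.map (fun q : (Σ i, (pts i).fiber.obj U.unop) => 𝟙 (M q.1)) ≫ Pi.π _ q =
        𝟙 _ ≫ Pi.π _ q := by
      simp
    exact h
  map_comp φ ψ := by
    apply NatTrans.ext; funext U
    refine Pi.hom_ext _ _ fun q => ?_
    have h : (Limits.Pi.map (fun q : (Σ i, (pts i).fiber.obj U.unop) => φ q.1) ≫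
        Limits.Pi.map (fun q : (Σ i, (pts i).fiber.obj U.unop) => ψ q.1)) ≫ Pi.π _ q =
        Limits.Pi.map (fun q : (Σ i, (pts i).fiber.obj U.unop) => φ q.1 ≫ ψ q.1) ≫ Pi.π _ q := by
      simp
    exact h.symm

/-- The morphism `F ⟶ p_* M` of a family of morphisms out of the fibres of `F`. -/
noncomputable def toSkyscrapers {F : Cᵒᵖ ⥤ E} {M : ι → E}
    (f : ∀ i, (stalk E (pts i)).obj F ⟶ M i) : F ⟶ (skyscrapers E pts).obj M where
  app U := Pi.lift fun q : (Σ i, (pts i).fiber.obj U.unop) => germ (pts q.1) q.2 F ≫ f q.1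
  naturality U V g := by
    refine Pi.hom_ext _ _ fun q => ?_
    change (F.map g ≫ Pi.lift _) ≫ _ = (Pi.lift _ ≫ Pi.lift _) ≫ _
    rw [Category.assoc, Pi.lift_π, Category.assoc, Pi.lift_π, Pi.lift_π]
    exact comp_comp_eq_comp (germ_res (pts q.1) g.unop q.2 F) (f q.1)

/-- The components of a morphism `F ⟶ p_* M`. -/
noncomputable def skyscrapersπ {F : Cᵒᵖ ⥤ E} {M : ι → E} (g : F ⟶ (skyscrapers E pts).obj M)
    (i : ι) (U : C) (s : (pts i).fiber.obj U) : F.obj (op U) ⟶ M i :=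
  g.app (op U) ≫ Pi.π (fun q : (Σ i, (pts i).fiber.obj U) => M q.1) ⟨i, s⟩

theorem skyscrapersπ_w {F : Cᵒᵖ ⥤ E} {M : ι → E} (g : F ⟶ (skyscrapers E pts).obj M)
    (i : ι) ⦃U V : C⦄ (f : U ⟶ V) (s : (pts i).fiber.obj U) :
    F.map f.op ≫ skyscrapersπ pts g i U s = skyscrapersπ pts g i V ((pts i).fiber.map f s) :=
  (comp_comp_eq_comp (g.naturality f.op) _).trans
    ((Category.assoc _ _ _).trans (congrArg (fun t => g.app (op V) ≫ t) (Pi.lift_π _ _)))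

theorem skyscrapersπ_ext {F : Cᵒᵖ ⥤ E} {M : ι → E} {g g' : F ⟶ (skyscrapers E pts).obj M}
    (h : ∀ (i : ι) (U : C) (s : (pts i).fiber.obj U),
      skyscrapersπ pts g i U s = skyscrapersπ pts g' i U s) : g = g' := by
  apply NatTrans.ext; funext U
  exact Pi.hom_ext _ _ fun q => h q.1 U.unop q.2

theorem skyscrapersπ_to {F : Cᵒᵖ ⥤ E} {M : ι → E} (f : ∀ i, (stalk E (pts i)).obj F ⟶ M i)
    (i : ι) (U : C) (s : (pts i).fiber.obj U) :
    skyscrapersπ pts (toSkyscrapers pts f) i U s = germ (pts i) s F ≫ f i :=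
  Pi.lift_π _ _

theorem skyscrapersπ_map {F : Cᵒᵖ ⥤ E} {M M' : ι → E} (g : F ⟶ (skyscrapers E pts).obj M)
    (φ : M ⟶ M') (i : ι) (U : C) (s : (pts i).fiber.obj U) :
    skyscrapersπ pts (g ≫ (skyscrapers E pts).map φ) i U s = skyscrapersπ pts g i U s ≫ φ i := by
  have h : Limits.Pi.map (fun q : (Σ i, (pts i).fiber.obj U) => φ q.1) ≫ Pi.π _ ⟨i, s⟩ =
      Pi.π (fun q : (Σ i, (pts i).fiber.obj U) => M q.1) ⟨i, s⟩ ≫ φ i := Pi.map_π _ _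
  exact (Category.assoc _ _ _).trans
    ((congrArg (fun t => g.app (op U) ≫ t) h).trans (Category.assoc _ _ _).symm)

/-- The adjunction between `p^*` and `p_*`. -/
noncomputable def stalksAdjunction : stalks E pts ⊣ skyscrapers E pts :=
  Adjunction.mkOfHomEquiv
    { homEquiv := fun F M =>
        { toFun := fun f => toSkyscrapers pts f
          invFun := fun g i => stalkDesc (pts i) (skyscrapersπ pts g i) (skyscrapersπ_w pts g i)
          left_inv := fun f => by
            funext i
            refine stalk_hom_ext _ fun U s => ?_
            exact (germ_stalkDesc _ _ _ s).trans (skyscrapersπ_to pts f i U s)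
          right_inv := fun g => skyscrapersπ_ext pts fun i U s =>
            (skyscrapersπ_to pts _ i U s).trans (germ_stalkDesc _ _ _ s) }
      homEquiv_naturality_left_symm := fun {F F' M} f g => by
        funext i
        refine stalk_hom_ext (pts i) (F := F) (M := M i) fun U s => ?_
        refine (germ_stalkDesc (pts i) _ (skyscrapersπ_w pts (f ≫ g) i) s).trans (Eq.symm ?_)
        refine (comp_comp_eq_comp (germ_naturality (pts i) s f)
          (stalkDesc (pts i) _ (skyscrapersπ_w pts g i))).trans ((Category.assoc _ _ _).trans ?_)
        exact (congrArg (fun t => f.app (op U) ≫ t) (germ_stalkDesc _ _ _ s)).trans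
          (Category.assoc _ _ _).symm
      homEquiv_naturality_right := fun {F M M'} f g => skyscrapersπ_ext pts fun i U s =>
        (skyscrapersπ_to pts _ i U s).trans (Eq.symm
          ((skyscrapersπ_map pts (toSkyscrapers pts f) g i U s).trans
            ((congrArg (fun t => t ≫ g i) (skyscrapersπ_to pts f i U s)).trans
              (Category.assoc _ _ _)))) }

variable (E) in
/-- The monad `T = p_* p^*`. -/
noncomputable def godementMonad : CategoryTheory.Monad (Cᵒᵖ ⥤ E) :=
  (stalksAdjunction (E := E) pts).toMonad

variable (E) in
/-- The cosimplicial Godement resolution `G^p F = T^{p+1} F`. -/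
noncomputable def godement : (Cᵒᵖ ⥤ E) ⥤ Cosimp (Cᵒᵖ ⥤ E) :=
  cobar (godementMonad E pts)

/-- The coaugmentation `F ⟶ G^• F`, seen object-wise on the site. -/
noncomputable def godementAugmentation (F : Cᵒᵖ ⥤ E) :
    F ⋙ Functor.const SimplexCategory ⟶ ((godement E pts).obj F).flip where
  app U :=
    { app := fun n => (((cobarAugmentation (godementMonad E pts)).app F).app n).app U
      naturality := fun n m f =>
        congrArg (fun t => t.app U) (((cobarAugmentation (godementMonad E pts)).app F).naturality f) }
  naturality U V f := by
    apply NatTrans.ext; funext n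
    exact (((cobarAugmentation (godementMonad E pts)).app F).app n).naturality f

/-- The hypercohomology `ℍ F = 𝐬 G^• F`, the simple functor being applied object-wise. -/
noncomputable def hypercohomology (𝔰 : DescentStructure E) (F : Cᵒᵖ ⥤ E) : Cᵒᵖ ⥤ E :=
  ((godement E pts).obj F).flip ⋙ 𝔰.simple

/-- The natural morphism `ρ : F ⟶ ℍ F`. -/
noncomputable def toHypercohomology (𝔰 : DescentStructure E) (F : Cᵒᵖ ⥤ E) :
    F ⟶ hypercohomology pts 𝔰 F :=
  Functor.whiskerLeft F 𝔰.lam ≫ Functor.whiskerRight (godementAugmentation pts F) 𝔰.simple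

variable (J) in
/-- The global equivalences of sheaves. -/
def globalEquivalences (𝔰 : DescentStructure E) : MorphismProperty (Sheaf J E) :=
  fun _ _ f => ∀ U : Cᵒᵖ, 𝔰.E (f.hom.app U)

/-- The local equivalences of sheaves. -/
def localEquivalences (𝔰 : DescentStructure E) : MorphismProperty (Sheaf J E) :=
  fun _ _ f => ∀ i, 𝔰.E ((stalk E (pts i)).map f.hom)

end Site

section Compatible
variable {C : Type w} [SmallCategory C] (J : GrothendieckTopology C) {ι : Type w}
  (pts : ι → GrothendieckTopology.Point.{w} J) {E : Type u} [Category.{v} E]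

/-- Compatibility of a site, with a set `pts` of points, and a descent category: the points are
enough, products and filtered colimits exist and are exact with respect to the equivalences, and
sheaves form a right Cartan-Eilenberg category, with the global equivalences as strong and the
local equivalences as weak equivalences, in which `ρ : F ⟶ ℍ F` is a Cartan-Eilenberg fibrant
model of every sheaf `F`. For this to make sense, the object-wise simple of the cosimplicial sheaf
`G^• F` has to be a sheaf. -/
structure Compatible (𝔰 : DescentStructure E) : Prop where
  enoughPoints : (ObjectProperty.ofObj pts).IsConservativeFamilyOfPoints
  [hasFilteredColimits : HasFilteredColimitsOfSize.{w, w} E]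
  [hasProducts : HasProducts.{w} E]
  E_filteredColimits {K : Type w} [SmallCategory K] [IsFiltered K] {X Y : K ⥤ E} (f : X ⟶ Y)
    [HasColimitsOfShape K E] : (∀ k, 𝔰.E (f.app k)) → 𝔰.E (colimMap f)
  E_products {K : Type w} {X Y : K → E} (f : ∀ k, X k ⟶ Y k) :
    (∀ k, 𝔰.E (f k)) → 𝔰.E (Limits.Pi.map f)
  isSheaf (F : Cᵒᵖ ⥤ E) : Presheaf.IsSheaf J (hypercohomology pts 𝔰 F)
  cartanEilenberg : IsRightCartanEilenberg (globalEquivalences J 𝔰) (localEquivalences pts 𝔰)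
  fibrantModel (F : Sheaf J E) : IsCEFibrantModel (X := F)
    (M := ⟨hypercohomology pts 𝔰 F.obj, isSheaf F.obj⟩) cartanEilenberg.inverted
    ((globalEquivalences J 𝔰).Q.map ⟨toHypercohomology pts 𝔰 F.obj⟩)

end Compatible

section Transfer
variable {D : Type u} [Category.{v} D]

/-- For a functor `U`, the comparison between the constant cosimplicial object of `U A` and the
image by `U` of the constant cosimplicial object of `A`. -/
def constComparison {A : Type u₁} [Category.{v₁} A] (U : A ⥤ D) (X : A) :
    (Functor.const SimplexCategory).obj X ⋙ U ⟶ (Functor.const SimplexCategory).obj (U.obj X) where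
  app _ := 𝟙 _

/-- The comparison between the image by `U` of a diagonal, and the diagonal of the image. -/
def diagonalComparison {A : Type u₁} [Category.{v₁} A] (U : A ⥤ D) (Z : Cosimp (Cosimp A)) :
    diagonal.obj Z ⋙ U ⟶
      diagonal.obj (Z ⋙ (Functor.whiskeringRight SimplexCategory _ _).obj U) where
  app n := 𝟙 (U.obj ((Z.obj n).obj n))
  naturality n m f := by
    change U.map ((Z.map f).app n ≫ (Z.obj m).map f) ≫ 𝟙 _ =
      𝟙 _ ≫ U.map ((Z.map f).app n) ≫ U.map ((Z.obj m).map f)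
    rw [Category.comp_id, Category.id_comp, U.map_comp]

/-- A descent structure `𝔰'` which is computed by `𝔰` through a family of forgetful functors
`U k`: products and filtered colimits are preserved by these functors, the equivalences are
the morphisms sent to equivalences by all of them, and the simple functor and the transformations
`λ` and `μ` are those of `𝔰` on underlying objects. -/
structure DescentLift {A : Type u₁} [Category.{v₁} A] (𝔰' : DescentStructure A)
    (𝔰 : DescentStructure D) {κ : Type} (U : κ → A ⥤ D) where
  preservesProducts (k : κ) (I : Type w) : PreservesLimitsOfShape (Discrete I) (U k)
  preservesFilteredColimits (k : κ) : PreservesFilteredColimitsOfSize.{w, w} (U k)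
  E_iff ⦃X Y : A⦄ (f : X ⟶ Y) : 𝔰'.E f ↔ ∀ k, 𝔰.E ((U k).map f)
  simpleIso (k : κ) : 𝔰'.simple ⋙ U k ≅
    (Functor.whiskeringRight SimplexCategory _ _).obj (U k) ⋙ 𝔰.simple
  lam (k : κ) (X : A) :
    (U k).map (𝔰'.lam.app X) ≫ (simpleIso k).hom.app ((Functor.const SimplexCategory).obj X) ≫
      𝔰.simple.map (constComparison (U k) X) = 𝔰.lam.app ((U k).obj X)
  mu (k : κ) (Z : Cosimp (Cosimp A)) :
    (U k).map (𝔰'.mu.app Z) ≫ (simpleIso k).hom.app (diagonal.obj Z) ≫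
        𝔰.simple.map (diagonalComparison (U k) Z) =
      (simpleIso k).hom.app (Z ⋙ 𝔰'.simple) ≫
        𝔰.simple.map (Z.whiskerLeft (simpleIso k).hom) ≫
        𝔰.mu.app (Z ⋙ (Functor.whiskeringRight SimplexCategory _ _).obj (U k))

end Transfer

section MonoidalTransfer
variable {D : Type u} [Category.{v} D] [MonoidalCategory D]

/-- The iterated Künneth morphism `F X₁ ⊗ ⋯ ⊗ F Xₙ ⟶ F (X₁ ⊗ ⋯ ⊗ Xₙ)` of a lax monoidal functor. -/
def tensorListLax {A : Type u₁} [Category.{v₁} A] [MonoidalCategory A] (F : A ⥤ D) [F.LaxMonoidal]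
    {ι : Type w} (X : ι → A) :
    (L : List ι) → (tensorList (fun i => F.obj (X i)) L ⟶ F.obj (tensorList X L))
  | [] => Functor.LaxMonoidal.ε F
  | a :: L => (F.obj (X a) ◁ tensorListLax F X L) ≫ Functor.LaxMonoidal.μ F (X a) (tensorList X L)

/-- The Künneth morphism `F X ⊗ (F Y₁ ⊗ ⋯ ⊗ F Yₙ) ⟶ F (X ⊗ (Y₁ ⊗ ⋯ ⊗ Yₙ))` of a lax monoidal
functor. -/
def kunneth {A : Type u₁} [Category.{v₁} A] [MonoidalCategory A] (F : A ⥤ D) [F.LaxMonoidal]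
    (X : A) {n : ℕ} (Y : Fin n → A) :
    F.obj X ⊗ tensorFin (fun i => F.obj (Y i)) ⟶ F.obj (X ⊗ tensorFin Y) :=
  (F.obj X ◁ tensorListLax F Y (List.finRange n)) ≫ Functor.LaxMonoidal.μ F X (tensorFin Y)

/-- The levels of a tensor product of cosimplicial objects are the tensor products of the
levels. -/
def tensorListLevel {ι : Type w} (X : ι → Cosimp D) (n : SimplexCategory) :
    (L : List ι) → ((tensorList X L).obj n ⟶ tensorList (fun i => (X i).obj n) L)
  | [] => 𝟙 (𝟙_ D)
  | a :: L => (X a).obj n ◁ tensorListLevel X n L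

theorem tensorListLevel_naturality {ι : Type w} (X : ι → Cosimp D) {n m : SimplexCategory}
    (f : n ⟶ m) : (L : List ι) →
    (tensorList X L).map f ≫ tensorListLevel X m L =
      tensorListLevel X n L ≫ tensorListMap (fun i => (X i).map f) L
  | [] => rfl
  | a :: L => by
    have h := tensorListLevel_naturality X f L
    change ((X a).map f ⊗ₘ (tensorList X L).map f) ≫ ((X a).obj m ◁ tensorListLevel X m L) =
      ((X a).obj n ◁ tensorListLevel X n L) ≫
        ((X a).map f ⊗ₘ tensorListMap (fun i => (X i).map f) L)
    rw [← id_tensorHom, ← id_tensorHom, tensorHom_comp_tensorHom, tensorHom_comp_tensorHom, h,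
      Category.comp_id, Category.id_comp]

/-- The levels of a tensor product of cosimplicial objects. -/
def tensorFinLevel {n : ℕ} (X : Fin n → Cosimp D) (p : SimplexCategory) :
    (tensorFin X).obj p ⟶ tensorFin (fun i => (X i).obj p) :=
  tensorListLevel X p (List.finRange n)

theorem tensorFinLevel_naturality {n : ℕ} (X : Fin n → Cosimp D) {p q : SimplexCategory}
    (f : p ⟶ q) : (tensorFin X).map f ≫ tensorFinLevel X q =
      tensorFinLevel X p ≫ tensorFinMap (fun i => (X i).map f) :=
  tensorListLevel_naturality X f (List.finRange n)

theorem tensorHom_whiskerLeft_comp {A A' B B' B₁ B₂ Z Z' : D} {a : A ⟶ A'} {b : B ⟶ B'}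
    {c : B' ⟶ B₁} {d : B ⟶ B₂} {e : B₂ ⟶ B₁} (h : b ≫ c = d ≫ e) {φ : A ⊗ B₂ ⟶ Z}
    {z : Z ⟶ Z'} {ψ : A' ⊗ B₁ ⟶ Z'} (hφ : φ ≫ z = (a ⊗ₘ e) ≫ ψ) :
    (a ⊗ₘ b) ≫ (A' ◁ c) ≫ ψ = ((A ◁ d) ≫ φ) ≫ z := by
  rw [Category.assoc, hφ, ← Category.assoc, ← Category.assoc, ← id_tensorHom, ← id_tensorHom,
    tensorHom_comp_tensorHom, tensorHom_comp_tensorHom, h, Category.comp_id, Category.id_comp]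

/-- A morphism `X ⊗ (Y₁ ⊗ ⋯ ⊗ Yₙ) ⟶ Z` of cosimplicial objects, given level-wise. -/
def levelwise {X Z : Cosimp D} {n : ℕ} {Y : Fin n → Cosimp D}
    (φ : ∀ p, X.obj p ⊗ tensorFin (fun i => (Y i).obj p) ⟶ Z.obj p)
    (hφ : ∀ ⦃p q : SimplexCategory⦄ (f : p ⟶ q),
      φ p ≫ Z.map f = (X.map f ⊗ₘ tensorFinMap fun i => (Y i).map f) ≫ φ q) :
    X ⊗ tensorFin Y ⟶ Z where
  app p := (X.obj p ◁ tensorFinLevel Y p) ≫ φ p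
  naturality _ _ f := tensorHom_whiskerLeft_comp (tensorFinLevel_naturality Y f) (hφ f)

end MonoidalTransfer

section OperadTransfer
variable {D : Type u} [Category.{v} D] [MonoidalCategory D] [SymmetricCategory D]

/-- The action of a permutation on a cosimplicial operad, level-wise. -/
def levelAct (P : Cosimp (Operad D)) {l m : ℕ+} (σ : Fin l ≃ Fin m) :
    P ⋙ Operad.eval m ⟶ P ⋙ Operad.eval l where
  app p := (P.obj p).act σ
  naturality _ _ f := (Operad.Hom.act (P.map f) σ).symm

/-- The unit of a cosimplicial operad, level-wise. -/
def levelUnit (P : Cosimp (Operad D)) : 𝟙_ (Cosimp D) ⟶ P ⋙ Operad.eval 1 where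
  app p := (P.obj p).unit
  naturality _ q f := (Category.id_comp (P.obj q).unit).trans (Operad.Hom.unit (P.map f)).symm

/-- The composition of a cosimplicial operad, level-wise. -/
def levelComp (P : Cosimp (Operad D)) {l : ℕ+} (m : Fin l → ℕ+) :
    (P ⋙ Operad.eval l) ⊗ tensorFin (fun i => P ⋙ Operad.eval (m i)) ⟶
      P ⋙ Operad.eval (sumArity m) :=
  levelwise (fun p => (P.obj p).comp m) fun _ _ f => Operad.Hom.comp (P.map f) m

/-- The action of a cosimplicial algebra over a variable operad, level-wise. -/
def levelAlgAct (A : Cosimp (Alg D)) (l : ℕ+) :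
    (A ⋙ Alg.toOperad ⋙ Operad.eval l) ⊗ tensorFin (fun _ : Fin l => A ⋙ Alg.forget) ⟶
      A ⋙ Alg.forget :=
  levelwise (fun p => (A.obj p).alg.act l) fun _ _ f => Alg.Hom.act (A.map f) l

/-- The action of a cosimplicial algebra over a fixed operad, level-wise. -/
def levelOperadAlgebraAct {P : Operad D} (A : Cosimp (OperadAlgebra P)) (l : ℕ+) :
    (Functor.const SimplexCategory).obj (P.obj l) ⊗
        tensorFin (fun _ : Fin l => A ⋙ OperadAlgebra.forget P) ⟶
      A ⋙ OperadAlgebra.forget P :=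
  levelwise (fun p => (A.obj p).act l) fun _ _ f => OperadAlgebra.Hom.act (A.map f) l

/-- Isomorphisms `θ` of the objects of an operad `Q` with the simples of the arities of
a cosimplicial operad `P`, under which the structure of `Q` is induced by that of `P` through the
Künneth morphisms of the simple functor `s`. -/
structure IsInducedOperad (s : Cosimp D ⥤ D) [s.LaxMonoidal] (P : Cosimp (Operad D)) (Q : Operad D)
    (θ : ∀ l : ℕ+, Q.obj l ⟶ s.obj (P ⋙ Operad.eval l)) : Prop where
  act {l m : ℕ+} (σ : Fin l ≃ Fin m) : Q.act σ ≫ θ l = θ m ≫ s.map (levelAct P σ)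
  unit : Q.unit ≫ θ 1 = Functor.LaxMonoidal.ε s ≫ s.map (levelUnit P)
  comp {l : ℕ+} (m : Fin l → ℕ+) : Q.comp m ≫ θ (sumArity m) =
    (θ l ⊗ₘ tensorFinMap fun i => θ (m i)) ≫ kunneth s _ _ ≫ s.map (levelComp P m)

variable (𝔰 : MonoidalDescentStructure D)

/-- The descent structure on operads which is defined arity-wise, the operad structure of a simple
being induced through the Künneth morphisms. -/
structure OperadDescentLift (𝔰' : DescentStructure (Operad D)) extends
    DescentLift.{w} 𝔰' 𝔰.toDescentStructure Operad.eval where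
  induced (P : Cosimp (Operad D)) : letI := 𝔰.simpleLax
    IsInducedOperad 𝔰.simple P (𝔰'.simple.obj P) fun l => (simpleIso l).hom.app P

/-- The underlying objects of an algebra over a variable operad: the arities of the operad, and
the object on which it acts. -/
def Alg.components : Option ℕ+ → (Alg D ⥤ D)
  | none => Alg.forget
  | some l => Alg.toOperad ⋙ Operad.eval l

/-- The descent structure on algebras over variable operads which is defined by forgetting the
structure, the structure of a simple being induced through the Künneth morphisms. -/
structure AlgDescentLift (𝔰' : DescentStructure (Alg D)) extends
    DescentLift.{w} 𝔰' 𝔰.toDescentStructure Alg.components where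
  induced (A : Cosimp (Alg D)) : letI := 𝔰.simpleLax
    IsInducedOperad 𝔰.simple (A ⋙ Alg.toOperad) (𝔰'.simple.obj A).operad
      fun l => (simpleIso (some l)).hom.app A
  act (A : Cosimp (Alg D)) (l : ℕ+) : letI := 𝔰.simpleLax
    (𝔰'.simple.obj A).alg.act l ≫ (simpleIso none).hom.app A =
      ((simpleIso (some l)).hom.app A ⊗ₘ tensorFinMap fun _ => (simpleIso none).hom.app A) ≫
        kunneth 𝔰.simple _ _ ≫ 𝔰.simple.map (levelAlgAct A l)

/-- The descent structure on algebras over a fixed operad which is defined by forgetting the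
algebra structure, the algebra structure of a simple being induced through the transformation `λ`
and the Künneth morphisms. -/
structure OperadAlgebraDescentLift (P : Operad D) (𝔰' : DescentStructure (OperadAlgebra P)) extends
    DescentLift.{w} 𝔰' 𝔰.toDescentStructure fun _ : Unit => OperadAlgebra.forget P where
  act (A : Cosimp (OperadAlgebra P)) (l : ℕ+) : letI := 𝔰.simpleLax
    (𝔰'.simple.obj A).act l ≫ (simpleIso ()).hom.app A =
      (𝔰.lam.app (P.obj l) ⊗ₘ tensorFinMap fun _ => (simpleIso ()).hom.app A) ≫
        kunneth 𝔰.simple _ _ ≫ 𝔰.simple.map (levelOperadAlgebraAct A l)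

end OperadTransfer

end GodementOperads

set_option linter.unusedSectionVars false

universe v₃ u₃

namespace GodementOperads

/-! ### Equivalences, homotopies and contractions in a descent category. -/

namespace DescentStructure
variable {D : Type u} [Category.{v} D] (𝔰 : DescentStructure D)

/-! The theorem splits into two problems: carrying the descent structure of `D` over to algebraic
structures in `D`, and showing that compatibility with a site can be tested on underlying objects.

Compatibility. Suppose that filtered colimits and products preserve equivalences, and that ℍ takes
values in sheaves. Then compatibility amounts to two properties of ρ, for all presheaves F: ρ_F is a
local equivalence, and ρ_{ℍF} is a global one. If they hold, ℍ turns local equivalences into global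
ones and ρ exhibits it as a resolvent functor, so the ℍF are fibrant models
(`isCEFibrantModel_of_resolvent`, `Compatible.of_hyperUnit`). The converse is harder, because
compatibility only speaks of sheaves, whereas `D` is not assumed to have equalizers and the presheaf
underlying a sheaf of operads is not known to be a sheaf. What is known is that ℍF is always a
sheaf, so that ρ_{ℍF} is a local equivalence, and one has to go back from ℍF to F. This is
`ExactEquivalences.local_hyperUnit`. It rests on the contractions of the resolution G^•F given by
extra degeneracies: on fibres, on the objects TF, and after application of T^{p+1}. These
contractions make ρℍ and ℍρ comparable as maps ℍ → ℍℍ, and the two-out-of-six property finishes the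
argument on fibres.

Both properties of ρ then pass through any family of functors which preserves products and filtered
colimits, commutes with 𝐬 and λ, and detects equivalences and limit cones, since ℍ commutes with
such functors up to isomorphism (`DescentLift.compatible`).

Descent structure. In every axiom of operads and algebras, the two sides for the image under a lax
symmetric monoidal functor Φ are the images of the original sides, preceded by one and the same
Künneth morphism. Hence Φ preserves the axioms; for the same reason, a jointly faithful family of
strong monoidal functors reflects them. Through evaluations, a diagram of operads is therefore an
operad in a functor category, and applying Φ yields an operad again. With Φ a product, a filtered
colimit (this uses (G3)) or 𝐬, one obtains products, filtered colimits and simples on underlying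
objects (`LaxClosed`). That λ and μ are monoidal says precisely that they are morphisms of
structures, and all axioms of a descent structure can be read off on underlying objects
(`transferDescentStructure`).

For a fixed operad P, these constructions give algebras over the limit, colimit or simple of the
constant diagram P, which are restricted along the canonical morphism from P; for 𝐬 this morphism is
λ_P. The double simple is restricted along λ twice and the simple of the diagonal only once, and the
compatibility of λ with μ is what makes μ linear over P (`OperadAlgebra.muComparison_operad`). -/

theorem E_iff_isIso {X Y : D} (f : X ⟶ Y) : 𝔰.E f ↔ IsIso (𝔰.E.Q.map f) :=
  ⟨fun h => MorphismProperty.Q_inverts _ f h, 𝔰.E_saturated f⟩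

theorem E_comp {X Y Z : D} {f : X ⟶ Y} {g : Y ⟶ Z} (hf : 𝔰.E f) (hg : 𝔰.E g) : 𝔰.E (f ≫ g) := by
  rw [E_iff_isIso] at *
  rw [Functor.map_comp]
  infer_instance

theorem E_of_isIso {X Y : D} (f : X ⟶ Y) [IsIso f] : 𝔰.E f := by
  rw [E_iff_isIso]
  infer_instance

theorem E_of_comp_left {X Y Z : D} {f : X ⟶ Y} {g : Y ⟶ Z} (hf : 𝔰.E f) (h : 𝔰.E (f ≫ g)) :
    𝔰.E g := by
  rw [E_iff_isIso] at *
  rw [Functor.map_comp] at h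
  exact IsIso.of_isIso_comp_left (𝔰.E.Q.map f) _

theorem E_of_comp_right {X Y Z : D} {f : X ⟶ Y} {g : Y ⟶ Z} (hg : 𝔰.E g) (h : 𝔰.E (f ≫ g)) :
    𝔰.E f := by
  rw [E_iff_isIso] at *
  rw [Functor.map_comp] at h
  exact IsIso.of_isIso_comp_right _ (𝔰.E.Q.map g)

/-- The two-out-of-six property of a saturated class, for its first morphism. -/
theorem E_of_two_of_six {X Y Z W : D} {f : X ⟶ Y} {g : Y ⟶ Z} {h : Z ⟶ W} (hfg : 𝔰.E (f ≫ g))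
    (hgh : 𝔰.E (g ≫ h)) : 𝔰.E f := by
  rw [E_iff_isIso] at *
  rw [Functor.map_comp] at hfg hgh
  -- In the localization `g` has a section because `f ≫ g` is invertible, and is a monomorphism
  -- because `g ≫ h` is invertible.
  have : IsSplitEpi (𝔰.E.Q.map g) :=
    ⟨⟨⟨inv (𝔰.E.Q.map f ≫ 𝔰.E.Q.map g) ≫ 𝔰.E.Q.map f, by simp⟩⟩⟩
  have : Mono (𝔰.E.Q.map g) := mono_of_mono _ (𝔰.E.Q.map h)
  have : IsIso (𝔰.E.Q.map g) := isIso_of_mono_of_isSplitEpi _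
  exact IsIso.of_isIso_comp_right _ (𝔰.E.Q.map g)

theorem E_congr {X Y X' Y' : D} {f : X ⟶ Y} {g : X' ⟶ Y'} (a : X ⟶ X') (b : Y ⟶ Y') [IsIso a]
    [IsIso b] (w : f ≫ b = a ≫ g) : 𝔰.E f ↔ 𝔰.E g :=
  ⟨fun h => 𝔰.E_of_comp_left (𝔰.E_of_isIso a) (w ▸ 𝔰.E_comp h (𝔰.E_of_isIso b)),
    fun h => 𝔰.E_of_comp_right (𝔰.E_of_isIso b) (w.symm ▸ 𝔰.E_comp (𝔰.E_of_isIso a) h)⟩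

theorem coaugmentation_w {K : Type*} [Category* K] {A : D} {Z : K ⥤ D}
    (a : (Functor.const K).obj A ⟶ Z) {n m : K} (f : n ⟶ m) : a.app n ≫ Z.map f = a.app m :=
  (a.naturality f).symm.trans (Category.id_comp (a.app m))

/-- The coaugmentation in a fixed second degree of a coaugmented bicosimplicial object. -/
def coaugmentationLevel {Y : Cosimp D} {Z : Cosimp (Cosimp D)}
    (a : (Functor.const SimplexCategory).obj Y ⟶ Z) :
    Y ⋙ Functor.const SimplexCategory ⟶ Z.flip where
  app p :=
    { app := fun n => (a.app n).app p
      naturality := fun _ _ f => congrArg (fun t => t.app p) (a.naturality f) }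
  naturality _ _ f := NatTrans.ext (funext fun n => (a.app n).naturality f)

/-- The map from the simple of `Y` to the double simple of `Z` given by a coaugmentation of the
bicosimplicial object `Z` in the first direction is an equivalence if the coaugmentation is
an equivalence in each second degree, after application of the simple functor. -/
theorem E_lam_map_coaugmentation {Y : Cosimp D} {Z : Cosimp (Cosimp D)}
    (a : (Functor.const SimplexCategory).obj Y ⟶ Z)
    (h : ∀ p, 𝔰.E (𝔰.lam.app (Y.obj p) ≫ 𝔰.simple.map ((coaugmentationLevel a).app p))) :
    𝔰.E (𝔰.lam.app (𝔰.simple.obj Y) ≫ 𝔰.simple.map (constSimpleTo 𝔰.simple Y) ≫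
      𝔰.simple.map (Functor.whiskerRight a 𝔰.simple)) := by
  let b := coaugmentationLevel a
  -- The diagonal of the coaugmentation. The hypothesis and the conclusion both amount to 𝐬 `d`
  -- being an equivalence, one through each of the two compatibilities of λ with μ.
  let d : Y ⟶ diagonal.obj Z :=
    { app := fun n => (a.app n).app n
      naturality := fun n m f => by
        have h1 := congrArg (fun t => t.app n) (coaugmentation_w a f)
        have h2 := (a.app m).naturality f
        change (a.app n).app n ≫ (Z.map f).app n = (a.app m).app n at h1
        change Y.map f ≫ (a.app m).app m = (a.app m).app n ≫ (Z.obj m).map f at h2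
        change Y.map f ≫ (a.app m).app m = (a.app n).app n ≫ (Z.map f).app n ≫ (Z.obj m).map f
        rw [h2, ← h1, Category.assoc] }
  -- The two diagonals have the same objects; their structure maps compose the two directions in
  -- opposite orders, and agree by naturality.
  let e : diagonal.obj Z ⟶ diagonal.obj Z.flip :=
    { app := fun n => 𝟙 _
      naturality := fun _ _ f => (Category.comp_id _).trans
        (((Z.map f).naturality f).symm.trans (Category.id_comp _).symm) }
  have he : ∀ n, IsIso (e.app n) := fun n => inferInstanceAs (IsIso (𝟙 _))
  have : IsIso e := NatIso.isIso_of_isIso_app e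
  -- After flipping, the hypothesis is a degree-wise equivalence in `p`, to which 𝐬 applies.
  -- Composed with μ it becomes 𝐬 `d` up to the isomorphism `e`, by `map_lam_mu`.
  have hd : 𝔰.E (𝔰.simple.map d) := by
    have h1 : 𝔰.E (𝔰.simple.map (Y.whiskerLeft 𝔰.lam) ≫
        𝔰.simple.map (Functor.whiskerRight b 𝔰.simple)) := by
      rw [← Functor.map_comp]
      exact 𝔰.E_simple _ h
    have h2 := 𝔰.E_comp h1 (𝔰.E_mu Z.flip)
    have h4 := 𝔰.map_lam_mu Y
    have h5 : (𝔰.simple.map (Functor.whiskerRight b 𝔰.simple) ≫ 𝔰.mu.app Z.flip) =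
        𝔰.mu.app (Y ⋙ Functor.const SimplexCategory) ≫ 𝔰.simple.map (diagonal.map b) :=
      𝔰.mu.naturality b
    have hdiag : diagonal.map b = diagonalLevelConst Y ≫ d ≫ e :=
      NatTrans.ext (funext fun n => ((Category.id_comp _).trans (Category.comp_id _)).symm)
    rw [Category.assoc, h5, hdiag, Functor.map_comp, Functor.map_comp] at h2
    have h6 : (𝔰.simple.map (Y.whiskerLeft 𝔰.lam) ≫ 𝔰.mu.app (Y ⋙ Functor.const SimplexCategory) ≫
        𝔰.simple.map (diagonalLevelConst Y)) ≫ 𝔰.simple.map d ≫ 𝔰.simple.map e =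
        𝔰.simple.map d ≫ 𝔰.simple.map e :=
      (congrArg (fun t => t ≫ 𝔰.simple.map d ≫ 𝔰.simple.map e) h4).trans (Category.id_comp _)
    rw [Category.assoc, Category.assoc] at h6
    rw [h6] at h2
    exact 𝔰.E_of_comp_right (𝔰.E_of_isIso _) h2
  -- By `lam_mu`, the morphism in question followed by μ at `Z` is 𝐬 `d`, so it is an equivalence
  -- along with μ.
  have h4 := 𝔰.lam_mu Y
  have hdiag : diagonal.map a = diagonalConst Y ≫ d :=
    NatTrans.ext (funext fun n => (Category.id_comp _).symm)
  refine 𝔰.E_of_comp_right (𝔰.E_mu Z) ?_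
  have h5 : 𝔰.simple.map (Functor.whiskerRight a 𝔰.simple) ≫ 𝔰.mu.app Z =
        𝔰.mu.app ((Functor.const SimplexCategory).obj Y) ≫ 𝔰.simple.map (diagonal.map a) :=
    𝔰.mu.naturality a
  have h6 : (𝔰.lam.app (𝔰.simple.obj Y) ≫ 𝔰.simple.map (constSimpleTo 𝔰.simple Y) ≫
      𝔰.mu.app ((Functor.const SimplexCategory).obj Y) ≫ 𝔰.simple.map (diagonalConst Y)) ≫
      𝔰.simple.map d = 𝔰.simple.map d :=
    (congrArg (fun t => t ≫ 𝔰.simple.map d) h4).trans (Category.id_comp _)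
  rw [Category.assoc, Category.assoc, h5, hdiag, Functor.map_comp]
  simp only [Category.assoc] at h6
  rw [h6]
  exact hd

/-- The cosimplicial object of paths in `Y`. -/
noncomputable def pathCosimp [HasFiniteProducts D] (Y : Cosimp D) : Cosimp D where
  obj n := ∏ᶜ fun _ : n ⟶ SimplexCategory.mk 1 => Y.obj n
  map {n m} f := Pi.lift fun α => Pi.π (fun _ : n ⟶ SimplexCategory.mk 1 => Y.obj n) (f ≫ α) ≫
    Y.map f

/-- The evaluation of paths in `Y` at a vertex. -/
noncomputable def pathCosimpEval [HasFiniteProducts D] (Y : Cosimp D) (i : Fin 2) :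
    pathCosimp Y ⟶ Y where
  app n := Pi.π _ (SimplexCategory.const n (SimplexCategory.mk 1) i)
  naturality n m f := by
    have h : f ≫ SimplexCategory.const m (SimplexCategory.mk 1) i =
        SimplexCategory.const n (SimplexCategory.mk 1) i := rfl
    simp [pathCosimp, h]

/-- The constant paths in `Y`. -/
noncomputable def pathCosimpConst [HasFiniteProducts D] (Y : Cosimp D) : Y ⟶ pathCosimp Y where
  app n := Pi.lift fun _ => 𝟙 _
  naturality n m f := by
    refine Pi.hom_ext _ _ fun α => ?_
    change (_ ≫ Pi.lift _) ≫ _ = (Pi.lift _ ≫ Pi.lift _) ≫ _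
    simp

theorem pathCosimpConst_eval [HasFiniteProducts D] (Y : Cosimp D) (i : Fin 2) :
    pathCosimpConst Y ≫ pathCosimpEval Y i = 𝟙 Y := by
  refine NatTrans.ext (funext fun n => ?_)
  exact Pi.lift_π _ _

/-- The functoriality of `A^{Δ[1]}`. -/
noncomputable def pathObjectMap [HasFiniteProducts D] {A B : D} (f : A ⟶ B) :
    pathObject A ⟶ pathObject B where
  app n := Limits.Pi.map fun _ => f
  naturality n m g := by
    dsimp [pathObject]
    ext α
    simp

/-- The paths in `Y` are the diagonal of the bicosimplicial object made of the path objects of the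
`Y.obj n`. In each degree the evaluation at the vertex 1 is an equivalence by `E_path`, and μ passes
from the double simple to the simple of the diagonal. -/
theorem E_pathCosimpEval_one [HasFiniteProducts D] (Y : Cosimp D) :
    𝔰.E (𝔰.simple.map (pathCosimpEval Y 1)) := by
  let P : Cosimp (Cosimp D) :=
    { obj := fun n => pathObject (Y.obj n)
      map := fun f => pathObjectMap (Y.map f)
      map_id := fun n => by ext m; dsimp [pathObjectMap, pathObject]; ext; simp
      map_comp := fun f g => by ext m; dsimp [pathObjectMap, pathObject]; ext; simp }
  let b : P ⟶ Y ⋙ Functor.const SimplexCategory :=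
    { app := fun n => pathObjectEval (Y.obj n)
      naturality := fun n m f => by
        refine NatTrans.ext (funext fun p => ?_)
        exact Pi.map_π (fun _ : p ⟶ SimplexCategory.mk 1 => Y.map f) _ }
  have h1 : 𝔰.E (𝔰.simple.map (Functor.whiskerRight b 𝔰.simple)) :=
    𝔰.E_simple _ fun n => 𝔰.E_path (Y.obj n)
  have h2 : 𝔰.simple.map (Functor.whiskerRight b 𝔰.simple) ≫
      𝔰.mu.app (Y ⋙ Functor.const SimplexCategory) =
        𝔰.mu.app P ≫ 𝔰.simple.map (diagonal.map b) := 𝔰.mu.naturality b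
  have h3 : 𝔰.E (𝔰.simple.map (diagonal.map b)) := by
    refine 𝔰.E_of_comp_left (𝔰.E_mu P) ?_
    rw [← h2]
    exact 𝔰.E_comp h1 (𝔰.E_mu _)
  -- The identity in each degree: only the transition maps have to be compared, on each factor of
  -- the product.
  let e : pathCosimp Y ⟶ diagonal.obj P :=
    { app := fun n => 𝟙 _
      naturality := fun n m f => by
        refine Pi.hom_ext _ _ fun α => ?_
        have h1 : (pathCosimp Y).map f ≫ Pi.π (fun _ : m ⟶ SimplexCategory.mk 1 => Y.obj m) α =
            Pi.π (fun _ : n ⟶ SimplexCategory.mk 1 => Y.obj n) (f ≫ α) ≫ Y.map f := Pi.lift_π _ _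
        have h2 : (pathObject (Y.obj m)).map f ≫
            Pi.π (fun _ : m ⟶ SimplexCategory.mk 1 => Y.obj m) α =
            Pi.π (fun _ : n ⟶ SimplexCategory.mk 1 => Y.obj m) (f ≫ α) := Pi.lift_π _ _
        have h3 : (pathObjectMap (Y.map f)).app n ≫
            Pi.π (fun _ : n ⟶ SimplexCategory.mk 1 => Y.obj m) (f ≫ α) =
            Pi.π (fun _ : n ⟶ SimplexCategory.mk 1 => Y.obj n) (f ≫ α) ≫ Y.map f :=
          Pi.map_π (fun _ : n ⟶ SimplexCategory.mk 1 => Y.map f) _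
        have h4 := (Category.assoc _ _ _).trans ((congrArg (fun t => (pathObjectMap (Y.map f)).app n ≫ t) h2).trans h3)
        have h5 := congrArg (fun t => t ≫ Pi.π (fun _ : m ⟶ SimplexCategory.mk 1 => Y.obj m) α)
          (Category.comp_id ((pathCosimp Y).map f))
        have h6 := congrArg (fun t => t ≫ Pi.π (fun _ : m ⟶ SimplexCategory.mk 1 => Y.obj m) α)
          (Category.id_comp ((pathObjectMap (Y.map f)).app n ≫ (pathObject (Y.obj m)).map f))
        exact h5.trans (h1.trans (h4.symm.trans h6.symm)) }
  let e' : Y ⟶ diagonal.obj (Y ⋙ Functor.const SimplexCategory) :=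
    { app := fun n => 𝟙 _
      naturality := fun _ _ _ => (Category.comp_id _).trans
        ((Category.comp_id _).symm.trans (Category.id_comp _).symm) }
  have he : ∀ n, IsIso (e.app n) := fun n => inferInstanceAs (IsIso (𝟙 _))
  have he' : ∀ n, IsIso (e'.app n) := fun n => inferInstanceAs (IsIso (𝟙 _))
  have : IsIso e := NatIso.isIso_of_isIso_app e
  have : IsIso e' := NatIso.isIso_of_isIso_app e'
  refine (𝔰.E_congr (𝔰.simple.map e) (𝔰.simple.map e') ?_).2 h3
  rw [← Functor.map_comp, ← Functor.map_comp]
  congr 1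
  refine NatTrans.ext (funext fun n => ?_)
  exact (Category.comp_id _).trans (Category.id_comp _).symm

/-- Both evaluations are retractions of the constant paths, which become invertible because the
evaluation at 1 does. Consequently 𝐬 sends homotopic maps to the same map of the localization. -/
theorem Q_map_pathCosimpEval [HasFiniteProducts D] (Y : Cosimp D) :
    𝔰.E.Q.map (𝔰.simple.map (pathCosimpEval Y 0)) =
      𝔰.E.Q.map (𝔰.simple.map (pathCosimpEval Y 1)) := by
  have h1 := (𝔰.E_iff_isIso _).1 (𝔰.E_pathCosimpEval_one Y)
  have h (i : Fin 2) : 𝔰.E.Q.map (𝔰.simple.map (pathCosimpConst Y)) ≫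
      𝔰.E.Q.map (𝔰.simple.map (pathCosimpEval Y i)) = 𝟙 _ := by
    rw [← Functor.map_comp, ← Functor.map_comp, pathCosimpConst_eval, CategoryTheory.Functor.map_id,
      CategoryTheory.Functor.map_id]
  have h2 : IsIso (𝔰.E.Q.map (𝔰.simple.map (pathCosimpConst Y))) := by
    have := h 1
    rw [← IsIso.eq_comp_inv, Category.id_comp] at this
    rw [this]
    infer_instance
  rw [← cancel_epi (𝔰.E.Q.map (𝔰.simple.map (pathCosimpConst Y))), h, h]

/-- The data of a contraction of a coaugmented cosimplicial object: a retraction `r` onto the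
coaugmentation and a homotopy `K`, indexed by the simplices of `Δ[1]`, between the
identity and the map `Y ⟶ A ⟶ Y`, where `i` is the vertex at which the homotopy is
the latter. -/
structure Contraction {Y : Cosimp D} {A : D} (a : (Functor.const SimplexCategory).obj A ⟶ Y) where
  r : Y ⟶ (Functor.const SimplexCategory).obj A
  a_r : a ≫ r = 𝟙 _
  K (n : SimplexCategory) (α : n ⟶ SimplexCategory.mk 1) : Y.obj n ⟶ Y.obj n
  K_naturality {n m : SimplexCategory} (f : n ⟶ m) (α : m ⟶ SimplexCategory.mk 1) :
    K n (f ≫ α) ≫ Y.map f = Y.map f ≫ K m α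
  i : Fin 2
  j : Fin 2
  K_i (n : SimplexCategory) :
    K n (SimplexCategory.const n (SimplexCategory.mk 1) i) = r.app n ≫ a.app n
  K_j (n : SimplexCategory) : K n (SimplexCategory.const n (SimplexCategory.mk 1) j) = 𝟙 _

/-- A contraction makes `a` a homotopy equivalence, which 𝐬 sends to an equivalence since the
evaluations of paths at both vertices agree in the localization. The direction of the homotopy does
not matter, so both kinds of contraction below are covered. -/
theorem E_of_contraction {Y : Cosimp D} {A : D} {a : (Functor.const SimplexCategory).obj A ⟶ Y}
    (c : Contraction a) : 𝔰.E (𝔰.lam.app A ≫ 𝔰.simple.map a) := by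
  have := 𝔰.hasFiniteProducts
  refine 𝔰.E_comp (𝔰.E_lam A) ?_
  let κ : Y ⟶ pathCosimp Y :=
    { app := fun n => Pi.lift fun α => c.K n α
      naturality := fun n m f => by
        refine Pi.hom_ext _ _ fun α => ?_
        change (_ ≫ Pi.lift _) ≫ _ = (Pi.lift _ ≫ Pi.lift _) ≫ _
        simp [c.K_naturality] }
  have hi : κ ≫ pathCosimpEval Y c.i = c.r ≫ a := by
    refine NatTrans.ext (funext fun n => ?_)
    exact (Pi.lift_π _ _).trans (c.K_i n)
  have hj : κ ≫ pathCosimpEval Y c.j = 𝟙 _ := by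
    refine NatTrans.ext (funext fun n => ?_)
    exact (Pi.lift_π _ _).trans (c.K_j n)
  have hQ (k : Fin 2) : 𝔰.E.Q.map (𝔰.simple.map (pathCosimpEval Y k)) =
      𝔰.E.Q.map (𝔰.simple.map (pathCosimpEval Y 1)) := by
    fin_cases k
    · exact 𝔰.Q_map_pathCosimpEval Y
    · rfl
  -- `c.r ≫ a` and the identity are the evaluations of κ at the vertices `i` and `j`.
  have h : 𝔰.E.Q.map (𝔰.simple.map c.r) ≫ 𝔰.E.Q.map (𝔰.simple.map a) = 𝟙 _ := by
    rw [← Functor.map_comp, ← Functor.map_comp, ← hi, Functor.map_comp, Functor.map_comp, hQ,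
      ← hQ c.j, ← Functor.map_comp, ← Functor.map_comp, hj, CategoryTheory.Functor.map_id, CategoryTheory.Functor.map_id]
  have h' : 𝔰.E.Q.map (𝔰.simple.map a) ≫ 𝔰.E.Q.map (𝔰.simple.map c.r) = 𝟙 _ := by
    rw [← Functor.map_comp, ← Functor.map_comp, c.a_r, CategoryTheory.Functor.map_id]
    exact CategoryTheory.Functor.map_id _ _
  rw [E_iff_isIso]
  exact ⟨_, h', h⟩

end DescentStructure

/-! ### Extra degeneracies for the resolution of a monad. -/

section Cobar
variable {A : Type u} [Category.{v} A] (T : CategoryTheory.Monad A)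

/-- The successor map between finite ordinals. -/
def succHom (n : ℕ) : Fin n →o Fin (n + 1) where
  toFun := Fin.succ
  monotone' _ _ h := Fin.succ_le_succ_iff.2 h

/-- The extension of a monotone map which preserves an added least element. -/
def consHom {m n : ℕ} (f : Fin m →o Fin n) : Fin (m + 1) →o Fin (n + 1) where
  toFun := Fin.cases 0 fun i => (f i).succ
  monotone' i j := by
    refine Fin.cases (fun _ => Fin.zero_le _) (fun i => ?_) i
    refine Fin.cases (fun h => absurd h (by simp)) (fun j h => ?_) j
    exact Fin.succ_le_succ_iff.2 (f.monotone (Fin.succ_le_succ_iff.1 h))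

/-- The extension of a monotone map which preserves an added greatest element. -/
def snocHom {m n : ℕ} (f : Fin m →o Fin n) : Fin (m + 1) →o Fin (n + 1) where
  toFun := Fin.lastCases (Fin.last n) fun i => (f i).castSucc
  monotone' i j := by
    refine Fin.lastCases (fun _ => ?_) (fun j => ?_) j
    · simp [Fin.le_last]
    · refine Fin.lastCases (fun h => absurd h (by simp)) (fun i h => ?_) i
      simpa using f.monotone (by simpa using h)

theorem snocHom_last {m n : ℕ} (f : Fin m →o Fin n) : snocHom f (Fin.last m) = Fin.last n :=
  Fin.lastCases_last (motive := fun _ => Fin (n + 1))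

theorem snocHom_castSucc {m n : ℕ} (f : Fin m →o Fin n) (i : Fin m) :
    snocHom f i.castSucc = (f i).castSucc :=
  Fin.lastCases_castSucc (motive := fun _ => Fin (n + 1)) i

/-- The constant monotone map. -/
def constHom (m n : ℕ) (i : Fin n) : Fin m →o Fin n where
  toFun _ := i
  monotone' _ _ _ := le_rfl

theorem monadPowMap_comp' (X : A) {m n p : ℕ} (f : Fin m →o Fin n) (g : Fin n →o Fin p) :
    monadPowMap T X n m f ≫ monadPowMap T X p n g = monadPowMap T X p m (g.comp f) :=
  (monadPowMap_comp T X _ m n p rfl f g).symm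

theorem monadPowMap_succHom (X : A) : (n : ℕ) →
    monadPowMap T X (n + 1) n (succHom n) = monadPowUnit T X n
  | 0 => by
    rw [monadPowMap_zero_succ, eq_emptyHom (emptyHom 0), ← eq_emptyHom OrderHom.id, monadPowMap_id,
      Category.id_comp]
  | n + 1 => by
    have h0 : succHom (n + 1) 0 ≠ 0 := Fin.succ_ne_zero (0 : Fin (n + 1))
    have h : predHom (succHom (n + 1)) h0 = OrderHom.id := OrderHom.ext _ _ (funext fun i =>
      Fin.succ_injective _ (succ_predHom _ h0 i))
    rw [monadPowMap_succ_neg T X _ h0, h, monadPowMap_id, Category.id_comp]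

theorem monadPowMap_succHom_comp (X : A) {m n : ℕ} (f : Fin m →o Fin n) :
    monadPowMap T X (n + 1) m ((succHom n).comp f) = monadPowMap T X n m f ≫ monadPowUnit T X n := by
  rw [← monadPowMap_comp', monadPowMap_succHom]

/-- The added least element is the outermost factor `T`. The map fixes it and sends nothing else to
it, so it acts as `T` applied to the action of `f`; the unit and the multiplication that the
recursion introduces cancel. -/
theorem monadPowMap_consHom (X : A) {m n : ℕ} (f : Fin m →o Fin n) :
    monadPowMap T X (n + 1) (m + 1) (consHom f) = T.map (monadPowMap T X n m f) := by
  have h : tailHom (consHom f) = (succHom n).comp f := rfl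
  rw [monadPowMap_succ_pos T X _ rfl, h, monadPowMap_succHom_comp]
  have key {Y Z : A} (f : Y ⟶ Z) : T.map (f ≫ T.η.app Z) ≫ T.μ.app Z = T.map f := by
    rw [Functor.map_comp, Category.assoc, T.right_unit]
    exact Category.comp_id _
  exact key _

/-- The multiplication of an algebra, applied at the innermost factor of an iterate of a monad. -/
def monadPowAlg {M : A} (a : T.obj M ⟶ M) : (n : ℕ) → (monadPow T M (n + 1) ⟶ monadPow T M n)
  | 0 => a
  | n + 1 => T.map (monadPowAlg a n)

/-- Only the greatest element is sent to the greatest element, so the innermost factor `T` is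
neither multiplied nor created. Any morphism `T M ⟶ M` may be applied there, and no axiom of
algebras is needed. -/
theorem monadPowAlg_naturality {M : A} (a : T.obj M ⟶ M) : (n m : ℕ) → (f : Fin m →o Fin n) →
    monadPowMap T M (n + 1) (m + 1) (snocHom f) ≫ monadPowAlg T a n =
      monadPowAlg T a m ≫ monadPowMap T M n m f
  | 0, 0, f => by
    rw [monadPowMap_zero_zero, Category.comp_id, show snocHom f = OrderHom.id from
      OrderHom.ext _ _ (funext fun _ => Subsingleton.elim (α := Fin 1) _ _), monadPowMap_id, Category.id_comp]
  | 0, _ + 1, f => (f 0).elim0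
  | n + 1, 0, f => by
    have h0 : snocHom f 0 ≠ 0 := by
      have : snocHom f 0 = Fin.last (n + 1) := snocHom_last f
      rw [this]
      exact (Fin.last_pos).ne'
    have h : predHom (snocHom f) h0 = snocHom (emptyHom n) := by
      refine OrderHom.ext _ _ (funext fun i => Fin.succ_injective _ ?_)
      refine (succ_predHom _ h0 i).trans ?_
      obtain rfl : i = Fin.last 0 := Subsingleton.elim (α := Fin 1) _ _
      rw [snocHom_last, snocHom_last, Fin.succ_last]
    rw [monadPowMap_succ_neg T M _ h0, h, monadPowMap_zero_succ, ← Category.assoc,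
      ← monadPowAlg_naturality a n 0, Category.assoc, Category.assoc]
    congr 1
    exact (T.η.naturality (monadPowAlg T a n)).symm
  | n + 1, m + 1, f => by
    by_cases h0 : f 0 = 0
    · have h0' : snocHom f 0 = 0 := by
        have : snocHom f (Fin.castSucc 0) = (f 0).castSucc := snocHom_castSucc f 0
        simpa [h0] using this
      have h : tailHom (snocHom f) = snocHom (tailHom f) := by
        refine OrderHom.ext _ _ (funext fun i => ?_)
        refine Fin.lastCases ?_ (fun i => ?_) i
        · change snocHom f (Fin.last m).succ = snocHom (tailHom f) (Fin.last m)
          rw [Fin.succ_last, snocHom_last, snocHom_last]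
        · change snocHom f i.castSucc.succ = snocHom (tailHom f) i.castSucc
          rw [Fin.succ_castSucc, snocHom_castSucc, snocHom_castSucc]
          rfl
      rw [monadPowMap_succ_pos T M _ h0', monadPowMap_succ_pos T M f h0, h]
      have key {Y Z Y' Z' : A} (c : Y ⟶ Y') (b : Z ⟶ Z') (h : Y ⟶ T.obj Z) (h' : Y' ⟶ T.obj Z')
          (w : h ≫ T.map b = c ≫ h') :
          (T.map h ≫ T.μ.app Z) ≫ T.map b = T.map c ≫ T.map h' ≫ T.μ.app Z' := by
        have e := T.μ.naturality b
        simp only [Functor.comp_map] at e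
        rw [Category.assoc, ← e, ← Category.assoc, ← T.map_comp, w, T.map_comp, Category.assoc]
      exact key _ _ _ _ (monadPowAlg_naturality a (n + 1) m (tailHom f))
    · have h0' : snocHom f 0 ≠ 0 := by
        have : snocHom f (Fin.castSucc 0) = (f 0).castSucc := snocHom_castSucc f 0
        intro h
        refine h0 (Fin.castSucc_injective _ ?_)
        rw [← this]
        exact h
      have h : predHom (snocHom f) h0' = snocHom (predHom f h0) := by
        refine OrderHom.ext _ _ (funext fun i => Fin.succ_injective _ ?_)
        refine (succ_predHom _ h0' i).trans ?_
        refine Fin.lastCases ?_ (fun i => ?_) i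
        · rw [snocHom_last, snocHom_last, Fin.succ_last]
        · rw [snocHom_castSucc, snocHom_castSucc, Fin.succ_castSucc, succ_predHom]
      rw [monadPowMap_succ_neg T M _ h0', monadPowMap_succ_neg T M f h0, h, ← Category.assoc,
        ← monadPowAlg_naturality a n (m + 1), Category.assoc, Category.assoc]
      congr 1
      exact (T.η.naturality (monadPowAlg T a n)).symm

/-- The inclusion of an initial segment of a finite ordinal. -/
def castSuccHom (n : ℕ) : Fin n →o Fin (n + 1) where
  toFun := Fin.castSucc
  monotone' _ _ h := Fin.castSucc_le_castSucc_iff.2 h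

/-- The inclusion which misses the greatest element inserts a unit at the innermost factor, where
the unit law for `a` cancels it. -/
theorem monadPowMap_castSuccHom {M : A} (a : T.obj M ⟶ M) (ha : T.η.app M ≫ a = 𝟙 M) : (n : ℕ) →
    monadPowMap T M (n + 1) n (castSuccHom n) ≫ monadPowAlg T a n = 𝟙 _
  | 0 => by
    rw [monadPowMap_zero_succ, eq_emptyHom (emptyHom 0), ← eq_emptyHom OrderHom.id, monadPowMap_id,
      Category.id_comp]
    exact ha
  | n + 1 => by
    have h : tailHom (castSuccHom (n + 1)) = (succHom (n + 1)).comp (castSuccHom n) := rfl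
    rw [monadPowMap_succ_pos T M _ rfl, h, monadPowMap_succHom_comp]
    have key {Y Z : A} (f : Y ⟶ Z) (g : Z ⟶ Y) (e : f ≫ g = 𝟙 Y) :
        (T.map (f ≫ T.η.app Z) ≫ T.μ.app Z) ≫ T.map g = 𝟙 _ := by
      rw [Functor.map_comp, Category.assoc, Category.assoc]
      have := T.right_unit Z
      rw [← Category.assoc (T.map (T.η.app Z)), this]
      refine (congrArg (fun t => T.map f ≫ t) (Category.id_comp (T.map g))).trans ?_
      rw [← T.map_comp, e, T.map_id]
    exact key _ _ (monadPowMap_castSuccHom a ha n)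

/-- The map of finite ordinals which collapses an initial segment, given by a simplex of `Δ[1]`, onto
an added least element. -/
def collapseLeft (n : SimplexCategory) (α : n ⟶ SimplexCategory.mk 1) :
    Fin (n.len + 1) →o Fin (n.len + 1 + 1) where
  toFun i := if α.toOrderHom i = 0 then 0 else i.succ
  monotone' i j h := by
    have h' := α.toOrderHom.monotone h
    dsimp only
    split_ifs with h1 h2
    · exact le_rfl
    · exact Fin.zero_le _
    · rename_i h2
      rw [h2] at h'
      exact absurd (le_antisymm h' (Fin.zero_le _)) h1
    · exact Fin.succ_le_succ_iff.2 h

/-- The map of finite ordinals which collapses a final segment, given by a simplex of `Δ[1]`, onto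
an added greatest element. -/
def collapseRight (n : SimplexCategory) (α : n ⟶ SimplexCategory.mk 1) :
    Fin (n.len + 1) →o Fin (n.len + 1 + 1) where
  toFun i := if α.toOrderHom i = 0 then i.castSucc else Fin.last _
  monotone' i j h := by
    have h' := α.toOrderHom.monotone h
    dsimp only
    split_ifs with h1 h2
    · exact Fin.castSucc_le_castSucc_iff.2 h
    · exact Fin.le_last _
    · rename_i h2
      rw [h2] at h'
      exact absurd (le_antisymm h' (Fin.zero_le _)) h1
    · exact le_rfl

variable {D : Type u₁} [Category.{v₁} D]

/-- The coaugmentation of the image by a functor of the resolution of a monad. -/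
def cobarCoaugmentation (N : A ⥤ D) (F : A) :
    (Functor.const SimplexCategory).obj (N.obj F) ⟶ (cobar T).obj F ⋙ N where
  app n := N.map (((cobarAugmentation T).app F).app n)
  naturality _ _ f := (Category.id_comp _).trans
    ((congrArg N.map (DescentStructure.coaugmentation_w ((cobarAugmentation T).app F) f).symm).trans
      (N.map_comp _ _))

/-- The morphisms `N Tⁿ⁺¹ F ⟶ N Tⁿ F` given by `N T ⟶ N`. -/
def monadPowAct {N : A ⥤ D} (a : T.toFunctor ⋙ N ⟶ N) (F : A) (n : ℕ) :
    N.obj (monadPow T F (n + 1)) ⟶ N.obj (monadPow T F n) :=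
  a.app (monadPow T F n)

/-- A map extended by a least element acts through `T`, by `monadPowMap_consHom`, so this is the
naturality of `a`. -/
theorem monadPowAct_naturality {N : A ⥤ D} (a : T.toFunctor ⋙ N ⟶ N) (F : A) {m n : ℕ}
    (f : Fin m →o Fin n) :
    N.map (monadPowMap T F (n + 1) (m + 1) (consHom f)) ≫ monadPowAct T a F n =
      monadPowAct T a F m ≫ N.map (monadPowMap T F n m f) := by
  rw [monadPowMap_consHom]
  exact a.naturality (monadPowMap T F n m f)

theorem monadPowAct_unit {N : A ⥤ D} {a : T.toFunctor ⋙ N ⟶ N}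
    (ha : ∀ X, N.map (T.η.app X) ≫ a.app X = 𝟙 _) (F : A) (n : ℕ) :
    N.map (monadPowMap T F (n + 1) n (succHom n)) ≫ monadPowAct T a F n = 𝟙 _ := by
  rw [monadPowMap_succHom]
  exact ha _

/-- The resolution of a monad contracts after application of a functor `N` with a retraction
`N T X ⟶ N X`. -/
def cobarContractionLeft (N : A ⥤ D) (a : T.toFunctor ⋙ N ⟶ N)
    (ha : ∀ X, N.map (T.η.app X) ≫ a.app X = 𝟙 _) (F : A) :
    DescentStructure.Contraction (cobarCoaugmentation T N F) where
  r :=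
    { app := fun n => N.map (monadPowMap T F 1 (n.len + 1) (constHom _ _ 0)) ≫ monadPowAct T a F 0
      naturality := fun n m f => by
        have : N.map (monadPowMap T F (m.len + 1) (n.len + 1) f.toOrderHom) ≫
            N.map (monadPowMap T F 1 (m.len + 1) (constHom _ _ 0)) ≫ monadPowAct T a F 0 =
            N.map (monadPowMap T F 1 (n.len + 1) (constHom _ _ 0)) ≫ monadPowAct T a F 0 := by
          rw [← Category.assoc, ← N.map_comp, monadPowMap_comp']
          rfl
        exact this.trans (Category.comp_id _).symm }
  a_r := by
    refine NatTrans.ext (funext fun n => ?_)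
    have : N.map (monadPowMap T F (n.len + 1) 0 (emptyHom _)) ≫
        N.map (monadPowMap T F 1 (n.len + 1) (constHom _ _ 0)) ≫ monadPowAct T a F 0 = 𝟙 _ := by
      rw [← Category.assoc, ← N.map_comp, monadPowMap_comp', eq_emptyHom (OrderHom.comp _ _),
        ← eq_emptyHom (succHom 0), monadPowAct_unit T ha]
    exact this
  -- The factors on which α is 0 are moved into an additional outermost factor `T`, which `a` then
  -- removes. For α constant with value 0 all factors are collapsed and one gets `r` followed by the
  -- coaugmentation; for α constant with value 1 a mere unit is inserted and removed.
  K n α := N.map (monadPowMap T F (n.len + 1 + 1) (n.len + 1) (collapseLeft n α)) ≫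
    monadPowAct T a F (n.len + 1)
  K_naturality {n m} f α := by
    have h : (consHom f.toOrderHom).comp (collapseLeft n (f ≫ α)) =
        (collapseLeft m α).comp f.toOrderHom := by
      refine OrderHom.ext _ _ (funext fun i => ?_)
      change consHom f.toOrderHom (if α.toOrderHom (f.toOrderHom i) = 0 then 0 else i.succ) =
        if α.toOrderHom (f.toOrderHom i) = 0 then 0 else (f.toOrderHom i).succ
      split_ifs <;> rfl
    change (N.map _ ≫ monadPowAct T a F _) ≫
        N.map (monadPowMap T F (m.len + 1) (n.len + 1) f.toOrderHom) =
      N.map (monadPowMap T F (m.len + 1) (n.len + 1) f.toOrderHom) ≫ N.map _ ≫ monadPowAct T a F _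
    rw [Category.assoc, ← monadPowAct_naturality, ← Category.assoc, ← N.map_comp,
      monadPowMap_comp' T F (collapseLeft n (f ≫ α)) (consHom f.toOrderHom), h,
      ← monadPowMap_comp', N.map_comp, Category.assoc]
  i := 0
  j := 1
  K_i n := by
    have h : collapseLeft n (SimplexCategory.const n (SimplexCategory.mk 1) 0) =
        (consHom (emptyHom (n.len + 1))).comp (constHom (n.len + 1) 1 0) := by
      refine OrderHom.ext _ _ (funext fun i => ?_)
      exact if_pos (c := (0 : Fin 2) = 0) (e := i.succ) rfl
    change N.map _ ≫ monadPowAct T a F _ =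
      (N.map (monadPowMap T F 1 (n.len + 1) (constHom _ _ 0)) ≫ monadPowAct T a F 0) ≫
      N.map (monadPowMap T F (n.len + 1) 0 (emptyHom _))
    rw [h, ← monadPowMap_comp', N.map_comp, Category.assoc, Category.assoc,
      monadPowAct_naturality]
  K_j n := by
    have h : collapseLeft n (SimplexCategory.const n (SimplexCategory.mk 1) 1) =
        succHom (n.len + 1) := by
      refine OrderHom.ext _ _ (funext fun i => ?_)
      exact if_neg (c := (1 : Fin 2) = 0) (t := 0) one_ne_zero
    rw [h]
    exact monadPowAct_unit T ha F (n.len + 1)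

/-- The resolution by a monad of the underlying object of an algebra contracts. -/
def cobarContractionRight (N : A ⥤ D) {M : A} (a : T.obj M ⟶ M) (ha : T.η.app M ≫ a = 𝟙 M) :
    DescentStructure.Contraction (cobarCoaugmentation T N M) where
  r :=
    { app := fun n => N.map (monadPowMap T M 1 (n.len + 1) (constHom _ _ 0) ≫ monadPowAlg T a 0)
      naturality := fun n m f => by
        have : N.map (monadPowMap T M (m.len + 1) (n.len + 1) f.toOrderHom) ≫
            N.map (monadPowMap T M 1 (m.len + 1) (constHom _ _ 0) ≫ monadPowAlg T a 0) =
            N.map (monadPowMap T M 1 (n.len + 1) (constHom _ _ 0) ≫ monadPowAlg T a 0) := by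
          rw [← N.map_comp, ← Category.assoc, monadPowMap_comp']
          rfl
        exact this.trans (Category.comp_id _).symm }
  a_r := by
    refine NatTrans.ext (funext fun n => ?_)
    have : N.map (monadPowMap T M (n.len + 1) 0 (emptyHom _)) ≫
        N.map (monadPowMap T M 1 (n.len + 1) (constHom _ _ 0) ≫ monadPowAlg T a 0) =
        𝟙 (N.obj (monadPow T M 0)) := by
      rw [← N.map_comp, ← Category.assoc, monadPowMap_comp', eq_emptyHom (OrderHom.comp _ _),
        ← eq_emptyHom (castSuccHom 0), monadPowMap_castSuccHom T a ha]
      exact N.map_id _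
    exact this
  -- The mirror image of the other contraction: the factors on which α is 1 are moved into an
  -- additional innermost factor, which the structure map of `M` removes.
  K n α := N.map (monadPowMap T M (n.len + 1 + 1) (n.len + 1) (collapseRight n α) ≫
    monadPowAlg T a (n.len + 1))
  K_naturality {n m} f α := by
    have h : (snocHom f.toOrderHom).comp (collapseRight n (f ≫ α)) =
        (collapseRight m α).comp f.toOrderHom := by
      refine OrderHom.ext _ _ (funext fun i => ?_)
      change snocHom f.toOrderHom
          (if α.toOrderHom (f.toOrderHom i) = 0 then i.castSucc else Fin.last _) =
        if α.toOrderHom (f.toOrderHom i) = 0 then (f.toOrderHom i).castSucc else Fin.last _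
      split_ifs
      · exact snocHom_castSucc _ _
      · exact snocHom_last _
    have : N.map (monadPowMap T M (n.len + 1 + 1) (n.len + 1) (collapseRight n (f ≫ α)) ≫
          monadPowAlg T a (n.len + 1)) ≫
        N.map (monadPowMap T M (m.len + 1) (n.len + 1) f.toOrderHom) =
      N.map (monadPowMap T M (m.len + 1) (n.len + 1) f.toOrderHom) ≫
        N.map (monadPowMap T M (m.len + 1 + 1) (m.len + 1) (collapseRight m α) ≫
          monadPowAlg T a (m.len + 1)) := by
      rw [← N.map_comp, ← N.map_comp, Category.assoc, ← monadPowAlg_naturality, ← Category.assoc,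
        monadPowMap_comp', h, ← monadPowMap_comp', Category.assoc]
    exact this
  -- The roles of the vertices are exchanged with respect to `cobarContractionLeft`, since here a
  -- final segment is collapsed.
  i := 1
  j := 0
  K_i n := by
    have h : collapseRight n (SimplexCategory.const n (SimplexCategory.mk 1) 1) =
        (snocHom (emptyHom (n.len + 1))).comp (constHom (n.len + 1) 1 0) := by
      refine OrderHom.ext _ _ (funext fun i => ?_)
      exact (if_neg (c := (1 : Fin 2) = 0) (t := i.castSucc) one_ne_zero).trans (snocHom_last _).symm
    rw [h]
    have : N.map (monadPowMap T M (n.len + 1 + 1) (n.len + 1)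
        ((snocHom (emptyHom (n.len + 1))).comp (constHom (n.len + 1) 1 0)) ≫
          monadPowAlg T a (n.len + 1)) =
        N.map (monadPowMap T M 1 (n.len + 1) (constHom _ _ 0) ≫ monadPowAlg T a 0) ≫
      N.map (monadPowMap T M (n.len + 1) 0 (emptyHom _)) := by
      rw [← monadPowMap_comp', ← N.map_comp, Category.assoc, Category.assoc,
        monadPowAlg_naturality]
    exact this
  K_j n := by
    have h : collapseRight n (SimplexCategory.const n (SimplexCategory.mk 1) 0) =
        castSuccHom (n.len + 1) := by
      refine OrderHom.ext _ _ (funext fun i => ?_)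
      exact if_pos (c := (0 : Fin 2) = 0) (e := Fin.last _) rfl
    rw [h]
    exact (congrArg N.map (monadPowMap_castSuccHom T a ha (n.len + 1))).trans (N.map_id _)

end Cobar

section Cobar
variable {A : Type u} [Category.{v} A] (T : CategoryTheory.Monad A)

/-- The iterates of a monad, as functors. -/
def monadPowFunctor (n : ℕ) : A ⥤ A where
  obj X := monadPow T X n
  map f := monadPowFunctorMap T f n
  map_id X := monadPowFunctorMap_id T X n
  map_comp f g := monadPowFunctorMap_comp T f g n

/-- The multiplication of a monad, applied at the innermost factors of an iterate. -/
def monadPowMul (X : A) : (n : ℕ) → (monadPow T (T.obj X) (n + 1) ⟶ monadPow T X (n + 1))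
  | 0 => T.μ.app X
  | n + 1 => T.map (monadPowMul X n)

theorem monadPowMul_naturality {X Y : A} (f : X ⟶ Y) : (n : ℕ) →
    monadPowFunctorMap T (T.map f) (n + 1) ≫ monadPowMul T Y n =
      monadPowMul T X n ≫ monadPowFunctorMap T f (n + 1)
  | 0 => T.μ.naturality f
  | n + 1 => (T.map_comp _ _).symm.trans
      ((congrArg T.map (monadPowMul_naturality f n)).trans (T.map_comp _ _))

theorem monadPowMul_unit (X : A) : (n : ℕ) →
    monadPowFunctorMap T (T.η.app X) (n + 1) ≫ monadPowMul T X n = 𝟙 _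
  | 0 => T.right_unit X
  | n + 1 => (T.map_comp _ _).symm.trans
      ((congrArg T.map (monadPowMul_unit X n)).trans (T.map_id _))

end Cobar

theorem of_eq_of_property {A : Type u} [Category.{v} A] {W : MorphismProperty A} {X Y : A}
    {f g : X ⟶ Y} (h : f = g) (hf : W f) : W g := h ▸ hf

/-! ### Hypercohomology of presheaves, local and global equivalences. -/

section Presheaf
variable {C : Type w} [SmallCategory C] {J : GrothendieckTopology C}
variable {E : Type u} [Category.{v} E] (𝔰 : DescentStructure E)

/-- The simple functor, applied object-wise to cosimplicial presheaves. -/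
def presheafSimple : Cosimp (Cᵒᵖ ⥤ E) ⥤ (Cᵒᵖ ⥤ E) where
  obj X := X.flip ⋙ 𝔰.simple
  map f := Functor.whiskerRight ((flipFunctor _ _ _).map f) 𝔰.simple
  map_id _ := NatTrans.ext (funext fun _ => 𝔰.simple.map_id _)
  map_comp f g := NatTrans.ext (funext fun U =>
    𝔰.simple.map_comp (((flipFunctor _ _ _).map f).app U) (((flipFunctor _ _ _).map g).app U))

variable [HasFilteredColimitsOfSize.{w, w} E] [HasProducts.{w} E] {ι : Type w}
  (pts : ι → GrothendieckTopology.Point.{w} J)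

/-- Filtered colimits and products preserve the equivalences of a descent structure. -/
structure ExactEquivalences : Prop where
  colimits {K : Type w} [SmallCategory K] [IsFiltered K] {X Y : K ⥤ E} (f : X ⟶ Y)
    [HasColimitsOfShape K E] : (∀ k, 𝔰.E (f.app k)) → 𝔰.E (colimMap f)
  products {K : Type w} {X Y : K → E} (f : ∀ k, X k ⟶ Y k) :
    (∀ k, 𝔰.E (f k)) → 𝔰.E (Limits.Pi.map f)

/-- The hypercohomology functor on presheaves. -/
noncomputable def hyperFunctor : (Cᵒᵖ ⥤ E) ⥤ (Cᵒᵖ ⥤ E) :=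
  godement E pts ⋙ presheafSimple 𝔰

/-- The image by a functor `L` of the coaugmentation of the Godement resolution, object-wise on
the site. -/
noncomputable def functorAugmentation (L : (Cᵒᵖ ⥤ E) ⥤ (Cᵒᵖ ⥤ E)) (F : Cᵒᵖ ⥤ E) :
    L.obj F ⋙ Functor.const SimplexCategory ⟶ ((godement E pts).obj F ⋙ L).flip where
  app U := cobarCoaugmentation (godementMonad E pts) (L ⋙ (evaluation _ _).obj U) F
  naturality _ _ f := NatTrans.ext (funext fun n =>
    (L.map (((cobarAugmentation (godementMonad E pts)).app F).app n)).naturality f)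

/-- The morphism `L F ⟶ 𝐬 (L G^• F)` given by `λ` and the coaugmentation. -/
noncomputable def toSimpleResolution (L : (Cᵒᵖ ⥤ E) ⥤ (Cᵒᵖ ⥤ E)) (F : Cᵒᵖ ⥤ E) :
    L.obj F ⟶ (presheafSimple 𝔰).obj ((godement E pts).obj F ⋙ L) :=
  Functor.whiskerLeft (L.obj F) 𝔰.lam ≫
    Functor.whiskerRight (functorAugmentation pts L F) 𝔰.simple

theorem toSimpleResolution_naturality {L L' : (Cᵒᵖ ⥤ E) ⥤ (Cᵒᵖ ⥤ E)} (τ : L ⟶ L')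
    (F : Cᵒᵖ ⥤ E) :
    toSimpleResolution 𝔰 pts L F ≫
      (presheafSimple 𝔰).map (Functor.whiskerLeft ((godement E pts).obj F) τ) =
    τ.app F ≫ toSimpleResolution 𝔰 pts L' F := by
  refine NatTrans.ext (funext fun U => ?_)
  have h1 := 𝔰.lam.naturality ((τ.app F).app U)
  have h2 : cobarCoaugmentation (godementMonad E pts) (L ⋙ (evaluation _ _).obj U) F ≫
      Functor.whiskerLeft ((godement E pts).obj F)
        (Functor.whiskerRight τ ((evaluation _ _).obj U)) =
      (Functor.const SimplexCategory).map ((τ.app F).app U) ≫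
        cobarCoaugmentation (godementMonad E pts) (L' ⋙ (evaluation _ _).obj U) F :=
    NatTrans.ext (funext fun n => congrArg (fun t => t.app U)
      (τ.naturality (((cobarAugmentation (godementMonad E pts)).app F).app n)))
  have h3 : (𝔰.lam.app ((L.obj F).obj U) ≫ 𝔰.simple.map
      (cobarCoaugmentation (godementMonad E pts) (L ⋙ (evaluation _ _).obj U) F)) ≫
      𝔰.simple.map (Functor.whiskerLeft ((godement E pts).obj F)
        (Functor.whiskerRight τ ((evaluation _ _).obj U))) =
      (τ.app F).app U ≫ 𝔰.lam.app ((L'.obj F).obj U) ≫ 𝔰.simple.map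
        (cobarCoaugmentation (godementMonad E pts) (L' ⋙ (evaluation _ _).obj U) F) := by
    have h4 := (Category.assoc _ _ _).symm.trans (congrArg (fun t => t ≫ 𝔰.simple.map
        (cobarCoaugmentation (godementMonad E pts) (L' ⋙ (evaluation _ _).obj U) F)) h1)
    refine Eq.trans ?_ h4.symm
    refine (Category.assoc _ _ _).trans (Eq.trans ?_ (Category.assoc _ _ _).symm)
    exact congrArg (fun t => 𝔰.lam.app ((L.obj F).obj U) ≫ t)
      ((𝔰.simple.map_comp _ _).symm.trans ((congrArg 𝔰.simple.map h2).trans (𝔰.simple.map_comp _ _)))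
  exact h3

/-- The natural transformation `ρ`. -/
noncomputable def hyperUnit : 𝟭 (Cᵒᵖ ⥤ E) ⟶ hyperFunctor 𝔰 pts where
  app F := toSimpleResolution 𝔰 pts (𝟭 _) F
  naturality F G f := by
    refine NatTrans.ext (funext fun U => ?_)
    have h1 := 𝔰.lam.naturality (f.app U)
    have h2 : cobarCoaugmentation (godementMonad E pts) ((evaluation _ _).obj U) F ≫
        Functor.whiskerRight ((godement E pts).map f) ((evaluation _ _).obj U) =
        (Functor.const SimplexCategory).map (f.app U) ≫
          cobarCoaugmentation (godementMonad E pts) ((evaluation _ _).obj U) G :=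
      NatTrans.ext (funext fun n => congrArg (fun t => (t.app n).app U)
        ((cobarAugmentation (godementMonad E pts)).naturality f).symm)
    have h3 : f.app U ≫ 𝔰.lam.app (G.obj U) ≫ 𝔰.simple.map
        (cobarCoaugmentation (godementMonad E pts) ((evaluation _ _).obj U) G) =
        (𝔰.lam.app (F.obj U) ≫ 𝔰.simple.map
          (cobarCoaugmentation (godementMonad E pts) ((evaluation _ _).obj U) F)) ≫
        𝔰.simple.map (Functor.whiskerRight ((godement E pts).map f) ((evaluation _ _).obj U)) := by
      have h4 := (Category.assoc _ _ _).symm.trans (congrArg (fun t => t ≫ 𝔰.simple.map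
          (cobarCoaugmentation (godementMonad E pts) ((evaluation _ _).obj U) G)) h1)
      refine h4.trans ?_
      refine (Category.assoc _ _ _).trans (Eq.trans ?_ (Category.assoc _ _ _).symm)
      exact congrArg (fun t => 𝔰.lam.app (F.obj U) ≫ t)
        ((𝔰.simple.map_comp _ _).symm.trans ((congrArg 𝔰.simple.map h2.symm).trans
          (𝔰.simple.map_comp _ _)))
    exact h3

/-- The global equivalences of presheaves. -/
def globalPresheafEquivalences : MorphismProperty (Cᵒᵖ ⥤ E) :=
  fun _ _ f => ∀ U : Cᵒᵖ, 𝔰.E (f.app U)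

/-- The local equivalences of presheaves. -/
def localPresheafEquivalences : MorphismProperty (Cᵒᵖ ⥤ E) :=
  fun _ _ f => ∀ i, 𝔰.E ((stalk E (pts i)).map f)

variable {𝔰}

theorem global_comp {F G H : Cᵒᵖ ⥤ E} {f : F ⟶ G} {g : G ⟶ H} (hf : globalPresheafEquivalences 𝔰 f) (hg : globalPresheafEquivalences 𝔰 g) :
    globalPresheafEquivalences 𝔰 (f ≫ g) := fun U => 𝔰.E_comp (hf U) (hg U)

theorem global_of_comp_left {F G H : Cᵒᵖ ⥤ E} {f : F ⟶ G} {g : G ⟶ H} (hf : globalPresheafEquivalences 𝔰 f)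
    (h : globalPresheafEquivalences 𝔰 (f ≫ g)) : globalPresheafEquivalences 𝔰 g := fun U => 𝔰.E_of_comp_left (hf U) (h U)

theorem global_of_comp_right {F G H : Cᵒᵖ ⥤ E} {f : F ⟶ G} {g : G ⟶ H} (hg : globalPresheafEquivalences 𝔰 g)
    (h : globalPresheafEquivalences 𝔰 (f ≫ g)) : globalPresheafEquivalences 𝔰 f := fun U => 𝔰.E_of_comp_right (hg U) (h U)

variable {pts} in
theorem local_of_comp_left {F G H : Cᵒᵖ ⥤ E} {f : F ⟶ G} {g : G ⟶ H} (hf : localPresheafEquivalences 𝔰 pts f)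
    (h : localPresheafEquivalences 𝔰 pts (f ≫ g)) : localPresheafEquivalences 𝔰 pts g := fun i => 𝔰.E_of_comp_left (hf i) (by
      rw [← Functor.map_comp]; exact h i)

variable {pts} in
theorem local_of_comp_right {F G H : Cᵒᵖ ⥤ E} {f : F ⟶ G} {g : G ⟶ H} (hg : localPresheafEquivalences 𝔰 pts g)
    (h : localPresheafEquivalences 𝔰 pts (f ≫ g)) : localPresheafEquivalences 𝔰 pts f := fun i => 𝔰.E_of_comp_right (hg i) (by
      rw [← Functor.map_comp]; exact h i)

theorem ExactEquivalences.local_of_global (hE : ExactEquivalences.{w} 𝔰) {F G : Cᵒᵖ ⥤ E}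
    {f : F ⟶ G} (hf : globalPresheafEquivalences 𝔰 f) : localPresheafEquivalences 𝔰 pts f :=
  fun i => hE.colimits (Functor.whiskerLeft (CategoryOfElements.π (pts i).fiber).op f)
    fun _ => hf _

/-- The value of `T f` at an object is a product of fibres of `f`, so the exactness of products
makes a local equivalence global. -/
theorem ExactEquivalences.global_godementMonad (hE : ExactEquivalences.{w} 𝔰) {F G : Cᵒᵖ ⥤ E}
    {f : F ⟶ G} (hf : localPresheafEquivalences 𝔰 pts f) :
    globalPresheafEquivalences 𝔰 ((godementMonad E pts).map f) :=
  fun U => hE.products (fun q : (Σ i, (pts i).fiber.obj U.unop) => (stalk E (pts q.1)).map f)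
    fun q => hf q.1

theorem ExactEquivalences.global_monadPow (hE : ExactEquivalences.{w} 𝔰) {F G : Cᵒᵖ ⥤ E}
    {f : F ⟶ G} (hf : localPresheafEquivalences 𝔰 pts f) : (n : ℕ) →
    globalPresheafEquivalences 𝔰 (monadPowFunctorMap (godementMonad E pts) f (n + 1))
  | 0 => hE.global_godementMonad pts hf
  | n + 1 => hE.global_godementMonad pts (hE.local_of_global pts (global_monadPow hE hf n))

/-- Every degree of the resolution contains at least one factor `T`, which already makes local
equivalences global; 𝐬 preserves degree-wise equivalences. -/
theorem ExactEquivalences.global_hyper (hE : ExactEquivalences.{w} 𝔰) {F G : Cᵒᵖ ⥤ E}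
    {f : F ⟶ G} (hf : localPresheafEquivalences 𝔰 pts f) :
    globalPresheafEquivalences 𝔰 ((hyperFunctor 𝔰 pts).map f) :=
  fun U => 𝔰.E_simple _ fun n => hE.global_monadPow pts hf n.len U

variable (𝔰) in
-- `T F` carries the structure of a free algebra, so its resolution contracts at the innermost
-- factor, over every object of the site.
theorem global_hyperUnit_monad (F : Cᵒᵖ ⥤ E) : globalPresheafEquivalences 𝔰 ((hyperUnit 𝔰 pts).app ((godementMonad E pts).obj F)) :=
  fun U => 𝔰.E_of_contraction (cobarContractionRight (godementMonad E pts)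
    ((evaluation _ _).obj U) ((godementMonad E pts).μ.app F) ((godementMonad E pts).left_unit F))

variable (𝔰) in
-- The target is the double simple of the bicosimplicial object T^{p+1} T^{n+1} F. For fixed `p`,
-- the functor T^{p+1} absorbs a further `T` on its right through the multiplication, so the
-- direction of `n` contracts onto T^{p+1} F, and `E_lam_map_coaugmentation` applies.
theorem global_toSimpleResolution_hyper (F : Cᵒᵖ ⥤ E) : globalPresheafEquivalences 𝔰 (toSimpleResolution 𝔰 pts (hyperFunctor 𝔰 pts) F) := by
  intro U
  let T := godementMonad E pts
  let V : Cosimp (Cᵒᵖ ⥤ E) ⥤ Cosimp E :=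
    (Functor.whiskeringRight SimplexCategory _ _).obj ((evaluation _ _).obj U)
  let a := cobarCoaugmentation T (godement E pts ⋙ V) F
  have h := 𝔰.E_lam_map_coaugmentation a fun p => by
    let N : (Cᵒᵖ ⥤ E) ⥤ E := monadPowFunctor T (p.len + 1) ⋙ (evaluation _ _).obj U
    let b : T.toFunctor ⋙ N ⟶ N :=
      { app := fun X => (monadPowMul T X p.len).app U
        naturality := fun X Y f => congrArg (fun t => t.app U) (monadPowMul_naturality T f p.len) }
    exact 𝔰.E_of_contraction (cobarContractionLeft T N b
      (fun X => congrArg (fun t => t.app U) (monadPowMul_unit T X p.len)) F)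
  rw [← Functor.map_comp] at h
  have e : constSimpleTo 𝔰.simple (((godement E pts ⋙ V)).obj F) ≫
      Functor.whiskerRight a 𝔰.simple =
      cobarCoaugmentation T ((hyperFunctor 𝔰 pts) ⋙ (evaluation _ _).obj U) F :=
    NatTrans.ext (funext fun n => Category.id_comp _)
  rw [e] at h
  exact h

/-- The morphism of cosimplicial objects given by the germs at a section of the fibre. -/
noncomputable def cosimpGerm (x : GrothendieckTopology.Point.{w} J) {U : C} (s : x.fiber.obj U)
    (X : Cosimp (Cᵒᵖ ⥤ E)) : X.flip.obj (op U) ⟶ X ⋙ stalk E x where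
  app n := germ x s (X.obj n)
  naturality _ _ f := (germ_naturality x s (X.map f)).symm

/-- The comparison between the fibre of the object-wise simple of a cosimplicial presheaf, and the
simple of its fibre. -/
noncomputable def stalkSimple (x : GrothendieckTopology.Point.{w} J) (X : Cosimp (Cᵒᵖ ⥤ E)) :
    (stalk E x).obj ((presheafSimple 𝔰).obj X) ⟶ 𝔰.simple.obj (X ⋙ stalk E x) :=
  stalkDesc x (fun _ s => 𝔰.simple.map (cosimpGerm x s X)) (fun U V f s => by
    refine (𝔰.simple.map_comp _ _).symm.trans (congrArg 𝔰.simple.map ?_)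
    exact NatTrans.ext (funext fun n => germ_res x f s (X.obj n)))

theorem germ_stalkSimple (x : GrothendieckTopology.Point.{w} J) {U : C} (s : x.fiber.obj U)
    (X : Cosimp (Cᵒᵖ ⥤ E)) : germ x s ((presheafSimple 𝔰).obj X) ≫ stalkSimple x X =
      𝔰.simple.map (cosimpGerm x s X) :=
  germ_stalkDesc x _ _ s

theorem stalkSimple_naturality (x : GrothendieckTopology.Point.{w} J) {X Y : Cosimp (Cᵒᵖ ⥤ E)}
    (φ : X ⟶ Y) : (stalk E x).map ((presheafSimple 𝔰).map φ) ≫ stalkSimple x Y =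
      stalkSimple x X ≫ 𝔰.simple.map (Functor.whiskerRight φ (stalk E x)) := by
  refine stalk_hom_ext x fun U s => ?_
  have h : ((presheafSimple 𝔰).map φ).app (op U) ≫ 𝔰.simple.map (cosimpGerm x s Y) =
      𝔰.simple.map (cosimpGerm x s X) ≫ 𝔰.simple.map (Functor.whiskerRight φ (stalk E x)) := by
    refine (𝔰.simple.map_comp _ _).symm.trans (Eq.trans (congrArg 𝔰.simple.map ?_)
      (𝔰.simple.map_comp _ _))
    exact NatTrans.ext (funext fun n => (germ_naturality x s (φ.app n)).symm)
  rw [← Category.assoc, germ_naturality, Category.assoc, germ_stalkSimple, ← Category.assoc,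
    germ_stalkSimple]
  exact h

/-- Fibres need not commute with 𝐬, so the fibre of ρ can only be controlled after the comparison
with the simple of the fibres of G^•F. The composite is λ followed by the coaugmentation of these
fibres, which contract by means of the counit of the adjunction between `p^*` and `p_*`. -/
theorem stalk_hyperUnit (i : ι) (F : Cᵒᵖ ⥤ E) :
    𝔰.E ((stalk E (pts i)).map ((hyperUnit 𝔰 pts).app F) ≫
      stalkSimple (pts i) ((godement E pts).obj F)) := by
  let T := godementMonad E pts
  let a : T.toFunctor ⋙ stalk E (pts i) ⟶ stalk E (pts i) :=
    { app := fun X => (stalksAdjunction pts).counit.app ((stalks E pts).obj X) i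
      naturality := fun X Y f =>
        congrFun ((stalksAdjunction pts).counit.naturality ((stalks E pts).map f)) i }
  have h := 𝔰.E_of_contraction (cobarContractionLeft T (stalk E (pts i)) a
    (fun X => congrFun ((stalksAdjunction (E := E) pts).left_triangle_components X) i) F)
  have e : (stalk E (pts i)).map ((hyperUnit 𝔰 pts).app F) ≫
      stalkSimple (pts i) ((godement E pts).obj F) =
      𝔰.lam.app ((stalk E (pts i)).obj F) ≫
        𝔰.simple.map (cobarCoaugmentation T (stalk E (pts i)) F) := by
    refine stalk_hom_ext (pts i) fun U s => ?_
    have h1 := 𝔰.lam.naturality (germ (pts i) s F)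
    have h2 : (Functor.const SimplexCategory).map (germ (pts i) s F) ≫
        cobarCoaugmentation T (stalk E (pts i)) F =
        cobarCoaugmentation T ((evaluation _ _).obj (op U)) F ≫
          cosimpGerm (pts i) s ((godement E pts).obj F) :=
      NatTrans.ext (funext fun n =>
        germ_naturality (pts i) s (((cobarAugmentation T).app F).app n))
    have h3 : ((hyperUnit 𝔰 pts).app F).app (op U) ≫
        𝔰.simple.map (cosimpGerm (pts i) s ((godement E pts).obj F)) =
        𝔰.lam.app (F.obj (op U)) ≫
          𝔰.simple.map ((Functor.const SimplexCategory).map (germ (pts i) s F)) ≫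
            𝔰.simple.map (cobarCoaugmentation T (stalk E (pts i)) F) := by
      refine (Category.assoc _ _ _).trans (congrArg (fun t => 𝔰.lam.app (F.obj (op U)) ≫ t) ?_)
      exact (𝔰.simple.map_comp _ _).symm.trans ((congrArg 𝔰.simple.map h2.symm).trans
        (𝔰.simple.map_comp _ _))
    refine (Category.assoc _ _ _).symm.trans ((congrArg (fun t => t ≫ _)
      (germ_naturality (pts i) s _)).trans ((Category.assoc _ _ _).trans ?_))
    refine (congrArg (fun t => _ ≫ t) (germ_stalkSimple (pts i) s _)).trans (h3.trans ?_)
    exact (Category.assoc _ _ _).symm.trans ((congrArg (fun t => t ≫ 𝔰.simple.map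
      (cobarCoaugmentation T (stalk E (pts i)) F)) h1.symm).trans (Category.assoc _ _ _))
  rw [e]
  exact h

variable {pts}

/-- If `ρ` is a local equivalence for the hypercohomology of `F`, then it is so for `F`. -/
theorem ExactEquivalences.local_hyperUnit (hE : ExactEquivalences.{w} 𝔰) (F : Cᵒᵖ ⥤ E)
    (h : localPresheafEquivalences 𝔰 pts ((hyperUnit 𝔰 pts).app ((hyperFunctor 𝔰 pts).obj F))) :
    localPresheafEquivalences 𝔰 pts ((hyperUnit 𝔰 pts).app F) := by
  let T := godementMonad E pts
  let H := hyperFunctor 𝔰 pts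
  let ρ := hyperUnit 𝔰 pts
  have hT (n : SimplexCategory) : globalPresheafEquivalences 𝔰
      (ρ.app (((godement E pts).obj F).obj n)) := global_hyperUnit_monad 𝔰 pts _
  -- A transformation ℍ → ℍℍ which is a global equivalence on each degree of G^•F becomes a global
  -- equivalence at F after composition with the morphism ℍℍF → 𝐬(ℍℍG^•F). This morphism does not
  -- depend on τ, so it links τ = ρℍ with τ = ℍρ.
  have key (τ : H ⟶ H ⋙ H) (hτ : ∀ n : SimplexCategory,
      globalPresheafEquivalences 𝔰 (τ.app (((godement E pts).obj F).obj n))) :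
      globalPresheafEquivalences 𝔰 (τ.app F ≫ toSimpleResolution 𝔰 pts (H ⋙ H) F) := by
    rw [← toSimpleResolution_naturality]
    exact global_comp (global_toSimpleResolution_hyper 𝔰 pts F)
      fun U => 𝔰.E_simple _ fun n => hτ n U
  have h1 := key (Functor.whiskerLeft H ρ) fun n => by
    -- With X this degree of G^•F, the naturality of ρ along ρ_X itself reads ρ_X ≫ ρ_{ℍX} = ρ_X ≫
    -- ℍ(ρ_X). As ρ_X and ℍ(ρ_X) are global equivalences, so is ρ_{ℍX}.
    have hn : ρ.app (((godement E pts).obj F).obj n) ≫ ρ.app (H.obj (((godement E pts).obj F).obj n)) =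
        ρ.app (((godement E pts).obj F).obj n) ≫ H.map (ρ.app (((godement E pts).obj F).obj n)) :=
      ρ.naturality (ρ.app (((godement E pts).obj F).obj n))
    have h0 := global_comp (hT n) (hE.global_hyper pts (hE.local_of_global pts (hT n)))
    have h1 : globalPresheafEquivalences 𝔰 (ρ.app (((godement E pts).obj F).obj n) ≫
        ρ.app (H.obj (((godement E pts).obj F).obj n))) := hn ▸ h0
    exact global_of_comp_left (hT n) h1
  have h2 := key (Functor.whiskerRight ρ H) fun n =>
    hE.global_hyper pts (hE.local_of_global pts (hT n))
  -- The hypothesis on ρ_{ℍF} makes the common morphism a local equivalence; then ℍ(ρ_F) is one as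
  -- well.
  have h3 : localPresheafEquivalences 𝔰 pts (toSimpleResolution 𝔰 pts (H ⋙ H) F) :=
    local_of_comp_left h (hE.local_of_global pts h1)
  have h4 : localPresheafEquivalences 𝔰 pts (H.map (ρ.app F)) :=
    local_of_comp_right h3 (hE.local_of_global pts h2)
  intro i
  -- At a point x the three morphisms are F_x → (ℍF)_x, the comparison (ℍF)_x → 𝐬((G^•F)_x), and 𝐬
  -- of the fibre of G^•(ρ_F). The first two compose to an equivalence by contraction. The last two
  -- compose to the fibre of ℍ(ρ_F) followed by the comparison for ℍF, which is an equivalence by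
  -- the hypothesis on ρ_{ℍF}.
  exact 𝔰.E_of_two_of_six (stalk_hyperUnit pts i F)
    (of_eq_of_property (stalkSimple_naturality (pts i) ((godement E pts).map (ρ.app F)))
      (𝔰.E_comp (h4 i) (𝔰.E_of_comp_left (h i) (stalk_hyperUnit pts i (H.obj F)))))

/-- If `ρ` is a local equivalence for `F`, and a global equivalence for the double
hypercohomology of `F`, then it is a global equivalence for the hypercohomology of `F`. -/
theorem ExactEquivalences.global_hyperUnit (hE : ExactEquivalences.{w} 𝔰) (F : Cᵒᵖ ⥤ E)
    (h : localPresheafEquivalences 𝔰 pts ((hyperUnit 𝔰 pts).app F))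
    (h' : globalPresheafEquivalences 𝔰 ((hyperUnit 𝔰 pts).app
      ((hyperFunctor 𝔰 pts).obj ((hyperFunctor 𝔰 pts).obj F)))) :
    globalPresheafEquivalences 𝔰 ((hyperUnit 𝔰 pts).app ((hyperFunctor 𝔰 pts).obj F)) := by
  have h1 := hE.global_hyper pts h
  have h2 := hE.global_hyper pts (hE.local_of_global pts h1)
  -- The naturality square of ρ along ℍ(ρ_F): ρ at ℍF is opposite to ρ at ℍℍF, and the two remaining
  -- sides are global equivalences.
  have h3 := (hyperUnit 𝔰 pts).naturality ((hyperFunctor 𝔰 pts).map ((hyperUnit 𝔰 pts).app F))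
  exact global_of_comp_right h2 (of_eq_of_property h3 (global_comp h1 h'))

end Presheaf

/-! ### Fibrant models from a resolvent functor. -/

section CartanEilenberg
variable {A : Type u} [Category.{v} A] {S W : MorphismProperty A}

/-- An extension of `g` along `w`: both are moved to the resolved objects, where `w` has the left
inverse needed, and the result is brought back along `j`, a right inverse of `z`. -/
theorem comp_section_eq {X Y Z X' Y' Z' : A} {w : X ⟶ Y} {g : X ⟶ Z} {x : X ⟶ X'} {y : Y ⟶ Y'}
    {z : Z ⟶ Z'} {w' : X' ⟶ Y'} {g' : X' ⟶ Z'} {i : Y' ⟶ X'} {j : Z' ⟶ Z} (hw : w ≫ y = x ≫ w')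
    (hg : g ≫ z = x ≫ g') (hi : w' ≫ i = 𝟙 _) (hj : z ≫ j = 𝟙 _) : w ≫ y ≫ i ≫ g' ≫ j = g := by
  rw [reassoc_of% hw, reassoc_of% hi, ← reassoc_of% hg, hj, Category.comp_id]

/-- In the localization at `S`, the functor `H` inverts `W` and ρ is invertible at every `H X`. A
morphism into `H X` is therefore determined by its image under `H`, where weak equivalences in the
source are invisible. -/
theorem isCEFibrantModel_of_resolvent (H : A ⥤ A) (ρ : 𝟭 A ⟶ H) (hSW : S ≤ W)
    (hH : ∀ ⦃X Y : A⦄ (f : X ⟶ Y), W f → S (H.map f))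
    (hρ : ∀ X, W (ρ.app X)) (hρH : ∀ X, S (ρ.app (H.obj X))) (hW : S.IsInvertedBy W.Q) (X : A) :
    IsCEFibrantModel (S := S) (X := X) hW (S.Q.map (ρ.app X)) := by
  have hHS : S.IsInvertedBy (H ⋙ S.Q) := fun Y Z f hf =>
    MorphismProperty.Q_inverts S _ (hH f (hSW _ hf))
  let H' : S.Localization ⥤ S.Localization := Localization.Construction.lift (H ⋙ S.Q) hHS
  have hiso (X : A) : IsIso (S.Q.map (ρ.app (H.obj X))) := MorphismProperty.Q_inverts S _ (hρH X)
  let τ : S.Q ⋙ 𝟭 _ ⟶ S.Q ⋙ H' :=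
    { app := fun Y => S.Q.map (ρ.app Y)
      naturality := fun Y Z f => (S.Q.map_comp _ _).symm.trans
        ((congrArg S.Q.map (ρ.naturality f)).trans (S.Q.map_comp _ _)) }
  -- The naturality of ρ is needed for all morphisms of the localization, not only for those coming
  -- from `A`.
  let ρ' : 𝟭 S.Localization ⟶ H' := Localization.Construction.natTransExtension τ
  have hρ' (Y : A) : ρ'.app (S.Q.obj Y) = S.Q.map (ρ.app Y) :=
    Localization.Construction.NatTransExtension.app_eq τ Y
  have nat {Y Z : A} (g : S.Q.obj Y ⟶ S.Q.obj Z) :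
      g ≫ S.Q.map (ρ.app Z) = S.Q.map (ρ.app Y) ≫ H'.map g := by
    rw [← hρ', ← hρ']
    exact ρ'.naturality g
  refine ⟨fun Y Z w hw => ⟨fun g g' hg => ?_, fun g => ?_⟩, ?_⟩
  · have hwi : IsIso (H'.map (S.Q.map w)) := MorphismProperty.Q_inverts S _ (hH w hw)
    have hg' : H'.map g = H'.map g' := by
      have := congrArg H'.map hg
      dsimp only at this
      rw [H'.map_comp, H'.map_comp] at this
      exact (cancel_epi _).1 this
    have h := nat g
    rw [hg', ← nat g'] at h
    exact (cancel_mono _).1 h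
  · have hwi : IsIso (H'.map (S.Q.map w)) := MorphismProperty.Q_inverts S _ (hH w hw)
    obtain ⟨i, hi, -⟩ := hwi
    obtain ⟨j, hj, -⟩ := hiso X
    exact ⟨_, comp_section_eq (nat (S.Q.map w)) (nat g) hi hj⟩
  · exact MorphismProperty.Q_inverts W _ (hρ X)

/-- A weak equivalence between fibrant objects is invertible in the localization at the strong
equivalences. -/
theorem IsCEFibrant.isIso {X Y : A} {w : X ⟶ Y} (hX : IsCEFibrant S W X) (hY : IsCEFibrant S W Y)
    (hw : W w) : IsIso (S.Q.map w) := by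
  obtain ⟨r, hr⟩ := (hX w hw).2 (𝟙 _)
  refine ⟨r, hr, (hY w hw).1 ?_⟩
  change S.Q.map w ≫ r ≫ S.Q.map w = S.Q.map w ≫ 𝟙 _
  rw [← Category.assoc, Category.comp_id]
  exact (congrArg (fun t => t ≫ S.Q.map w) hr).trans (Category.id_comp _)

theorem isIso_map_of_isIso_Q {B : Type*} [Category* B] (G : A ⥤ B) (hG : W.IsInvertedBy G)
    {X Y : A} (f : X ⟶ Y) (h : IsIso (W.Q.map f)) : IsIso (G.map f) := by
  have : IsIso ((W.Q ⋙ Localization.Construction.lift G hG).map f) :=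
    inferInstanceAs (IsIso ((Localization.Construction.lift G hG).map (W.Q.map f)))
  rwa [Localization.Construction.fac] at this

end CartanEilenberg

/-! ### Compatibility expressed through ρ alone. -/

section Criterion
variable {C : Type w} [SmallCategory C] {J : GrothendieckTopology C}
variable {E : Type u} [Category.{v} E] {𝔰 : DescentStructure E}
variable [HasFilteredColimitsOfSize.{w, w} E] [HasProducts.{w} E] {ι : Type w}
  {pts : ι → GrothendieckTopology.Point.{w} J}

/-- A fibre functor followed by the localization of the coefficients factors through the
localization of sheaves, and the saturation of `E` turns invertibility back into an equivalence. The
definition of a fibrant model only provides such invertibility. -/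
theorem local_of_isIso_Q {F G : Sheaf J E} (f : F ⟶ G)
    (h : IsIso ((localEquivalences pts 𝔰).Q.map f)) : localEquivalences pts 𝔰 f := fun i => by
  rw [𝔰.E_iff_isIso]
  exact isIso_map_of_isIso_Q (sheafToPresheaf J E ⋙ stalk E (pts i) ⋙ 𝔰.E.Q)
    (fun _ _ f hf => MorphismProperty.Q_inverts _ _ (hf i)) f h

theorem global_of_isIso_Q {F G : Sheaf J E} (f : F ⟶ G)
    (h : IsIso ((globalEquivalences J 𝔰).Q.map f)) : globalEquivalences J 𝔰 f := fun U => by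
  rw [𝔰.E_iff_isIso]
  exact isIso_map_of_isIso_Q (sheafToPresheaf J E ⋙ (evaluation _ _).obj U ⋙ 𝔰.E.Q)
    (fun _ _ f hf => MorphismProperty.Q_inverts _ _ (hf U)) f h

theorem Compatible.exactEquivalences (c : Compatible J pts 𝔰) : ExactEquivalences.{w} 𝔰 where
  colimits f _ h := c.E_filteredColimits f h
  products f h := c.E_products f h

/-- Here compatibility is extended from sheaves to presheaves: ℍF is a sheaf in any case, which
gives the claim for ℍF, and the claim for F follows from it. -/
theorem Compatible.local_hyperUnit (c : Compatible J pts 𝔰) (F : Cᵒᵖ ⥤ E) :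
    localPresheafEquivalences 𝔰 pts ((hyperUnit 𝔰 pts).app F) :=
  c.exactEquivalences.local_hyperUnit F
    (local_of_isIso_Q _ (c.fibrantModel ⟨_, c.isSheaf F⟩).isIso)

/-- A weak equivalence between fibrant objects is a strong one. Applied to ρ at the double
hypercohomology, this gives the hypothesis of `ExactEquivalences.global_hyperUnit`. -/
theorem Compatible.global_hyperUnit (c : Compatible J pts 𝔰) (F : Cᵒᵖ ⥤ E) :
    globalPresheafEquivalences 𝔰 ((hyperUnit 𝔰 pts).app ((hyperFunctor 𝔰 pts).obj F)) := by
  refine c.exactEquivalences.global_hyperUnit F (c.local_hyperUnit F) ?_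
  -- `F₁` is the hypercohomology of a mere presheaf and is not yet known to be fibrant. `F₂` and
  -- `F₃` are hypercohomologies of sheaves, so the argument has to start one step higher.
  let F₁ : Sheaf J E := ⟨_, c.isSheaf F⟩
  let F₂ : Sheaf J E := ⟨_, c.isSheaf F₁.obj⟩
  let F₃ : Sheaf J E := ⟨_, c.isSheaf F₂.obj⟩
  let w : F₂ ⟶ F₃ := ⟨(hyperUnit 𝔰 pts).app F₂.obj⟩
  exact global_of_isIso_Q w ((c.fibrantModel F₁).fibrant.isIso (c.fibrantModel F₂).fibrant
    (c.local_hyperUnit F₂.obj))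

/-- Compatibility follows from the exactness of filtered colimits and products, if hypercohomology
takes values in sheaves and `ρ` is a local equivalence, and a global equivalence for the
hypercohomology of a sheaf. -/
theorem Compatible.of_hyperUnit (hpts : (ObjectProperty.ofObj pts).IsConservativeFamilyOfPoints)
    (hE : ExactEquivalences.{w} 𝔰) (hS : ∀ F, Presheaf.IsSheaf J (hypercohomology pts 𝔰 F))
    (hl : ∀ F, localPresheafEquivalences 𝔰 pts ((hyperUnit 𝔰 pts).app F))
    (hg : ∀ F, globalPresheafEquivalences 𝔰
      ((hyperUnit 𝔰 pts).app ((hyperFunctor 𝔰 pts).obj F))) : Compatible J pts 𝔰 := by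
  let H : Sheaf J E ⥤ Sheaf J E :=
    { obj := fun F => ⟨(hyperFunctor 𝔰 pts).obj F.obj, hS F.obj⟩
      map := fun f => ⟨(hyperFunctor 𝔰 pts).map f.hom⟩
      map_id := fun F => Sheaf.hom_ext ((hyperFunctor 𝔰 pts).map_id _)
      map_comp := fun f g => Sheaf.hom_ext ((hyperFunctor 𝔰 pts).map_comp _ _) }
  let ρ : 𝟭 _ ⟶ H :=
    { app := fun F => ⟨(hyperUnit 𝔰 pts).app F.obj⟩
      naturality := fun F G f => Sheaf.hom_ext ((hyperUnit 𝔰 pts).naturality f.hom) }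
  have hSW : globalEquivalences J 𝔰 ≤ localEquivalences pts 𝔰 :=
    fun F G f hf => hE.local_of_global pts hf
  have hinv : (globalEquivalences J 𝔰).IsInvertedBy (localEquivalences pts 𝔰).Q :=
    fun F G f hf => MorphismProperty.Q_inverts _ _ (hSW _ hf)
  have key (F : Sheaf J E) := isCEFibrantModel_of_resolvent H ρ hSW
    (fun F G f hf => hE.global_hyper pts hf) (fun F => hl F.obj) (fun F => hg F.obj) hinv F
  exact
    { enoughPoints := hpts
      E_filteredColimits := fun f _ h => hE.colimits f h
      E_products := hE.products
      isSheaf := hS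
      cartanEilenberg := ⟨hinv, fun F => ⟨_, _, key F⟩⟩
      fibrantModel := key }

end Criterion

/-! ### Transfer of a descent structure through forgetful functors. -/

section Chase
variable {B : Type*} [Category* B] {X Y V₁ V₂ V₃ W₁ W₂ W₃ P₁ P₂ Q R K L : B}

/-- The comparison σ, a monomorphism, is moved leftwards through the four factors. Each of them is
replaced by its counterpart in the category of coefficients, where the composite is the identity by
`h₈`. -/
theorem unit_chase {u₁ : X ⟶ V₁} {u₂ : V₁ ⟶ V₂} {u₃ : V₂ ⟶ V₃} {u₄ : V₃ ⟶ X} {σ : X ⟶ Y} [Mono σ]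
    {σ₁ : V₁ ⟶ W₁} {σ₂ : V₂ ⟶ W₂} {σ₃ : V₃ ⟶ W₃} {p₁ : W₃ ⟶ P₁} {p₂ : P₁ ⟶ P₂} {p₃ : P₂ ⟶ Y}
    {q₁ : W₂ ⟶ Q} {q₂ : Q ⟶ P₁} {r₁ : Q ⟶ R} {r₂ : R ⟶ P₂} {c : W₁ ⟶ W₂} {k₁ : W₁ ⟶ K}
    {k₂ : K ⟶ L} {k₃ : L ⟶ R} {l : X ⟶ K} {l' : Y ⟶ L} (h₁ : u₄ ≫ σ = σ₃ ≫ p₁ ≫ p₂ ≫ p₃)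
    (h₂ : u₃ ≫ σ₃ ≫ p₁ = σ₂ ≫ q₁ ≫ q₂) (h₃ : q₂ ≫ p₂ = r₁ ≫ r₂) (h₄ : u₂ ≫ σ₂ = σ₁ ≫ c)
    (h₅ : c ≫ q₁ ≫ r₁ = k₁ ≫ k₂ ≫ k₃) (h₆ : u₁ ≫ σ₁ ≫ k₁ = l) (h₇ : l ≫ k₂ = σ ≫ l')
    (h₈ : l' ≫ k₃ ≫ r₂ ≫ p₃ = 𝟙 _) : u₁ ≫ u₂ ≫ u₃ ≫ u₄ = 𝟙 _ := by
  rw [← cancel_mono σ]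
  simp only [Category.assoc]
  rw [h₁, reassoc_of% h₂, reassoc_of% h₃, reassoc_of% h₄, reassoc_of% h₅, reassoc_of% h₆,
    reassoc_of% h₇, h₈, Category.comp_id, Category.id_comp]

theorem unit_chase' {u₁ : X ⟶ V₂} {u₃ : V₂ ⟶ V₃} {u₄ : V₃ ⟶ X} {σ : X ⟶ Y} [Mono σ]
    {σ₂ : V₂ ⟶ W₂} {σ₃ : V₃ ⟶ W₃} {p₁ : W₃ ⟶ P₁} {p₂ : P₁ ⟶ P₂} {p₃ : P₂ ⟶ Y}
    {q₁ : W₂ ⟶ Q} {q₂ : Q ⟶ P₁} {r₁ : Q ⟶ R} {r₂ : R ⟶ P₂} {c : Y ⟶ W₂} {k : Y ⟶ R}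
    (h₁ : u₄ ≫ σ = σ₃ ≫ p₁ ≫ p₂ ≫ p₃)
    (h₂ : u₃ ≫ σ₃ ≫ p₁ = σ₂ ≫ q₁ ≫ q₂) (h₃ : q₂ ≫ p₂ = r₁ ≫ r₂) (h₄ : u₁ ≫ σ₂ = σ ≫ c)
    (h₅ : c ≫ q₁ ≫ r₁ = k) (h₆ : k ≫ r₂ ≫ p₃ = 𝟙 _) : u₁ ≫ u₃ ≫ u₄ = 𝟙 _ := by
  rw [← cancel_mono σ]
  simp only [Category.assoc]
  rw [h₁, reassoc_of% h₂, reassoc_of% h₃, reassoc_of% h₄, reassoc_of% h₅, h₆,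
    Category.comp_id, Category.id_comp]

end Chase

section SimpleComparison
variable {D : Type u} [Category.{v} D] {A : Type u₁} [Category.{v₁} A] (𝔰 : DescentStructure D)
  {s : Cosimp A ⥤ A} {lam : 𝟭 A ⟶ Functor.const SimplexCategory ⋙ s}
  {mu : (Functor.whiskeringRight SimplexCategory _ _).obj s ⋙ s ⟶ diagonal ⋙ s} {U : A ⥤ D}
  (σ : s ⋙ U ≅ (Functor.whiskeringRight SimplexCategory _ _).obj U ⋙ 𝔰.simple)

/-- The image of a constant bicosimplicial object in the first direction. -/
def constWhiskerComparison (U : A ⥤ D) (X : Cosimp A) :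
    (Functor.const SimplexCategory).obj X ⋙ (Functor.whiskeringRight SimplexCategory _ _).obj U ⟶
      (Functor.const SimplexCategory).obj (X ⋙ U) where
  app _ := 𝟙 (X ⋙ U)
  naturality n m f := NatTrans.ext (funext fun p => by
    change U.map (𝟙 (X.obj p)) ≫ 𝟙 _ = 𝟙 _ ≫ 𝟙 _
    rw [CategoryTheory.Functor.map_id])

/-- The image of a constant bicosimplicial object in the second direction. -/
def levelConstComparison (U : A ⥤ D) (X : Cosimp A) :
    (X ⋙ Functor.const SimplexCategory) ⋙ (Functor.whiskeringRight SimplexCategory _ _).obj U ⟶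
      (X ⋙ U) ⋙ Functor.const SimplexCategory where
  app n := constComparison U (X.obj n)
  naturality _ _ _ := NatTrans.ext (funext fun _ =>
    (Category.comp_id _).trans (Category.id_comp _).symm)

theorem isIso_constComparison (U : A ⥤ D) (X : A) : IsIso (constComparison U X) := by
  have : ∀ n, IsIso ((constComparison U X).app n) := fun n => inferInstanceAs (IsIso (𝟙 _))
  exact NatIso.isIso_of_isIso_app _

theorem isIso_diagonalComparison (U : A ⥤ D) (Z : Cosimp (Cosimp A)) :
    IsIso (diagonalComparison U Z) := by
  have : ∀ n, IsIso ((diagonalComparison U Z).app n) := fun n => inferInstanceAs (IsIso (𝟙 _))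
  exact NatIso.isIso_of_isIso_app _

theorem map_simple_comparison {X Y : Cosimp A} (f : X ⟶ Y) :
    U.map (s.map f) ≫ σ.hom.app Y = σ.hom.app X ≫ 𝔰.simple.map (Functor.whiskerRight f U) :=
  σ.hom.naturality f

/-- The isomorphism σ carries λ and μ to those of `𝔰`, hence the composite to the corresponding one
for `X ⋙ U`, which is the identity by `lam_mu`. -/
theorem map_lam_mu_comparison
    (hl : ∀ X, U.map (lam.app X) ≫ σ.hom.app ((Functor.const SimplexCategory).obj X) ≫
      𝔰.simple.map (constComparison U X) = 𝔰.lam.app (U.obj X))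
    (hm : ∀ Z, U.map (mu.app Z) ≫ σ.hom.app (diagonal.obj Z) ≫
        𝔰.simple.map (diagonalComparison U Z) =
      σ.hom.app (Z ⋙ s) ≫ 𝔰.simple.map (Z.whiskerLeft σ.hom) ≫
        𝔰.mu.app (Z ⋙ (Functor.whiskeringRight SimplexCategory _ _).obj U)) (X : Cosimp A) :
    U.map (lam.app (s.obj X) ≫ s.map (constSimpleTo s X) ≫
      mu.app ((Functor.const SimplexCategory).obj X) ≫ s.map (diagonalConst X)) = 𝟙 _ := by
  have e1 : Functor.whiskerRight (diagonalConst X) U =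
      diagonalComparison U ((Functor.const SimplexCategory).obj X) ≫
        diagonal.map (constWhiskerComparison U X) ≫ diagonalConst (X ⋙ U) :=
    NatTrans.ext (funext fun n => (U.map_id _).trans
      ((Category.id_comp _).trans (Category.id_comp _)).symm)
  have e2 := 𝔰.mu.naturality (constWhiskerComparison U X)
  have e2' : 𝔰.mu.app ((Functor.const SimplexCategory).obj X ⋙
      (Functor.whiskeringRight SimplexCategory _ _).obj U) ≫
        𝔰.simple.map (diagonal.map (constWhiskerComparison U X)) =
      𝔰.simple.map (Functor.whiskerRight (constWhiskerComparison U X) 𝔰.simple) ≫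
        𝔰.mu.app ((Functor.const SimplexCategory).obj (X ⋙ U)) := e2.symm
  have e3 : Functor.whiskerRight (constSimpleTo s X) U ≫
      Functor.whiskerLeft ((Functor.const SimplexCategory).obj X) σ.hom ≫
        Functor.whiskerRight (constWhiskerComparison U X) 𝔰.simple =
      constComparison U (s.obj X) ≫ (Functor.const SimplexCategory).map (σ.hom.app X) ≫
        constSimpleTo 𝔰.simple (X ⋙ U) :=
    NatTrans.ext (funext fun n => by
      change U.map (𝟙 _) ≫ σ.hom.app X ≫ 𝔰.simple.map (𝟙 _) = 𝟙 _ ≫ σ.hom.app X ≫ 𝟙 _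
      rw [CategoryTheory.Functor.map_id, CategoryTheory.Functor.map_id]
      rfl)
  have e4 := 𝔰.lam.naturality (σ.hom.app X)
  have e4' : 𝔰.lam.app (U.obj (s.obj X)) ≫
      𝔰.simple.map ((Functor.const SimplexCategory).map (σ.hom.app X)) =
      σ.hom.app X ≫ 𝔰.lam.app (𝔰.simple.obj (X ⋙ U)) := e4.symm
  have e5 := 𝔰.lam_mu (X ⋙ U)
  have f3 := congrArg (fun t => 𝔰.simple.map t) e3
  simp only [Functor.map_comp] at f3
  have f1 := congrArg (fun t => 𝔰.simple.map t) e1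
  simp only [Functor.map_comp] at f1
  have n1 := map_simple_comparison 𝔰 σ (diagonalConst X)
  rw [f1] at n1
  simp only [Functor.map_comp]
  exact unit_chase n1 (hm ((Functor.const SimplexCategory).obj X)) e2'
    (map_simple_comparison 𝔰 σ (constSimpleTo s X)) f3 (hl (s.obj X)) e4' e5

/-- As for `map_lam_mu_comparison`, with `map_lam_mu`; the shorter chase suffices since λ is now
applied in each degree. -/
theorem map_map_lam_mu_comparison
    (hl : ∀ X, U.map (lam.app X) ≫ σ.hom.app ((Functor.const SimplexCategory).obj X) ≫
      𝔰.simple.map (constComparison U X) = 𝔰.lam.app (U.obj X))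
    (hm : ∀ Z, U.map (mu.app Z) ≫ σ.hom.app (diagonal.obj Z) ≫
        𝔰.simple.map (diagonalComparison U Z) =
      σ.hom.app (Z ⋙ s) ≫ 𝔰.simple.map (Z.whiskerLeft σ.hom) ≫
        𝔰.mu.app (Z ⋙ (Functor.whiskeringRight SimplexCategory _ _).obj U)) (X : Cosimp A) :
    U.map (s.map (X.whiskerLeft lam) ≫ mu.app (X ⋙ Functor.const SimplexCategory) ≫
      s.map (diagonalLevelConst X)) = 𝟙 _ := by
  have e1 : Functor.whiskerRight (diagonalLevelConst X) U =
      diagonalComparison U (X ⋙ Functor.const SimplexCategory) ≫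
        diagonal.map (levelConstComparison U X) ≫ diagonalLevelConst (X ⋙ U) :=
    NatTrans.ext (funext fun n => (U.map_id _).trans
      ((Category.id_comp _).trans (Category.id_comp _)).symm)
  have e2 : 𝔰.mu.app ((X ⋙ Functor.const SimplexCategory) ⋙
      (Functor.whiskeringRight SimplexCategory _ _).obj U) ≫
        𝔰.simple.map (diagonal.map (levelConstComparison U X)) =
      𝔰.simple.map (Functor.whiskerRight (levelConstComparison U X) 𝔰.simple) ≫
        𝔰.mu.app ((X ⋙ U) ⋙ Functor.const SimplexCategory) :=
    (𝔰.mu.naturality (levelConstComparison U X)).symm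
  have e3 : Functor.whiskerRight (X.whiskerLeft lam) U ≫
      Functor.whiskerLeft (X ⋙ Functor.const SimplexCategory) σ.hom ≫
        Functor.whiskerRight (levelConstComparison U X) 𝔰.simple =
      (X ⋙ U).whiskerLeft 𝔰.lam :=
    NatTrans.ext (funext fun n => hl (X.obj n))
  have f3 := congrArg (fun t => 𝔰.simple.map t) e3
  simp only [Functor.map_comp] at f3
  have f1 := congrArg (fun t => 𝔰.simple.map t) e1
  simp only [Functor.map_comp] at f1
  have n1 := map_simple_comparison 𝔰 σ (diagonalLevelConst X)
  rw [f1] at n1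
  simp only [Functor.map_comp]
  exact unit_chase' n1 (hm (X ⋙ Functor.const SimplexCategory)) e2
    (map_simple_comparison 𝔰 σ (X.whiskerLeft lam)) f3 (𝔰.map_lam_mu (X ⋙ U))

end SimpleComparison

section Transfer
variable {D : Type u} [Category.{v} D] {A : Type u₁} [Category.{v₁} A] {κ : Type}

/-- The forgetful functors `U k` detect and preserve what is needed to transfer a descent
structure. -/
structure ForgetfulFamily (U : κ → A ⥤ D) : Prop where
  [hasProducts : HasProducts.{w} A]
  [hasFilteredColimits : HasFilteredColimitsOfSize.{w, w} A]
  preservesProducts (k : κ) (I : Type w) : PreservesLimitsOfShape (Discrete I) (U k)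
  preservesFilteredColimits (k : κ) : PreservesFilteredColimitsOfSize.{w, w} (U k)
  hom_ext ⦃X Y : A⦄ (f g : X ⟶ Y) : (∀ k, (U k).map f = (U k).map g) → f = g
  isLimit {I : Type w} [SmallCategory I] {G : I ⥤ A} (c : Cone G) :
    (∀ k, Nonempty (IsLimit ((U k).mapCone c))) → Nonempty (IsLimit c)

theorem preservesFiniteProducts_of_discrete {F : A ⥤ D}
    (h : ∀ I : Type w, PreservesLimitsOfShape (Discrete I) F) : PreservesFiniteProducts F where
  preserves n := by
    have := h (ULift (Fin n))
    exact preservesLimitsOfShape_of_equiv (Discrete.equivalence Equiv.ulift) F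

theorem ForgetfulFamily.preservesFiniteProducts {U : κ → A ⥤ D} (hU : ForgetfulFamily.{w} U)
    (k : κ) : PreservesFiniteProducts (U k) :=
  preservesFiniteProducts_of_discrete (hU.preservesProducts k)

variable (𝔰 : DescentStructure D)

/-- By naturality σ conjugates the product comparison of `s ⋙ U` into that of the composite of `U`,
applied degree-wise, with 𝐬. As `U` preserves finite products, these differ from the two comparisons
of interest by isomorphisms. -/
theorem E_prodComparison_comparison {s : Cosimp A ⥤ A} {U : A ⥤ D} [HasFiniteProducts A]
    [HasFiniteProducts D] [PreservesFiniteProducts U]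
    (σ : s ⋙ U ≅ (Functor.whiskeringRight SimplexCategory _ _).obj U ⋙ 𝔰.simple)
    (X Y : Cosimp A) (h : 𝔰.E (prodComparison 𝔰.simple (X ⋙ U) (Y ⋙ U))) :
    𝔰.E (U.map (prodComparison s X Y)) := by
  let V := (Functor.whiskeringRight SimplexCategory _ _).obj U
  have h1 : 𝔰.E (prodComparison (V ⋙ 𝔰.simple) X Y) := by
    rw [prodComparison_comp]
    exact 𝔰.E_comp (𝔰.E_of_isIso _) h
  have h2 : prodComparison (s ⋙ U) X Y ≫ prod.map (σ.hom.app X) (σ.hom.app Y) =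
      σ.hom.app (X ⨯ Y) ≫ prodComparison (V ⋙ 𝔰.simple) X Y := by
    apply Limits.prod.hom_ext
    · rw [Category.assoc, Category.assoc, prod.map_fst, prodComparison_fst,
        prodComparison_fst_assoc]
      exact σ.hom.naturality prod.fst
    · rw [Category.assoc, Category.assoc, prod.map_snd, prodComparison_snd,
        prodComparison_snd_assoc]
      exact σ.hom.naturality prod.snd
  have h3 := (𝔰.E_congr _ _ h2).2 h1
  rw [prodComparison_comp] at h3
  exact 𝔰.E_of_comp_right (𝔰.E_of_isIso _) h3

/-- A functor which preserves finite products commutes with path objects. -/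
noncomputable def pathObjectComparison (U : A ⥤ D) [HasFiniteProducts A] [HasFiniteProducts D]
    (X : A) : pathObject X ⋙ U ⟶ pathObject (U.obj X) where
  app n := piComparison U fun _ : n ⟶ SimplexCategory.mk 1 => X
  naturality n m f := by
    refine Pi.hom_ext _ _ fun α => ?_
    change (U.map (Pi.lift fun α : m ⟶ SimplexCategory.mk 1 => Pi.π (fun _ => X) (f ≫ α)) ≫
      piComparison U _) ≫ _ = (piComparison U _ ≫ Pi.lift fun α => Pi.π _ (f ≫ α)) ≫ _
    rw [Category.assoc, piComparison_comp_π, ← U.map_comp, Pi.lift_π, Category.assoc, Pi.lift_π,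
      piComparison_comp_π]

instance isIso_pathObjectComparison (U : A ⥤ D) [HasFiniteProducts A] [HasFiniteProducts D]
    [PreservesFiniteProducts U] (X : A) : IsIso (pathObjectComparison U X) := by
  have : ∀ n, IsIso ((pathObjectComparison U X).app n) := fun n =>
    inferInstanceAs (IsIso (piComparison U fun _ : n ⟶ SimplexCategory.mk 1 => X))
  exact NatIso.isIso_of_isIso_app _

theorem pathObjectComparison_eval (U : A ⥤ D) [HasFiniteProducts A] [HasFiniteProducts D] (X : A) :
    Functor.whiskerRight (pathObjectEval X) U ≫ constComparison U X =
      pathObjectComparison U X ≫ pathObjectEval (U.obj X) :=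
  NatTrans.ext (funext fun n => (Category.comp_id _).trans
    (piComparison_comp_π U (fun _ : n ⟶ SimplexCategory.mk 1 => X)
      (SimplexCategory.const n (SimplexCategory.mk 1) 1)).symm)

/-- The descent structure on a category `A` with a family of forgetful functors to a category `D`
with a descent structure, through which the simple functor and the transformations `λ` and `μ`
of `A` are those of `D`. -/
noncomputable def transferDescentStructure {U : κ → A ⥤ D} (hU : ForgetfulFamily.{w} U)
    {s : Cosimp A ⥤ A} {lam : 𝟭 A ⟶ Functor.const SimplexCategory ⋙ s}
    {mu : (Functor.whiskeringRight SimplexCategory _ _).obj s ⋙ s ⟶ diagonal ⋙ s}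
    (σ : ∀ k, s ⋙ U k ≅ (Functor.whiskeringRight SimplexCategory _ _).obj (U k) ⋙ 𝔰.simple)
    (hl : ∀ k X, (U k).map (lam.app X) ≫ (σ k).hom.app ((Functor.const SimplexCategory).obj X) ≫
      𝔰.simple.map (constComparison (U k) X) = 𝔰.lam.app ((U k).obj X))
    (hm : ∀ k Z, (U k).map (mu.app Z) ≫ (σ k).hom.app (diagonal.obj Z) ≫
        𝔰.simple.map (diagonalComparison (U k) Z) =
      (σ k).hom.app (Z ⋙ s) ≫ 𝔰.simple.map (Z.whiskerLeft (σ k).hom) ≫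
        𝔰.mu.app (Z ⋙ (Functor.whiskeringRight SimplexCategory _ _).obj (U k))) :
    DescentStructure A :=
  haveI := 𝔰.hasFiniteProducts
  haveI := hU.hasProducts
  haveI := hU.preservesFiniteProducts
  haveI : HasFiniteProducts A := hasFiniteProducts_of_hasProducts A
  { hasFiniteProducts := inferInstance
    E := fun _ _ f => ∀ k, 𝔰.E ((U k).map f)
    -- `U k` followed by the localization of `D` inverts the new class of equivalences, so
    -- saturation is inherited from `D` for each `k` separately.
    E_saturated := fun X Y f hf k => by
      rw [𝔰.E_iff_isIso]
      exact isIso_map_of_isIso_Q (U k ⋙ 𝔰.E.Q)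
        (fun _ _ f hf => MorphismProperty.Q_inverts _ _ (hf k)) f hf
    E_prod := fun X Y X' Y' f g hf hg k =>
      (𝔰.E_congr _ _ (prodComparison_natural (U k) f g)).2 (𝔰.E_prod _ _ (hf k) (hg k))
    simple := s
    simple_prod := fun X Y k => E_prodComparison_comparison 𝔰 (σ k) X Y (𝔰.simple_prod _ _)
    mu := mu
    E_mu := fun Z k => by
      have h := 𝔰.E_comp (𝔰.E_of_isIso ((σ k).hom.app (Z ⋙ s))) (𝔰.E_comp
        (𝔰.E_of_isIso (𝔰.simple.map (Z.whiskerLeft (σ k).hom)))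
          (𝔰.E_mu (Z ⋙ (Functor.whiskeringRight SimplexCategory _ _).obj (U k))))
      have := isIso_diagonalComparison (U k) Z
      refine 𝔰.E_of_comp_right ?_ (of_eq_of_property (hm k Z).symm h)
      exact 𝔰.E_comp (𝔰.E_of_isIso _) (𝔰.E_of_isIso _)
    lam := lam
    E_lam := fun X k => by
      have := isIso_constComparison (U k) X
      refine 𝔰.E_of_comp_right ?_ (of_eq_of_property (hl k X).symm (𝔰.E_lam _))
      exact 𝔰.E_comp (𝔰.E_of_isIso _) (𝔰.E_of_isIso _)
    lam_mu := fun X => hU.hom_ext _ _ fun k =>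
      (map_lam_mu_comparison 𝔰 (σ k) (hl k) (hm k) X).trans ((U k).map_id _).symm
    map_lam_mu := fun X => hU.hom_ext _ _ fun k =>
      (map_map_lam_mu_comparison 𝔰 (σ k) (hl k) (hm k) X).trans ((U k).map_id _).symm
    E_simple := fun X Y f hf k => (𝔰.E_congr _ _ (map_simple_comparison 𝔰 (σ k) f)).2
      (𝔰.E_simple _ fun n => hf n k)
    -- Since `U k` preserves finite products, it sends the path object of `X` to that of its image,
    -- compatibly with the evaluation.
    E_path := fun X k => by
      have := isIso_constComparison (U k) X
      refine (𝔰.E_congr _ _ (map_simple_comparison 𝔰 (σ k) (pathObjectEval X))).2 ?_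
      refine (𝔰.E_congr (𝔰.simple.map (pathObjectComparison (U k) X))
        (𝔰.simple.map (constComparison (U k) X)) ?_).2 (𝔰.E_path ((U k).obj X))
      exact (𝔰.simple.map_comp _ _).symm.trans ((congrArg 𝔰.simple.map
        (pathObjectComparison_eval (U k) X)).trans (𝔰.simple.map_comp _ _)) }

/-- The transferred descent structure is computed through the forgetful functors. -/
noncomputable def transferDescentLift {U : κ → A ⥤ D} (hU : ForgetfulFamily.{w} U)
    {s : Cosimp A ⥤ A} {lam : 𝟭 A ⟶ Functor.const SimplexCategory ⋙ s}
    {mu : (Functor.whiskeringRight SimplexCategory _ _).obj s ⋙ s ⟶ diagonal ⋙ s}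
    (σ : ∀ k, s ⋙ U k ≅ (Functor.whiskeringRight SimplexCategory _ _).obj (U k) ⋙ 𝔰.simple)
    (hl : ∀ k X, (U k).map (lam.app X) ≫ (σ k).hom.app ((Functor.const SimplexCategory).obj X) ≫
      𝔰.simple.map (constComparison (U k) X) = 𝔰.lam.app ((U k).obj X))
    (hm : ∀ k Z, (U k).map (mu.app Z) ≫ (σ k).hom.app (diagonal.obj Z) ≫
        𝔰.simple.map (diagonalComparison (U k) Z) =
      (σ k).hom.app (Z ⋙ s) ≫ 𝔰.simple.map (Z.whiskerLeft (σ k).hom) ≫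
        𝔰.mu.app (Z ⋙ (Functor.whiskeringRight SimplexCategory _ _).obj (U k))) :
    DescentLift.{w} (transferDescentStructure 𝔰 hU σ hl hm) 𝔰 U where
  preservesProducts := hU.preservesProducts
  preservesFilteredColimits := hU.preservesFilteredColimits
  E_iff _ _ _ := Iff.rfl
  simpleIso := σ
  lam := hl
  mu := hm

end Transfer

/-! ### Comparison of Godement resolutions along a functor. -/

section MonadComparison
variable {A : Type u} [Category.{v} A] {B : Type u₁} [Category.{v₁} B]
  (T : CategoryTheory.Monad A) (T' : CategoryTheory.Monad B) (V : A ⥤ B)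

/-- A comparison of two monads along a functor, compatible with their units and multiplications. -/
structure MonadComparison where
  iso : T.toFunctor ⋙ V ≅ V ⋙ T'.toFunctor
  unit (X : A) : V.map (T.η.app X) ≫ iso.hom.app X = T'.η.app (V.obj X)
  mul (X : A) : V.map (T.μ.app X) ≫ iso.hom.app X =
    iso.hom.app (T.obj X) ≫ T'.map (iso.hom.app X) ≫ T'.μ.app (V.obj X)

namespace MonadComparison
variable {T T' V} (χ : MonadComparison T T' V)

/-- The comparison of the iterates. -/
def pow (X : A) : (n : ℕ) → (V.obj (monadPow T X n) ⟶ monadPow T' (V.obj X) n)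
  | 0 => 𝟙 _
  | n + 1 => χ.iso.hom.app (monadPow T X n) ≫ T'.map (pow X n)

instance isIso_pow (X : A) : (n : ℕ) → IsIso (χ.pow X n)
  | 0 => inferInstanceAs (IsIso (𝟙 _))
  | n + 1 => by
    have := isIso_pow X n
    exact inferInstanceAs (IsIso (χ.iso.hom.app (monadPow T X n) ≫ T'.map (χ.pow X n)))

theorem pow_unit (X : A) (n : ℕ) :
    V.map (monadPowUnit T X n) ≫ χ.pow X (n + 1) = χ.pow X n ≫ monadPowUnit T' (V.obj X) n := by
  have h := T'.η.naturality (χ.pow X n)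
  exact (Category.assoc _ _ _).symm.trans ((congrArg (fun t => t ≫ T'.map (χ.pow X n))
    (χ.unit (monadPow T X n))).trans h.symm)

/-- The comparison of monads respects Kleisli extensions: `mul` takes care of the multiplication,
and naturality of `T f`. -/
theorem ext_aux {Y Z : A} {Y' Z' : B} (f : Y ⟶ T.obj Z) (f' : Y' ⟶ T'.obj Z') (y : V.obj Y ⟶ Y')
    (z : V.obj Z ⟶ Z') (h : V.map f ≫ χ.iso.hom.app Z ≫ T'.map z = y ≫ f') :
    V.map (T.map f ≫ T.μ.app Z) ≫ χ.iso.hom.app Z ≫ T'.map z =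
      (χ.iso.hom.app Y ≫ T'.map y) ≫ T'.map f' ≫ T'.μ.app Z' := by
  have h1 := χ.iso.hom.naturality f
  have h2 := T'.μ.naturality z
  have h3 := χ.mul Z
  dsimp only [Functor.comp_map, Functor.comp_obj] at h1 h2 h3
  rw [V.map_comp, Category.assoc, reassoc_of% h3, ← h2, reassoc_of% h1, Category.assoc,
    ← T'.map_comp_assoc]
  have h4 := congrArg T'.map h
  simp only [Functor.map_comp] at h4
  simp only [Functor.map_comp, Category.assoc]
  rw [reassoc_of% h4]

theorem pow_ext (X : A) {m n : ℕ} (f : monadPow T X m ⟶ monadPow T X (n + 1))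
    (f' : monadPow T' (V.obj X) m ⟶ monadPow T' (V.obj X) (n + 1))
    (h : V.map f ≫ χ.pow X (n + 1) = χ.pow X m ≫ f') :
    V.map (monadPowExt T X f) ≫ χ.pow X (n + 1) =
      χ.pow X (m + 1) ≫ monadPowExt T' (V.obj X) f' :=
  χ.ext_aux f f' (χ.pow X m) (χ.pow X n) h

/-- The action of monotone maps is built from units and Kleisli extensions only, so it suffices that
the comparison respects these two; the induction follows the recursion of `monadPowMap`. -/
theorem pow_map (X : A) : (n m : ℕ) → (θ : Fin m →o Fin n) →
    V.map (monadPowMap T X n m θ) ≫ χ.pow X n = χ.pow X m ≫ monadPowMap T' (V.obj X) n m θ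
  | 0, 0, _ => by
    rw [monadPowMap_zero_zero, monadPowMap_zero_zero, V.map_id, Category.id_comp,
      Category.comp_id]
  | 0, _ + 1, θ => (θ 0).elim0
  | n + 1, 0, _ => by
    rw [monadPowMap_zero_succ, monadPowMap_zero_succ, V.map_comp, Category.assoc, pow_unit,
      ← Category.assoc, pow_map X n 0, Category.assoc]
  | n + 1, m + 1, θ => by
    by_cases h0 : θ 0 = 0
    · rw [monadPowMap_succ_pos T X θ h0, monadPowMap_succ_pos T' _ θ h0]
      exact χ.pow_ext X _ _ (pow_map X (n + 1) m (tailHom θ))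
    · rw [monadPowMap_succ_neg T X θ h0, monadPowMap_succ_neg T' _ θ h0, V.map_comp,
        Category.assoc, pow_unit, ← Category.assoc, pow_map X n (m + 1), Category.assoc]

/-- The comparison of the cosimplicial resolutions. -/
def cobarMap (X : A) : (cobar T).obj X ⋙ V ⟶ (cobar T').obj (V.obj X) where
  app n := χ.pow X (n.len + 1)
  naturality n m θ := χ.pow_map X (m.len + 1) (n.len + 1) θ.toOrderHom

instance isIso_cobarMap (X : A) : IsIso (χ.cobarMap X) := by
  have : ∀ n, IsIso ((χ.cobarMap X).app n) := fun n => χ.isIso_pow X (n.len + 1)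
  exact NatIso.isIso_of_isIso_app _

theorem cobarMap_augmentation (X : A) (n : SimplexCategory) :
    V.map (((cobarAugmentation T).app X).app n) ≫ (χ.cobarMap X).app n =
      ((cobarAugmentation T').app (V.obj X)).app n :=
  (χ.pow_map X (n.len + 1) 0 (emptyHom _)).trans (Category.id_comp _)

end MonadComparison

end MonadComparison

section Chase
variable {B : Type*} [Category* B] {X₀ X₁ X₂ X₃ Y₁ Y₂ Y₃ Z₁ Z₂ Z₃ : B}

theorem naturality_chase {a : X₁ ⟶ X₂} {χ₂ : X₂ ⟶ Y₂} {t₂ : Y₂ ⟶ Z₂} {χ₁ : X₁ ⟶ Y₁} {b : Y₁ ⟶ Y₂}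
    {t₁ : Y₁ ⟶ Z₁} {c : Z₁ ⟶ Z₂} {u₁ : X₁ ⟶ X₀} {u₂ : X₂ ⟶ X₃} {c' : X₀ ⟶ X₃} {p₁ : X₀ ⟶ Z₁}
    {p₂ : X₃ ⟶ Z₂} (h₂ : χ₂ ≫ t₂ = u₂ ≫ p₂) (h : b ≫ t₂ = t₁ ≫ c) (h₁ : χ₁ ≫ t₁ = u₁ ≫ p₁)
    (h₃ : a ≫ u₂ = u₁ ≫ c') (h₄ : p₁ ≫ c = c' ≫ p₂) : (a ≫ χ₂) ≫ t₂ = (χ₁ ≫ b) ≫ t₂ := by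
  rw [Category.assoc, h₂, reassoc_of% h₃, Category.assoc, h, reassoc_of% h₁, h₄]

theorem unit_comparison_chase {a : X₁ ⟶ X₂} {χ : X₂ ⟶ Y₂} {t : Y₂ ⟶ Z₂} {u : X₂ ⟶ X₃} {g : X₁ ⟶ Z₂}
    {p : Z₂ ⟶ X₃} {q : X₃ ⟶ Z₂} {η : X₁ ⟶ Y₂} (h₁ : a ≫ u = g ≫ p) (h₂ : χ ≫ t = u ≫ q)
    (h₃ : p ≫ q = 𝟙 _) (h₄ : η ≫ t = g) : (a ≫ χ) ≫ t = η ≫ t := by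
  rw [Category.assoc, h₂, reassoc_of% h₁, h₃, Category.comp_id, h₄]

theorem mul_comparison_chase {m : X₁ ⟶ X₂} {χ : X₂ ⟶ Y₁} {t : Y₁ ⟶ Z₁} {u : X₂ ⟶ X₃} {q : X₃ ⟶ Z₁}
    {p : Z₁ ⟶ X₃} {c : X₀ ⟶ X₃} {u' : X₁ ⟶ X₀} {χ' : X₁ ⟶ Y₂} {b : Y₂ ⟶ Y₃} {m' : Y₃ ⟶ Y₁}
    {t' : Y₂ ⟶ Z₂} {t'' : Y₃ ⟶ Z₃} {b' : Z₂ ⟶ Z₃} {c' : Z₃ ⟶ Z₁} {q' : X₀ ⟶ Z₂} {p' : Z₂ ⟶ X₀}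
    (h₁ : χ ≫ t = u ≫ q) (h₂ : m ≫ u = u' ≫ c) (h₃ : m' ≫ t = t'' ≫ c')
    (h₄ : b ≫ t'' = t' ≫ b') (h₅ : χ' ≫ t' = u' ≫ q') (h₆ : b' ≫ c' ≫ p = p' ≫ c)
    (h₇ : p ≫ q = 𝟙 _) (h₈ : q' ≫ p' = 𝟙 _) :
    (m ≫ χ) ≫ t = (χ' ≫ b ≫ m') ≫ t := by
  have h : q' ≫ b' ≫ c' = c ≫ q := by
    have := congrArg (fun t => q' ≫ t ≫ q) h₆
    simpa only [Category.assoc, h₇, Category.comp_id, reassoc_of% h₈] using this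
  rw [Category.assoc, h₁, reassoc_of% h₂, Category.assoc, Category.assoc, h₃, reassoc_of% h₄,
    reassoc_of% h₅, h]

end Chase

section GodementComparison
variable {C : Type w} [SmallCategory C] {J : GrothendieckTopology C}
  {D : Type u} [Category.{v} D] [HasFilteredColimitsOfSize.{w, w} D]
  {A : Type u₁} [Category.{v₁} A] [HasFilteredColimitsOfSize.{w, w} A]
  (U : A ⥤ D) [PreservesFilteredColimitsOfSize.{w, w} U]

/-- The comparison of fibres along a functor. -/
noncomputable def stalkComparison (x : GrothendieckTopology.Point.{w} J) (F : Cᵒᵖ ⥤ A) :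
    (stalk D x).obj (F ⋙ U) ⟶ U.obj ((stalk A x).obj F) :=
  colimit.post ((CategoryOfElements.π x.fiber).op ⋙ F) U

theorem germ_stalkComparison (x : GrothendieckTopology.Point.{w} J) {V : C} (s : x.fiber.obj V)
    (F : Cᵒᵖ ⥤ A) : germ x s (F ⋙ U) ≫ stalkComparison U x F = U.map (germ x s F) :=
  colimit.ι_post ((CategoryOfElements.π x.fiber).op ⋙ F) U (op ⟨V, s⟩)

instance isIso_stalkComparison (x : GrothendieckTopology.Point.{w} J) (F : Cᵒᵖ ⥤ A) :
    IsIso (stalkComparison U x F) := by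
  have := PreservesFilteredColimitsOfSize.preserves_filtered_colimits (F := U) x.fiber.Elementsᵒᵖ
  exact inferInstanceAs (IsIso (colimit.post ((CategoryOfElements.π x.fiber).op ⋙ F) U))

theorem stalkComparison_naturality (x : GrothendieckTopology.Point.{w} J) {F G : Cᵒᵖ ⥤ A}
    (f : F ⟶ G) : (stalk D x).map (Functor.whiskerRight f U) ≫ stalkComparison U x G =
      stalkComparison U x F ≫ U.map ((stalk A x).map f) := by
  refine stalk_hom_ext x fun V s => ?_
  have h : (Functor.whiskerRight f U).app (op V) ≫ U.map (germ x s G) =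
      U.map (germ x s F) ≫ U.map ((stalk A x).map f) :=
    (U.map_comp _ _).symm.trans ((congrArg U.map (germ_naturality x s f).symm).trans
      (U.map_comp _ _))
  rw [← Category.assoc, germ_naturality, Category.assoc, germ_stalkComparison, ← Category.assoc,
    germ_stalkComparison]
  exact h

/-- The inverse of the comparison of fibres along a functor. -/
noncomputable def stalkComparisonInv (x : GrothendieckTopology.Point.{w} J) (F : Cᵒᵖ ⥤ A) :
    U.obj ((stalk A x).obj F) ⟶ (stalk D x).obj (F ⋙ U) :=
  inv (stalkComparison U x F)

instance isIso_stalkComparisonInv (x : GrothendieckTopology.Point.{w} J) (F : Cᵒᵖ ⥤ A) :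
    IsIso (stalkComparisonInv U x F) := IsIso.inv_isIso

theorem stalkComparison_hom_inv (x : GrothendieckTopology.Point.{w} J) (F : Cᵒᵖ ⥤ A) :
    stalkComparison U x F ≫ stalkComparisonInv U x F = 𝟙 _ := IsIso.hom_inv_id _

theorem stalkComparison_inv_hom (x : GrothendieckTopology.Point.{w} J) (F : Cᵒᵖ ⥤ A) :
    stalkComparisonInv U x F ≫ stalkComparison U x F = 𝟙 _ := IsIso.inv_hom_id _

variable [HasProducts.{w} D] [HasProducts.{w} A]
  [∀ I : Type w, PreservesLimitsOfShape (Discrete I) U] {ι : Type w}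
  (pts : ι → GrothendieckTopology.Point.{w} J)

/-- The comparison of the values of the functors `p_*` along a functor, given comparisons `g` of
the families. -/
noncomputable def skyscrapersComparison {M : ι → A} {N : ι → D} (g : ∀ i, U.obj (M i) ⟶ N i) :
    (skyscrapers A pts).obj M ⋙ U ⟶ (skyscrapers D pts).obj N where
  app V := piComparison U (fun q : (Σ i, (pts i).fiber.obj V.unop) => M q.1) ≫
    Limits.Pi.map fun q => g q.1
  naturality V W f := by
    refine Pi.hom_ext _ _ fun q => ?_
    change (U.map (Pi.lift fun q : (Σ i, (pts i).fiber.obj W.unop) =>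
          Pi.π (fun q : (Σ i, (pts i).fiber.obj V.unop) => M q.1)
            ⟨q.1, (pts q.1).fiber.map f.unop q.2⟩) ≫ piComparison U _ ≫ Limits.Pi.map _) ≫ _ =
      ((piComparison U _ ≫ Limits.Pi.map _) ≫ Pi.lift fun q : (Σ i, (pts i).fiber.obj W.unop) =>
          Pi.π (fun q : (Σ i, (pts i).fiber.obj V.unop) => N q.1)
            ⟨q.1, (pts q.1).fiber.map f.unop q.2⟩) ≫ _
    simp only [Category.assoc]
    rw [Pi.map_π, piComparison_comp_π_assoc, ← U.map_comp_assoc, Pi.lift_π, Pi.lift_π, Pi.map_π,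
      piComparison_comp_π_assoc]

theorem skyscrapersComparison_π {M : ι → A} {N : ι → D} (g : ∀ i, U.obj (M i) ⟶ N i) (i : ι)
    (V : C) (s : (pts i).fiber.obj V) :
    skyscrapersπ pts (skyscrapersComparison U pts g) i V s =
      U.map (Pi.π (fun q : (Σ i, (pts i).fiber.obj V) => M q.1) ⟨i, s⟩) ≫ g i := by
  refine (Category.assoc _ _ _).trans ?_
  exact (congrArg (fun t => piComparison U _ ≫ t) (Pi.map_π _ _)).trans
    (piComparison_comp_π_assoc _ _ _ _)

theorem isIso_skyscrapersComparison {M : ι → A} {N : ι → D} (g : ∀ i, U.obj (M i) ⟶ N i)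
    (hg : ∀ i, IsIso (g i)) : IsIso (skyscrapersComparison U pts g) := by
  have : ∀ V, IsIso ((skyscrapersComparison U pts g).app V) := fun V =>
    inferInstanceAs (IsIso (piComparison U (fun q : (Σ i, (pts i).fiber.obj V.unop) => M q.1) ≫
      Limits.Pi.map fun q => g q.1))
  exact NatIso.isIso_of_isIso_app _

/-- The comparison of the Godement monads. -/
noncomputable def godementMonadComparisonApp (F : Cᵒᵖ ⥤ A) :
    (godementMonad A pts).obj F ⋙ U ⟶ (godementMonad D pts).obj (F ⋙ U) :=
  skyscrapersComparison U pts (M := (stalks A pts).obj F)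
    (N := (stalks D pts).obj (F ⋙ U)) fun i => stalkComparisonInv U (pts i) F

instance isIso_godementMonadComparisonApp (F : Cᵒᵖ ⥤ A) :
    IsIso (godementMonadComparisonApp U pts F) :=
  isIso_skyscrapersComparison U pts _ fun i => isIso_stalkComparisonInv U (pts i) F

/-- The component of the Godement monad at an element of a fibre. -/
noncomputable def godementπ (i : ι) {V : C} (s : (pts i).fiber.obj V) (F : Cᵒᵖ ⥤ D) :
    ((godementMonad D pts).obj F).obj (op V) ⟶ (stalk D (pts i)).obj F :=
  Pi.π (fun q : (Σ i, (pts i).fiber.obj V) => (stalk D (pts q.1)).obj F) ⟨i, s⟩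

theorem godementπ_ext {F G : Cᵒᵖ ⥤ D} {f g : F ⟶ (godementMonad D pts).obj G}
    (h : ∀ (i : ι) (V : C) (s : (pts i).fiber.obj V),
      f.app (op V) ≫ godementπ pts i s G = g.app (op V) ≫ godementπ pts i s G) : f = g :=
  skyscrapersπ_ext pts h

theorem godementMonad_η_π (F : Cᵒᵖ ⥤ D) (i : ι) (V : C) (s : (pts i).fiber.obj V) :
    ((godementMonad D pts).η.app F).app (op V) ≫ godementπ pts i s F = germ (pts i) s F :=
  (skyscrapersπ_to pts _ i V s).trans (Category.comp_id _)

theorem godementMonad_map_π {F G : Cᵒᵖ ⥤ D} (f : F ⟶ G) (i : ι) (V : C)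
    (s : (pts i).fiber.obj V) :
    ((godementMonad D pts).map f).app (op V) ≫ godementπ pts i s G =
      godementπ pts i s F ≫ (stalk D (pts i)).map f :=
  Pi.map_π (fun q : (Σ i, (pts i).fiber.obj V) => (stalk D (pts q.1)).map f) ⟨i, s⟩

/-- The counit of the adjunction between `p^*` and `p_*`, at a point. -/
noncomputable def godementCounit (i : ι) (F : Cᵒᵖ ⥤ D) :
    (stalk D (pts i)).obj ((godementMonad D pts).obj F) ⟶ (stalk D (pts i)).obj F :=
  (stalksAdjunction pts).counit.app ((stalks D pts).obj F) i

theorem germ_godementCounit (i : ι) {V : C} (s : (pts i).fiber.obj V) (F : Cᵒᵖ ⥤ D) :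
    germ (pts i) s ((godementMonad D pts).obj F) ≫ godementCounit pts i F =
      godementπ pts i s F :=
  (germ_stalkDesc (pts i) _ (skyscrapersπ_w pts (𝟙 ((godementMonad D pts).obj F)) i) s).trans
    (Category.id_comp _)

theorem godementMonad_μ_π (F : Cᵒᵖ ⥤ D) (i : ι) (V : C) (s : (pts i).fiber.obj V) :
    ((godementMonad D pts).μ.app F).app (op V) ≫ godementπ pts i s F =
      godementπ pts i s ((godementMonad D pts).obj F) ≫ godementCounit pts i F :=
  Pi.map_π (fun q : (Σ i, (pts i).fiber.obj V) => godementCounit pts q.1 F) ⟨i, s⟩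

theorem godementMonadComparisonApp_π (F : Cᵒᵖ ⥤ A) (i : ι) (V : C) (s : (pts i).fiber.obj V) :
    (godementMonadComparisonApp U pts F).app (op V) ≫ godementπ pts i s (F ⋙ U) =
      U.map (godementπ pts i s F) ≫ stalkComparisonInv U (pts i) F :=
  skyscrapersComparison_π U pts (M := (stalks A pts).obj F)
    (N := (stalks D pts).obj (F ⋙ U)) (fun i => stalkComparisonInv U (pts i) F) i V s

theorem godementMonadComparisonApp_naturality {F G : Cᵒᵖ ⥤ A} (f : F ⟶ G) :
    Functor.whiskerRight ((godementMonad A pts).map f) U ≫ godementMonadComparisonApp U pts G =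
      godementMonadComparisonApp U pts F ≫
        (godementMonad D pts).map (Functor.whiskerRight f U) := by
  refine godementπ_ext pts fun i V s => ?_
  have h1 : U.map (godementπ pts i s F) ≫ U.map ((stalk A (pts i)).map f) =
      U.map (((godementMonad A pts).map f).app (op V)) ≫ U.map (godementπ pts i s G) :=
    (U.map_comp _ _).symm.trans ((congrArg U.map (godementMonad_map_π pts f i V s).symm).trans
      (U.map_comp _ _))
  have h2 : stalkComparisonInv U (pts i) F ≫
      (stalk D (pts i)).map (Functor.whiskerRight f U) =
      U.map ((stalk A (pts i)).map f) ≫ stalkComparisonInv U (pts i) G := by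
    rw [stalkComparisonInv, IsIso.inv_comp_eq, ← Category.assoc, ← stalkComparison_naturality,
      Category.assoc, stalkComparison_hom_inv, Category.comp_id]
  exact naturality_chase (godementMonadComparisonApp_π U pts G i V s)
    (godementMonad_map_π pts (Functor.whiskerRight f U) i V s)
    (godementMonadComparisonApp_π U pts F i V s) h1.symm h2

theorem godementMonadComparisonApp_unit (F : Cᵒᵖ ⥤ A) :
    Functor.whiskerRight ((godementMonad A pts).η.app F) U ≫ godementMonadComparisonApp U pts F =
      (godementMonad D pts).η.app (F ⋙ U) := by
  refine godementπ_ext pts fun i V s => ?_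
  have h : U.map (((godementMonad A pts).η.app F).app (op V)) ≫ U.map (godementπ pts i s F) =
      germ (pts i) s (F ⋙ U) ≫ stalkComparison U (pts i) F :=
    (U.map_comp _ _).symm.trans ((congrArg U.map (godementMonad_η_π pts F i V s)).trans
      (germ_stalkComparison U _ s F).symm)
  exact unit_comparison_chase h (godementMonadComparisonApp_π U pts F i V s)
    (stalkComparison_hom_inv U _ _) (godementMonad_η_π pts _ i V s)

/-- On the germ at `s`, both composites are the image under `U` of the projection to the factor at
`s`. -/
theorem stalk_godementMonadComparisonApp_counit (F : Cᵒᵖ ⥤ A) (i : ι) :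
    (stalk D (pts i)).map (godementMonadComparisonApp U pts F) ≫ godementCounit pts i (F ⋙ U) ≫
        stalkComparison U (pts i) F =
      stalkComparison U (pts i) _ ≫ U.map (godementCounit pts i F) := by
  refine stalk_hom_ext (pts i) fun V s => ?_
  have h : U.map (germ (pts i) s ((godementMonad A pts).obj F)) ≫ U.map (godementCounit pts i F) =
      U.map (godementπ pts i s F) :=
    (U.map_comp _ _).symm.trans (congrArg U.map (germ_godementCounit pts i s F))
  rw [← Category.assoc, germ_naturality, ← Category.assoc (germ _ _ _), germ_stalkComparison, h,
    Category.assoc, ← Category.assoc (germ _ _ _), germ_godementCounit,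
    ← Category.assoc, godementMonadComparisonApp_π, Category.assoc, stalkComparison_inv_hom,
    Category.comp_id]

/-- On each factor of the product the multiplication is a counit, so the claim reduces to the
compatibility of the counits with the comparison of fibres. -/
theorem godementMonadComparisonApp_mul (F : Cᵒᵖ ⥤ A) :
    Functor.whiskerRight ((godementMonad A pts).μ.app F) U ≫ godementMonadComparisonApp U pts F =
      godementMonadComparisonApp U pts ((godementMonad A pts).obj F) ≫
        (godementMonad D pts).map (godementMonadComparisonApp U pts F) ≫
          (godementMonad D pts).μ.app (F ⋙ U) := by
  refine godementπ_ext pts fun i V s => ?_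
  have h1 : U.map (((godementMonad A pts).μ.app F).app (op V)) ≫ U.map (godementπ pts i s F) =
      U.map (godementπ pts i s _) ≫ U.map (godementCounit pts i F) :=
    (U.map_comp _ _).symm.trans ((congrArg U.map (godementMonad_μ_π pts F i V s)).trans
      (U.map_comp _ _))
  exact mul_comparison_chase (godementMonadComparisonApp_π U pts F i V s) h1
    (godementMonad_μ_π pts (F ⋙ U) i V s)
    (godementMonad_map_π pts (godementMonadComparisonApp U pts F) i V s)
    (godementMonadComparisonApp_π U pts _ i V s)
    (stalk_godementMonadComparisonApp_counit U pts F i) (stalkComparison_hom_inv U _ _)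
    (stalkComparison_inv_hom U _ _)

/-- The comparison of the Godement monads. -/
noncomputable def godementMonadComparison :
    MonadComparison (godementMonad A pts) (godementMonad D pts)
      ((Functor.whiskeringRight _ _ _).obj U) where
  iso := NatIso.ofComponents (fun F => asIso (godementMonadComparisonApp U pts F))
    (godementMonadComparisonApp_naturality U pts)
  unit := godementMonadComparisonApp_unit U pts
  mul := godementMonadComparisonApp_mul U pts

end GodementComparison

section Chase
variable {B : Type*} [Category* B] {X₀ X₁ X₂ X₃ Y₁ Y₂ Y₃ Z₁ Z₂ : B}

theorem simple_comparison_chase {a : X₁ ⟶ X₂} {b : Y₁ ⟶ Y₂} {c : Z₁ ⟶ Z₂} {σ₁ : X₁ ⟶ Y₁}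
    {σ₂ : X₂ ⟶ Y₂} {τ₁ : Y₁ ⟶ Z₁} {τ₂ : Y₂ ⟶ Z₂} (h : a ≫ σ₂ = σ₁ ≫ b) (h' : b ≫ τ₂ = τ₁ ≫ c) :
    a ≫ σ₂ ≫ τ₂ = (σ₁ ≫ τ₁) ≫ c := by
  rw [reassoc_of% h, h', Category.assoc]

theorem unit_simple_comparison_chase {f : X₁ ⟶ X₃} {l : X₁ ⟶ X₂} {m : X₂ ⟶ X₃} {σ₂ : X₂ ⟶ Y₂}
    {σ₃ : X₃ ⟶ Y₃} {b : Y₂ ⟶ Y₃} {g : Y₃ ⟶ Z₂} {k : Y₂ ⟶ Z₁} {n : Z₁ ⟶ Z₂} {l' : X₁ ⟶ Z₁}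
    (h₁ : f = l ≫ m) (h₂ : m ≫ σ₃ = σ₂ ≫ b) (h₃ : l ≫ σ₂ ≫ k = l') (h₄ : b ≫ g = k ≫ n) :
    f ≫ σ₃ ≫ g = l' ≫ n := by
  rw [h₁, Category.assoc, reassoc_of% h₂, h₄, reassoc_of% h₃]

end Chase

section HyperComparison
variable {C : Type w} [SmallCategory C] {J : GrothendieckTopology C}
  {D : Type u} [Category.{v} D] [HasFilteredColimitsOfSize.{w, w} D]
  {A : Type u₁} [Category.{v₁} A] [HasFilteredColimitsOfSize.{w, w} A]
  {U : A ⥤ D} [PreservesFilteredColimitsOfSize.{w, w} U] [HasProducts.{w} D] [HasProducts.{w} A]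
  [∀ I : Type w, PreservesLimitsOfShape (Discrete I) U] {ι : Type w}
  (pts : ι → GrothendieckTopology.Point.{w} J) {𝔰' : DescentStructure A} {𝔰 : DescentStructure D}
  (σ : 𝔰'.simple ⋙ U ≅ (Functor.whiskeringRight SimplexCategory _ _).obj U ⋙ 𝔰.simple)

/-- The comparison of the Godement resolutions at an object of the site. -/
noncomputable def godementComparison (U : A ⥤ D) [PreservesFilteredColimitsOfSize.{w, w} U]
    [∀ I : Type w, PreservesLimitsOfShape (Discrete I) U] (F : Cᵒᵖ ⥤ A) (V : Cᵒᵖ) :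
    ((godement A pts).obj F).flip.obj V ⋙ U ⟶ ((godement D pts).obj (F ⋙ U)).flip.obj V where
  app n := (((godementMonadComparison U pts).cobarMap F).app n).app V
  naturality _ _ f := congrArg (fun t => t.app V)
    (((godementMonadComparison U pts).cobarMap F).naturality f)

instance isIso_godementComparison (F : Cᵒᵖ ⥤ A) (V : Cᵒᵖ) :
    IsIso (godementComparison pts U F V) := by
  have : ∀ n, IsIso ((godementComparison pts U F V).app n) := fun n =>
    inferInstanceAs (IsIso ((((godementMonadComparison U pts).cobarMap F).app n).app V))
  exact NatIso.isIso_of_isIso_app _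

/-- The comparison of hypercohomology along a functor. -/
noncomputable def hyperComparison (F : Cᵒᵖ ⥤ A) :
    (hyperFunctor 𝔰' pts).obj F ⋙ U ⟶ (hyperFunctor 𝔰 pts).obj (F ⋙ U) where
  app V := σ.hom.app (((godement A pts).obj F).flip.obj V) ≫
    𝔰.simple.map (godementComparison pts U F V)
  naturality V W f := by
    have h : Functor.whiskerRight (((godement A pts).obj F).flip.map f) U ≫
        godementComparison pts U F W = godementComparison pts U F V ≫
          ((godement D pts).obj (F ⋙ U)).flip.map f :=
      NatTrans.ext (funext fun n =>
        (((godementMonadComparison U pts).cobarMap F).app n).naturality f)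
    exact simple_comparison_chase (σ.hom.naturality (((godement A pts).obj F).flip.map f))
      ((𝔰.simple.map_comp _ _).symm.trans ((congrArg 𝔰.simple.map h).trans
        (𝔰.simple.map_comp _ _)))

instance isIso_hyperComparison (F : Cᵒᵖ ⥤ A) : IsIso (hyperComparison pts σ F) := by
  have : ∀ V, IsIso ((hyperComparison pts σ F).app V) := fun V =>
    inferInstanceAs (IsIso (σ.hom.app (((godement A pts).obj F).flip.obj V) ≫
      𝔰.simple.map (godementComparison pts U F V)))
  exact NatIso.isIso_of_isIso_app _

/-- ρ is made of λ, which σ respects by hypothesis, and of the coaugmentation, which the comparison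
of the resolutions respects. -/
theorem hyperUnit_hyperComparison (hl : ∀ X, U.map (𝔰'.lam.app X) ≫
      σ.hom.app ((Functor.const SimplexCategory).obj X) ≫
        𝔰.simple.map (constComparison U X) = 𝔰.lam.app (U.obj X)) (F : Cᵒᵖ ⥤ A) :
    Functor.whiskerRight ((hyperUnit 𝔰' pts).app F) U ≫ hyperComparison pts σ F =
      (hyperUnit 𝔰 pts).app (F ⋙ U) := by
  refine NatTrans.ext (funext fun V => ?_)
  have h : Functor.whiskerRight ((functorAugmentation pts (𝟭 _) F).app V) U ≫
      godementComparison pts U F V =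
      constComparison U (F.obj V) ≫ (functorAugmentation pts (𝟭 _) (F ⋙ U)).app V :=
    NatTrans.ext (funext fun n => (congrArg (fun t => t.app V)
      ((godementMonadComparison U pts).cobarMap_augmentation F n)).trans (Category.id_comp _).symm)
  exact unit_simple_comparison_chase (U.map_comp _ _) (σ.hom.naturality _) (hl (F.obj V))
      ((𝔰.simple.map_comp _ _).symm.trans ((congrArg 𝔰.simple.map h).trans
        (𝔰.simple.map_comp _ _)))

end HyperComparison

/-! ### Compatibility through a family of forgetful functors. -/

section Compatible
variable {C : Type w} [SmallCategory C] {J : GrothendieckTopology C}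
  {D : Type u} [Category.{v} D] {A : Type u₁} [Category.{v₁} A] {κ : Type}
  {U : κ → A ⥤ D} {ι : Type w}
  {pts : ι → GrothendieckTopology.Point.{w} J} {𝔰' : DescentStructure A} {𝔰 : DescentStructure D}

/-- Compatibility with a site is inherited through a family of forgetful functors. -/
theorem DescentLift.compatible (L : DescentLift.{w} 𝔰' 𝔰 U) (hU : ForgetfulFamily.{w} U)
    (c : Compatible J pts 𝔰) : Compatible J pts 𝔰' := by
  have := c.hasFilteredColimits
  have := c.hasProducts
  have := hU.hasFilteredColimits
  have := hU.hasProducts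
  have := hU.preservesFilteredColimits
  have := hU.preservesProducts
  have hE := c.exactEquivalences
  have hE' : ExactEquivalences.{w} 𝔰' :=
    { colimits := fun {K} _ _ {X Y} f _ hf => by
        refine (L.E_iff _).2 fun k => ?_
        have := PreservesFilteredColimitsOfSize.preserves_filtered_colimits (F := U k) K
        have := HasFilteredColimitsOfSize.HasColimitsOfShape (C := D) K
        have h := hE.colimits (Functor.whiskerRight f (U k)) fun n => (L.E_iff _).1 (hf n) k
        refine (𝔰.E_congr (colimit.post X (U k)) (colimit.post Y (U k)) ?_).1 h
        refine colimit.hom_ext fun n => ?_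
        rw [ι_colimMap_assoc, colimit.ι_post, colimit.ι_post_assoc, ← Functor.map_comp, ι_colimMap,
          Functor.map_comp]
        rfl
      products := fun {K X Y} f hf => by
        refine (L.E_iff _).2 fun k => ?_
        have h := hE.products (fun n => (U k).map (f n)) fun n => (L.E_iff _).1 (hf n) k
        refine (𝔰.E_congr (piComparison (U k) X) (piComparison (U k) Y) ?_).2 h
        refine Pi.hom_ext _ _ fun n => ?_
        rw [Category.assoc, piComparison_comp_π, ← Functor.map_comp, Pi.map_π, Functor.map_comp,
          Category.assoc, Pi.map_π, piComparison_comp_π_assoc] }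
  have hglobal {F G : Cᵒᵖ ⥤ A} (f : F ⟶ G)
      (h : ∀ k, globalPresheafEquivalences 𝔰 (Functor.whiskerRight f (U k))) :
      globalPresheafEquivalences 𝔰' f := fun V => (L.E_iff _).2 fun k => h k V
  have hlocal {F G : Cᵒᵖ ⥤ A} (f : F ⟶ G)
      (h : ∀ k, localPresheafEquivalences 𝔰 pts (Functor.whiskerRight f (U k))) :
      localPresheafEquivalences 𝔰' pts f := fun i => (L.E_iff _).2 fun k =>
    (𝔰.E_congr _ _ (stalkComparison_naturality (U k) (pts i) f)).1 (h k i)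
  have hiso {F G : Cᵒᵖ ⥤ D} (f : F ⟶ G) [IsIso f] : globalPresheafEquivalences 𝔰 f :=
    fun V => 𝔰.E_of_isIso _
  have hρ (k : κ) (F : Cᵒᵖ ⥤ A) :=
    hyperUnit_hyperComparison pts (L.simpleIso k) (L.lam k) F
  refine Compatible.of_hyperUnit c.enoughPoints hE' (fun F => ?_) (fun F => ?_) fun F => ?_
  -- The sheaf condition asks that certain cones be limit cones, which the functors `U k` detect
  -- jointly. The underlying presheaves are isomorphic to ℍ(F ⋙ U k), hence sheaves.
  · rw [Presheaf.isSheaf_iff_isLimit]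
    intro X S hS
    refine hU.isLimit _ fun k => ?_
    have h : Presheaf.IsSheaf J ((hyperFunctor 𝔰' pts).obj F ⋙ U k) :=
      (Presheaf.isSheaf_of_iso_iff (asIso (hyperComparison pts (L.simpleIso k) F))).2
        (c.isSheaf (F ⋙ U k))
    rw [Presheaf.isSheaf_iff_isLimit] at h
    exact h S hS
  -- Nothing ensures that `F ⋙ U k` is a sheaf, so the extension of compatibility to presheaves is
  -- essential here.
  · refine hlocal _ fun k => local_of_comp_right
      (hE.local_of_global pts (hiso (hyperComparison pts (L.simpleIso k) F))) ?_
    exact of_eq_of_property (hρ k F).symm (c.local_hyperUnit (F ⋙ U k))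
  · refine hglobal _ fun k => global_of_comp_right
      (hiso (hyperComparison pts (L.simpleIso k) _)) ?_
    refine of_eq_of_property (hρ k _).symm ?_
    -- ρ is wanted at the presheaf underlying ℍF, while compatibility gives it at ℍ(F ⋙ U k). The
    -- two are isomorphic by ζ, and naturality of ρ moves from one to the other.
    let ζ := hyperComparison pts (L.simpleIso k) F
    have h := (hyperUnit 𝔰 pts).naturality ζ
    have hz : IsIso ((hyperFunctor 𝔰 pts).map ζ) := inferInstance
    refine global_of_comp_right (hiso ((hyperFunctor 𝔰 pts).map ζ)) (of_eq_of_property h ?_)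
    exact global_comp (hiso ζ) (c.global_hyperUnit (F ⋙ U k))

end Compatible

/-! ### Künneth morphisms and the coherence maps of iterated tensor products. -/

section Lax
variable {A : Type u₁} [Category.{v₁} A] [MonoidalCategory A]
  {B : Type u₂} [Category.{v₂} B] [MonoidalCategory B] (F : A ⥤ B) [F.LaxMonoidal]

open Functor.LaxMonoidal

/-- The inductive step for the compatibility of Künneth morphisms with maps of tensor products over
a list: one more factor only involves the naturality of `μ F`. -/
theorem lax_tensorHom_step {X Y S T : A} {P Q : B} (f : X ⟶ Y) {g : P ⟶ Q} {k : P ⟶ F.obj S}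
    {k' : Q ⟶ F.obj T} {g' : S ⟶ T} (h : g ≫ k' = k ≫ F.map g') :
    (F.map f ⊗ₘ g) ≫ (F.obj Y ◁ k') ≫ μ F Y T = ((F.obj X ◁ k) ≫ μ F X S) ≫ F.map (f ⊗ₘ g') := by
  rw [Category.assoc, ← μ_natural, ← id_tensorHom, ← id_tensorHom, tensorHom_comp_tensorHom_assoc,
    tensorHom_comp_tensorHom_assoc, h, Category.comp_id, Category.id_comp]

theorem lax_whiskerLeft_step (X : A) {S T : A} {P Q : B} {g : P ⟶ Q} {k : P ⟶ F.obj S}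
    {k' : Q ⟶ F.obj T} {g' : S ⟶ T} (h : g ≫ k' = k ≫ F.map g') :
    (F.obj X ◁ g) ≫ (F.obj X ◁ k') ≫ μ F X T = ((F.obj X ◁ k) ≫ μ F X S) ≫ F.map (X ◁ g') := by
  rw [Category.assoc, ← μ_natural_right, ← whiskerLeft_comp_assoc, ← whiskerLeft_comp_assoc, h]

theorem tensorListLax_naturality {ι : Type w} {X Y : ι → A} (f : ∀ i, X i ⟶ Y i) : (L : List ι) →
    tensorListMap (fun i => F.map (f i)) L ≫ tensorListLax F Y L =
      tensorListLax F X L ≫ F.map (tensorListMap f L)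
  | [] => (Category.id_comp _).trans ((congrArg (fun t => ε F ≫ t) (F.map_id _)).trans
      (Category.comp_id _)).symm
  | a :: L => lax_tensorHom_step F (f a) (tensorListLax_naturality f L)

theorem tensorListOfMap_lax {ι κ : Type w} (e : κ → ι) (X : ι → A) : (L : List κ) →
    tensorListOfMap e (fun i => F.obj (X i)) L ≫ tensorListLax F (fun k => X (e k)) L =
      tensorListLax F X (L.map e) ≫ F.map (tensorListOfMap e X L)
  | [] => (Category.id_comp _).trans ((congrArg (fun t => ε F ≫ t) (F.map_id _)).trans
      (Category.comp_id _)).symm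
  | a :: L => lax_whiskerLeft_step F (X (e a)) (tensorListOfMap_lax e X L)

theorem tensorListToMap_lax {ι κ : Type w} (e : κ → ι) (X : ι → A) : (L : List κ) →
    tensorListToMap e (fun i => F.obj (X i)) L ≫ tensorListLax F X (L.map e) =
      tensorListLax F (fun k => X (e k)) L ≫ F.map (tensorListToMap e X L)
  | [] => (Category.id_comp _).trans ((congrArg (fun t => ε F ≫ t) (F.map_id _)).trans
      (Category.comp_id _)).symm
  | a :: L => lax_whiskerLeft_step F (X (e a)) (tensorListToMap_lax e X L)

theorem lax_append_nil {T : A} {P : B} (k : P ⟶ F.obj T) :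
    (ε F ⊗ₘ k) ≫ μ F (𝟙_ A) T ≫ F.map (λ_ T).hom = (λ_ P).hom ≫ k := by
  rw [tensorHom_def', Category.assoc, ← left_unitality, leftUnitor_naturality]

/-- This is the associativity of `μ F`, together with the compatibility already known for the
shorter list. It serves again for the associativity axiom of operads. -/
theorem lax_append_cons {X S T R : A} {P Q P' : B} {k : P ⟶ F.obj S} {m : Q ⟶ F.obj T}
    {a : S ⊗ T ⟶ R} {a' : P ⊗ Q ⟶ P'} {k' : P' ⟶ F.obj R}
    (h : (k ⊗ₘ m) ≫ μ F S T ≫ F.map a = a' ≫ k') :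
    (((F.obj X ◁ k) ≫ μ F X S) ⊗ₘ m) ≫ μ F (X ⊗ S) T ≫ F.map ((α_ X S T).hom ≫ (X ◁ a)) =
      ((α_ (F.obj X) P Q).hom ≫ (F.obj X ◁ a')) ≫ (F.obj X ◁ k') ≫ μ F X R := by
  have e : ((F.obj X ◁ k) ≫ μ F X S) ⊗ₘ m =
      ((F.obj X ◁ k) ⊗ₘ m) ≫ (μ F X S ▷ F.obj T) := by
    rw [← tensorHom_id, tensorHom_comp_tensorHom, Category.comp_id]
  rw [e, F.map_comp, Category.assoc, associativity_assoc, Category.assoc, ← whiskerLeft_comp_assoc,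
    ← h, ← μ_natural_right, whiskerLeft_comp, whiskerLeft_comp, Category.assoc, Category.assoc,
    ← id_tensorHom, associator_naturality_assoc, id_tensorHom]

theorem tensorListAppend_lax {ι : Type w} (X : ι → A) (M : List ι) : (L : List ι) →
    (tensorListLax F X L ⊗ₘ tensorListLax F X M) ≫ μ F _ _ ≫ F.map (tensorListAppend X M L) =
      tensorListAppend (fun i => F.obj (X i)) M L ≫ tensorListLax F X (L ++ M)
  | [] => lax_append_nil F _
  | _ :: L => lax_append_cons F (tensorListAppend_lax X M L)

theorem lax_join_cons {S T T' R : A} {P Q Q' R' P' : B} {k : P ⟶ F.obj S} {m : Q ⟶ Q'}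
    {n : Q' ⟶ F.obj T} {j : T ⟶ T'} {a : S ⊗ T' ⟶ R} {j' : Q ⟶ R'} {a' : P ⊗ R' ⟶ P'}
    {k₂ : R' ⟶ F.obj T'} {K : P' ⟶ F.obj R}
    (h : m ≫ n ≫ F.map j = j' ≫ k₂) (h' : (k ⊗ₘ k₂) ≫ μ F S T' ≫ F.map a = a' ≫ K) :
    (k ⊗ₘ m) ≫ ((F.obj S ◁ n) ≫ μ F S T) ≫ F.map ((S ◁ j) ≫ a) =
      ((P ◁ j') ≫ a') ≫ K := by
  rw [Category.assoc, Category.assoc, ← h', F.map_comp, ← μ_natural_right_assoc, ← id_tensorHom,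
    ← id_tensorHom, ← id_tensorHom, tensorHom_comp_tensorHom_assoc, tensorHom_comp_tensorHom_assoc,
    tensorHom_comp_tensorHom_assoc, ← h, Category.comp_id, Category.comp_id, Category.id_comp,
    Category.assoc]

theorem tensorListJoin_lax {ι κ : Type w} (X : κ → A) (f : ι → List κ) : (L : List ι) →
    tensorListMap (fun i => tensorListLax F X (f i)) L ≫
        tensorListLax F (fun i => tensorList X (f i)) L ≫ F.map (tensorListJoin X f L) =
      tensorListJoin (fun k => F.obj (X k)) f L ≫ tensorListLax F X (L.flatMap f)
  | [] => congrArg (fun t => 𝟙 (𝟙_ B) ≫ t) ((congrArg (fun t => ε F ≫ t) (F.map_id _)).trans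
      (Category.comp_id _))
  | a :: L => lax_join_cons F (tensorListJoin_lax X f L) (tensorListAppend_lax F X _ (f a))

/-- A unit map for one more factor: by unitality, two copies of `ε F` are multiplied into a single
one. -/
theorem lax_unit_cons {X S : A} {P : B} {x : 𝟙_ A ⟶ X} {s : 𝟙_ A ⟶ S} {s' : 𝟙_ B ⟶ P}
    {k : P ⟶ F.obj S} (h : s' ≫ k = ε F ≫ F.map s) :
    ((λ_ (𝟙_ B)).inv ≫ ((ε F ≫ F.map x) ⊗ₘ s')) ≫ (F.obj X ◁ k) ≫ μ F X S =
      ε F ≫ F.map ((λ_ (𝟙_ A)).inv ≫ (x ⊗ₘ s)) := by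
  have e : (λ_ (F.obj (𝟙_ A))).inv ≫ ε F ▷ F.obj (𝟙_ A) ≫ μ F (𝟙_ A) (𝟙_ A) =
      F.map (λ_ (𝟙_ A)).inv := left_unitality_inv F (𝟙_ A)
  have e' : (λ_ (𝟙_ B)).inv ≫ (ε F ⊗ₘ ε F) ≫ μ F (𝟙_ A) (𝟙_ A) =
      ε F ≫ F.map (λ_ (𝟙_ A)).inv := by
    rw [← e, tensorHom_def', Category.assoc, leftUnitor_inv_naturality_assoc]
  rw [F.map_comp, ← reassoc_of% e', ← μ_natural, ← id_tensorHom, Category.assoc,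
    tensorHom_comp_tensorHom_assoc, h, Category.comp_id, tensorHom_comp_tensorHom_assoc]

theorem tensorListUnit_lax {ι : Type w} (X : ι → A) (x : ∀ i, 𝟙_ A ⟶ X i) : (L : List ι) →
    tensorListUnit (fun i => F.obj (X i)) (fun i => ε F ≫ F.map (x i)) L ≫ tensorListLax F X L =
      ε F ≫ F.map (tensorListUnit X x L)
  | [] => (Category.id_comp _).trans ((congrArg (fun t => ε F ≫ t) (F.map_id _)).trans
      (Category.comp_id _)).symm
  | _ :: L => lax_unit_cons F (tensorListUnit_lax X x L)

end Lax

section LaxBraided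
variable {A : Type u₁} [Category.{v₁} A] [MonoidalCategory A] [BraidedCategory A]
  {B : Type u₂} [Category.{v₂} B] [MonoidalCategory B] [BraidedCategory B] (F : A ⥤ B)
  [F.LaxBraided]

open Functor.LaxMonoidal

/-- Removing an element of a list yields the expected list only up to a propositional equality, so
the symmetries contain transports which the Künneth morphisms have to pass. -/
theorem tensorListLax_eqToHom {ι : Type w} (X : ι → A) (a : ι) {L M : List ι} (h : L = M)
    (h₁ : X a ⊗ tensorList X L = X a ⊗ tensorList X M)
    (h₂ : F.obj (X a) ⊗ tensorList (fun i => F.obj (X i)) L =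
      F.obj (X a) ⊗ tensorList (fun i => F.obj (X i)) M) :
    ((F.obj (X a) ◁ tensorListLax F X L) ≫ μ F _ _) ≫ F.map (eqToHom h₁) =
      eqToHom h₂ ≫ (F.obj (X a) ◁ tensorListLax F X M) ≫ μ F _ _ := by
  subst h
  rw [eqToHom_refl, eqToHom_refl, CategoryTheory.Functor.map_id, Category.comp_id, Category.id_comp]

/-- Pulling `X` in front of one more factor `Y` uses the compatibility of `F` with the braiding; the
associativity of `μ F` is used before and after it. -/
theorem lax_pull_cons {X Y S T : A} {P Q : B} {k : P ⟶ F.obj S} {p : S ⟶ X ⊗ T}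
    {p' : P ⟶ F.obj X ⊗ Q} {k' : Q ⟶ F.obj T} (h : k ≫ F.map p = p' ≫ (F.obj X ◁ k') ≫ μ F X T) :
    ((F.obj Y ◁ k) ≫ μ F Y S) ≫
        F.map ((Y ◁ p) ≫ (α_ Y X T).inv ≫ ((β_ Y X).hom ▷ T) ≫ (α_ X Y T).hom) =
      ((F.obj Y ◁ p') ≫ (α_ _ _ Q).inv ≫ ((β_ (F.obj Y) (F.obj X)).hom ▷ Q) ≫ (α_ _ _ Q).hom) ≫
        (F.obj X ◁ ((F.obj Y ◁ k') ≫ μ F Y T)) ≫ μ F X (Y ⊗ T) := by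
  simp only [Functor.map_comp, Category.assoc]
  rw [← μ_natural_right_assoc, ← whiskerLeft_comp_assoc, h]
  simp only [whiskerLeft_comp, Category.assoc]
  rw [whiskerLeft_μ_comp_μ_assoc, Iso.map_hom_inv_id_assoc, ← μ_natural_left_assoc,
    ← comp_whiskerRight_assoc, Functor.LaxBraided.braided, comp_whiskerRight_assoc, associativity,
    associator_inv_naturality_right_assoc, whisker_exchange_assoc,
    associator_naturality_right_assoc]

theorem map_comp_comp_chase {X₁ X₂ X₃ X₄ X₅ X₆ : A} {Y₁ Y₂ Y₃ Y₄ Y₅ Y₆ : B} {k : Y₁ ⟶ F.obj X₁}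
    {m : Y₅ ⟶ F.obj X₅} {m' : Y₆ ⟶ F.obj X₆} {a : X₁ ⟶ X₂} {b : X₂ ⟶ X₃} {c : X₃ ⟶ X₄}
    {d : X₄ ⟶ X₅} {e : X₅ ⟶ X₆} {a' : Y₁ ⟶ Y₂} {b' : Y₂ ⟶ Y₃} {c' : Y₃ ⟶ Y₄}
    {d' : Y₄ ⟶ Y₅} {e' : Y₅ ⟶ Y₆} (h : k ≫ F.map (a ≫ b ≫ c ≫ d) = (a' ≫ b' ≫ c' ≫ d') ≫ m)
    (h' : m ≫ F.map e = e' ≫ m') :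
    k ≫ F.map (a ≫ b ≫ c ≫ d ≫ e) = (a' ≫ b' ≫ c' ≫ d' ≫ e') ≫ m' := by
  have := congrArg (fun t => t ≫ F.map e) h
  simpa only [Category.assoc, h', Functor.map_comp] using this

theorem tensorListPull_lax {ι : Type w} [DecidableEq ι] (X : ι → A) (a : ι) :
    (L : List ι) → (h : a ∈ L) →
    tensorListLax F X L ≫ F.map (tensorListPull X a L h) =
      tensorListPull (fun i => F.obj (X i)) a L h ≫
        (F.obj (X a) ◁ tensorListLax F X (L.erase a)) ≫ μ F _ _
  | [], h => absurd h List.not_mem_nil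
  | b :: L, h => by
    by_cases e : b = a
    · subst e
      rw [tensorListPull, tensorListPull, dif_pos rfl, dif_pos rfl]
      exact tensorListLax_eqToHom F X b (List.erase_cons_head b L).symm _ _
    · rw [tensorListPull, tensorListPull, dif_neg e, dif_neg e]
      exact map_comp_comp_chase F (lax_pull_cons F (Y := X b) (tensorListPull_lax X a L
        ((List.mem_cons.1 h).resolve_left (Ne.symm e)))) (tensorListLax_eqToHom F X a
          (L := b :: L.erase a) (List.erase_cons_tail (by simpa using e)).symm _ _)

theorem lax_reorder_cons {X S S' T : A} {P Q Q' : B} {k : P ⟶ F.obj T} {p : T ⟶ X ⊗ S}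
    {p' : P ⟶ F.obj X ⊗ Q} {k' : Q ⟶ F.obj S} {r : S ⟶ S'} {r' : Q ⟶ Q'} {k₂ : Q' ⟶ F.obj S'}
    (h : k ≫ F.map p = p' ≫ (F.obj X ◁ k') ≫ μ F X S) (h' : k' ≫ F.map r = r' ≫ k₂) :
    k ≫ F.map (p ≫ (X ◁ r)) = (p' ≫ (F.obj X ◁ r')) ≫ (F.obj X ◁ k₂) ≫ μ F X S' := by
  rw [F.map_comp, reassoc_of% h, ← μ_natural_right, ← whiskerLeft_comp_assoc, h', Category.assoc,
    whiskerLeft_comp_assoc]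

theorem tensorListReorder_lax {ι : Type w} [DecidableEq ι] (X : ι → A) :
    (L' L : List ι) → (h : L.Perm L') →
    tensorListLax F X L ≫ F.map (tensorListReorder X L' L h) =
      tensorListReorder (fun i => F.obj (X i)) L' L h ≫ tensorListLax F X L'
  | [], L, h => by
    obtain rfl := h.eq_nil
    rw [tensorListReorder, tensorListReorder, eqToHom_refl, eqToHom_refl,
      CategoryTheory.Functor.map_id, Category.comp_id, Category.id_comp]
  | a :: L', L, h => lax_reorder_cons F (tensorListPull_lax F X a L _)
      (tensorListReorder_lax X L' (L.erase a) _)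

/-- The interchange of the two middle factors commutes with `μ F`, because `F` is lax braided; the
remaining factors are handled by induction. -/
theorem lax_shuffle_cons {X S Y T R : A} {P Q P' P'' : B} {k : P ⟶ F.obj S} {m : Q ⟶ F.obj T}
    {s : S ⊗ T ⟶ R} {s' : P ⊗ Q ⟶ P'} {t : P' ⟶ P''} {K : P'' ⟶ F.obj R}
    (h : (k ⊗ₘ m) ≫ μ F S T ≫ F.map s = s' ≫ t ≫ K) :
    (((F.obj X ◁ k) ≫ μ F X S) ⊗ₘ ((F.obj Y ◁ m) ≫ μ F Y T)) ≫ μ F (X ⊗ S) (Y ⊗ T) ≫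
        F.map (tensorμ X S Y T ≫ ((X ⊗ Y) ◁ s)) =
      (tensorμ (F.obj X) P (F.obj Y) Q ≫ ((F.obj X ⊗ F.obj Y) ◁ s')) ≫
        (μ F X Y ⊗ₘ t) ≫ (F.obj (X ⊗ Y) ◁ K) ≫ μ F (X ⊗ Y) R := by
  have e := tensorμ_comp_μ_tensorHom_μ_comp_μ F X S Y T
  have n := tensorμ_natural (𝟙 (F.obj X)) k (𝟙 (F.obj Y)) m
  rw [F.map_comp, ← tensorHom_comp_tensorHom_assoc, ← reassoc_of% e, ← id_tensorHom, ← id_tensorHom,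
    reassoc_of% n, ← μ_natural_right, Category.assoc, ← id_tensorHom, ← id_tensorHom,
    ← id_tensorHom, tensorHom_comp_tensorHom_assoc, tensorHom_comp_tensorHom_assoc,
    tensorHom_comp_tensorHom_assoc, tensorHom_comp_tensorHom_assoc]
  simp only [Category.comp_id, Category.id_comp, id_tensorHom_id, Category.assoc, h]

theorem tensorListShuffle_lax {ι : Type w} (X Y : ι → A) : (L : List ι) →
    (tensorListLax F X L ⊗ₘ tensorListLax F Y L) ≫ μ F _ _ ≫ F.map (tensorListShuffle X Y L) =
      tensorListShuffle (fun i => F.obj (X i)) (fun i => F.obj (Y i)) L ≫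
        tensorListMap (fun i => μ F (X i) (Y i)) L ≫ tensorListLax F (fun i => X i ⊗ Y i) L
  | [] => (lax_append_nil F (ε F)).trans (congrArg (fun t => (λ_ (𝟙_ B)).hom ≫ t)
      (Category.id_comp (ε F)).symm)
  | a :: L => lax_shuffle_cons F (X := X a) (Y := Y a) (tensorListShuffle_lax X Y L)

theorem tensorListShuffle_naturality {ι : Type w} {X Y X' Y' : ι → A} (f : ∀ i, X i ⟶ X' i)
    (g : ∀ i, Y i ⟶ Y' i) : (L : List ι) →
    (tensorListMap f L ⊗ₘ tensorListMap g L) ≫ tensorListShuffle X' Y' L =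
      tensorListShuffle X Y L ≫ tensorListMap (fun i => f i ⊗ₘ g i) L
  | [] => by
    change (𝟙 (𝟙_ A) ⊗ₘ 𝟙 (𝟙_ A)) ≫ (λ_ (𝟙_ A)).hom = (λ_ (𝟙_ A)).hom ≫ 𝟙 _
    rw [id_tensorHom_id, Category.id_comp, Category.comp_id]
  | a :: L => by
    have ih := tensorListShuffle_naturality f g L
    have key {P Q P' Q' R R' S S' T T' : A} (x : P ⟶ P') (y : Q ⟶ Q') {s : R ⟶ R'} {t : S ⟶ S'}
        {z : T ⟶ T'} {c : R ⊗ S ⟶ T} {c' : R' ⊗ S' ⟶ T'} (h : (s ⊗ₘ t) ≫ c' = c ≫ z) :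
        ((x ⊗ₘ s) ⊗ₘ (y ⊗ₘ t)) ≫ tensorμ P' R' Q' S' ≫ ((P' ⊗ Q') ◁ c') =
          (tensorμ P R Q S ≫ ((P ⊗ Q) ◁ c)) ≫ ((x ⊗ₘ y) ⊗ₘ z) := by
      have n := tensorμ_natural x s y t
      rw [reassoc_of% n, ← id_tensorHom, ← id_tensorHom, tensorHom_comp_tensorHom, h,
        Category.assoc, tensorHom_comp_tensorHom, Category.comp_id, Category.id_comp]
    exact key (f a) (g a) ih

theorem map_comp_chase {X₁ X₂ X₃ : A} {Y₁ Y₂ Y₃ : B} {k : Y₁ ⟶ F.obj X₁} {m : Y₂ ⟶ F.obj X₂}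
    {n : Y₃ ⟶ F.obj X₃} {a : X₁ ⟶ X₂} {b : X₂ ⟶ X₃} {a' : Y₁ ⟶ Y₂} {b' : Y₂ ⟶ Y₃}
    (h : k ≫ F.map a = a' ≫ m) (h' : m ≫ F.map b = b' ≫ n) :
    k ≫ F.map (a ≫ b) = (a' ≫ b') ≫ n := by
  rw [F.map_comp, reassoc_of% h, h', Category.assoc]

theorem flatten_chase {X₁ X₂ X₃ X₄ X₅ : A} {Y₀ Y₁ Y₁' Y₂ Y₃ Y₄ Y₅ : B} {k : Y₀ ⟶ Y₁}
    {k₁ : Y₁ ⟶ F.obj X₁} {a : X₁ ⟶ X₂} {b : X₂ ⟶ X₃} {c : X₃ ⟶ X₄} {d : X₄ ⟶ X₅} {a₁ : Y₁ ⟶ Y₂}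
    {a' : Y₀ ⟶ Y₁'} {k' : Y₁' ⟶ Y₂} {k₂ : Y₂ ⟶ F.obj X₂} {b' : Y₁' ⟶ Y₃} {k₃ : Y₃ ⟶ F.obj X₃}
    {c' : Y₃ ⟶ Y₄} {k₄ : Y₄ ⟶ F.obj X₄} {d' : Y₄ ⟶ Y₅} {k₅ : Y₅ ⟶ F.obj X₅}
    (h₀ : k ≫ a₁ = a' ≫ k') (h₁ : k₁ ≫ F.map a = a₁ ≫ k₂) (h₂ : k' ≫ k₂ ≫ F.map b = b' ≫ k₃)
    (h₃ : k₃ ≫ F.map c = c' ≫ k₄) (h₄ : k₄ ≫ F.map d = d' ≫ k₅) :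
    k ≫ k₁ ≫ F.map (a ≫ b ≫ c ≫ d) = (a' ≫ b' ≫ c' ≫ d') ≫ k₅ := by
  simp only [Functor.map_comp, Category.assoc]
  rw [reassoc_of% h₁, reassoc_of% h₀, reassoc_of% h₂, reassoc_of% h₃, h₄]

theorem tensorFinPerm_lax {l m : ℕ} (σ : Fin l ≃ Fin m) (X : Fin m → A) :
    tensorListLax F X (List.finRange m) ≫ F.map (tensorFinPerm σ X) =
      tensorFinPerm σ (fun i => F.obj (X i)) ≫
        tensorListLax F (fun i => X (σ i)) (List.finRange l) := by
  have h1 := tensorListReorder_lax F X _ _ (finRange_perm_map σ)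
  have h2 := tensorListOfMap_lax F σ X (List.finRange l)
  exact map_comp_chase F h1 h2.symm

theorem tensorFinFlatten_lax {l : ℕ} (m : Fin l → ℕ) (X : (Σ i, Fin (m i)) → A) :
    tensorFinMap (fun i => tensorListLax F (fun j => X ⟨i, j⟩) (List.finRange (m i))) ≫
        tensorListLax F (fun i => tensorFin fun j => X ⟨i, j⟩) (List.finRange l) ≫
        F.map (tensorFinFlatten m X) =
      tensorFinFlatten m (fun s => F.obj (X s)) ≫
        tensorListLax F (fun k => X (finSigmaFinEquiv.symm k)) (List.finRange (∑ i, m i)) := by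
  have h0 : tensorFinMap (fun i => tensorListLax F (fun j => X ⟨i, j⟩) (List.finRange (m i))) ≫
      tensorFinMap (fun i => F.map (tensorListToMap (Sigma.mk i) X (List.finRange (m i)))) =
      tensorFinMap (fun i => tensorListToMap (Sigma.mk i) (fun s => F.obj (X s))
        (List.finRange (m i))) ≫ tensorFinMap fun i => tensorListLax F X _ := by
    rw [← tensorFinMap_comp, ← tensorFinMap_comp]
    exact congrArg tensorFinMap (funext fun i => (tensorListToMap_lax F (Sigma.mk i) X _).symm)
  have h1 := tensorListLax_naturality F
    (fun i => tensorListToMap (Sigma.mk i) X (List.finRange (m i))) (List.finRange l)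
  have h2 := tensorListJoin_lax F X (fun i => (List.finRange (m i)).map (Sigma.mk i))
    (List.finRange l)
  have h3 := tensorListReorder_lax F X _ _ (flatMap_perm_map m)
  have h4 := tensorListOfMap_lax F (finSigmaFinEquiv (n := m)).symm X
    (List.finRange (∑ i, m i))
  exact flatten_chase F h0 h1.symm h2 h3 h4.symm

end LaxBraided

section Comp
variable {A : Type u₁} [Category.{v₁} A] [MonoidalCategory A]
  {B : Type u₂} [Category.{v₂} B] [MonoidalCategory B] {D : Type u} [Category.{v} D]
  [MonoidalCategory D]

open Functor.LaxMonoidal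

theorem lax_comp_step (F : A ⥤ B) [F.LaxMonoidal] (G : B ⥤ D) [G.LaxMonoidal] (Y : A) {P : A}
    {Q : B} {R : D} {k : Q ⟶ F.obj P} {m : R ⟶ G.obj Q} {n : R ⟶ G.obj (F.obj P)}
    (h : n = m ≫ G.map k) :
    (G.obj (F.obj Y) ◁ n) ≫ μ G (F.obj Y) (F.obj P) ≫ G.map (μ F Y P) =
      ((G.obj (F.obj Y) ◁ m) ≫ μ G (F.obj Y) Q) ≫ G.map ((F.obj Y ◁ k) ≫ μ F Y P) := by
  rw [h, G.map_comp, Category.assoc, whiskerLeft_comp, ← μ_natural_right_assoc, Category.assoc]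

theorem tensorListLax_comp (F : A ⥤ B) [F.LaxMonoidal] (G : B ⥤ D) [G.LaxMonoidal] {ι : Type w}
    (X : ι → A) : (L : List ι) →
    tensorListLax (F ⋙ G) X L =
      tensorListLax G (fun i => F.obj (X i)) L ≫ G.map (tensorListLax F X L)
  | [] => rfl
  | a :: L => lax_comp_step F G (X a) (tensorListLax_comp F G X L)

theorem monoidal_step {F G : A ⥤ B} [F.LaxMonoidal] [G.LaxMonoidal] (τ : F ⟶ G)
    [hτ : NatTrans.IsMonoidal τ] (Y : A) {P : A} {Q R : B} {k : Q ⟶ F.obj P} {m : R ⟶ G.obj P}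
    {n : Q ⟶ R} (h : n ≫ m = k ≫ τ.app P) :
    (τ.app Y ⊗ₘ n) ≫ (G.obj Y ◁ m) ≫ μ G Y P =
      ((F.obj Y ◁ k) ≫ μ F Y P) ≫ τ.app (Y ⊗ P) := by
  rw [Category.assoc, hτ.tensor, ← id_tensorHom, ← id_tensorHom, tensorHom_comp_tensorHom_assoc,
    tensorHom_comp_tensorHom_assoc, h, Category.comp_id, Category.id_comp]

theorem tensorListMap_monoidal {F G : A ⥤ B} [F.LaxMonoidal] [G.LaxMonoidal] (τ : F ⟶ G)
    [hτ : NatTrans.IsMonoidal τ] {ι : Type w} (X : ι → A) : (L : List ι) →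
    tensorListMap (fun i => τ.app (X i)) L ≫ tensorListLax G X L =
      tensorListLax F X L ≫ τ.app (tensorList X L)
  | [] => (Category.id_comp _).trans hτ.unit.symm
  | a :: L => monoidal_step τ (X a) (tensorListMap_monoidal τ X L)

theorem isIso_lax_step (F : A ⥤ B) [F.LaxMonoidal] {X Y : A} {P : B} {k : P ⟶ F.obj Y}
    (hk : IsIso k) (hμ : IsIso (μ F X Y)) : IsIso ((F.obj X ◁ k) ≫ μ F X Y) :=
  inferInstance

theorem isIso_tensorListLax (F : A ⥤ B) [F.LaxMonoidal] (hε : IsIso (ε F))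
    (hμ : ∀ X Y, IsIso (μ F X Y)) {ι : Type w} (X : ι → A) : (L : List ι) →
    IsIso (tensorListLax F X L)
  | [] => hε
  | _ :: L => isIso_lax_step F (isIso_tensorListLax F hε hμ X L) (hμ _ _)

theorem isIso_kunneth (F : A ⥤ B) [F.LaxMonoidal] (hε : IsIso (ε F))
    (hμ : ∀ X Y, IsIso (μ F X Y)) (X : A) {n : ℕ} (Y : Fin n → A) : IsIso (kunneth F X Y) :=
  isIso_lax_step F (isIso_tensorListLax F hε hμ Y _) (hμ _ _)

theorem kunneth_naturality (F : A ⥤ B) [F.LaxMonoidal] {X X' : A} (f : X ⟶ X') {n : ℕ}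
    {Y Y' : Fin n → A} (g : ∀ i, Y i ⟶ Y' i) :
    (F.map f ⊗ₘ tensorFinMap fun i => F.map (g i)) ≫ kunneth F X' Y' =
      kunneth F X Y ≫ F.map (f ⊗ₘ tensorFinMap g) :=
  lax_tensorHom_step F f (tensorListLax_naturality F g _)

theorem kunneth_comp (F : A ⥤ B) [F.LaxMonoidal] (G : B ⥤ D) [G.LaxMonoidal] (X : A) {n : ℕ}
    (Y : Fin n → A) : kunneth (F ⋙ G) X Y =
      kunneth G (F.obj X) (fun i => F.obj (Y i)) ≫ G.map (kunneth F X Y) :=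
  lax_comp_step F G X (tensorListLax_comp F G Y _)

theorem kunneth_monoidal {F G : A ⥤ B} [F.LaxMonoidal] [G.LaxMonoidal] (τ : F ⟶ G)
    [NatTrans.IsMonoidal τ] (X : A) {n : ℕ} (Y : Fin n → A) :
    (τ.app X ⊗ₘ tensorFinMap fun i => τ.app (Y i)) ≫ kunneth G X Y =
      kunneth F X Y ≫ τ.app (X ⊗ tensorFin Y) :=
  monoidal_step τ X (tensorListMap_monoidal τ Y _)

end Comp

theorem isIso_tensorListMap {B : Type u₂} [Category.{v₂} B] [MonoidalCategory B] {ι : Type w}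
    {X Y : ι → B} (f : ∀ i, X i ⟶ Y i) (hf : ∀ i, IsIso (f i)) : (L : List ι) →
    IsIso (tensorListMap f L)
  | [] => inferInstanceAs (IsIso (𝟙 _))
  | a :: L => by
    have := isIso_tensorListMap f hf L
    exact inferInstanceAs (IsIso (f a ⊗ₘ tensorListMap f L))

section Kunneth
variable {A : Type u₁} [Category.{v₁} A] [MonoidalCategory A] [BraidedCategory A]
  {B : Type u₂} [Category.{v₂} B] [MonoidalCategory B] [BraidedCategory B] (F : A ⥤ B)
  [F.LaxBraided]

open Functor.LaxMonoidal

theorem kunneth_perm {X X' : A} (f : X ⟶ X') {l m : ℕ} (σ : Fin l ≃ Fin m) (Y : Fin m → A) :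
    (F.map f ⊗ₘ tensorFinPerm σ fun j => F.obj (Y j)) ≫ kunneth F X' (fun i => Y (σ i)) =
      kunneth F X Y ≫ F.map (f ⊗ₘ tensorFinPerm σ Y) :=
  lax_tensorHom_step F f (tensorFinPerm_lax F σ Y).symm

theorem kunneth_whiskerLeft (X : A) {n : ℕ} {Y Y' : Fin n → A} (g : ∀ i, Y i ⟶ Y' i) :
    (F.obj X ◁ tensorFinMap fun i => F.map (g i)) ≫ kunneth F X Y' =
      kunneth F X Y ≫ F.map (X ◁ tensorFinMap g) :=
  lax_whiskerLeft_step F X (tensorListLax_naturality F g _)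

/-- The tensor product over `Fin 1` is `Y ⊗ 𝟙`, so the Künneth morphism contains an `ε F`, and right
unitality turns it with the inverse unitor of `F.obj Y` into the image of the inverse unitor of `Y`.
-/
theorem kunneth_unit_left {X : A} (x : 𝟙_ A ⟶ X) (Y : A) :
    ((ε F ≫ F.map x) ⊗ₘ (ρ_ (F.obj Y)).inv) ≫ kunneth F X (fun _ : Fin 1 => Y) =
      ((ε F ▷ F.obj Y) ≫ μ F (𝟙_ A) Y) ≫ F.map (x ⊗ₘ (ρ_ Y).inv) := by
  change _ ≫ (F.obj X ◁ ((F.obj Y ◁ ε F) ≫ μ F Y (𝟙_ A))) ≫ μ F X (Y ⊗ 𝟙_ A) = _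
  have e : (ρ_ (F.obj Y)).inv ≫ F.obj Y ◁ ε F ≫ μ F Y (𝟙_ A) = F.map (ρ_ Y).inv :=
    right_unitality_inv F Y
  rw [Category.assoc, ← μ_natural, ← id_tensorHom, tensorHom_comp_tensorHom_assoc, e,
    ← tensorHom_id, tensorHom_comp_tensorHom_assoc, Category.comp_id, Category.id_comp]

theorem kunneth_unit_right (X : A) {n : ℕ} {Y : Fin n → A} (y : ∀ i, 𝟙_ A ⟶ Y i) :
    (F.obj X ◁ tensorListUnit (fun i => F.obj (Y i)) (fun i => ε F ≫ F.map (y i))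
        (List.finRange n)) ≫ kunneth F X Y =
      ((F.obj X ◁ ε F) ≫ μ F X (𝟙_ A)) ≫ F.map (X ◁ tensorListUnit Y y (List.finRange n)) :=
  lax_whiskerLeft_step F X (tensorListUnit_lax F Y y _)

/-- The Künneth morphism for iterated tensor products. -/
def kunneth₂ {n : ℕ} {m : Fin n → ℕ} (X : A) (Y : Fin n → A) (Z : ∀ i, Fin (m i) → A) :
    (F.obj X ⊗ tensorFin fun i => F.obj (Y i)) ⊗ (tensorFin fun i => tensorFin fun j =>
      F.obj (Z i j)) ⟶ F.obj ((X ⊗ tensorFin Y) ⊗ tensorFin fun i => tensorFin (Z i)) :=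
  (kunneth F X Y ⊗ₘ (tensorFinMap (fun i => tensorListLax F (Z i) (List.finRange (m i))) ≫
    tensorListLax F (fun i => tensorFin (Z i)) (List.finRange n))) ≫ μ F _ _

theorem shuffle_chase {X₁ X₂ X₃ : A} {P Q Q' R R' R'' : B} {k : P ⟶ F.obj X₁}
    {k₀ : Q ⟶ Q'} {k' : Q' ⟶ F.obj X₂} {s : X₁ ⊗ X₂ ⟶ X₃} {s₁ : P ⊗ Q ⟶ R} {s₂ : P ⊗ Q' ⟶ R'}
    {a : R ⟶ R'} {b : R' ⟶ R''} {K : R'' ⟶ F.obj X₃}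
    (h₁ : (𝟙 P ⊗ₘ k₀) ≫ s₂ = s₁ ≫ a) (h₂ : (k ⊗ₘ k') ≫ μ F X₁ X₂ ≫ F.map s = s₂ ≫ b ≫ K) :
    (k ⊗ₘ (k₀ ≫ k')) ≫ μ F X₁ X₂ ≫ F.map s = s₁ ≫ (a ≫ b) ≫ K := by
  rw [Category.assoc, ← reassoc_of% h₁, ← h₂, tensorHom_comp_tensorHom_assoc, Category.id_comp]

theorem tensorListMap_comp₃ {ι : Type w} {X Y Z W : ι → B} (f : ∀ i, X i ⟶ W i)
    (a : ∀ i, X i ⟶ Y i) (b : ∀ i, Y i ⟶ Z i) (c : ∀ i, Z i ⟶ W i)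
    (h : ∀ i, f i = (a i ≫ b i) ≫ c i) (L : List ι) :
    tensorListMap f L = (tensorListMap a L ≫ tensorListMap b L) ≫ tensorListMap c L := by
  rw [← tensorListMap_comp, ← tensorListMap_comp]
  exact congrArg (fun t => tensorListMap t L) (funext h)

/-- Multiplying the two rows and then shuffling inside `F` agrees with shuffling first, multiplying
within each block, and then multiplying the blocks. -/
theorem tensorFinShuffle_kunneth {n : ℕ} {m : Fin n → ℕ} (Y : Fin n → A) (Z : ∀ i, Fin (m i) → A)
    {W : Fin n → A} (c : ∀ i, Y i ⊗ tensorFin (Z i) ⟶ W i) :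
    (tensorListLax F Y (List.finRange n) ⊗ₘ
        (tensorFinMap (fun i => tensorListLax F (Z i) (List.finRange (m i))) ≫
          tensorListLax F (fun i => tensorFin (Z i)) (List.finRange n))) ≫ μ F _ _ ≫
        F.map (tensorFinShuffle Y (fun i => tensorFin (Z i)) ≫ tensorFinMap c) =
      (tensorFinShuffle _ _ ≫ tensorFinMap fun i => kunneth F (Y i) (Z i) ≫ F.map (c i)) ≫
        tensorListLax F W (List.finRange n) := by
  have h1 := tensorListShuffle_naturality (fun i => 𝟙 (F.obj (Y i)))
    (fun i => tensorListLax F (Z i) (List.finRange (m i))) (List.finRange n)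
  rw [tensorListMap_id] at h1
  have h2 := shuffle_chase F h1
    (tensorListShuffle_lax F Y (fun i => tensorFin (Z i)) (List.finRange n))
  have h3 := tensorListLax_naturality F c (List.finRange n)
  have h4 : tensorFinMap (fun i => kunneth F (Y i) (Z i) ≫ F.map (c i)) =
      (tensorListMap (fun i => 𝟙 (F.obj (Y i)) ⊗ₘ tensorListLax F (Z i) (List.finRange (m i)))
        (List.finRange n) ≫ tensorListMap (fun i => μ F (Y i) (tensorFin (Z i)))
        (List.finRange n)) ≫ tensorListMap (fun i => F.map (c i)) (List.finRange n) := by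
    exact tensorListMap_comp₃ _ _ _ _ (fun i => by rw [id_tensorHom]; rfl) _
  have key {X₁ X₂ X₃ : A} {P P₁ P₂ P₃ : B} {k : P ⟶ F.obj X₁} {a : X₁ ⟶ X₂} {b : X₂ ⟶ X₃}
      {a' : P ⟶ P₁} {m : P₁ ⟶ P₂} {k' : P₂ ⟶ F.obj X₂} {b' : P₂ ⟶ P₃} {k'' : P₃ ⟶ F.obj X₃}
      {t : P₁ ⟶ P₃} (h : k ≫ F.map a = a' ≫ m ≫ k') (h' : b' ≫ k'' = k' ≫ F.map b)
      (h'' : t = m ≫ b') : k ≫ F.map (a ≫ b) = (a' ≫ t) ≫ k'' := by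
    rw [h'', F.map_comp, reassoc_of% h, ← h', Category.assoc, Category.assoc]
  have h5 := (Category.assoc _ _ _).trans h2
  exact (Category.assoc _ _ _).symm.trans (key h5 h3 h4)

/-- Together with `kunneth_assoc_right`, this lets both sides of the associativity axiom of an image
start with the same morphism `kunneth₂`. -/
theorem kunneth_assoc_left {n : ℕ} {m : Fin n → ℕ} (X : A) (Y : Fin n → A)
    (Z : ∀ i, Fin (m i) → A) {W : Fin n → A} (c : ∀ i, Y i ⊗ tensorFin (Z i) ⟶ W i) :
    (α_ (F.obj X) (tensorFin fun i => F.obj (Y i))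
        (tensorFin fun i => tensorFin fun j => F.obj (Z i j))).hom ≫
      (F.obj X ◁ (tensorFinShuffle _ _ ≫
        tensorFinMap fun i => kunneth F (Y i) (Z i) ≫ F.map (c i))) ≫ kunneth F X W =
    kunneth₂ F X Y Z ≫ F.map ((α_ X (tensorFin Y) (tensorFin fun i => tensorFin (Z i))).hom ≫
      (X ◁ (tensorFinShuffle _ _ ≫ tensorFinMap c))) :=
  ((Category.assoc _ _ _).trans ((lax_append_cons F (X := X)
    (tensorFinShuffle_kunneth F Y Z c)).trans (Category.assoc _ _ _))).symm

theorem lax_whisker_exchange {X X' S T : A} {P Q Q' : B} {k : P ⟶ F.obj X} {c : X ⟶ X'}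
    {k' : Q ⟶ F.obj S} {f : S ⟶ T} {f' : Q ⟶ Q'} {K : Q' ⟶ F.obj T}
    (h : k' ≫ F.map f = f' ≫ K) :
    ((k ≫ F.map c) ▷ Q) ≫ (F.obj X' ◁ f') ≫ (F.obj X' ◁ K) ≫ μ F X' T =
      ((k ⊗ₘ k') ≫ μ F X S) ≫ F.map ((c ▷ S) ≫ (X' ◁ f)) := by
  rw [← whiskerLeft_comp_assoc, ← h, ← MonoidalCategory.tensorHom_def,
    ← MonoidalCategory.tensorHom_def_assoc, Category.assoc, ← μ_natural,
    tensorHom_comp_tensorHom_assoc]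

theorem kunneth_assoc_right {n : ℕ} {m : Fin n → ℕ} (X : A) (Y : Fin n → A)
    (Z : (Σ i, Fin (m i)) → A) {X' : A} (c : X ⊗ tensorFin Y ⟶ X') :
    ((kunneth F X Y ≫ F.map c) ▷ _) ≫
      (F.obj X' ◁ tensorFinFlatten m (fun s => F.obj (Z s))) ≫
        kunneth F X' (fun k => Z (finSigmaFinEquiv.symm k)) =
      kunneth₂ F X Y (fun i j => Z ⟨i, j⟩) ≫ F.map ((c ▷ _) ≫ (X' ◁ tensorFinFlatten m Z)) :=
  lax_whisker_exchange F ((Category.assoc _ _ _).trans (tensorFinFlatten_lax F m Z))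

end Kunneth

/-! ### The axioms of operads and algebras under lax symmetric monoidal functors. -/

section Raw
variable (D : Type u) [Category.{v} D] [MonoidalCategory D] [SymmetricCategory D]

/-- The data of an operad. -/
structure RawOperad where
  obj : ℕ+ → D
  act {l m : ℕ+} (σ : Fin l ≃ Fin m) : obj m ⟶ obj l
  unit : 𝟙_ D ⟶ obj 1
  comp {l : ℕ+} (m : Fin l → ℕ+) : obj l ⊗ tensorFin (fun i => obj (m i)) ⟶ obj (sumArity m)

variable {D}

/-- The axioms of an operad. -/
structure RawOperad.IsOperad (P : RawOperad D) : Prop where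
  act_refl (l : ℕ+) : P.act (Equiv.refl (Fin l)) = 𝟙 (P.obj l)
  act_trans {l m n : ℕ+} (σ : Fin l ≃ Fin m) (τ : Fin m ≃ Fin n) :
    P.act (σ.trans τ) = P.act τ ≫ P.act σ
  comp_perm {l l' : ℕ+} (σ : Fin l ≃ Fin l') (m : Fin l' → ℕ+) :
    (P.act σ ⊗ₘ tensorFinPerm σ (fun j => P.obj (m j))) ≫ P.comp (fun i => m (σ i)) =
      P.comp m ≫ P.act (blockPerm σ m)
  comp_act {l : ℕ+} {m m' : Fin l → ℕ+} (τ : ∀ i, Fin (m i) ≃ Fin (m' i)) :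
    (P.obj l ◁ tensorFinMap (fun i => P.act (τ i))) ≫ P.comp m = P.comp m' ≫ P.act (sumPerm τ)
  unit_comp (n : ℕ+) :
    (P.unit ⊗ₘ (ρ_ (P.obj n)).inv) ≫ P.comp (l := 1) (fun _ => n) =
      (λ_ (P.obj n)).hom ≫ P.act (arityCast (sumArity_one n))
  comp_unit (l : ℕ+) :
    (P.obj l ◁ tensorListUnit (fun _ => P.obj 1) (fun _ => P.unit) (List.finRange l)) ≫
        P.comp (fun _ : Fin l => 1) =
      (ρ_ (P.obj l)).hom ≫ P.act (arityCast (sumArity_const_one l))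
  assoc {l : ℕ+} (m : Fin l → ℕ+) (n : (i : Fin l) → Fin (m i) → ℕ+) :
    (α_ (P.obj l) (tensorFin fun i => P.obj (m i))
        (tensorFin fun i => tensorFin fun j => P.obj (n i j))).hom ≫
      (P.obj l ◁ (tensorFinShuffle _ _ ≫ tensorFinMap fun i => P.comp (n i))) ≫
        P.comp (fun i => sumArity (n i)) ≫ P.act (arityCast (sumArity_flattenArity n)) =
    (P.comp m ▷ _) ≫
      (P.obj (sumArity m) ◁ tensorFinFlatten (fun i => (m i : ℕ)) (fun s => P.obj (n s.1 s.2))) ≫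
        P.comp (flattenArity n)

/-- The data underlying an operad. -/
def Operad.raw (P : Operad D) : RawOperad D where
  obj := P.obj
  act := P.act
  unit := P.unit
  comp := P.comp

theorem Operad.isOperad_raw (P : Operad D) : P.raw.IsOperad where
  act_refl := P.act_refl
  act_trans := P.act_trans
  comp_perm := P.comp_perm
  comp_act := P.comp_act
  unit_comp := P.unit_comp
  comp_unit := P.comp_unit
  assoc := P.assoc

/-- The operad given by data which satisfy the axioms. -/
def RawOperad.IsOperad.operad {P : RawOperad D} (h : P.IsOperad) : Operad D :=
  { P, h with }

/-- The data of an algebra. -/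
structure RawAlgebra (P : RawOperad D) where
  obj : D
  act (l : ℕ+) : P.obj l ⊗ tensorFin (fun _ : Fin l => obj) ⟶ obj

/-- The axioms of an algebra. -/
structure RawAlgebra.IsAlgebra {P : RawOperad D} (A : RawAlgebra P) : Prop where
  act_perm {l l' : ℕ+} (σ : Fin l ≃ Fin l') :
    (P.act σ ⊗ₘ tensorFinPerm σ (fun _ => A.obj)) ≫ A.act l = A.act l'
  unit_act : (P.unit ⊗ₘ (ρ_ A.obj).inv) ≫ A.act 1 = (λ_ A.obj).hom
  comp_act {l : ℕ+} (m : Fin l → ℕ+) :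
    (α_ (P.obj l) (tensorFin fun i => P.obj (m i))
        (tensorFin fun i => tensorFin fun _ : Fin (m i) => A.obj)).hom ≫
      (P.obj l ◁ (tensorFinShuffle _ _ ≫ tensorFinMap fun i => A.act (m i))) ≫ A.act l =
    (P.comp m ▷ _) ≫
      (P.obj (sumArity m) ◁ tensorFinFlatten (fun i => (m i : ℕ)) (fun _ => A.obj)) ≫
        A.act (sumArity m)

/-- The data underlying an algebra. -/
def OperadAlgebra.raw {P : Operad D} (A : OperadAlgebra P) : RawAlgebra P.raw where
  obj := A.obj
  act := A.act

theorem OperadAlgebra.isAlgebra_raw {P : Operad D} (A : OperadAlgebra P) : A.raw.IsAlgebra where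
  act_perm := A.act_perm
  unit_act := A.unit_act
  comp_act := A.comp_act

/-- The algebra given by data which satisfy the axioms. -/
def RawAlgebra.IsAlgebra.algebra {P : Operad D} {A : RawAlgebra P.raw} (h : A.IsAlgebra) :
    OperadAlgebra P :=
  { A, h with }

end Raw

section RawMap
variable {A : Type u₁} [Category.{v₁} A] [MonoidalCategory A] [SymmetricCategory A]
  {B : Type u₂} [Category.{v₂} B] [MonoidalCategory B] [SymmetricCategory B] (F : A ⥤ B)
  [F.LaxBraided]

open Functor.LaxMonoidal

/-- The morphisms `L'` and `R'` are obtained from the images by `F` of `L` and `R` by composition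
with the same morphism `k`. -/
structure IsLaxImage {P : B} {X Y : A} (k : P ⟶ F.obj X) (L R : X ⟶ Y) (L' R' : P ⟶ F.obj Y) :
    Prop where
  left : L' = k ≫ F.map L
  right : R' = k ≫ F.map R

variable {F} in
theorem IsLaxImage.map {P : B} {X Y : A} {k : P ⟶ F.obj X} {L R : X ⟶ Y} {L' R' : P ⟶ F.obj Y}
    (h : IsLaxImage F k L R L' R') (e : L = R) : L' = R' := by
  rw [h.left, h.right, e]

variable {F} in
-- If the common Künneth morphism is invertible, an axiom of the image can be taken back to the
-- images of the two original sides; joint faithfulness does the rest.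
theorem IsLaxImage.reflect {P : B} {X Y : A} {k : P ⟶ F.obj X} {L R : X ⟶ Y} {L' R' : P ⟶ F.obj Y}
    (h : IsLaxImage F k L R L' R') (hk : IsIso k) (e : L' = R') : F.map L = F.map R := by
  rw [h.left, h.right] at e
  exact (cancel_epi k).1 e

theorem lax_image_left {P Q : B} {X Y Z : A} {k : P ⟶ F.obj X} {k' : Q ⟶ F.obj Y} {x : X ⟶ Y}
    {x' : P ⟶ Q} {y : Y ⟶ Z} (h : x' ≫ k' = k ≫ F.map x) :
    x' ≫ k' ≫ F.map y = k ≫ F.map (x ≫ y) := by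
  rw [reassoc_of% h, F.map_comp]

theorem lax_image_left₂ {P P₁ P₂ : B} {X X₁ X₂ X₃ : A} {k : P ⟶ F.obj X} {k' : P₂ ⟶ F.obj X₂}
    {a : X ⟶ X₁} {b : X₁ ⟶ X₂} {c : X₂ ⟶ X₃} {a' : P ⟶ P₁} {b' : P₁ ⟶ P₂}
    (h : a' ≫ b' ≫ k' = k ≫ F.map (a ≫ b)) :
    a' ≫ b' ≫ k' ≫ F.map c = k ≫ F.map (a ≫ b ≫ c) := by
  rw [reassoc_of% h, ← F.map_comp, Category.assoc]

theorem lax_image_left₃ {P P₁ P₂ : B} {X X₁ X₂ X₃ X₄ : A} {k : P ⟶ F.obj X} {k' : P₂ ⟶ F.obj X₂}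
    {a : X ⟶ X₁} {b : X₁ ⟶ X₂} {c : X₂ ⟶ X₃} {d : X₃ ⟶ X₄} {a' : P ⟶ P₁} {b' : P₁ ⟶ P₂}
    (h : a' ≫ b' ≫ k' = k ≫ F.map (a ≫ b)) :
    a' ≫ b' ≫ (k' ≫ F.map c) ≫ F.map d = k ≫ F.map (a ≫ b ≫ c ≫ d) := by
  rw [Category.assoc, reassoc_of% h, ← F.map_comp, ← F.map_comp, Category.assoc]

theorem lax_image_right {P : B} {X Y Z : A} {k : P ⟶ F.obj X} {x : X ⟶ Y} {y : Y ⟶ Z} :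
    (k ≫ F.map x) ≫ F.map y = k ≫ F.map (x ≫ y) := by
  rw [Category.assoc, F.map_comp]

theorem lax_image_leftUnitor {X Y : A} (f : X ⟶ Y) :
    (λ_ (F.obj X)).hom ≫ F.map f = ((ε F ▷ F.obj X) ≫ μ F (𝟙_ A) X) ≫
      F.map ((λ_ X).hom ≫ f) := by
  rw [left_unitality, F.map_comp, Category.assoc, Category.assoc, Category.assoc]

theorem lax_image_rightUnitor {X Y : A} (f : X ⟶ Y) :
    (ρ_ (F.obj X)).hom ≫ F.map f = ((F.obj X ◁ ε F) ≫ μ F X (𝟙_ A)) ≫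
      F.map ((ρ_ X).hom ≫ f) := by
  rw [right_unitality, F.map_comp, Category.assoc, Category.assoc, Category.assoc]

/-- The image of the data of an operad by a lax monoidal functor. -/
def RawOperad.map (P : RawOperad A) : RawOperad B where
  obj l := F.obj (P.obj l)
  act σ := F.map (P.act σ)
  unit := ε F ≫ F.map P.unit
  comp m := kunneth F _ _ ≫ F.map (P.comp m)

/-- The image of the data of an algebra by a lax monoidal functor. -/
def RawAlgebra.map {P : RawOperad A} (M : RawAlgebra P) : RawAlgebra (P.map F) where
  obj := F.obj M.obj
  act l := kunneth F _ _ ≫ F.map (M.act l)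

namespace RawOperad
variable (P : RawOperad A)

theorem map_comp_perm {l l' : ℕ+} (σ : Fin l ≃ Fin l') (m : Fin l' → ℕ+) :
    IsLaxImage F (kunneth F (P.obj l') fun j => P.obj (m j))
      ((P.act σ ⊗ₘ tensorFinPerm σ (fun j => P.obj (m j))) ≫ P.comp (fun i => m (σ i)))
      (P.comp m ≫ P.act (blockPerm σ m))
      (((P.map F).act σ ⊗ₘ tensorFinPerm σ (fun j => (P.map F).obj (m j))) ≫
        (P.map F).comp (fun i => m (σ i)))
      ((P.map F).comp m ≫ (P.map F).act (blockPerm σ m)) :=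
  ⟨lax_image_left F (kunneth_perm F (P.act σ) σ fun j => P.obj (m j)), lax_image_right F⟩

theorem map_comp_act {l : ℕ+} {m m' : Fin l → ℕ+} (τ : ∀ i, Fin (m i) ≃ Fin (m' i)) :
    IsLaxImage F (kunneth F (P.obj l) fun j => P.obj (m' j))
      ((P.obj l ◁ tensorFinMap (fun i => P.act (τ i))) ≫ P.comp m) (P.comp m' ≫ P.act (sumPerm τ))
      (((P.map F).obj l ◁ tensorFinMap (fun i => (P.map F).act (τ i))) ≫ (P.map F).comp m)
      ((P.map F).comp m' ≫ (P.map F).act (sumPerm τ)) :=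
  ⟨lax_image_left F (kunneth_whiskerLeft F (P.obj l) fun i => P.act (τ i)), lax_image_right F⟩

theorem map_unit_comp (n : ℕ+) :
    IsLaxImage F ((ε F ▷ F.obj (P.obj n)) ≫ μ F (𝟙_ A) (P.obj n))
      ((P.unit ⊗ₘ (ρ_ (P.obj n)).inv) ≫ P.comp (l := 1) (fun _ => n))
      ((λ_ (P.obj n)).hom ≫ P.act (arityCast (sumArity_one n)))
      (((P.map F).unit ⊗ₘ (ρ_ ((P.map F).obj n)).inv) ≫ (P.map F).comp (l := 1) (fun _ => n))
      ((λ_ ((P.map F).obj n)).hom ≫ (P.map F).act (arityCast (sumArity_one n))) :=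
  ⟨lax_image_left F (kunneth_unit_left F P.unit (P.obj n)), lax_image_leftUnitor F _⟩

theorem map_comp_unit (l : ℕ+) :
    IsLaxImage F ((F.obj (P.obj l) ◁ ε F) ≫ μ F (P.obj l) (𝟙_ A))
      ((P.obj l ◁ tensorListUnit (fun _ => P.obj 1) (fun _ => P.unit) (List.finRange l)) ≫
        P.comp (fun _ : Fin l => 1))
      ((ρ_ (P.obj l)).hom ≫ P.act (arityCast (sumArity_const_one l)))
      (((P.map F).obj l ◁ tensorListUnit (fun _ => (P.map F).obj 1) (fun _ => (P.map F).unit)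
        (List.finRange l)) ≫ (P.map F).comp (fun _ : Fin l => 1))
      ((ρ_ ((P.map F).obj l)).hom ≫ (P.map F).act (arityCast (sumArity_const_one l))) :=
  ⟨lax_image_left F (kunneth_unit_right F (P.obj l) fun _ => P.unit), lax_image_rightUnitor F _⟩

theorem map_assoc {l : ℕ+} (m : Fin l → ℕ+) (n : (i : Fin l) → Fin (m i) → ℕ+) :
    IsLaxImage F (kunneth₂ F (P.obj l) (fun i => P.obj (m i)) fun i j => P.obj (n i j))
      ((α_ (P.obj l) (tensorFin fun i => P.obj (m i))
          (tensorFin fun i => tensorFin fun j => P.obj (n i j))).hom ≫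
        (P.obj l ◁ (tensorFinShuffle _ _ ≫ tensorFinMap fun i => P.comp (n i))) ≫
          P.comp (fun i => sumArity (n i)) ≫ P.act (arityCast (sumArity_flattenArity n)))
      ((P.comp m ▷ _) ≫
        (P.obj (sumArity m) ◁ tensorFinFlatten (fun i => (m i : ℕ)) (fun s => P.obj (n s.1 s.2))) ≫
          P.comp (flattenArity n))
      ((α_ ((P.map F).obj l) (tensorFin fun i => (P.map F).obj (m i))
          (tensorFin fun i => tensorFin fun j => (P.map F).obj (n i j))).hom ≫
        ((P.map F).obj l ◁ (tensorFinShuffle _ _ ≫ tensorFinMap fun i => (P.map F).comp (n i))) ≫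
          (P.map F).comp (fun i => sumArity (n i)) ≫
            (P.map F).act (arityCast (sumArity_flattenArity n)))
      (((P.map F).comp m ▷ _) ≫ ((P.map F).obj (sumArity m) ◁
          tensorFinFlatten (fun i => (m i : ℕ)) (fun s => (P.map F).obj (n s.1 s.2))) ≫
          (P.map F).comp (flattenArity n)) :=
  ⟨lax_image_left₃ F (kunneth_assoc_left F (P.obj l) (fun i => P.obj (m i))
      (fun i j => P.obj (n i j)) fun i => P.comp (n i)),
    lax_image_left₂ F (kunneth_assoc_right F (m := fun i => (m i : ℕ)) (P.obj l)
      (fun i => P.obj (m i)) (fun s : (Σ i, Fin (m i : ℕ)) => P.obj (n s.1 s.2)) (P.comp m))⟩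

variable {P} in
-- Apart from functoriality of the action, each axiom is transported along an `IsLaxImage`: both of
-- its sides factor through the same Künneth morphism.
theorem IsOperad.map (h : P.IsOperad) : (P.map F).IsOperad where
  act_refl l := (congrArg F.map (h.act_refl l)).trans (F.map_id _)
  act_trans σ τ := (congrArg F.map (h.act_trans σ τ)).trans (F.map_comp _ _)
  comp_perm σ m := (P.map_comp_perm F σ m).map (h.comp_perm σ m)
  comp_act τ := (P.map_comp_act F τ).map (h.comp_act τ)
  unit_comp n := (P.map_unit_comp F n).map (h.unit_comp n)
  comp_unit l := (P.map_comp_unit F l).map (h.comp_unit l)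
  assoc m n := (P.map_assoc F m n).map (h.assoc m n)

end RawOperad

namespace RawAlgebra
variable {P : RawOperad A} (M : RawAlgebra P)

theorem map_act_perm {l l' : ℕ+} (σ : Fin l ≃ Fin l') :
    IsLaxImage F (kunneth F (P.obj l') fun _ => M.obj)
      ((P.act σ ⊗ₘ tensorFinPerm σ (fun _ => M.obj)) ≫ M.act l) (M.act l')
      (((P.map F).act σ ⊗ₘ tensorFinPerm σ (fun _ => (M.map F).obj)) ≫ (M.map F).act l)
      ((M.map F).act l') :=
  ⟨lax_image_left F (kunneth_perm F (P.act σ) σ fun _ => M.obj), rfl⟩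

theorem map_unit_act :
    IsLaxImage F ((ε F ▷ F.obj M.obj) ≫ μ F (𝟙_ A) M.obj)
      ((P.unit ⊗ₘ (ρ_ M.obj).inv) ≫ M.act 1) (λ_ M.obj).hom
      (((P.map F).unit ⊗ₘ (ρ_ (M.map F).obj).inv) ≫ (M.map F).act 1) (λ_ (M.map F).obj).hom :=
  ⟨lax_image_left F (kunneth_unit_left F P.unit M.obj),
    (left_unitality F M.obj).trans (Category.assoc _ _ _).symm⟩

theorem map_comp_act {l : ℕ+} (m : Fin l → ℕ+) :
    IsLaxImage F (kunneth₂ F (P.obj l) (fun i => P.obj (m i))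
        fun (i : Fin l) (_ : Fin (m i)) => M.obj)
      ((α_ (P.obj l) (tensorFin fun i => P.obj (m i))
          (tensorFin fun i => tensorFin fun _ : Fin (m i) => M.obj)).hom ≫
        (P.obj l ◁ (tensorFinShuffle _ _ ≫ tensorFinMap fun i => M.act (m i))) ≫ M.act l)
      ((P.comp m ▷ _) ≫
        (P.obj (sumArity m) ◁ tensorFinFlatten (fun i => (m i : ℕ)) (fun _ => M.obj)) ≫
          M.act (sumArity m))
      ((α_ ((P.map F).obj l) (tensorFin fun i => (P.map F).obj (m i))
          (tensorFin fun i => tensorFin fun _ : Fin (m i) => (M.map F).obj)).hom ≫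
        ((P.map F).obj l ◁ (tensorFinShuffle _ _ ≫ tensorFinMap fun i => (M.map F).act (m i))) ≫
          (M.map F).act l)
      (((P.map F).comp m ▷ _) ≫ ((P.map F).obj (sumArity m) ◁
          tensorFinFlatten (fun i => (m i : ℕ)) (fun _ => (M.map F).obj)) ≫
          (M.map F).act (sumArity m)) :=
  ⟨lax_image_left₂ F (kunneth_assoc_left F (P.obj l) (fun i => P.obj (m i))
      (fun (i : Fin l) (_ : Fin (m i)) => M.obj) fun i => M.act (m i)),
    lax_image_left₂ F (kunneth_assoc_right F (P.obj l) (fun i => P.obj (m i))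
      (fun _ : (Σ i, Fin (m i)) => M.obj) (P.comp m))⟩

variable {M} in
theorem IsAlgebra.map (h : M.IsAlgebra) : (M.map F).IsAlgebra where
  act_perm σ := (M.map_act_perm F σ).map (h.act_perm σ)
  unit_act := (M.map_unit_act F).map h.unit_act
  comp_act m := (M.map_comp_act F m).map (h.comp_act m)

end RawAlgebra

end RawMap

section Reflect
variable {A : Type u₁} [Category.{v₁} A] [MonoidalCategory A] [SymmetricCategory A]
  {B : Type u₂} [Category.{v₂} B] [MonoidalCategory B] [SymmetricCategory B] {K : Type*}
  (F : K → A ⥤ B) [∀ k, (F k).LaxBraided]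

open Functor.LaxMonoidal

theorem isIso_kunneth₂ (F : A ⥤ B) [F.LaxBraided] (hε : IsIso (ε F))
    (hμ : ∀ X Y, IsIso (μ F X Y)) {n : ℕ} {m : Fin n → ℕ} (X : A) (Y : Fin n → A)
    (Z : ∀ i, Fin (m i) → A) : IsIso (kunneth₂ F X Y Z) := by
  have key {P Q Q' : B} {S T : A} {k : P ⟶ F.obj S} {a : Q ⟶ Q'} {b : Q' ⟶ F.obj T} (hk : IsIso k)
      (ha : IsIso a) (hb : IsIso b) : IsIso ((k ⊗ₘ (a ≫ b)) ≫ μ F S T) := by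
    have := hμ S T
    infer_instance
  refine key (isIso_kunneth F hε hμ X Y) ?_ (isIso_tensorListLax F hε hμ _ _)
  exact isIso_tensorListMap _ (fun i => isIso_tensorListLax F hε hμ _ _) _

variable {F}

/-- Reflection of the axioms by a jointly faithful family with invertible constraints. It is meant
for the evaluations of a functor category, where it makes a diagram of operads an operad in
diagrams. -/
theorem RawOperad.IsOperad.of_map (hF : ∀ ⦃X Y : A⦄ (f g : X ⟶ Y),
      (∀ k, (F k).map f = (F k).map g) → f = g) (hε : ∀ k, IsIso (ε (F k)))
    (hμ : ∀ k X Y, IsIso (μ (F k) X Y)) {P : RawOperad A} (h : ∀ k, (P.map (F k)).IsOperad) :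
    P.IsOperad where
  act_refl l := hF _ _ fun k => ((h k).act_refl l).trans ((F k).map_id _).symm
  act_trans σ τ := hF _ _ fun k => ((h k).act_trans σ τ).trans ((F k).map_comp _ _).symm
  comp_perm σ m := hF _ _ fun k => (P.map_comp_perm (F k) σ m).reflect
    (isIso_kunneth (F k) (hε k) (hμ k) _ _) ((h k).comp_perm σ m)
  comp_act τ := hF _ _ fun k => (P.map_comp_act (F k) τ).reflect
    (isIso_kunneth (F k) (hε k) (hμ k) _ _) ((h k).comp_act τ)
  unit_comp n := hF _ _ fun k => by
    have := hε k
    have := hμ k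
    exact (P.map_unit_comp (F k) n).reflect inferInstance ((h k).unit_comp n)
  comp_unit l := hF _ _ fun k => by
    have := hε k
    have := hμ k
    exact (P.map_comp_unit (F k) l).reflect inferInstance ((h k).comp_unit l)
  assoc m n := hF _ _ fun k => (P.map_assoc (F k) m n).reflect
    (isIso_kunneth₂ (F k) (hε k) (hμ k) _ _ _) ((h k).assoc m n)

theorem RawAlgebra.IsAlgebra.of_map (hF : ∀ ⦃X Y : A⦄ (f g : X ⟶ Y),
      (∀ k, (F k).map f = (F k).map g) → f = g) (hε : ∀ k, IsIso (ε (F k)))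
    (hμ : ∀ k X Y, IsIso (μ (F k) X Y)) {P : RawOperad A} {M : RawAlgebra P}
    (h : ∀ k, (M.map (F k)).IsAlgebra) : M.IsAlgebra where
  act_perm σ := hF _ _ fun k => (M.map_act_perm (F k) σ).reflect
    (isIso_kunneth (F k) (hε k) (hμ k) _ _) ((h k).act_perm σ)
  unit_act := hF _ _ fun k => by
    have := hε k
    have := hμ k
    exact (M.map_unit_act (F k)).reflect inferInstance (h k).unit_act
  comp_act m := hF _ _ fun k => (M.map_comp_act (F k) m).reflect
    (isIso_kunneth₂ (F k) (hε k) (hμ k) _ _ _) ((h k).comp_act m)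

end Reflect

open Functor.LaxMonoidal

/-! ### Structures of a given signature and diagrams of them. -/

section Evaluation
variable {K : Type u₁} [Category.{v₁} K] {D : Type u} [Category.{v} D] [MonoidalCategory D]

/-- Evaluation is (strictly) monoidal. -/
instance evaluationLaxMonoidal (k : K) : ((evaluation K D).obj k).LaxMonoidal where
  ε := 𝟙 (𝟙_ D)
  μ X Y := 𝟙 (X.obj k ⊗ Y.obj k)
  μ_natural_left _ _ := (Category.comp_id _).trans (Category.id_comp _).symm
  μ_natural_right _ _ := (Category.comp_id _).trans (Category.id_comp _).symm
  associativity X Y Z := by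
    change (𝟙 (X.obj k ⊗ Y.obj k) ▷ Z.obj k) ≫ 𝟙 _ ≫ (α_ (X.obj k) (Y.obj k) (Z.obj k)).hom =
      (α_ (X.obj k) (Y.obj k) (Z.obj k)).hom ≫ (X.obj k ◁ 𝟙 (Y.obj k ⊗ Z.obj k)) ≫ 𝟙 _
    rw [Category.comp_id, Category.id_comp, id_whiskerRight, whiskerLeft_id, Category.comp_id,
      Category.id_comp]
  left_unitality X := by
    change (λ_ (X.obj k)).hom = (𝟙 (𝟙_ D) ▷ X.obj k) ≫ 𝟙 _ ≫ (λ_ (X.obj k)).hom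
    rw [id_whiskerRight, Category.id_comp, Category.id_comp]
  right_unitality X := by
    change (ρ_ (X.obj k)).hom = (X.obj k ◁ 𝟙 (𝟙_ D)) ≫ 𝟙 _ ≫ (ρ_ (X.obj k)).hom
    rw [whiskerLeft_id, Category.id_comp, Category.id_comp]

instance evaluationLaxBraided [BraidedCategory D] (k : K) :
    ((evaluation K D).obj k).LaxBraided where
  braided X Y := by
    change 𝟙 _ ≫ (β_ (X.obj k) (Y.obj k)).hom = (β_ (X.obj k) (Y.obj k)).hom ≫ 𝟙 _
    rw [Category.comp_id, Category.id_comp]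

theorem isIso_evaluation_ε (k : K) : IsIso (ε ((evaluation K D).obj k)) :=
  inferInstanceAs (IsIso (𝟙 (𝟙_ D)))

theorem isIso_evaluation_μ (k : K) (X Y : K ⥤ D) : IsIso (μ ((evaluation K D).obj k) X Y) :=
  inferInstanceAs (IsIso (𝟙 (X.obj k ⊗ Y.obj k)))

instance isIso_kunneth_evaluation (k : K) (X : K ⥤ D) {n : ℕ} (Y : Fin n → K ⥤ D) :
    IsIso (kunneth ((evaluation K D).obj k) X Y) :=
  isIso_kunneth _ (isIso_evaluation_ε k) (isIso_evaluation_μ k) X Y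

instance evaluation_map_isMonoidal {k k' : K} (f : k ⟶ k') :
    NatTrans.IsMonoidal ((evaluation K D).map f) where
  unit := Category.id_comp _
  tensor X Y := by
    change 𝟙 _ ≫ (X.map f ⊗ₘ Y.map f) = (X.map f ⊗ₘ Y.map f) ≫ 𝟙 _
    rw [Category.comp_id, Category.id_comp]

end Evaluation

/-- A type of algebraic structures: a set of sorts, and sets of unary operations, of constants and of
operations with a distinguished first argument. -/
structure Signature where
  sort : Type
  un : Type
  unSource : un → sort
  unTarget : un → sort
  const : Type
  constTarget : const → sort
  op : Type
  arity : op → ℕ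
  opHead : op → sort
  opArg (o : op) : Fin (arity o) → sort
  opTarget : op → sort

section Structures
variable (𝒮 : Signature)

/-- Operations of a given signature on a family of objects. -/
@[ext]
structure Ops {D : Type u} [Category.{v} D] [MonoidalCategory D] (X : 𝒮.sort → D) where
  un (a : 𝒮.un) : X (𝒮.unSource a) ⟶ X (𝒮.unTarget a)
  const (a : 𝒮.const) : 𝟙_ D ⟶ X (𝒮.constTarget a)
  op (a : 𝒮.op) : X (𝒮.opHead a) ⊗ tensorFin (fun i => X (𝒮.opArg a i)) ⟶ X (𝒮.opTarget a)

variable {𝒮}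

section
variable {D : Type u} [Category.{v} D] [MonoidalCategory D]

/-- The families of morphisms which are compatible with the operations. -/
structure IsHom {X Y : 𝒮.sort → D} (o : Ops 𝒮 X) (o' : Ops 𝒮 Y) (φ : ∀ s, X s ⟶ Y s) : Prop where
  un (a : 𝒮.un) : o.un a ≫ φ (𝒮.unTarget a) = φ (𝒮.unSource a) ≫ o'.un a
  const (a : 𝒮.const) : o.const a ≫ φ (𝒮.constTarget a) = o'.const a
  op (a : 𝒮.op) : o.op a ≫ φ (𝒮.opTarget a) =
    (φ (𝒮.opHead a) ⊗ₘ tensorFinMap fun i => φ (𝒮.opArg a i)) ≫ o'.op a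

namespace IsHom
variable {X Y Z : 𝒮.sort → D} {o : Ops 𝒮 X} {o' : Ops 𝒮 Y} {o'' : Ops 𝒮 Z}

theorem id (o : Ops 𝒮 X) : IsHom o o fun s => 𝟙 (X s) where
  un a := (Category.comp_id (o.un a)).trans (Category.id_comp (o.un a)).symm
  const a := Category.comp_id (o.const a)
  op a := (Category.comp_id (o.op a)).trans
    (id_tensorFinMap_id_comp (X _) (fun i => X (𝒮.opArg a i)) (o.op a)).symm

theorem comp {φ : ∀ s, X s ⟶ Y s} {ψ : ∀ s, Y s ⟶ Z s} (h : IsHom o o' φ) (h' : IsHom o' o'' ψ) :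
    IsHom o o'' fun s => φ s ≫ ψ s where
  un a := by rw [← Category.assoc, h.un, Category.assoc, h'.un, Category.assoc]
  const a := by rw [← Category.assoc, h.const, h'.const]
  op a := tensorFinMap_square (h.op a) (h'.op a)

theorem congr {φ ψ : ∀ s, X s ⟶ Y s} (h : IsHom o o' φ) (e : ∀ s, φ s = ψ s) : IsHom o o' ψ :=
  (funext e : φ = ψ) ▸ h

/-- Compatibility with operations is an equality of morphisms into the objects of `Y`, so it can be
tested after jointly monic homomorphisms. Lifts to limit cones and inverses of isomorphisms are
obtained in this way. -/
theorem of_comp_mono {K : Type*} {T : K → 𝒮.sort → D} {q : ∀ k, Ops 𝒮 (T k)} {φ : ∀ s, X s ⟶ Y s}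
    {ψ : ∀ k s, Y s ⟶ T k s} (hψ : ∀ k, IsHom o' (q k) (ψ k))
    (hm : ∀ (s) ⦃W : D⦄ (f g : W ⟶ Y s), (∀ k, f ≫ ψ k s = g ≫ ψ k s) → f = g)
    (h : ∀ k, IsHom o (q k) fun s => φ s ≫ ψ k s) : IsHom o o' φ where
  un a := hm _ _ _ fun k => by
    rw [Category.assoc, Category.assoc, (hψ k).un, (h k).un a, Category.assoc]
  const a := hm _ _ _ fun k => by
    rw [Category.assoc, (hψ k).const, (h k).const a]
  op a := hm _ _ _ fun k => by
    rw [Category.assoc, Category.assoc, (hψ k).op, (h k).op a, tensorFinMap_comp,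
      ← tensorHom_comp_tensorHom, Category.assoc]

/-- The dual for colimits. The operations start from tensor products, so the family has to be
jointly epic on these as well, which is the hypothesis `he'`. -/
theorem of_comp_epi {K : Type*} [Nonempty K] {T : K → 𝒮.sort → D} {q : ∀ k, Ops 𝒮 (T k)}
    {φ : ∀ s, X s ⟶ Y s} {ψ : ∀ k s, T k s ⟶ X s} (hψ : ∀ k, IsHom (q k) o (ψ k))
    (he : ∀ (s) ⦃W : D⦄ (f g : X s ⟶ W), (∀ k, ψ k s ≫ f = ψ k s ≫ g) → f = g)
    (he' : ∀ (a : 𝒮.op) ⦃W : D⦄ (f g : X (𝒮.opHead a) ⊗ tensorFin (fun i => X (𝒮.opArg a i)) ⟶ W),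
      (∀ k, (ψ k (𝒮.opHead a) ⊗ₘ tensorFinMap fun i => ψ k (𝒮.opArg a i)) ≫ f =
        (ψ k (𝒮.opHead a) ⊗ₘ tensorFinMap fun i => ψ k (𝒮.opArg a i)) ≫ g) → f = g)
    (h : ∀ k, IsHom (q k) o' fun s => ψ k s ≫ φ s) : IsHom o o' φ where
  un a := he _ _ _ fun k => by
    rw [← reassoc_of% (hψ k).un a, (h k).un a, Category.assoc]
  const a := by
    -- A constant starts from the tensor unit, which no `ψ k` covers; it is compared through any one
    -- index, so one must exist.
    obtain ⟨k⟩ := ‹Nonempty K›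
    rw [← (h k).const, ← (hψ k).const, Category.assoc]
  op a := he' _ _ _ fun k => by
    rw [← reassoc_of% (hψ k).op a, (h k).op a, tensorFinMap_comp,
      ← tensorHom_comp_tensorHom, Category.assoc]

theorem inv {φ : ∀ s, X s ≅ Y s} (h : IsHom o o' fun s => (φ s).hom) :
    IsHom o' o fun s => (φ s).inv :=
  of_comp_mono (K := Unit) (fun _ => h) (fun s _ _ _ e => (cancel_mono (φ s).hom).1 (e ()))
    fun _ => (id o').congr fun s => (φ s).inv_hom_id.symm

end IsHom

end

section
variable {A : Type u₁} [Category.{v₁} A] [MonoidalCategory A]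
  {B : Type u₂} [Category.{v₂} B] [MonoidalCategory B]
  {D : Type u₃} [Category.{v₃} D] [MonoidalCategory D]

/-- The image of operations by a lax monoidal functor. -/
def Ops.map (F : A ⥤ B) [F.LaxMonoidal] {X : 𝒮.sort → A} (o : Ops 𝒮 X) :
    Ops 𝒮 fun s => F.obj (X s) where
  un a := F.map (o.un a)
  const a := ε F ≫ F.map (o.const a)
  op a := kunneth F _ _ ≫ F.map (o.op a)

theorem Ops.map_comp (F : A ⥤ B) [F.LaxMonoidal] (G : B ⥤ D) [G.LaxMonoidal] {X : 𝒮.sort → A}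
    (o : Ops 𝒮 X) : o.map (F ⋙ G) = (o.map F).map G := by
  have key₁ {X₁ X₂ : A} {Y₁ : B} {Z₁ : D} (a : Z₁ ⟶ G.obj Y₁) (b : Y₁ ⟶ F.obj X₁) (f : X₁ ⟶ X₂) :
      (a ≫ G.map b) ≫ G.map (F.map f) = a ≫ G.map (b ≫ F.map f) := by
    rw [G.map_comp, Category.assoc]
  refine Ops.ext rfl (funext fun a => key₁ _ _ _) (funext fun a => ?_)
  exact (congrArg (· ≫ G.map (F.map (o.op a))) (kunneth_comp F G _ _)).trans (key₁ _ _ _)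

theorem Ops.map_id {X : 𝒮.sort → A} (o : Ops 𝒮 X) : o.map (𝟭 A) = o := by
  have h {n : ℕ} (X : A) (Y : Fin n → A) : kunneth (𝟭 A) X Y = 𝟙 _ := by
    have h' : ∀ L : List (Fin n), tensorListLax (𝟭 A) Y L = 𝟙 _ := fun L => by
      induction L with
      | nil => rfl
      | cons a L ih =>
        exact (congrArg (fun t => (Y a ◁ t) ≫ 𝟙 _) ih).trans
          ((Category.comp_id _).trans (whiskerLeft_id _ _))
    exact (congrArg (fun t => (X ◁ t) ≫ 𝟙 _) (h' _)).trans
      ((Category.comp_id _).trans (whiskerLeft_id _ _))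
  refine Ops.ext rfl (funext fun a => Category.id_comp _) (funext fun a => ?_)
  exact (congrArg (· ≫ o.op a) (h _ _)).trans (Category.id_comp _)

theorem IsHom.map (F : A ⥤ B) [F.LaxMonoidal] {X Y : 𝒮.sort → A} {o : Ops 𝒮 X} {o' : Ops 𝒮 Y}
    {φ : ∀ s, X s ⟶ Y s} (h : IsHom o o' φ) :
    IsHom (o.map F) (o'.map F) fun s => F.map (φ s) where
  un a := by
    have e := congrArg F.map (h.un a)
    rwa [F.map_comp, F.map_comp] at e
  const a := by
    have e := congrArg (fun t => ε F ≫ F.map t) (h.const a)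
    exact (Category.assoc _ _ _).trans ((congrArg (ε F ≫ ·) (F.map_comp _ _).symm).trans e)
  op a := lax_op_step F (kunneth_naturality F _ _) (h.op a)
where
  lax_op_step (F : A ⥤ B) [F.LaxMonoidal] {P Q : B} {S T X Y : A} {k : P ⟶ F.obj S}
      {k' : Q ⟶ F.obj T} {f : S ⟶ T} {f' : P ⟶ Q} {o : S ⟶ X} {o' : T ⟶ Y} {φ : X ⟶ Y}
      (h : f' ≫ k' = k ≫ F.map f) (e : o ≫ φ = f ≫ o') :
      (k ≫ F.map o) ≫ F.map φ = f' ≫ k' ≫ F.map o' := by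
    rw [reassoc_of% h, Category.assoc, ← F.map_comp, ← F.map_comp, e]

/-- Naturality, unit and tensor axioms of τ correspond to the three kinds of operations. In this way
λ, μ, the projections of limits and the coprojections of colimits become homomorphisms. -/
theorem isHom_of_isMonoidal {F G : A ⥤ B} [F.LaxMonoidal] [G.LaxMonoidal] (τ : F ⟶ G)
    [NatTrans.IsMonoidal τ] {X : 𝒮.sort → A} (o : Ops 𝒮 X) :
    IsHom (o.map F) (o.map G) fun s => τ.app (X s) where
  un a := τ.naturality (o.un a)
  const a := by
    have key {S T : A} {P : B} {e : P ⟶ F.obj S} {e' : P ⟶ G.obj S} (h : e ≫ τ.app S = e')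
        (f : S ⟶ T) : (e ≫ F.map f) ≫ τ.app T = e' ≫ G.map f := by
      rw [← h, Category.assoc, τ.naturality, Category.assoc]
    exact key (NatTrans.IsMonoidal.unit (τ := τ)) (o.const a)
  op a := by
    have key {S T : A} {P Q : B} {k : P ⟶ F.obj S} {k' : Q ⟶ G.obj S} {t : P ⟶ Q}
        (h : t ≫ k' = k ≫ τ.app S) (f : S ⟶ T) :
        (k ≫ F.map f) ≫ τ.app T = t ≫ k' ≫ G.map f := by
      rw [reassoc_of% h, Category.assoc, τ.naturality]
    exact key (kunneth_monoidal τ _ _) (o.op a)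

theorem IsHom.of_map {K : Type*} (F : K → A ⥤ B) [∀ k, (F k).LaxMonoidal]
    (hF : ∀ ⦃X Y : A⦄ (f g : X ⟶ Y), (∀ k, (F k).map f = (F k).map g) → f = g)
    (hε : ∀ k, IsIso (ε (F k))) (hμ : ∀ k X Y, IsIso (μ (F k) X Y)) {X Y : 𝒮.sort → A}
    {o : Ops 𝒮 X} {o' : Ops 𝒮 Y} {φ : ∀ s, X s ⟶ Y s}
    (h : ∀ k, IsHom (o.map (F k)) (o'.map (F k)) fun s => (F k).map (φ s)) : IsHom o o' φ where
  un a := hF _ _ fun k => by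
    rw [(F k).map_comp, (F k).map_comp]
    exact (h k).un a
  const a := hF _ _ fun k => by
    have := hε k
    have e := (h k).const a
    rw [(F k).map_comp, ← cancel_epi (ε (F k))]
    exact (Category.assoc _ _ _).symm.trans e
  op a := hF _ _ fun k => by
    have key {P Q : B} {S T X Y : A} {p : P ⟶ (F k).obj S} [IsIso p] {p' : Q ⟶ (F k).obj T}
        {f : S ⟶ T} {f' : P ⟶ Q} {o : S ⟶ X} {o' : T ⟶ Y} {φ : X ⟶ Y}
        (h : f' ≫ p' = p ≫ (F k).map f)
        (e : (p ≫ (F k).map o) ≫ (F k).map φ = f' ≫ p' ≫ (F k).map o') :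
        (F k).map (o ≫ φ) = (F k).map (f ≫ o') := by
      rw [reassoc_of% h, Category.assoc, cancel_epi] at e
      rw [(F k).map_comp, (F k).map_comp, e]
    have := isIso_kunneth (F k) (hε k) (hμ k) (X (𝒮.opHead a)) fun i => X (𝒮.opArg a i)
    exact key (kunneth_naturality (F k) _ _) ((h k).op a)

end

section
variable (𝒮) (D : Type u) [Category.{v} D] [MonoidalCategory D]

/-- Families of objects with operations of a given signature. -/
structure Str where
  obj : 𝒮.sort → D
  ops : Ops 𝒮 obj

variable {𝒮 D}

/-- Morphisms of structures. -/
@[ext]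
structure Str.Hom (M N : Str 𝒮 D) where
  app (s : 𝒮.sort) : M.obj s ⟶ N.obj s
  isHom : IsHom M.ops N.ops app

instance : Category (Str 𝒮 D) where
  Hom := Str.Hom
  id M := ⟨_, IsHom.id M.ops⟩
  comp f g := ⟨_, f.isHom.comp g.isHom⟩
  id_comp f := Str.Hom.ext (funext fun s => Category.id_comp (f.app s))
  comp_id f := Str.Hom.ext (funext fun s => Category.comp_id (f.app s))
  assoc f g h := Str.Hom.ext (funext fun s => Category.assoc (f.app s) (g.app s) (h.app s))

/-- The underlying objects of structures. -/
def Str.eval (s : 𝒮.sort) : Str 𝒮 D ⥤ D where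
  obj M := M.obj s
  map f := Str.Hom.app f s

theorem Str.hom_ext {M N : Str 𝒮 D} (f g : M ⟶ N) (h : ∀ s, (eval s).map f = (eval s).map g) :
    f = g :=
  Str.Hom.ext (funext h)

/-- Isomorphisms of structures, given by isomorphisms of the underlying objects. -/
def Str.isoMk {M N : Str 𝒮 D} (φ : ∀ s, M.obj s ≅ N.obj s)
    (h : IsHom M.ops N.ops fun s => (φ s).hom) : M ≅ N where
  hom := ⟨_, h⟩
  inv := ⟨_, h.inv⟩
  hom_inv_id := Str.Hom.ext (funext fun s => (φ s).hom_inv_id)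
  inv_hom_id := Str.Hom.ext (funext fun s => (φ s).inv_hom_id)

end

section
variable {A : Type u₁} [Category.{v₁} A] [MonoidalCategory A]
  {B : Type u₂} [Category.{v₂} B] [MonoidalCategory B]

variable (𝒮) in
/-- The functor on structures given by a lax monoidal functor. -/
def Str.mapFunctor (F : A ⥤ B) [F.LaxMonoidal] : Str 𝒮 A ⥤ Str 𝒮 B where
  obj M := ⟨_, M.ops.map F⟩
  map f := ⟨_, f.isHom.map F⟩
  map_id M := Str.Hom.ext (funext fun s => F.map_id (M.obj s))
  map_comp f g := Str.Hom.ext (funext fun s => F.map_comp (f.app s) (g.app s))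

end

section
variable {K : Type u₁} [Category.{v₁} K] {D : Type u} [Category.{v} D] [MonoidalCategory D]

/-- The operations on the underlying functors of a functor to a category of structures. -/
noncomputable def levelOps (G : K ⥤ Str 𝒮 D) : Ops 𝒮 fun s => G ⋙ Str.eval s where
  un a :=
    { app := fun k => (G.obj k).ops.un a
      naturality := fun _ _ f => ((G.map f).isHom.un a).symm }
  const a :=
    { app := fun k => (G.obj k).ops.const a
      naturality := fun _ k f => (Category.id_comp ((G.obj k).ops.const a)).trans
        ((G.map f).isHom.const a).symm }
  op a :=
    -- A tensor product over a list in the functor category has the expected values only up to the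
    -- invertible Künneth morphism of the evaluation, whose inverse is inserted here.
    { app := fun k => inv (kunneth ((evaluation K D).obj k) (G ⋙ Str.eval (𝒮.opHead a))
        fun i => G ⋙ Str.eval (𝒮.opArg a i)) ≫ (G.obj k).ops.op a
      naturality := fun k k' f => by
        have key {P Q R S X Y : D} {p : P ⟶ R} [IsIso p] {q : Q ⟶ S} [IsIso q] {f : P ⟶ Q}
            {g : R ⟶ S} {o : P ⟶ X} {o' : Q ⟶ Y} {φ : X ⟶ Y} (h : f ≫ q = p ≫ g)
            (e : o ≫ φ = f ≫ o') : g ≫ inv q ≫ o' = (inv p ≫ o) ≫ φ := by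
          rw [Category.assoc, e, ← cancel_epi p, IsIso.hom_inv_id_assoc, ← reassoc_of% h,
            IsIso.hom_inv_id_assoc]
        exact key (kunneth_monoidal ((evaluation K D).map f) _ _) ((G.map f).isHom.op a) }

/-- The Künneth morphism of the evaluation cancels the inverse inserted in `levelOps`. One obtains
an equality of operations on literally the same objects, along which axioms can be rewritten. -/
theorem levelOps_map (G : K ⥤ Str 𝒮 D) (k : K) :
    (levelOps G).map ((evaluation K D).obj k) = (G.obj k).ops :=
  Ops.ext rfl (funext fun _ => Category.id_comp _) (funext fun _ => IsIso.hom_inv_id_assoc _ _)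

theorem IsHom.of_evaluation {X Y : 𝒮.sort → K ⥤ D} {o : Ops 𝒮 X} {o' : Ops 𝒮 Y}
    {φ : ∀ s, X s ⟶ Y s}
    (h : ∀ k, IsHom (o.map ((evaluation K D).obj k)) (o'.map ((evaluation K D).obj k))
      fun s => (φ s).app k) : IsHom o o' φ :=
  IsHom.of_map (fun k => (evaluation K D).obj k) (fun _ _ _ _ h => NatTrans.ext (funext h))
    isIso_evaluation_ε isIso_evaluation_μ h

variable (𝒮 K D) in
/-- The functor sending a functor to a category of structures to the structure on its underlying
functors. -/
noncomputable def levelFunctor : (K ⥤ Str 𝒮 D) ⥤ Str 𝒮 (K ⥤ D) where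
  obj G := ⟨_, levelOps G⟩
  map {G H} τ := ⟨fun s => Functor.whiskerRight τ (Str.eval s), IsHom.of_evaluation fun k => by
    have h := (τ.app k).isHom
    rw [← levelOps_map, ← levelOps_map] at h
    exact h⟩
  map_id _ := rfl
  map_comp _ _ := rfl

end

end Structures

/-! ### The simple functor, λ and μ on structures. -/

section Comparison
variable {D : Type u} [Category.{v} D]

/-- The identity morphism from the constant object on the image by `U` of an object. -/
def constComparisonInv {A : Type u₁} [Category.{v₁} A] (U : A ⥤ D) (X : A) :
    (Functor.const SimplexCategory).obj (U.obj X) ⟶ (Functor.const SimplexCategory).obj X ⋙ U where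
  app _ := 𝟙 _
  naturality _ _ _ := congrArg (𝟙 (U.obj X) ≫ ·) (U.map_id X).symm

/-- The inverse of `diagonalComparison`. -/
def diagonalComparisonInv {A : Type u₁} [Category.{v₁} A] (U : A ⥤ D) (Z : Cosimp (Cosimp A)) :
    diagonal.obj (Z ⋙ (Functor.whiskeringRight SimplexCategory _ _).obj U) ⟶
      diagonal.obj Z ⋙ U where
  app n := 𝟙 (U.obj ((Z.obj n).obj n))
  naturality n m f := by
    change (U.map ((Z.map f).app n) ≫ U.map ((Z.obj m).map f)) ≫ 𝟙 _ =
      𝟙 _ ≫ U.map ((Z.map f).app n ≫ (Z.obj m).map f)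
    rw [Category.comp_id, Category.id_comp, U.map_comp]

end Comparison

section Simple
variable {𝒮 : Signature} {D : Type u} [Category.{v} D] [MonoidalCategory D]

/-- The constant cosimplicial objects have the original object as levels. -/
def constEvaluation (n : SimplexCategory) :
    Functor.const SimplexCategory ⋙ (evaluation SimplexCategory D).obj n ⟶ 𝟭 D where
  app X := 𝟙 X
  naturality _ _ f := (Category.comp_id f).trans (Category.id_comp f).symm

instance (n : SimplexCategory) : NatTrans.IsMonoidal (constEvaluation (D := D) n) where
  unit := by
    change (𝟙 (𝟙_ D) ≫ 𝟙 (𝟙_ D)) ≫ 𝟙 (𝟙_ D) = 𝟙 (𝟙_ D)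
    simp only [Category.comp_id]
  tensor X Y := by
    change (𝟙 (X ⊗ Y) ≫ 𝟙 (X ⊗ Y)) ≫ 𝟙 (X ⊗ Y) = (𝟙 X ⊗ₘ 𝟙 Y) ≫ 𝟙 (X ⊗ Y)
    rw [id_tensorHom_id, Category.comp_id]

/-- The levels of a diagonal. -/
def diagonalEvaluation (n : SimplexCategory) :
    diagonal ⋙ (evaluation SimplexCategory D).obj n ⟶
      (evaluation SimplexCategory (Cosimp D)).obj n ⋙ (evaluation SimplexCategory D).obj n where
  app X := 𝟙 ((X.obj n).obj n)
  naturality _ _ f := (Category.comp_id ((f.app n).app n)).trans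
    (Category.id_comp ((f.app n).app n)).symm

instance (n : SimplexCategory) : NatTrans.IsMonoidal (diagonalEvaluation (D := D) n) where
  unit := by
    change (𝟙 (𝟙_ D) ≫ 𝟙 (𝟙_ D)) ≫ 𝟙 (𝟙_ D) = 𝟙 (𝟙_ D) ≫ 𝟙 (𝟙_ D)
    simp only [Category.comp_id]
  tensor X Y := by
    change (𝟙 ((X.obj n).obj n ⊗ (Y.obj n).obj n) ≫ 𝟙 _) ≫ 𝟙 _ =
      (𝟙 ((X.obj n).obj n) ⊗ₘ 𝟙 ((Y.obj n).obj n)) ≫ 𝟙 _ ≫ 𝟙 _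
    simp only [id_tensorHom_id, Category.comp_id]

/-- The levels of an object-wise image. -/
def whiskeringEvaluation {K : Type u₃} [Category.{v₃} K] {A : Type u₁} [Category.{v₁} A]
    [MonoidalCategory A] (F : A ⥤ D) (k : K) :
    (Functor.whiskeringRight K _ _).obj F ⋙ (evaluation K D).obj k ⟶
      (evaluation K A).obj k ⋙ F where
  app X := 𝟙 (F.obj (X.obj k))
  naturality _ _ f := (Category.comp_id (F.map (f.app k))).trans
    (Category.id_comp (F.map (f.app k))).symm

instance {K : Type u₃} [Category.{v₃} K] {A : Type u₁} [Category.{v₁} A]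
    [MonoidalCategory A] (F : A ⥤ D) [F.LaxMonoidal] (k : K) :
    NatTrans.IsMonoidal (whiskeringEvaluation F k) where
  unit := by
    change (𝟙 (𝟙_ D) ≫ ε F) ≫ 𝟙 _ = ε F ≫ F.map (𝟙 _)
    rw [Category.comp_id, Category.id_comp, F.map_id, Category.comp_id]
  tensor X Y := by
    change (𝟙 (F.obj (X.obj k) ⊗ F.obj (Y.obj k)) ≫ μ F (X.obj k) (Y.obj k)) ≫ 𝟙 _ =
      (𝟙 (F.obj (X.obj k)) ⊗ₘ 𝟙 (F.obj (Y.obj k))) ≫ μ F (X.obj k) (Y.obj k) ≫ F.map (𝟙 _)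
    rw [id_tensorHom_id, Category.comp_id, Category.id_comp, Category.id_comp, F.map_id,
      Category.comp_id]

variable (𝒮) in
/-- The simple functor on cosimplicial structures. -/
noncomputable def simpleStr (s : Cosimp D ⥤ D) [s.LaxMonoidal] : Cosimp (Str 𝒮 D) ⥤ Str 𝒮 D :=
  levelFunctor 𝒮 SimplexCategory D ⋙ Str.mapFunctor 𝒮 s

/-- The morphism is the identity in every degree, but its source carries the image of the operations
under the constant functor and its target the level-wise operations. They agree because evaluating a
constant object is, monoidally, the identity. -/
theorem isHom_constComparisonInv (M : Str 𝒮 D) :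
    IsHom (M.ops.map (Functor.const SimplexCategory))
      (levelOps ((Functor.const SimplexCategory).obj M))
      fun s => constComparisonInv (Str.eval s) M :=
  IsHom.of_evaluation fun n => by
    have h := isHom_of_isMonoidal (constEvaluation (D := D) n) M.ops
    rw [Ops.map_comp] at h
    have e : M.ops.map (𝟭 D) = (levelOps ((Functor.const SimplexCategory).obj M)).map
      ((evaluation SimplexCategory D).obj n) :=
      (Ops.map_id M.ops).trans (levelOps_map ((Functor.const SimplexCategory).obj M) n).symm
    rw [e] at h
    exact h

theorem isHom_diagonalComparisonInv (Z : Cosimp (Cosimp (Str 𝒮 D))) :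
    IsHom ((levelOps (Z ⋙ levelFunctor 𝒮 SimplexCategory D)).map diagonal)
      (levelOps (diagonal.obj Z)) fun s => diagonalComparisonInv (Str.eval s) Z :=
  IsHom.of_evaluation fun n => by
    have h := isHom_of_isMonoidal (diagonalEvaluation (D := D) n)
      (levelOps (Z ⋙ levelFunctor 𝒮 SimplexCategory D))
    rw [Ops.map_comp, Ops.map_comp, levelOps_map] at h
    have e : (levelOps (Z.obj n)).map ((evaluation SimplexCategory D).obj n) =
      (levelOps (diagonal.obj Z)).map ((evaluation SimplexCategory D).obj n) :=
      (levelOps_map (Z.obj n) n).trans (levelOps_map (diagonal.obj Z) n).symm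
    exact e ▸ h

/-- Applying `F` to each structure of a diagram, or to the diagram as a structure in functors, gives
the same operations; evaluations show this, being compatible with `F` as monoidal functors. -/
theorem isHom_whiskeringEvaluation {A : Type u₁} [Category.{v₁} A] [MonoidalCategory A]
    {K : Type u₃} [Category.{v₃} K] (F : A ⥤ D) [F.LaxMonoidal] (G : K ⥤ Str 𝒮 A) :
    IsHom (levelOps (G ⋙ Str.mapFunctor 𝒮 F))
      ((levelOps G).map ((Functor.whiskeringRight K _ _).obj F)) fun _ => 𝟙 _ :=
  (IsHom.inv (φ := fun _ => Iso.refl _) <| IsHom.of_evaluation fun k => by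
    have h := isHom_of_isMonoidal (whiskeringEvaluation F k) (levelOps G)
    rw [Ops.map_comp, Ops.map_comp, levelOps_map] at h
    have e : (G.obj k).ops.map F =
      (levelOps (G ⋙ Str.mapFunctor 𝒮 F)).map ((evaluation K D).obj k) :=
      (levelOps_map (G ⋙ Str.mapFunctor 𝒮 F) k).symm
    exact e ▸ h)

section Transformations
variable {s : Cosimp D ⥤ D} [s.LaxMonoidal]

/-- The transformation `λ` for structures. -/
noncomputable def lamStr (lam : 𝟭 D ⟶ Functor.const SimplexCategory ⋙ s)
    [NatTrans.IsMonoidal lam] :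
    𝟭 (Str 𝒮 D) ⟶ Functor.const SimplexCategory ⋙ simpleStr 𝒮 s where
  app M := ⟨fun t => lam.app (M.obj t) ≫ s.map (constComparisonInv (Str.eval t) M), by
    have h := isHom_of_isMonoidal lam M.ops
    rw [Ops.map_comp, Ops.map_id] at h
    exact h.comp ((isHom_constComparisonInv M).map s)⟩
  naturality M N f := Str.Hom.ext (funext fun t => by
    have key {X Y : D} {X' Y' : Cosimp D} {f : X ⟶ Y} {c : (Functor.const _).obj X ⟶ X'}
        {c' : (Functor.const _).obj Y ⟶ Y'} {f' : X' ⟶ Y'}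
        (h : c ≫ f' = (Functor.const _).map f ≫ c') :
        f ≫ lam.app Y ≫ s.map c' = (lam.app X ≫ s.map c) ≫ s.map f' := by
      have e := lam.naturality f
      simp only [Functor.id_map, Functor.comp_map] at e
      rw [reassoc_of% e, ← s.map_comp, ← h, s.map_comp, Category.assoc]
    exact key (NatTrans.ext (funext fun n => (Category.id_comp (f.app t)).trans
      (Category.comp_id (f.app t)).symm)))

/-- The transformation `μ` for structures. -/
noncomputable def muStr
    (mu : (Functor.whiskeringRight SimplexCategory _ _).obj s ⋙ s ⟶ diagonal ⋙ s)
    [NatTrans.IsMonoidal mu] :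
    (Functor.whiskeringRight SimplexCategory _ _).obj (simpleStr 𝒮 s) ⋙ simpleStr 𝒮 s ⟶
      diagonal ⋙ simpleStr 𝒮 s where
  app Z := ⟨fun t => mu.app (Z ⋙ (Functor.whiskeringRight SimplexCategory _ _).obj (Str.eval t)) ≫
      s.map (diagonalComparisonInv (Str.eval t) Z), by
    have h := isHom_of_isMonoidal mu (levelOps (Z ⋙ levelFunctor 𝒮 SimplexCategory D))
    rw [Ops.map_comp, Ops.map_comp] at h
    -- The double simple takes simples of structures level by level, while `h` concerns the image
    -- under the object-wise simple. The identity is a homomorphism between the two and drops out of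
    -- the composite.
    have h' := (isHom_whiskeringEvaluation s (Z ⋙ levelFunctor 𝒮 SimplexCategory D)).map s
    refine ((h'.comp h).comp ((isHom_diagonalComparisonInv Z).map s)).congr fun t => ?_
    have key {X Y : Cosimp D} {W : D} (e : X = Y) (a : s.obj X ⟶ W) :
        s.map (𝟙 X) ≫ a = a := by
      rw [s.map_id, Category.id_comp]
    exact congrArg (· ≫ _) (key rfl _)⟩
  naturality Z Z' f := Str.Hom.ext (funext fun t => by
    have key {X Y : Cosimp (Cosimp D)} {X' Y' : Cosimp D} {f : X ⟶ Y} {c : diagonal.obj X ⟶ X'}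
        {c' : diagonal.obj Y ⟶ Y'} {f' : X' ⟶ Y'} (h : c ≫ f' = diagonal.map f ≫ c') :
        s.map (Functor.whiskerRight f s) ≫ mu.app Y ≫ s.map c' =
          (mu.app X ≫ s.map c) ≫ s.map f' := by
      have e := mu.naturality f
      simp only [Functor.comp_map, Functor.whiskeringRight_obj_map] at e
      rw [reassoc_of% e, ← s.map_comp, ← h, s.map_comp, Category.assoc]
    exact key (f := Functor.whiskerRight f ((Functor.whiskeringRight SimplexCategory _ _).obj
      (Str.eval t))) (NatTrans.ext (funext fun n =>
      (Category.id_comp (((f.app n).app n).app t)).trans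
        (Category.comp_id (((f.app n).app n).app t)).symm)))

end Transformations

end Simple

/-! ### Limits and filtered colimits as lax symmetric monoidal functors. -/

section Lim
variable {K : Type w} [SmallCategory K] {D : Type u} [Category.{v} D] [MonoidalCategory D]
  [HasLimitsOfShape K D]

noncomputable instance limLaxBraided [BraidedCategory D] : (lim : (K ⥤ D) ⥤ D).LaxBraided where
  braided X Y := by
    refine limit.hom_ext fun k => ?_
    have h₁ : (lim : (K ⥤ D) ⥤ D).map (β_ X Y).hom ≫ limit.π (Y ⊗ X) k =
        limit.π (X ⊗ Y) k ≫ (β_ (X.obj k) (Y.obj k)).hom := limMap_π _ _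
    have key {P Q R S T V : D} {m : P ⟶ Q} {b : Q ⟶ R} {π : R ⟶ S} {π' : Q ⟶ T} {b' : T ⟶ S}
        {b'' : P ⟶ V} {m' : V ⟶ R} {z : P ⟶ T} {z' : V ⟶ S} (h₁ : b ≫ π = π' ≫ b')
        (h₂ : m ≫ π' = z) (h₃ : m' ≫ π = z') (h₄ : z ≫ b' = b'' ≫ z') :
        (m ≫ b) ≫ π = (b'' ≫ m') ≫ π := by
      rw [Category.assoc, h₁, reassoc_of% h₂, h₄, Category.assoc, h₃]
    exact key h₁ (lim_μ_π X Y k) (lim_μ_π Y X k) (BraidedCategory.braiding_naturality _ _)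

/-- The projections of limits. -/
noncomputable def limProj (k : K) : lim ⟶ (evaluation K D).obj k where
  app X := limit.π X k
  naturality _ _ f := limMap_π f k

instance (k : K) : NatTrans.IsMonoidal (limProj (D := D) k) where
  unit := lim_ε_π k
  tensor X Y := (lim_μ_π X Y k).trans (Category.comp_id _).symm

end Lim

section Colim
variable {K : Type u₁} [Category.{v₁} K] [IsFiltered K] {D : Type u} [Category.{v} D]
  [MonoidalCategory D] [HasColimitsOfShape K D]

/-- The unit constraint of the colimit functor. -/
noncomputable def colimEps : 𝟙_ D ⟶ colimit (𝟙_ (K ⥤ D)) :=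
  colimit.ι (𝟙_ (K ⥤ D)) (Classical.choice IsFiltered.nonempty)

/-- The transition maps of the constant diagram are identities and any two indices have a common
upper bound, so the chosen index is irrelevant. -/
theorem colimEps_eq (k : K) : colimEps (D := D) = colimit.ι (𝟙_ (K ⥤ D)) k := by
  let j : K := Classical.choice IsFiltered.nonempty
  have h {l : K} (f : k ⟶ l) : colimit.ι (𝟙_ (K ⥤ D)) k = colimit.ι (𝟙_ (K ⥤ D)) l :=
    (colimit.w (𝟙_ (K ⥤ D)) f).symm.trans (Category.id_comp _)
  have h' {l : K} (f : j ⟶ l) : colimit.ι (𝟙_ (K ⥤ D)) j = colimit.ι (𝟙_ (K ⥤ D)) l :=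
    (colimit.w (𝟙_ (K ⥤ D)) f).symm.trans (Category.id_comp _)
  exact (h' (IsFiltered.leftToMax j k)).trans (h (IsFiltered.rightToMax j k)).symm

theorem isIso_colimEps : IsIso (colimEps (K := K) (D := D)) := by
  have := IsFiltered.isConnected K
  let k : K := Classical.choice IsFiltered.nonempty
  let d : colimit (𝟙_ (K ⥤ D)) ⟶ 𝟙_ D := colimit.desc (𝟙_ (K ⥤ D))
    { pt := 𝟙_ D, ι := { app := fun _ => 𝟙 (𝟙_ D) } }
  have hd (k : K) : colimit.ι (𝟙_ (K ⥤ D)) k ≫ d = 𝟙 (𝟙_ D) := colimit.ι_desc _ _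
  refine ⟨d, by rw [colimEps_eq k]; exact hd k, colimit.hom_ext fun k => ?_⟩
  have key {P Q : D} {i e : P ⟶ Q} {d : Q ⟶ P} (h : i ≫ d = 𝟙 P) (h' : e = i) :
      i ≫ d ≫ e = i ≫ 𝟙 Q := by
    rw [reassoc_of% h, h', Category.comp_id]
  exact key (hd k) (colimEps_eq k)

variable [∀ A : D, PreservesColimitsOfShape K (tensorLeft A)]
  [∀ A : D, PreservesColimitsOfShape K (tensorRight A)]

/-- Filtered colimits commute with tensor products. -/
noncomputable def isColimitTensor {X Y : K ⥤ D} {c : Cocone X} {c' : Cocone Y} (hc : IsColimit c)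
    (hc' : IsColimit c') : IsColimit (c.tensor c') := by
  -- A filtered category is sifted, so the colimit of the diagonal diagram of tensor products
  -- computes the colimit in two variables, in each of which the tensor product preserves colimits.
  have : IsSifted K := IsFiltered.isSifted
  have : PreservesColimit₂ X Y (curriedTensor D) := by
    have (A : D) : PreservesColimit Y ((curriedTensor D).obj A) :=
      inferInstanceAs (PreservesColimit Y (tensorLeft A))
    have (A : D) : PreservesColimit X ((curriedTensor D).flip.obj A) :=
      inferInstanceAs (PreservesColimit X (tensorRight A))
    infer_instance
  exact IsColimit.tensor hc hc'

theorem colimit_tensor_hom_ext {X Y : K ⥤ D} {Z : D} {f g : colimit X ⊗ colimit Y ⟶ Z}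
    (h : ∀ k, (colimit.ι X k ⊗ₘ colimit.ι Y k) ≫ f = (colimit.ι X k ⊗ₘ colimit.ι Y k) ≫ g) :
    f = g :=
  (isColimitTensor (colimit.isColimit X) (colimit.isColimit Y)).hom_ext h

theorem colimit_tensor_hom_ext₃ {X Y Z : K ⥤ D} {W : D}
    {f g : (colimit X ⊗ colimit Y) ⊗ colimit Z ⟶ W}
    (h : ∀ k, ((colimit.ι X k ⊗ₘ colimit.ι Y k) ⊗ₘ colimit.ι Z k) ≫ f =
      ((colimit.ι X k ⊗ₘ colimit.ι Y k) ⊗ₘ colimit.ι Z k) ≫ g) : f = g :=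
  (isColimitTensor (isColimitTensor (colimit.isColimit X) (colimit.isColimit Y))
    (colimit.isColimit Z)).hom_ext h

/-- The tensor constraint of the colimit functor. -/
noncomputable def colimMu (X Y : K ⥤ D) : colimit X ⊗ colimit Y ⟶ colimit (X ⊗ Y) :=
  (isColimitTensor (colimit.isColimit X) (colimit.isColimit Y)).desc (colimit.cocone (X ⊗ Y))

theorem colimMu_ι (X Y : K ⥤ D) (k : K) :
    (colimit.ι X k ⊗ₘ colimit.ι Y k) ≫ colimMu X Y = colimit.ι (X ⊗ Y) k :=
  (isColimitTensor (colimit.isColimit X) (colimit.isColimit Y)).fac _ k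

theorem isIso_colimMu (X Y : K ⥤ D) : IsIso (colimMu X Y) :=
  (IsColimit.coconePointUniqueUpToIso
    (isColimitTensor (colimit.isColimit X) (colimit.isColimit Y))
    (colimit.isColimit (X ⊗ Y))).isIso_hom

theorem ι_colim_map {X Y : K ⥤ D} (f : X ⟶ Y) (k : K) :
    colimit.ι X k ≫ (colim : (K ⥤ D) ⥤ D).map f = f.app k ≫ colimit.ι Y k :=
  ι_colimMap f k

theorem colim_natural_chase {X X' Y Y' Z Z' P Q R S : D} {x : X ⟶ X'} {y : Y ⟶ Y'}
    {F : X' ⟶ P} {G : Y' ⟶ Q} {M : P ⊗ Q ⟶ R} {M' : X' ⊗ Y' ⟶ S} {H : S ⟶ R} {f : X ⟶ Z}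
    {g : Y ⟶ Z'} {p : Z ⟶ P} {q : Z' ⟶ Q} {z : Z ⊗ Z' ⟶ R} {z' : X ⊗ Y ⟶ S}
    (h₁ : x ≫ F = f ≫ p) (h₂ : y ≫ G = g ≫ q) (h₃ : (p ⊗ₘ q) ≫ M = z)
    (h₄ : (x ⊗ₘ y) ≫ M' = z') (h₅ : z' ≫ H = (f ⊗ₘ g) ≫ z) :
    (x ⊗ₘ y) ≫ (F ⊗ₘ G) ≫ M = (x ⊗ₘ y) ≫ M' ≫ H := by
  rw [reassoc_of% h₄, tensorHom_comp_tensorHom_assoc, h₁, h₂, ← tensorHom_comp_tensorHom_assoc, h₃,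
    h₅]

theorem colim_associativity_chase {X Y Z X' Y' Z' P Q R T : D} {x : X ⟶ X'} {y : Y ⟶ Y'}
    {z : Z ⟶ Z'} {m : X' ⊗ Y' ⟶ P} {m' : P ⊗ Z' ⟶ Q} {a : Q ⟶ T} {n : Y' ⊗ Z' ⟶ R}
    {n' : X' ⊗ R ⟶ T} {p : X ⊗ Y ⟶ P} {q : (X ⊗ Y) ⊗ Z ⟶ Q} {r : Y ⊗ Z ⟶ R}
    {t : X ⊗ (Y ⊗ Z) ⟶ T} (h₁ : (x ⊗ₘ y) ≫ m = p) (h₂ : (p ⊗ₘ z) ≫ m' = q)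
    (h₃ : q ≫ a = (α_ X Y Z).hom ≫ t) (h₄ : (y ⊗ₘ z) ≫ n = r) (h₅ : (x ⊗ₘ r) ≫ n' = t) :
    ((x ⊗ₘ y) ⊗ₘ z) ≫ (m ⊗ₘ 𝟙 Z') ≫ m' ≫ a =
      ((x ⊗ₘ y) ⊗ₘ z) ≫ (α_ X' Y' Z').hom ≫ (𝟙 X' ⊗ₘ n) ≫ n' := by
  rw [tensorHom_comp_tensorHom_assoc, h₁, Category.comp_id, reassoc_of% h₂, h₃,
    associator_naturality_assoc, tensorHom_comp_tensorHom_assoc, h₄, Category.comp_id, h₅]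

theorem colim_left_unitality_chase {X X' P Q : D} {x : X ⟶ X'} {e : 𝟙_ D ⟶ P} {m : P ⊗ X' ⟶ Q}
    {l : Q ⟶ X'} {q : 𝟙_ D ⊗ X ⟶ Q} (h : (e ⊗ₘ x) ≫ m = q) (h' : q ≫ l = (λ_ X).hom ≫ x) :
    x ≫ (λ_ X').inv ≫ (λ_ X').hom = x ≫ (λ_ X').inv ≫ (e ⊗ₘ 𝟙 X') ≫ m ≫ l := by
  rw [Iso.inv_hom_id, Category.comp_id, leftUnitor_inv_naturality_assoc, ← id_tensorHom,
    tensorHom_comp_tensorHom_assoc, Category.comp_id, Category.id_comp, reassoc_of% h, h',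
    Iso.inv_hom_id_assoc]

theorem colim_right_unitality_chase {X X' P Q : D} {x : X ⟶ X'} {e : 𝟙_ D ⟶ P} {m : X' ⊗ P ⟶ Q}
    {l : Q ⟶ X'} {q : X ⊗ 𝟙_ D ⟶ Q} (h : (x ⊗ₘ e) ≫ m = q) (h' : q ≫ l = (ρ_ X).hom ≫ x) :
    x ≫ (ρ_ X').inv ≫ (ρ_ X').hom = x ≫ (ρ_ X').inv ≫ (𝟙 X' ⊗ₘ e) ≫ m ≫ l := by
  rw [Iso.inv_hom_id, Category.comp_id, rightUnitor_inv_naturality_assoc, ← tensorHom_id,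
    tensorHom_comp_tensorHom_assoc, Category.comp_id, Category.id_comp, reassoc_of% h, h',
    Iso.inv_hom_id_assoc]

/-- The colimit functor of a filtered category is lax monoidal. -/
noncomputable instance colimLaxMonoidal : (colim : (K ⥤ D) ⥤ D).LaxMonoidal :=
  Functor.LaxMonoidal.ofTensorHom
    (ε := colimEps)
    (μ := colimMu)
    (μ_natural := fun {X Y X' Y'} f g => colimit_tensor_hom_ext fun k =>
      colim_natural_chase (ι_colim_map f k) (ι_colim_map g k) (colimMu_ι Y Y' k)
        (colimMu_ι X X' k) (ι_colim_map (f ⊗ₘ g) k))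
    (associativity := fun X Y Z => colimit_tensor_hom_ext₃ fun k =>
      colim_associativity_chase (colimMu_ι X Y k) (colimMu_ι (X ⊗ Y) Z k)
        (ι_colim_map (α_ X Y Z).hom k) (colimMu_ι Y Z k) (colimMu_ι X (Y ⊗ Z) k))
    (left_unitality := fun X => (cancel_epi (λ_ (colimit X)).inv).1 (colimit.hom_ext fun k =>
      colim_left_unitality_chase (by rw [colimEps_eq k]; exact colimMu_ι (𝟙_ _) X k)
        (ι_colim_map (λ_ X).hom k)))
    (right_unitality := fun X => (cancel_epi (ρ_ (colimit X)).inv).1 (colimit.hom_ext fun k =>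
      colim_right_unitality_chase (by rw [colimEps_eq k]; exact colimMu_ι X (𝟙_ _) k)
        (ι_colim_map (ρ_ X).hom k)))

noncomputable instance colimLaxBraided [BraidedCategory D] :
    (colim : (K ⥤ D) ⥤ D).LaxBraided where
  braided X Y := by
    have key {X Y X' Y' P Q : D} {x : X ⟶ X'} {y : Y ⟶ Y'} {m : X' ⊗ Y' ⟶ P} {b : P ⟶ Q}
        {m' : Y' ⊗ X' ⟶ Q} {p : X ⊗ Y ⟶ P} {q : Y ⊗ X ⟶ Q} (h₁ : (x ⊗ₘ y) ≫ m = p)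
        (h₂ : p ≫ b = (β_ X Y).hom ≫ q) (h₃ : (y ⊗ₘ x) ≫ m' = q) :
        (x ⊗ₘ y) ≫ m ≫ b = (x ⊗ₘ y) ≫ (β_ X' Y').hom ≫ m' := by
      rw [reassoc_of% h₁, h₂, BraidedCategory.braiding_naturality_assoc, h₃]
    exact colimit_tensor_hom_ext fun k => key (colimMu_ι X Y k) (ι_colim_map (β_ X Y).hom k)
      (colimMu_ι Y X k)

/-- The coprojections of colimits. -/
noncomputable def colimInj (k : K) : (evaluation K D).obj k ⟶ colim where
  app X := colimit.ι X k
  naturality _ _ f := (ι_colim_map f k).symm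

instance (k : K) : NatTrans.IsMonoidal (colimInj (D := D) k) where
  unit := (Category.id_comp _).trans (colimEps_eq k).symm
  tensor X Y := (Category.id_comp _).trans (colimMu_ι X Y k).symm

/-- The Künneth morphism of `colim` is invertible, so the tensor product of colimits is again a
colimit over the same index category. This provides the joint epimorphy on sources of operations
asked for in `IsHom.of_comp_epi`. -/
theorem colimit_kunneth_hom_ext (X : K ⥤ D) {n : ℕ} (Y : Fin n → K ⥤ D) {W : D}
    (f g : colimit X ⊗ tensorFin (fun i => colimit (Y i)) ⟶ W)
    (h : ∀ k, (colimit.ι X k ⊗ₘ tensorFinMap fun i => colimit.ι (Y i) k) ≫ f =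
      (colimit.ι X k ⊗ₘ tensorFinMap fun i => colimit.ι (Y i) k) ≫ g) : f = g := by
  have hk : IsIso (kunneth (colim : (K ⥤ D) ⥤ D) X Y) :=
    isIso_kunneth _ isIso_colimEps isIso_colimMu X Y
  refine (cancel_epi (inv (kunneth (colim : (K ⥤ D) ⥤ D) X Y))).1 (colimit.hom_ext fun k => ?_)
  have key {P Q R S : D} {t : P ⟶ Q} {m : Q ⟶ R} [IsIso m] {m' : P ⟶ S} [IsIso m'] {i : S ⟶ R}
      (e : t ≫ m = m' ≫ i) {f g : Q ⟶ W} (h : t ≫ f = t ≫ g) : i ≫ inv m ≫ f = i ≫ inv m ≫ g := by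
    have e' : i ≫ inv m = inv m' ≫ t := by
      rw [← cancel_epi m', ← reassoc_of% e, IsIso.hom_inv_id, IsIso.hom_inv_id_assoc,
        Category.comp_id]
    rw [reassoc_of% e', reassoc_of% e', h]
  exact key (kunneth_monoidal (colimInj (D := D) k) X Y) (h k)

end Colim

/-! ### Lifting the simple functor along a fully faithful functor. -/

section LiftSimple
variable {A : Type u₁} [Category.{v₁} A] {B : Type u₂} [Category.{v₂} B] (U : A ⥤ B) [U.Full]
  [U.Faithful] {s : Cosimp B ⥤ B} {S : Cosimp A → A} (e : ∀ X, U.obj (S X) ≅ s.obj (X ⋙ U))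

/-- The lift of a simple functor along a fully faithful functor. -/
noncomputable def liftSimple : Cosimp A ⥤ A where
  obj := S
  map {X Y} f := U.preimage ((e X).hom ≫ s.map (Functor.whiskerRight f U) ≫ (e Y).inv)
  map_id X := U.map_injective <| by
    rw [U.map_preimage, U.map_id, Functor.whiskerRight_id', s.map_id, Category.id_comp,
      Iso.hom_inv_id]
  map_comp f g := U.map_injective <| by
    rw [U.map_comp, U.map_preimage, U.map_preimage, U.map_preimage, Functor.whiskerRight_comp,
      s.map_comp, Category.assoc, Category.assoc, Category.assoc, Iso.inv_hom_id_assoc]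

/-- The lifted simple functor is computed through the fully faithful functor. -/
noncomputable def liftSimpleIso :
    liftSimple U e ⋙ U ≅ (Functor.whiskeringRight SimplexCategory _ _).obj U ⋙ s :=
  NatIso.ofComponents e fun {X Y} f => by
    have h : U.map ((liftSimple U e).map f) =
      (e X).hom ≫ s.map (Functor.whiskerRight f U) ≫ (e Y).inv := U.map_preimage _
    have key {P Q R S : B} {x : P ⟶ Q} {i : P ≅ R} {j : Q ≅ S} {y : R ⟶ S}
        (h : x = i.hom ≫ y ≫ j.inv) : x ≫ j.hom = i.hom ≫ y := by
      rw [h, Category.assoc, Category.assoc, Iso.inv_hom_id, Category.comp_id]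
    exact key h

/-- The lift of the transformation `λ` along a fully faithful functor. -/
noncomputable def liftLam (lam : 𝟭 B ⟶ Functor.const SimplexCategory ⋙ s) :
    𝟭 A ⟶ Functor.const SimplexCategory ⋙ liftSimple U e where
  app X := U.preimage (lam.app (U.obj X) ≫ s.map (constComparisonInv U X) ≫
    (e ((Functor.const SimplexCategory).obj X)).inv)
  naturality X Y f := U.map_injective <| by
    have h := (liftSimpleIso U e).inv.naturality ((Functor.const SimplexCategory).map f)
    have key {X Y P Q R S T V : B} {f : X ⟶ Y} {l' : Y ⟶ Q} {c' : Q ⟶ R} {i' : R ⟶ S} {l : X ⟶ P}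
        {c : P ⟶ T} {i : T ⟶ V} {g : V ⟶ S} {g' : T ⟶ R} {g'' : P ⟶ Q} (h : g' ≫ i' = i ≫ g)
        (h' : c ≫ g' = g'' ≫ c') (h'' : f ≫ l' = l ≫ g'') :
        f ≫ l' ≫ c' ≫ i' = (l ≫ c ≫ i) ≫ g := by
      rw [Category.assoc, Category.assoc, ← h, reassoc_of% h', reassoc_of% h'']
    rw [U.map_comp, U.map_comp, U.map_preimage, U.map_preimage]
    refine key h ((s.map_comp _ _).symm.trans ((congrArg s.map (NatTrans.ext (funext fun n => ?_))).trans
      (s.map_comp _ _))) (lam.naturality (U.map f))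
    exact (Category.id_comp (U.map f)).trans (Category.comp_id (U.map f)).symm

/-- The lift of the transformation `μ` along a fully faithful functor. -/
noncomputable def liftMu
    (mu : (Functor.whiskeringRight SimplexCategory _ _).obj s ⋙ s ⟶ diagonal ⋙ s) :
    (Functor.whiskeringRight SimplexCategory _ _).obj (liftSimple U e) ⋙ liftSimple U e ⟶
      diagonal ⋙ liftSimple U e where
  app Z := U.preimage ((e (Z ⋙ liftSimple U e)).hom ≫ s.map (Z.whiskerLeft (liftSimpleIso U e).hom) ≫
    mu.app (Z ⋙ (Functor.whiskeringRight SimplexCategory _ _).obj U) ≫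
      s.map (diagonalComparisonInv U Z) ≫ (e (diagonal.obj Z)).inv)
  naturality Z Z' f := U.map_injective <| by
    have h := (liftSimpleIso U e).inv.naturality (diagonal.map f)
    have h₁ := (liftSimpleIso U e).hom.naturality (Functor.whiskerRight f (liftSimple U e))
    have key {X₁ X₂ X₃ X₄ X₅ X₆ Y₁ Y₂ Y₃ Y₄ Y₅ Y₆ : B} {x₁ : X₁ ⟶ X₂} {x₂ : X₂ ⟶ X₃} {x₃ : X₃ ⟶ X₄}
        {x₄ : X₄ ⟶ X₅} {x₅ : X₅ ⟶ X₆} {y₁ : Y₁ ⟶ Y₂} {y₂ : Y₂ ⟶ Y₃} {y₃ : Y₃ ⟶ Y₄} {y₄ : Y₄ ⟶ Y₅}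
        {y₅ : Y₅ ⟶ Y₆} {f₁ : X₁ ⟶ Y₁} {f₂ : X₂ ⟶ Y₂} {f₃ : X₃ ⟶ Y₃} {f₄ : X₄ ⟶ Y₄} {f₅ : X₅ ⟶ Y₅}
        {f₆ : X₆ ⟶ Y₆} (h₁ : f₁ ≫ y₁ = x₁ ≫ f₂) (h₂ : x₂ ≫ f₃ = f₂ ≫ y₂) (h₃ : f₃ ≫ y₃ = x₃ ≫ f₄)
        (h₄ : x₄ ≫ f₅ = f₄ ≫ y₄) (h₅ : f₅ ≫ y₅ = x₅ ≫ f₆) :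
        f₁ ≫ y₁ ≫ y₂ ≫ y₃ ≫ y₄ ≫ y₅ = (x₁ ≫ x₂ ≫ x₃ ≫ x₄ ≫ x₅) ≫ f₆ := by
      rw [reassoc_of% h₁, ← reassoc_of% h₂, reassoc_of% h₃, ← reassoc_of% h₄, h₅]
      simp only [Category.assoc]
    rw [U.map_comp, U.map_comp, U.map_preimage, U.map_preimage]
    refine key h₁ ((s.map_comp _ _).symm.trans ((congrArg s.map (NatTrans.ext
      (funext fun n => ?_))).trans (s.map_comp _ _))) (mu.naturality
        (Functor.whiskerRight f ((Functor.whiskeringRight SimplexCategory _ _).obj U)))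
      ((s.map_comp _ _).symm.trans ((congrArg s.map (NatTrans.ext
      (funext fun n => ?_))).trans (s.map_comp _ _))) h
    · exact ((liftSimpleIso U e).hom.naturality (f.app n)).symm
    · exact (Category.id_comp (U.map ((f.app n).app n))).trans
        (Category.comp_id (U.map ((f.app n).app n))).symm

end LiftSimple

/-! ### Limits and filtered colimits of structures and of their subcategories. -/

section StrLimits
variable {𝒮 : Signature} {D : Type u} [Category.{v} D] [MonoidalCategory D]

/-- A cone of structures is a limit cone if it is so on underlying objects. -/
noncomputable def Str.isLimitOfEval {K : Type u₁} [Category.{v₁} K] {G : K ⥤ Str 𝒮 D} (c : Cone G)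
    (h : ∀ s, IsLimit ((Str.eval s).mapCone c)) : IsLimit c where
  lift t := ⟨fun s => (h s).lift ((Str.eval s).mapCone t),
    IsHom.of_comp_mono (fun k => (c.π.app k).isHom) (fun s _ _ _ e => (h s).hom_ext e)
      fun k => (t.π.app k).isHom.congr fun s => ((h s).fac ((Str.eval s).mapCone t) k).symm⟩
  fac t k := Str.Hom.ext (funext fun s => (h s).fac ((Str.eval s).mapCone t) k)
  uniq t _ hm := Str.Hom.ext (funext fun s => (h s).uniq ((Str.eval s).mapCone t) _ fun k =>
    congrArg (fun f => Str.Hom.app f s) (hm k))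

section
variable {K : Type w} [SmallCategory K] [HasLimitsOfShape K D] (G : K ⥤ Str 𝒮 D)

theorem isHom_limProj (k : K) :
    IsHom ((levelOps G).map (lim : (K ⥤ D) ⥤ D)) (G.obj k).ops fun s =>
      limit.π (G ⋙ Str.eval s) k := by
  have h := isHom_of_isMonoidal (limProj (D := D) k) (levelOps G)
  rw [levelOps_map] at h
  exact h

/-- Limits of structures are computed on underlying objects. -/
noncomputable def Str.limitCone : Cone G where
  pt := (Str.mapFunctor 𝒮 lim).obj ((levelFunctor 𝒮 K D).obj G)
  π :=
    { app := fun k => ⟨_, isHom_limProj G k⟩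
      naturality := fun _ _ f => Str.Hom.ext (funext fun s =>
        (Category.id_comp _).trans (limit.w (G ⋙ Str.eval s) f).symm) }

noncomputable def Str.isLimitEvalLimitCone (s : 𝒮.sort) :
    IsLimit ((Str.eval s).mapCone (Str.limitCone G)) :=
  IsLimit.ofIsoLimit (limit.isLimit (G ⋙ Str.eval s)) (Cone.ext (Iso.refl _) fun _ =>
    (Category.id_comp _).symm)

noncomputable def Str.isLimitLimitCone : IsLimit (Str.limitCone G) :=
  Str.isLimitOfEval _ (Str.isLimitEvalLimitCone G)

end

section
variable {K : Type u₁} [Category.{v₁} K] [IsFiltered K] [HasColimitsOfShape K D]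
  [∀ A : D, PreservesColimitsOfShape K (tensorLeft A)]
  [∀ A : D, PreservesColimitsOfShape K (tensorRight A)] (G : K ⥤ Str 𝒮 D)

theorem isHom_colimInj (k : K) :
    IsHom (G.obj k).ops ((levelOps G).map (colim : (K ⥤ D) ⥤ D)) fun s =>
      colimit.ι (G ⋙ Str.eval s) k := by
  have h := isHom_of_isMonoidal (colimInj (D := D) k) (levelOps G)
  rw [levelOps_map] at h
  exact h

theorem IsHom.of_colimit {Y : 𝒮.sort → D} {o : Ops 𝒮 Y}
    {φ : ∀ s, colimit (G ⋙ Str.eval s) ⟶ Y s}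
    (h : ∀ k, IsHom (G.obj k).ops o fun s => colimit.ι (G ⋙ Str.eval s) k ≫ φ s) :
    IsHom ((levelOps G).map (colim : (K ⥤ D) ⥤ D)) o φ := by
  have : Nonempty K := IsFiltered.nonempty
  exact IsHom.of_comp_epi (isHom_colimInj G) (fun s _ _ _ e => colimit.hom_ext e)
    (fun a _ f g e => colimit_kunneth_hom_ext (G ⋙ Str.eval (𝒮.opHead a))
      (fun i => G ⋙ Str.eval (𝒮.opArg a i)) f g e) h

/-- Filtered colimits of structures are computed on underlying objects. -/
noncomputable def Str.colimitCocone : Cocone G where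
  pt := (Str.mapFunctor 𝒮 colim).obj ((levelFunctor 𝒮 K D).obj G)
  ι :=
    { app := fun k => ⟨_, isHom_colimInj G k⟩
      naturality := fun _ _ f => Str.Hom.ext (funext fun s =>
        (colimit.w (G ⋙ Str.eval s) f).trans (Category.comp_id _).symm) }

noncomputable def Str.isColimitEvalColimitCocone (s : 𝒮.sort) :
    IsColimit ((Str.eval s).mapCocone (Str.colimitCocone G)) :=
  IsColimit.ofIsoColimit (colimit.isColimit (G ⋙ Str.eval s)) (Cocone.ext (Iso.refl _) fun _ =>
    Category.comp_id _)

noncomputable def Str.isColimitColimitCocone : IsColimit (Str.colimitCocone G) where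
  desc t := ⟨fun s => colimit.desc (G ⋙ Str.eval s) ((Str.eval s).mapCocone t),
    IsHom.of_colimit G fun k => (t.ι.app k).isHom.congr fun s =>
      (colimit.ι_desc ((Str.eval s).mapCocone t) k).symm⟩
  fac t k := Str.Hom.ext (funext fun s => colimit.ι_desc ((Str.eval s).mapCocone t) k)
  uniq t _ hm := Str.Hom.ext (funext fun s => colimit.hom_ext fun k =>
    (congrArg (fun f => Str.Hom.app f s) (hm k)).trans
      (colimit.ι_desc ((Str.eval s).mapCocone t) k).symm)

end

/-- The image of a fully faithful functor to structures is closed under limits, colimits and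
the other constructions given by lax symmetric monoidal functors, for diagrams of shape `K`. -/
def LaxClosed {A : Type u₂} [Category.{v₂} A] [BraidedCategory D] (U : A ⥤ Str 𝒮 D) (K : Type u₁)
    [Category.{v₁} K] : Prop :=
  ∀ (Φ : (K ⥤ D) ⥤ D) [Φ.LaxBraided] (G : K ⥤ A),
    ∃ a : A, Nonempty (U.obj a ≅ (Str.mapFunctor 𝒮 Φ).obj ((levelFunctor 𝒮 K D).obj (G ⋙ U)))

variable {A : Type u₂} [Category.{v₂} A] [BraidedCategory D] (U : A ⥤ Str 𝒮 D) [U.Full]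
  [U.Faithful]

/-- The limit of a diagram of structures is its image under the lax symmetric monoidal functor
`lim`, so it lies in the image of the fully faithful functor `U`, which therefore creates it. -/
theorem hasLimitsOfShape_of_laxClosed {K : Type w} [SmallCategory K] [HasLimitsOfShape K D]
    (hU : LaxClosed U K) :
    HasLimitsOfShape K A ∧ ∀ s, PreservesLimitsOfShape K (U ⋙ Str.eval s) := by
  have h (G : K ⥤ A) : Nonempty (CreatesLimit G U) :=
    have ⟨a, ⟨i⟩⟩ := hU lim G
    ⟨createsLimitOfFullyFaithfulOfIso' (Str.isLimitLimitCone (G ⋙ U)) a i⟩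
  have h' (G : K ⥤ A) : HasLimit (G ⋙ U) := ⟨⟨_, Str.isLimitLimitCone (G ⋙ U)⟩⟩
  refine ⟨⟨fun G => ?_⟩, fun s => ⟨fun {G} => ?_⟩⟩
  · have := (h G).some
    exact hasLimit_of_created G U
  · have := (h G).some
    have : PreservesLimit (G ⋙ U) (Str.eval s) :=
      preservesLimit_of_preserves_limit_cone (Str.isLimitLimitCone (G ⋙ U))
        (Str.isLimitEvalLimitCone (G ⋙ U) s)
    infer_instance

/-- The same with `colim`, which is lax symmetric monoidal because the tensor product preserves
filtered colimits in each variable. -/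
theorem hasColimitsOfShape_of_laxClosed {K : Type u₁} [Category.{v₁} K] [IsFiltered K]
    [HasColimitsOfShape K D] [∀ A : D, PreservesColimitsOfShape K (tensorLeft A)]
    [∀ A : D, PreservesColimitsOfShape K (tensorRight A)] (hU : LaxClosed U K) :
    HasColimitsOfShape K A ∧ ∀ s, PreservesColimitsOfShape K (U ⋙ Str.eval s) := by
  have h (G : K ⥤ A) : Nonempty (CreatesColimit G U) :=
    have ⟨a, ⟨i⟩⟩ := hU colim G
    ⟨createsColimitOfFullyFaithfulOfIso' (Str.isColimitColimitCocone (G ⋙ U)) a i⟩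
  have h' (G : K ⥤ A) : HasColimit (G ⋙ U) := ⟨⟨_, Str.isColimitColimitCocone (G ⋙ U)⟩⟩
  refine ⟨⟨fun G => ?_⟩, fun s => ⟨fun {G} => ?_⟩⟩
  · have := (h G).some
    exact hasColimit_of_created G U
  · have := (h G).some
    have : PreservesColimit (G ⋙ U) (Str.eval s) :=
      preservesColimit_of_preserves_colimit_cocone (Str.isColimitColimitCocone (G ⋙ U))
        (Str.isColimitEvalColimitCocone (G ⋙ U) s)
    infer_instance

theorem forgetfulFamily_of_laxClosed [HasProducts.{w} D] [HasFilteredColimitsOfSize.{w, w} D]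
    (hD : ∀ A : D, PreservesFilteredColimitsOfSize.{w, w} (tensorLeft A))
    (hU : ∀ (K : Type w) [SmallCategory K], LaxClosed U K) :
    ForgetfulFamily.{w} fun s => U ⋙ Str.eval s := by
  have h₁ (I : Type w) := hasLimitsOfShape_of_laxClosed U (hU (Discrete I))
  -- The assumption only concerns tensoring on the left; the braiding supplies the other side.
  have hR (A : D) : PreservesFilteredColimitsOfSize.{w, w} (tensorRight A) :=
    have := hD A
    ⟨fun K _ _ => preservesColimitsOfShape_of_natIso (BraidedCategory.tensorLeftIsoTensorRight A)⟩
  have h₂ (K : Type w) [SmallCategory K] [IsFiltered K] := hasColimitsOfShape_of_laxClosed U (hU K)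
  exact
    { hasProducts := fun I => (h₁ I).1
      hasFilteredColimits := ⟨fun K _ _ => (h₂ K).1⟩
      preservesProducts := fun s I => (h₁ I).2 s
      preservesFilteredColimits := fun s => ⟨fun K _ _ => (h₂ K).2 s⟩
      hom_ext := fun X Y f g h => U.map_injective (Str.hom_ext _ _ h)
      isLimit := fun c h => ⟨isLimitOfReflects U
        (Str.isLimitOfEval (U.mapCone c) fun s => (h s).some)⟩ }

end StrLimits

section DescentData
variable {𝒮 : Signature} {D : Type u} [Category.{v} D] [MonoidalCategory D]
  {s : Cosimp D ⥤ D} [s.LaxMonoidal] {A : Type u₁} [Category.{v₁} A] (U : A ⥤ Str 𝒮 D)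
  [U.Full] [U.Faithful] {S : Cosimp A → A} (e : ∀ X, U.obj (S X) ≅ (simpleStr 𝒮 s).obj (X ⋙ U))

/-- The simple functor lifted to structures is computed on underlying objects. -/
noncomputable def simpleEvalIso (t : 𝒮.sort) :
    liftSimple U e ⋙ U ⋙ Str.eval t ≅
      (Functor.whiskeringRight SimplexCategory _ _).obj (U ⋙ Str.eval t) ⋙ s :=
  NatIso.ofComponents (fun X => (Str.eval t).mapIso (e X)) fun f =>
    congrArg (fun g => Str.Hom.app g t) ((liftSimpleIso U e).hom.naturality f)

/-- The lift of λ consists of λ, identities of constant objects, and the inverse of `e`; the latter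
two cancel against the comparisons on the left-hand side. -/
theorem liftLam_eval (lam : 𝟭 D ⟶ Functor.const SimplexCategory ⋙ s) [NatTrans.IsMonoidal lam]
    (t : 𝒮.sort) (X : A) :
    (U ⋙ Str.eval t).map ((liftLam U e (lamStr lam)).app X) ≫
      (simpleEvalIso U e t).hom.app ((Functor.const SimplexCategory).obj X) ≫
        s.map (constComparison (U ⋙ Str.eval t) X) = lam.app ((U ⋙ Str.eval t).obj X) := by
  have h : U.map ((liftLam U e (lamStr lam)).app X) = (lamStr lam).app (U.obj X) ≫
    (simpleStr 𝒮 s).map (constComparisonInv U X) ≫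
      (e ((Functor.const SimplexCategory).obj X)).inv := U.map_preimage _
  have h' := congrArg (fun g => Str.Hom.app g t) h
  have key {P Q : D} {X Y Z : Cosimp D} {u : P ⟶ Q} {l : P ⟶ s.obj X} {c : X ⟶ Y}
      {c' : Y ⟶ Z} {i : s.obj Z ⟶ Q} {j : Q ⟶ s.obj Z} {c'' : Z ⟶ X}
      (h : u = (l ≫ s.map c) ≫ s.map c' ≫ i) (hi : i ≫ j = 𝟙 _) (hc : c ≫ c' ≫ c'' = 𝟙 X) :
      u ≫ j ≫ s.map c'' = l := by
    rw [h, Category.assoc, Category.assoc, Category.assoc, reassoc_of% hi, ← s.map_comp,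
      ← s.map_comp, hc, s.map_id, Category.comp_id]
  refine key h'
    (congrArg (fun g => Str.Hom.app g t) (e ((Functor.const SimplexCategory).obj X)).inv_hom_id)
    (NatTrans.ext (funext fun n => ?_))
  exact (Category.id_comp _).trans (Category.id_comp _)

theorem liftMu_eval
    (mu : (Functor.whiskeringRight SimplexCategory _ _).obj s ⋙ s ⟶ diagonal ⋙ s)
    [NatTrans.IsMonoidal mu] (t : 𝒮.sort) (Z : Cosimp (Cosimp A)) :
    (U ⋙ Str.eval t).map ((liftMu U e (muStr mu)).app Z) ≫
      (simpleEvalIso U e t).hom.app (diagonal.obj Z) ≫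
        s.map (diagonalComparison (U ⋙ Str.eval t) Z) =
      (simpleEvalIso U e t).hom.app (Z ⋙ liftSimple U e) ≫
        s.map (Z.whiskerLeft (simpleEvalIso U e t).hom) ≫
          mu.app (Z ⋙ (Functor.whiskeringRight SimplexCategory _ _).obj (U ⋙ Str.eval t)) := by
  have h : U.map ((liftMu U e (muStr mu)).app Z) = (e (Z ⋙ liftSimple U e)).hom ≫
      (simpleStr 𝒮 s).map (Z.whiskerLeft (liftSimpleIso U e).hom) ≫
        (muStr mu).app (Z ⋙ (Functor.whiskeringRight SimplexCategory _ _).obj U) ≫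
          (simpleStr 𝒮 s).map (diagonalComparisonInv U Z) ≫ (e (diagonal.obj Z)).inv :=
    U.map_preimage _
  have h' := congrArg (fun g => Str.Hom.app g t) h
  have key {P Q R V : D} {X Y Z : Cosimp D} {u : P ⟶ V} {a : P ⟶ Q} {b : Q ⟶ R} {m : R ⟶ s.obj X}
      {c : X ⟶ Y} {c' : Y ⟶ Z} {i : s.obj Z ⟶ V} {j : V ⟶ s.obj Z} {c'' : Z ⟶ X}
      (h : u = a ≫ b ≫ (m ≫ s.map c) ≫ s.map c' ≫ i) (hi : i ≫ j = 𝟙 _)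
      (hc : c ≫ c' ≫ c'' = 𝟙 X) : u ≫ j ≫ s.map c'' = a ≫ b ≫ m := by
    rw [h]
    simp only [Category.assoc]
    rw [reassoc_of% hi, ← s.map_comp, ← s.map_comp, hc, s.map_id, Category.comp_id]
  refine key h' (congrArg (fun g => Str.Hom.app g t) (e (diagonal.obj Z)).inv_hom_id)
    (NatTrans.ext (funext fun n => ?_))
  exact (Category.id_comp _).trans (Category.id_comp _)

end DescentData

section Levels
variable {D : Type u} [Category.{v} D] [MonoidalCategory D]

theorem tensorListLax_evaluation {ι : Type w} (X : ι → Cosimp D) (n : SimplexCategory) :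
    (L : List ι) →
    tensorListLax ((evaluation SimplexCategory D).obj n) X L ≫ tensorListLevel X n L =
      𝟙 (tensorList (fun i => (X i).obj n) L)
  | [] => Category.comp_id _
  | a :: L => by
    have h := tensorListLax_evaluation X n L
    have key {P Q R : D} {f : Q ⟶ R} {g : R ⟶ Q} (h : f ≫ g = 𝟙 Q) :
        ((P ◁ f) ≫ 𝟙 (P ⊗ R)) ≫ (P ◁ g) = 𝟙 (P ⊗ Q) := by
      rw [Category.comp_id, ← whiskerLeft_comp, h, whiskerLeft_id]
    exact key h

theorem inv_kunneth_evaluation (X : Cosimp D) {n : ℕ} (Y : Fin n → Cosimp D)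
    (p : SimplexCategory) : inv (kunneth ((evaluation SimplexCategory D).obj p) X Y) =
      X.obj p ◁ tensorFinLevel Y p := by
  have key {P Q R : D} {f : Q ⟶ R} {g : R ⟶ Q} (h : f ≫ g = 𝟙 Q) :
      ((P ◁ f) ≫ 𝟙 (P ⊗ R)) ≫ (P ◁ g) = 𝟙 (P ⊗ Q) := by
    rw [Category.comp_id, ← whiskerLeft_comp, h, whiskerLeft_id]
  exact IsIso.inv_eq_of_hom_inv_id (key (tensorListLax_evaluation Y p (List.finRange n)))

/-- The level-wise operations were defined with an inverse of a Künneth morphism, whereas the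
induced structures are stated with `levelwise`; by `inv_kunneth_evaluation` these are the same. -/
theorem levelOps_op {𝒮 : Signature} (G : Cosimp (Str 𝒮 D)) (a : 𝒮.op) :
    (levelOps G).op a = levelwise (Z := G ⋙ Str.eval (𝒮.opTarget a))
      (X := G ⋙ Str.eval (𝒮.opHead a)) (Y := fun i => G ⋙ Str.eval (𝒮.opArg a i))
      (fun p => (G.obj p).ops.op a) fun _ _ f => (G.map f).isHom.op a :=
  NatTrans.ext (funext fun p => congrArg (· ≫ (G.obj p).ops.op a)
    (inv_kunneth_evaluation (G ⋙ Str.eval (𝒮.opHead a))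
      (fun i => G ⋙ Str.eval (𝒮.opArg a i)) p))

end Levels

/-! ### The descent structure on operads. -/

section Operads

/-- The signature of operads. -/
def operadSignature : Signature where
  sort := ℕ+
  un := Σ p : ℕ+ × ℕ+, Fin p.1 ≃ Fin p.2
  unSource a := a.1.2
  unTarget a := a.1.1
  const := Unit
  constTarget _ := 1
  op := Σ l : ℕ+, Fin l → ℕ+
  arity a := a.1
  opHead a := a.1
  opArg a := a.2
  opTarget a := sumArity a.2

variable {D : Type u} [Category.{v} D] [MonoidalCategory D] [SymmetricCategory D]

/-- The operad data given by operations of the signature of operads. -/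
def Ops.rawOperad {X : ℕ+ → D} (o : Ops operadSignature X) : RawOperad D where
  obj := X
  act {l m} σ := o.un ⟨(l, m), σ⟩
  unit := o.const ()
  comp {l} m := o.op ⟨l, m⟩

/-- The operations of an operad. -/
def Operad.ops (P : Operad D) : Ops operadSignature P.obj where
  un a := P.act a.2
  const _ := P.unit
  op a := P.comp a.2

theorem Operad.isHom_ops {P Q : Operad D} (f : P ⟶ Q) :
    IsHom P.ops Q.ops fun l => (Operad.eval l).map f where
  un a := Operad.Hom.act f a.2
  const _ := Operad.Hom.unit f
  op a := Operad.Hom.comp f a.2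

/-- The morphism of operads given by a compatible family of morphisms. -/
def Operad.homMk {P Q : Operad D} {φ : ∀ l, P.obj l ⟶ Q.obj l} (h : IsHom P.ops Q.ops φ) :
    P ⟶ Q where
  app := φ
  act {l m} σ := h.un ⟨(l, m), σ⟩
  unit := h.const ()
  comp {l} m := h.op ⟨l, m⟩

/-- Operads as structures. -/
def Operad.toStr : Operad D ⥤ Str operadSignature D where
  obj P := ⟨P.obj, P.ops⟩
  map f := ⟨_, Operad.isHom_ops f⟩

instance : (Operad.toStr : Operad D ⥤ _).Full where
  map_surjective f := ⟨Operad.homMk f.isHom, rfl⟩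

instance : (Operad.toStr : Operad D ⥤ _).Faithful where
  map_injective h := Operad.Hom.ext (congrArg Str.Hom.app h)

/-- Evaluations are jointly faithful with invertible constraints, and they return the given operads,
so they reflect the axioms. -/
theorem Ops.isOperad_level {K : Type u₁} [Category.{v₁} K] (G : K ⥤ Str operadSignature D)
    (h : ∀ k, (G.obj k).ops.rawOperad.IsOperad) : (levelOps G).rawOperad.IsOperad :=
  RawOperad.IsOperad.of_map (F := fun k => (evaluation K D).obj k)
    (fun _ _ _ _ h => NatTrans.ext (funext h)) isIso_evaluation_ε isIso_evaluation_μ fun k => by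
      have e := h k
      rw [← levelOps_map] at e
      exact e

theorem Operad.isOperad_map_level {K : Type u₁} [Category.{v₁} K] (Φ : (K ⥤ D) ⥤ D)
    [Φ.LaxBraided] (G : K ⥤ Operad D) :
    ((levelOps (G ⋙ Operad.toStr)).map Φ).rawOperad.IsOperad :=
  RawOperad.IsOperad.map Φ (Ops.isOperad_level (G ⋙ Operad.toStr) fun k => (G.obj k).isOperad_raw)

/-- The operad given by a diagram of operads and a lax symmetric monoidal functor. -/
noncomputable def Operad.laxImage {K : Type u₁} [Category.{v₁} K] (Φ : (K ⥤ D) ⥤ D)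
    [Φ.LaxBraided] (G : K ⥤ Operad D) : Operad D :=
  (Operad.isOperad_map_level Φ G).operad

theorem Operad.laxClosed (K : Type u₁) [Category.{v₁} K] :
    LaxClosed (Operad.toStr : Operad D ⥤ _) K :=
  fun Φ _ G => ⟨Operad.laxImage Φ G, ⟨Iso.refl _⟩⟩

/-- The image of a simple operad is the simple structure. -/
noncomputable def Operad.simpleIso (s : Cosimp D ⥤ D) [s.LaxBraided] (X : Cosimp (Operad D)) :
    Operad.toStr.obj (Operad.laxImage s X) ≅
      (simpleStr operadSignature s).obj (X ⋙ Operad.toStr) :=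
  Iso.refl _

/-- The operations of the simple were defined as images under `s` of level-wise operations, so only
the form of the level-wise composition has to be adjusted. -/
theorem Operad.isInducedOperad_laxImage (s : Cosimp D ⥤ D) [s.LaxBraided]
    (X : Cosimp (Operad D)) :
    IsInducedOperad s X (Operad.laxImage s X) fun _ => 𝟙 _ := by
  have h := IsHom.id ((levelOps (X ⋙ Operad.toStr)).map s)
  refine ⟨fun {l m} σ => h.un ⟨(l, m), σ⟩, h.const (), fun {l} m => ?_⟩
  have e := h.op ⟨l, m⟩
  have e' := congrArg (fun t => kunneth s _ _ ≫ s.map t) (levelOps_op (X ⋙ Operad.toStr) ⟨l, m⟩)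
  exact e.trans (congrArg _ e')

end Operads

section OperadDescent
variable {D : Type u} [Category.{v} D] [MonoidalCategory D] [SymmetricCategory D]
  (𝔰 : MonoidalDescentStructure D)

theorem Operad.forgetfulFamily [HasProducts.{w} D] [HasFilteredColimitsOfSize.{w, w} D]
    (hD : ∀ A : D, PreservesFilteredColimitsOfSize.{w, w} (tensorLeft A)) :
    ForgetfulFamily.{w} (Operad.eval (D := D)) :=
  forgetfulFamily_of_laxClosed Operad.toStr hD fun K _ => Operad.laxClosed K

theorem exists_operadDescentLift [HasProducts.{w} D] [HasFilteredColimitsOfSize.{w, w} D]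
    (hD : ∀ A : D, PreservesFilteredColimitsOfSize.{w, w} (tensorLeft A)) :
    ∃ 𝔰' : DescentStructure (Operad D), Nonempty (OperadDescentLift.{w} 𝔰 𝔰') := by
  let := 𝔰.simpleLax
  have := 𝔰.lam_monoidal
  have := 𝔰.mu_monoidal
  let e := Operad.simpleIso 𝔰.simple
  exact ⟨_, ⟨{ transferDescentLift 𝔰.toDescentStructure (Operad.forgetfulFamily hD)
      (simpleEvalIso Operad.toStr e) (liftLam_eval Operad.toStr e 𝔰.lam)
      (liftMu_eval Operad.toStr e 𝔰.mu) with
    induced := Operad.isInducedOperad_laxImage 𝔰.simple }⟩⟩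

end OperadDescent

/-! ### The descent structure on algebras over variable operads. -/

section Algebras

/-- The signature of algebras over variable operads; the sort `none` is the sort of the underlying
object. -/
def algSignature : Signature where
  sort := Option ℕ+
  un := operadSignature.un
  unSource a := some (operadSignature.unSource a)
  unTarget a := some (operadSignature.unTarget a)
  const := Unit
  constTarget _ := some (1 : ℕ+)
  op := operadSignature.op ⊕ ℕ+
  arity := Sum.elim operadSignature.arity fun l => l
  opHead := Sum.elim (fun a => some (operadSignature.opHead a)) some
  opArg
    | .inl a => fun i => some (operadSignature.opArg a i)
    | .inr _ => fun _ => none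
  opTarget := Sum.elim (fun a => some (operadSignature.opTarget a)) fun _ => none

variable {D : Type u} [Category.{v} D] [MonoidalCategory D] [SymmetricCategory D]

/-- The operations of an operad underlying operations of the signature of algebras. -/
def Ops.operadPart {X : Option ℕ+ → D} (o : Ops algSignature X) :
    Ops operadSignature fun l => X (some l) where
  un a := o.un a
  const a := o.const a
  op a := o.op (.inl a)

/-- The algebra data given by operations of the signature of algebras. -/
def Ops.rawAlgebra {X : Option ℕ+ → D} (o : Ops algSignature X) :
    RawAlgebra o.operadPart.rawOperad where
  obj := X none
  act l := o.op (.inr l)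

/-- The axioms of algebras over variable operads. -/
structure Ops.IsAlg {X : Option ℕ+ → D} (o : Ops algSignature X) : Prop where
  isOperad : o.operadPart.rawOperad.IsOperad
  isAlgebra : o.rawAlgebra.IsAlgebra

theorem Ops.IsAlg.map {A : Type u₁} [Category.{v₁} A] [MonoidalCategory A] [SymmetricCategory A]
    (F : A ⥤ D) [F.LaxBraided] {X : Option ℕ+ → A} {o : Ops algSignature X} (h : o.IsAlg) :
    (o.map F).IsAlg :=
  ⟨h.isOperad.map F, h.isAlgebra.map F⟩

/-- The objects underlying an algebra over a variable operad. -/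
def Alg.objects (A : Alg D) : Option ℕ+ → D
  | none => A.alg.obj
  | some l => A.operad.obj l

/-- The operations of an algebra over a variable operad. -/
def Alg.ops (A : Alg D) : Ops algSignature A.objects where
  un a := A.operad.ops.un a
  const a := A.operad.ops.const a
  op
    | .inl a => A.operad.ops.op a
    | .inr l => A.alg.act l

theorem Alg.isAlg_ops (A : Alg D) : A.ops.IsAlg :=
  ⟨A.operad.isOperad_raw, A.alg.isAlgebra_raw⟩

/-- The algebra given by operations which satisfy the axioms. -/
def Ops.IsAlg.alg {X : Option ℕ+ → D} {o : Ops algSignature X} (h : o.IsAlg) : Alg D where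
  operad := h.isOperad.operad
  alg := RawAlgebra.IsAlgebra.algebra (P := h.isOperad.operad) (A := o.rawAlgebra) h.isAlgebra

/-- The family of morphisms underlying a morphism of operads and a morphism of objects. -/
def Alg.family {A B : Option ℕ+ → D} (f : ∀ l, A (some l) ⟶ B (some l)) (h : A none ⟶ B none) :
    ∀ t, A t ⟶ B t
  | none => h
  | some l => f l

theorem IsHom.alg {X Y : Option ℕ+ → D} {o : Ops algSignature X} {o' : Ops algSignature Y}
    {φ : ∀ t, X t ⟶ Y t} (h : IsHom o.operadPart o'.operadPart fun l => φ (some l))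
    (h' : ∀ l : ℕ+, o.op (.inr l) ≫ φ none =
      (φ (some l) ⊗ₘ tensorFinMap fun _ : Fin l => φ none) ≫ o'.op (.inr l)) : IsHom o o' φ where
  un := h.un
  const := h.const
  op
    | .inl a => h.op a
    | .inr l => h' l

theorem IsHom.operadPart {X Y : Option ℕ+ → D} {o : Ops algSignature X} {o' : Ops algSignature Y}
    {φ : ∀ t, X t ⟶ Y t} (h : IsHom o o' φ) :
    IsHom o.operadPart o'.operadPart fun l => φ (some l) where
  un := h.un
  const := h.const
  op a := h.op (.inl a)

theorem Alg.isHom_ops {A B : Alg D} (f : A ⟶ B) :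
    IsHom A.ops B.ops (Alg.family (fun l => (Alg.toOperad ⋙ Operad.eval l).map f)
      (Alg.forget.map f)) :=
  IsHom.alg (Operad.isHom_ops (Alg.toOperad.map f)) (Alg.Hom.act f)

/-- The morphism of algebras given by a compatible family of morphisms. -/
def Alg.homMk {A B : Alg D} {φ : ∀ t, A.objects t ⟶ B.objects t} (h : IsHom A.ops B.ops φ) :
    A ⟶ B where
  operad := Operad.homMk (φ := fun l => φ (some l)) h.operadPart
  hom := φ none
  act l := h.op (.inr l)

/-- Algebras over variable operads as structures. -/
def Alg.toStr : Alg D ⥤ Str algSignature D where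
  obj A := ⟨A.objects, A.ops⟩
  map f := ⟨_, Alg.isHom_ops f⟩
  map_id _ := Str.Hom.ext (funext fun | none => rfl | some _ => rfl)
  map_comp _ _ := Str.Hom.ext (funext fun | none => rfl | some _ => rfl)

instance : (Alg.toStr : Alg D ⥤ _).Full where
  map_surjective f := ⟨Alg.homMk f.isHom,
    Str.Hom.ext (funext fun | none => rfl | some _ => rfl)⟩

instance : (Alg.toStr : Alg D ⥤ _).Faithful where
  map_injective h := Alg.Hom.ext
    (Operad.Hom.ext (funext fun l => congrArg (fun f => Str.Hom.app f (some l)) h))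
    (congrArg (fun f => Str.Hom.app f none) h)

/-- The argument of `Ops.isOperad_level`, carried out for the operad and for its action on the
object of sort `none`. -/
theorem Ops.isAlg_level {K : Type u₁} [Category.{v₁} K] (G : K ⥤ Str algSignature D)
    (h : ∀ k, (G.obj k).ops.IsAlg) : (levelOps G).IsAlg := by
  have e (k : K) : ((levelOps G).map ((evaluation K D).obj k)).IsAlg := by
    rw [levelOps_map]
    exact h k
  exact ⟨RawOperad.IsOperad.of_map (F := fun k => (evaluation K D).obj k)
      (fun _ _ _ _ h => NatTrans.ext (funext h)) isIso_evaluation_ε isIso_evaluation_μ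
      fun k => (e k).isOperad,
    RawAlgebra.IsAlgebra.of_map (F := fun k => (evaluation K D).obj k)
      (fun _ _ _ _ h => NatTrans.ext (funext h)) isIso_evaluation_ε isIso_evaluation_μ
      fun k => (e k).isAlgebra⟩

theorem Alg.isAlg_map_level {K : Type u₁} [Category.{v₁} K] (Φ : (K ⥤ D) ⥤ D)
    [Φ.LaxBraided] (G : K ⥤ Alg D) : ((levelOps (G ⋙ Alg.toStr)).map Φ).IsAlg :=
  (Ops.isAlg_level (G ⋙ Alg.toStr) fun k => (G.obj k).isAlg_ops).map Φ

/-- The algebra given by a diagram of algebras and a lax symmetric monoidal functor. -/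
noncomputable def Alg.laxImage {K : Type u₁} [Category.{v₁} K] (Φ : (K ⥤ D) ⥤ D)
    [Φ.LaxBraided] (G : K ⥤ Alg D) : Alg D :=
  (Alg.isAlg_map_level Φ G).alg

/-- The structure underlying the algebra given by operations which satisfy the axioms. -/
def Ops.IsAlg.toStrIso {X : Option ℕ+ → D} {o : Ops algSignature X} (h : o.IsAlg) :
    Alg.toStr.obj h.alg ≅ ⟨X, o⟩ :=
  -- The objects underlying an algebra are defined by cases on the sort, so this identification is
  -- the identity only after a case distinction.
  Str.isoMk (fun | none => Iso.refl _ | some _ => Iso.refl _) <|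
    IsHom.alg (IsHom.id o.operadPart) fun l => (Category.comp_id (o.op (.inr l))).trans
      (id_tensorFinMap_id_comp (X (some l)) (fun _ : Fin l => X none) (o.op (.inr l))).symm

theorem Alg.laxClosed (K : Type u₁) [Category.{v₁} K] :
    LaxClosed (Alg.toStr : Alg D ⥤ _) K :=
  fun Φ _ G => ⟨Alg.laxImage Φ G, ⟨(Alg.isAlg_map_level Φ G).toStrIso⟩⟩

/-- The image of a simple algebra is the simple structure. -/
noncomputable def Alg.simpleIso (s : Cosimp D ⥤ D) [s.LaxBraided] (X : Cosimp (Alg D)) :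
    Alg.toStr.obj (Alg.laxImage s X) ≅ (simpleStr algSignature s).obj (X ⋙ Alg.toStr) :=
  (Alg.isAlg_map_level s X).toStrIso

theorem Alg.isInducedOperad_laxImage (s : Cosimp D ⥤ D) [s.LaxBraided] (X : Cosimp (Alg D)) :
    IsInducedOperad s (X ⋙ Alg.toOperad) (Alg.laxImage s X).operad fun _ => 𝟙 _ := by
  have h := (IsHom.id ((levelOps (X ⋙ Alg.toStr)).map s)).operadPart
  refine ⟨fun {l m} σ => h.un ⟨(l, m), σ⟩, h.const (), fun {l} m => ?_⟩
  have e := h.op ⟨l, m⟩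
  have e' := congrArg (fun t => kunneth s _ _ ≫ s.map t)
    (levelOps_op (X ⋙ Alg.toStr) (.inl ⟨l, m⟩))
  exact e.trans (congrArg _ e')

theorem Alg.laxImage_act (s : Cosimp D ⥤ D) [s.LaxBraided] (X : Cosimp (Alg D)) (l : ℕ+) :
    (Alg.laxImage s X).alg.act l = kunneth s _ _ ≫ s.map (levelAlgAct X l) :=
  congrArg (fun t => kunneth s _ _ ≫ s.map t) (levelOps_op (X ⋙ Alg.toStr) (.inr l))

end Algebras

section AlgDescent
variable {D : Type u} [Category.{v} D] [MonoidalCategory D] [SymmetricCategory D]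
  (𝔰 : MonoidalDescentStructure D)

theorem Alg.components_eq : Alg.components (D := D) = fun t => Alg.toStr ⋙ Str.eval t :=
  funext fun | none => rfl | some _ => rfl

theorem Alg.forgetfulFamily [HasProducts.{w} D] [HasFilteredColimitsOfSize.{w, w} D]
    (hD : ∀ A : D, PreservesFilteredColimitsOfSize.{w, w} (tensorLeft A)) :
    ForgetfulFamily.{w} (Alg.components (D := D)) := by
  rw [Alg.components_eq]
  exact forgetfulFamily_of_laxClosed Alg.toStr hD fun K _ => Alg.laxClosed K

theorem exists_algDescentLift [HasProducts.{w} D] [HasFilteredColimitsOfSize.{w, w} D]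
    (hD : ∀ A : D, PreservesFilteredColimitsOfSize.{w, w} (tensorLeft A)) :
    ∃ 𝔰' : DescentStructure (Alg D), Nonempty (AlgDescentLift.{w} 𝔰 𝔰') := by
  let := 𝔰.simpleLax
  have := 𝔰.lam_monoidal
  have := 𝔰.mu_monoidal
  let e := Alg.simpleIso 𝔰.simple
  -- The same case distinction: for a variable sort, the functor `Alg.components t` is not by
  -- definition the evaluation of the associated structure.
  let σ : ∀ t, liftSimple Alg.toStr e ⋙ Alg.components t ≅
      (Functor.whiskeringRight SimplexCategory _ _).obj (Alg.components t) ⋙ 𝔰.simple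
    | none => simpleEvalIso Alg.toStr e none
    | some l => simpleEvalIso Alg.toStr e (some l)
  refine ⟨_, ⟨{ transferDescentLift 𝔰.toDescentStructure (Alg.forgetfulFamily hD) σ
      (lam := liftLam Alg.toStr e (lamStr 𝔰.lam)) (mu := liftMu Alg.toStr e (muStr 𝔰.mu))
      (fun | none => liftLam_eval Alg.toStr e 𝔰.lam none
           | some l => liftLam_eval Alg.toStr e 𝔰.lam (some l))
      (fun | none => liftMu_eval Alg.toStr e 𝔰.mu none
           | some l => liftMu_eval Alg.toStr e 𝔰.mu (some l)) with
    induced := Alg.isInducedOperad_laxImage 𝔰.simple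
    act := fun A l => ?_ }⟩⟩
  have key {P Q R V : D} {a : P ⊗ Q ⟶ R} {k : P ⊗ Q ⟶ V} {m : V ⟶ R} {q : Q ⟶ Q}
      (h : a = k ≫ m) (hq : q = 𝟙 Q) : a ≫ 𝟙 R = (𝟙 P ⊗ₘ q) ≫ k ≫ m := by
    rw [hq, id_tensorHom_id, Category.id_comp, Category.comp_id, h]
  exact key (Alg.laxImage_act 𝔰.simple A l) (tensorFinMap_id _)

end AlgDescent

/-! ### Restriction of algebras along a morphism of operads. -/

section Restriction
variable {D : Type u} [Category.{v} D] [MonoidalCategory D] [SymmetricCategory D]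

/-- A morphism of operads passes the shuffle (`hs`) and the composition (`hc`), so the associativity
of an action pulls back along it. -/
theorem restrict_comp_act_chase {X X' Y Y' Z W W' V V' R R' S : D} {g : X ⟶ X'} {y : Y ⟶ Y'}
    {s : Y ⊗ Z ⟶ W} {s' : Y' ⊗ Z ⟶ W'} {w : W ⟶ W'} {a : W' ⟶ V} {a' : W ⟶ V}
    {b : X' ⊗ V ⟶ S} {c : X ⊗ Y ⟶ R} {c' : X' ⊗ Y' ⟶ R'} {r : R ⟶ R'} {t : Z ⟶ V'}
    {b' : R' ⊗ V' ⟶ S} (hs : (y ⊗ₘ 𝟙 Z) ≫ s' = s ≫ w) (ha : a' = w ≫ a)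
    (hc : c ≫ r = (g ⊗ₘ y) ≫ c')
    (h : (α_ X' Y' Z).hom ≫ (X' ◁ (s' ≫ a)) ≫ b = (c' ▷ Z) ≫ (R' ◁ t) ≫ b') :
    (α_ X Y Z).hom ≫ (X ◁ (s ≫ a')) ≫ (g ▷ V) ≫ b = (c ▷ Z) ≫ (R ◁ t) ≫ (r ▷ V') ≫ b' := by
  have h₁ : (X ◁ (s ≫ a')) ≫ (g ▷ V) = (g ⊗ₘ (y ⊗ₘ 𝟙 Z)) ≫ (X' ◁ (s' ≫ a)) := by
    rw [ha, ← reassoc_of% hs, ← id_tensorHom, ← tensorHom_id, ← id_tensorHom,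
      tensorHom_comp_tensorHom, tensorHom_comp_tensorHom, Category.comp_id, Category.comp_id,
      Category.id_comp]
  have h₂ : (c ▷ Z) ≫ (R ◁ t) ≫ (r ▷ V') = ((g ⊗ₘ y) ⊗ₘ 𝟙 Z) ≫ (c' ▷ Z) ≫ (R' ◁ t) := by
    rw [whisker_exchange, ← comp_whiskerRight_assoc, hc, tensorHom_id, ← comp_whiskerRight_assoc]
  rw [reassoc_of% h₁, reassoc_of% h₂, ← h, ← associator_naturality_assoc]

/-- The restriction of an algebra along a morphism of operads. -/
def OperadAlgebra.restrict {P : Operad D} (B : Alg D) (g : P ⟶ B.operad) : OperadAlgebra P where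
  obj := B.alg.obj
  act l := ((Operad.eval l).map g ▷ _) ≫ B.alg.act l
  act_perm {l l'} σ := by
    have h : P.act σ ≫ (Operad.eval l).map g = (Operad.eval l').map g ≫ B.operad.act σ :=
      Operad.Hom.act g σ
    have key {X X' Y Y' Z W S : D} {p : X ⟶ X'} {g : X' ⟶ Y'} {g' : X ⟶ Y} {p' : Y ⟶ Y'}
        {q : Z ⟶ W} {a : Y' ⊗ W ⟶ S} {b : Y ⊗ Z ⟶ S} (h : p ≫ g = g' ≫ p')
        (h' : (p' ⊗ₘ q) ≫ a = b) : (p ⊗ₘ q) ≫ (g ▷ W) ≫ a = (g' ▷ Z) ≫ b := by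
      rw [← h', ← tensorHom_id, tensorHom_comp_tensorHom_assoc, Category.comp_id, h,
        ← tensorHom_id, tensorHom_comp_tensorHom_assoc, Category.id_comp]
    exact key h (B.alg.act_perm σ)
  unit_act := by
    have h : P.unit ≫ (Operad.eval 1).map g = B.operad.unit := Operad.Hom.unit g
    have key {X Y Z V W : D} {p : X ⟶ Y} {r : V ⟶ W} {g : Y ⟶ Z} {q : X ⟶ Z} {S : D}
        {a : Z ⊗ W ⟶ S} {t : X ⊗ V ⟶ S} (h : p ≫ g = q) (h' : (q ⊗ₘ r) ≫ a = t) :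
        (p ⊗ₘ r) ≫ (g ▷ W) ≫ a = t := by
      rw [← tensorHom_id, tensorHom_comp_tensorHom_assoc, Category.comp_id, h, h']
    exact key h B.alg.unit_act
  comp_act {l} m := by
    -- The morphism of operads only acts on the operad factors; the blocks of algebra factors are
    -- carried along by identities.
    have hs := tensorListShuffle_naturality (fun i => (Operad.eval (m i)).map g)
      (fun i => 𝟙 (tensorFin fun _ : Fin (m i) => B.alg.obj)) (List.finRange l)
    rw [tensorListMap_id] at hs
    refine restrict_comp_act_chase hs ?_ (Operad.Hom.comp g m) (B.alg.comp_act m)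
    refine (congrArg (fun t => tensorFinMap t) (funext fun i => ?_)).trans
      (tensorFinMap_comp (fun i => (Operad.eval (m i)).map g ⊗ₘ
        𝟙 (tensorFin fun _ : Fin (m i) => B.alg.obj)) fun i => B.alg.act (m i))
    rw [tensorHom_id]
    rfl

/-- Algebras over a fixed operad as algebras over variable operads. -/
def OperadAlgebra.toAlg (P : Operad D) : OperadAlgebra P ⥤ Alg D where
  obj A := ⟨P, A⟩
  map f := ⟨𝟙 P, OperadAlgebra.Hom.hom f, OperadAlgebra.Hom.act f⟩
  map_id _ := rfl
  map_comp _ _ := Alg.Hom.ext (Category.comp_id (𝟙 _)).symm rfl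

variable {P : Operad D} {B : Alg D} {g : P ⟶ B.operad}

/-- Morphisms to the restriction of an algebra. -/
def OperadAlgebra.toRestrict {A : OperadAlgebra P} (h : A.obj ⟶ B.alg.obj)
    (hh : ∀ l, A.act l ≫ h = ((Operad.eval l).map g ⊗ₘ tensorFinMap fun _ => h) ≫ B.alg.act l) :
    A ⟶ OperadAlgebra.restrict B g where
  hom := h
  act l := by
    have key {X Y Z V W : D} {g : X ⟶ Y} {q : Z ⟶ V} {a : Y ⊗ V ⟶ W} :
        (g ⊗ₘ q) ≫ a = (𝟙 X ⊗ₘ q) ≫ (g ▷ V) ≫ a := by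
      rw [← tensorHom_id, tensorHom_comp_tensorHom_assoc, Category.id_comp, Category.comp_id]
    exact (hh l).trans key

/-- Morphisms from the restriction of an algebra. -/
def OperadAlgebra.ofRestrict {A : OperadAlgebra P} (h : B.alg.obj ⟶ A.obj)
    (f : ∀ l, B.operad.obj l ⟶ P.obj l) (hf : ∀ l, (Operad.eval l).map g ≫ f l = 𝟙 (P.obj l))
    (hh : ∀ l, B.alg.act l ≫ h = (f l ⊗ₘ tensorFinMap fun _ => h) ≫ A.act l) :
    OperadAlgebra.restrict B g ⟶ A where
  hom := h
  act l := by
    have key {X Y Z V R S : D} {g : X ⟶ Y} {f : Y ⟶ X} (hf : g ≫ f = 𝟙 X) {q : Z ⟶ V}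
        {a : X ⊗ V ⟶ S} {b : Y ⊗ Z ⟶ R} {h : R ⟶ S} (hh : b ≫ h = (f ⊗ₘ q) ≫ a) :
        ((g ▷ Z) ≫ b) ≫ h = (𝟙 X ⊗ₘ q) ≫ a := by
      rw [Category.assoc, hh, ← tensorHom_id, tensorHom_comp_tensorHom_assoc, hf,
        Category.id_comp]
    exact key (hf l) (hh l)

/-- The canonical morphism from the restriction of an algebra. -/
def OperadAlgebra.restrictMap (B : Alg D) (g : P ⟶ B.operad) :
    (OperadAlgebra.toAlg P).obj (OperadAlgebra.restrict B g) ⟶ B where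
  operad := g
  hom := 𝟙 B.alg.obj
  act l := by
    have key {X Y Z W : D} {g : X ⟶ Y} {q : Z ⟶ Z} (hq : q = 𝟙 Z) {a : Y ⊗ Z ⟶ W} :
        ((g ▷ Z) ≫ a) ≫ 𝟙 W = (g ⊗ₘ q) ≫ a := by
      rw [hq, tensorHom_id, Category.comp_id]
    exact key (tensorFinMap_id _)

/-- The morphism to the restriction of an algebra given by a morphism over `g`. -/
def OperadAlgebra.restrictLift {A : OperadAlgebra P} (f : (OperadAlgebra.toAlg P).obj A ⟶ B)
    (h : A.obj ⟶ B.alg.obj) (hh : Alg.forget.map f = h)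
    (hf : ∀ l, (Alg.toOperad ⋙ Operad.eval l).map f = (Operad.eval l).map g) :
    A ⟶ OperadAlgebra.restrict B g :=
  OperadAlgebra.toRestrict h fun l => by
    rw [← hf, ← hh]
    exact Alg.Hom.act f l

end Restriction

/-! ### Limits and filtered colimits of algebras over a fixed operad. -/

section FiberLimits
variable {D : Type u} [Category.{v} D] [MonoidalCategory D] [SymmetricCategory D]
  {P : Operad D}

/-- A cone of algebras is a limit cone if it is so on underlying objects. -/
noncomputable def OperadAlgebra.isLimitOfForget {K : Type u₁} [Category.{v₁} K]
    {G : K ⥤ OperadAlgebra P} (c : Cone G)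
    (h : IsLimit ((OperadAlgebra.forget P).mapCone c)) : IsLimit c where
  lift t :=
    { hom := h.lift ((OperadAlgebra.forget P).mapCone t)
      act := fun l => h.hom_ext fun k => by
        have key {X Y Y' Y'' Z Z' Z'' : D} {a : X ⊗ Y ⟶ Z} {f : Z ⟶ Z'} {p : Z' ⟶ Z''}
            {F : Y ⟶ Y'} {Q : Y' ⟶ Y''} {R : Y ⟶ Y''} {b : X ⊗ Y' ⟶ Z'} {c : X ⊗ Y'' ⟶ Z''}
            {r : Z ⟶ Z''} (h₁ : a ≫ r = (𝟙 X ⊗ₘ R) ≫ c) (h₂ : b ≫ p = (𝟙 X ⊗ₘ Q) ≫ c)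
            (h₃ : f ≫ p = r) (h₄ : F ≫ Q = R) : (a ≫ f) ≫ p = ((𝟙 X ⊗ₘ F) ≫ b) ≫ p := by
          rw [Category.assoc, Category.assoc, h₃, h₁, h₂, tensorHom_comp_tensorHom_assoc,
            Category.comp_id, h₄]
        have e := h.fac ((OperadAlgebra.forget P).mapCone t) k
        exact key (OperadAlgebra.Hom.act (t.π.app k) l) (OperadAlgebra.Hom.act (c.π.app k) l) e
          ((tensorFinMap_comp _ _).symm.trans
            (congrArg (fun f => tensorFinMap fun _ : Fin l => f) e)) }
  fac t k := OperadAlgebra.Hom.ext (h.fac ((OperadAlgebra.forget P).mapCone t) k)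
  uniq t _ hm := OperadAlgebra.Hom.ext (h.uniq ((OperadAlgebra.forget P).mapCone t) _ fun k =>
    congrArg OperadAlgebra.Hom.hom (hm k))

section
variable {K : Type w} [SmallCategory K] [HasLimitsOfShape K D] (G : K ⥤ OperadAlgebra P)

/-- The structures underlying a diagram of algebras. -/
abbrev OperadAlgebra.strDiagram {K : Type u₁} [Category.{v₁} K] (G : K ⥤ OperadAlgebra P) :
    K ⥤ Str algSignature D :=
  (G ⋙ OperadAlgebra.toAlg P) ⋙ Alg.toStr

/-- The diagonal of a limit of the constant diagram of the objects of an operad. -/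
noncomputable def OperadAlgebra.toLimit (l : ℕ+) :
    P.obj l ⟶ limit (OperadAlgebra.strDiagram G ⋙ Str.eval (some l)) :=
  limit.lift (OperadAlgebra.strDiagram G ⋙ Str.eval (some l))
    { pt := P.obj l, π := { app := fun _ => 𝟙 (P.obj l) } }

theorem OperadAlgebra.toLimit_π (l : ℕ+) (k : K) :
    OperadAlgebra.toLimit G l ≫ limit.π (OperadAlgebra.strDiagram G ⋙ Str.eval (some l)) k =
      𝟙 (P.obj l) :=
  limit.lift_π _ _

theorem OperadAlgebra.isHom_toLimit :
    IsHom P.ops ((levelOps (OperadAlgebra.strDiagram G)).map (lim : (K ⥤ D) ⥤ D)).operadPart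
      (OperadAlgebra.toLimit G) :=
  IsHom.of_comp_mono (fun k => (isHom_limProj (OperadAlgebra.strDiagram G) k).operadPart)
    (fun _ _ _ _ e => limit.hom_ext e)
    fun k => (IsHom.id P.ops).congr fun l => (OperadAlgebra.toLimit_π G l k).symm

/-- Limits of algebras are computed on underlying objects. -/
noncomputable def OperadAlgebra.limitCone : Cone G where
  -- The limit of the constant diagram on `P` differs from `P` in general, for instance it is a
  -- power of `P` for a product. The limit of the algebras is an algebra over it, restricted to `P`
  -- along the diagonal.
  pt := OperadAlgebra.restrict (Alg.laxImage lim (G ⋙ OperadAlgebra.toAlg P))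
    (Operad.homMk (OperadAlgebra.isHom_toLimit G))
  π :=
    { app := fun k => OperadAlgebra.ofRestrict
        (limit.π (OperadAlgebra.strDiagram G ⋙ Str.eval none) k)
        (fun l => limit.π (OperadAlgebra.strDiagram G ⋙ Str.eval (some l)) k)
        (fun l => OperadAlgebra.toLimit_π G l k)
        fun l => (isHom_limProj (OperadAlgebra.strDiagram G) k).op (.inr l)
      naturality := fun _ _ f => OperadAlgebra.Hom.ext ((Category.id_comp _).trans
        (limit.w (OperadAlgebra.strDiagram G ⋙ Str.eval none) f).symm) }

noncomputable def OperadAlgebra.isLimitForgetLimitCone :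
    IsLimit ((OperadAlgebra.forget P).mapCone (OperadAlgebra.limitCone G)) :=
  IsLimit.ofIsoLimit (limit.isLimit (OperadAlgebra.strDiagram G ⋙ Str.eval none))
    (Cone.ext (Iso.refl _) fun _ => (Category.id_comp _).symm)

end

section
variable {K : Type u₁} [Category.{v₁} K] [IsFiltered K] [HasColimitsOfShape K D]
  [∀ A : D, PreservesColimitsOfShape K (tensorLeft A)]
  [∀ A : D, PreservesColimitsOfShape K (tensorRight A)] (G : K ⥤ OperadAlgebra P)

/-- The inclusion in a filtered colimit of the constant diagram of the objects of an operad. -/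
noncomputable def OperadAlgebra.toColimit (l : ℕ+) :
    P.obj l ⟶ colimit (OperadAlgebra.strDiagram G ⋙ Str.eval (some l)) :=
  colimit.ι (OperadAlgebra.strDiagram G ⋙ Str.eval (some l)) (Classical.choice IsFiltered.nonempty)

/-- The operad part of the diagram is constant and any two indices have a common upper bound. It
follows that the coprojections at all indices are linear over `P` for one and the same restriction.
-/
theorem OperadAlgebra.toColimit_eq (l : ℕ+) (k : K) : OperadAlgebra.toColimit G l =
    colimit.ι (OperadAlgebra.strDiagram G ⋙ Str.eval (some l)) k := by
  have h {k k' : K} (f : k ⟶ k') :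
      colimit.ι (OperadAlgebra.strDiagram G ⋙ Str.eval (some l)) k =
        colimit.ι (OperadAlgebra.strDiagram G ⋙ Str.eval (some l)) k' :=
    (colimit.w (OperadAlgebra.strDiagram G ⋙ Str.eval (some l)) f).symm.trans (Category.id_comp _)
  exact (h (IsFiltered.leftToMax _ k)).trans (h (IsFiltered.rightToMax _ k)).symm

/-- The inverse of `toColimit`. -/
noncomputable def OperadAlgebra.ofColimit (l : ℕ+) :
    colimit (OperadAlgebra.strDiagram G ⋙ Str.eval (some l)) ⟶ P.obj l :=
  colimit.desc (OperadAlgebra.strDiagram G ⋙ Str.eval (some l))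
    { pt := P.obj l, ι := { app := fun _ => 𝟙 (P.obj l) } }

theorem OperadAlgebra.ι_ofColimit (l : ℕ+) (k : K) :
    colimit.ι (OperadAlgebra.strDiagram G ⋙ Str.eval (some l)) k ≫ OperadAlgebra.ofColimit G l =
      𝟙 (P.obj l) :=
  colimit.ι_desc _ _

theorem OperadAlgebra.isHom_toColimit :
    IsHom P.ops ((levelOps (OperadAlgebra.strDiagram G)).map (colim : (K ⥤ D) ⥤ D)).operadPart
      (OperadAlgebra.toColimit G) :=
  (isHom_colimInj (OperadAlgebra.strDiagram G) (Classical.choice IsFiltered.nonempty)).operadPart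

/-- Filtered colimits of algebras are computed on underlying objects. -/
noncomputable def OperadAlgebra.colimitCocone : Cocone G where
  pt := OperadAlgebra.restrict (Alg.laxImage colim (G ⋙ OperadAlgebra.toAlg P))
    (Operad.homMk (OperadAlgebra.isHom_toColimit G))
  ι :=
    { app := fun k => OperadAlgebra.toRestrict
        (colimit.ι (OperadAlgebra.strDiagram G ⋙ Str.eval none) k) fun l => by
          have h := (isHom_colimInj (OperadAlgebra.strDiagram G) k).op (.inr l)
          have key {X Y Z V W : D} {a : X ⊗ Y ⟶ Z} {f : Z ⟶ V} {g g' : X ⟶ W} {S : D} {q : Y ⟶ S}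
              {b : W ⊗ S ⟶ V} (h : a ≫ f = (g ⊗ₘ q) ≫ b) (e : g' = g) :
              a ≫ f = (g' ⊗ₘ q) ≫ b := by
            rw [h, e]
          exact key h (OperadAlgebra.toColimit_eq G l k)
      naturality := fun _ _ f => OperadAlgebra.Hom.ext ((colimit.w
        (OperadAlgebra.strDiagram G ⋙ Str.eval none) f).trans (Category.comp_id _).symm) }

noncomputable def OperadAlgebra.isColimitForgetColimitCocone :
    IsColimit ((OperadAlgebra.forget P).mapCocone (OperadAlgebra.colimitCocone G)) :=
  IsColimit.ofIsoColimit (colimit.isColimit (OperadAlgebra.strDiagram G ⋙ Str.eval none))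
    (Cocone.ext (Iso.refl _) fun _ => Category.comp_id _)

/-- The family of morphisms from the colimit of the underlying structures given by a cocone. -/
noncomputable def OperadAlgebra.colimitFamily (t : Cocone G) : ∀ s,
    colimit (OperadAlgebra.strDiagram G ⋙ Str.eval s) ⟶ Alg.objects ⟨P, t.pt⟩ s
  | none => colimit.desc (OperadAlgebra.strDiagram G ⋙ Str.eval none)
      ((OperadAlgebra.forget P).mapCocone t)
  | some l => OperadAlgebra.ofColimit G l

theorem OperadAlgebra.isHom_colimitFamily (t : Cocone G) :
    IsHom ((levelOps (OperadAlgebra.strDiagram G)).map (colim : (K ⥤ D) ⥤ D))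
      (Alg.ops ⟨P, t.pt⟩) (OperadAlgebra.colimitFamily G t) :=
  IsHom.of_colimit _ fun k => (Alg.isHom_ops ((OperadAlgebra.toAlg P).map (t.ι.app k))).congr
    fun
      | none => (colimit.ι_desc ((OperadAlgebra.forget P).mapCocone t) k).symm
      | some l => (OperadAlgebra.ι_ofColimit G l k).symm

noncomputable def OperadAlgebra.isColimitColimitCocone :
    IsColimit (OperadAlgebra.colimitCocone G) where
  -- The morphism from the colimit of the operads back to `P` undoes the restriction, so a
  -- homomorphism of algebras over variable operads yields one over `P`.
  desc t := OperadAlgebra.ofRestrict (OperadAlgebra.colimitFamily G t none)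
    (OperadAlgebra.ofColimit G) (fun l => OperadAlgebra.ι_ofColimit G l _)
    fun l => (OperadAlgebra.isHom_colimitFamily G t).op (.inr l)
  fac t k := OperadAlgebra.Hom.ext (colimit.ι_desc ((OperadAlgebra.forget P).mapCocone t) k)
  uniq t _ hm := OperadAlgebra.Hom.ext ((OperadAlgebra.isColimitForgetColimitCocone G).hom_ext
    fun k => (congrArg OperadAlgebra.Hom.hom (hm k)).trans
      (colimit.ι_desc ((OperadAlgebra.forget P).mapCocone t) k).symm)

end

theorem OperadAlgebra.forgetfulFamily [HasProducts.{w} D] [HasFilteredColimitsOfSize.{w, w} D]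
    (hD : ∀ A : D, PreservesFilteredColimitsOfSize.{w, w} (tensorLeft A)) :
    ForgetfulFamily.{w} fun _ : Unit => OperadAlgebra.forget P := by
  have hR (A : D) : PreservesFilteredColimitsOfSize.{w, w} (tensorRight A) :=
    have := hD A
    ⟨fun K _ _ => preservesColimitsOfShape_of_natIso (BraidedCategory.tensorLeftIsoTensorRight A)⟩
  exact
    { hasProducts := fun I => ⟨fun G => ⟨⟨_, OperadAlgebra.isLimitOfForget _
        (OperadAlgebra.isLimitForgetLimitCone G)⟩⟩⟩
      hasFilteredColimits := ⟨fun K _ _ => ⟨fun G =>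
        ⟨⟨_, OperadAlgebra.isColimitColimitCocone G⟩⟩⟩⟩
      preservesProducts := fun _ I => ⟨fun {G} => preservesLimit_of_preserves_limit_cone
        (OperadAlgebra.isLimitOfForget _ (OperadAlgebra.isLimitForgetLimitCone G))
        (OperadAlgebra.isLimitForgetLimitCone G)⟩
      preservesFilteredColimits := fun _ => ⟨fun K _ _ => ⟨fun {G} =>
        preservesColimit_of_preserves_colimit_cocone (OperadAlgebra.isColimitColimitCocone G)
          (OperadAlgebra.isColimitForgetColimitCocone G)⟩⟩
      hom_ext := fun X Y f g h => OperadAlgebra.Hom.ext (h ())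
      isLimit := fun c h => ⟨OperadAlgebra.isLimitOfForget c (h ()).some⟩ }

end FiberLimits

/-! ### Simples of algebras over a fixed operad. -/

section FiberSimple
variable {D : Type u} [Category.{v} D] [MonoidalCategory D] [SymmetricCategory D]
  (s : Cosimp D ⥤ D) [s.LaxBraided]

/-- The simple functor on algebras over variable operads. -/
noncomputable abbrev Alg.simple : Cosimp (Alg D) ⥤ Alg D :=
  liftSimple Alg.toStr (Alg.simpleIso s)

theorem eq_of_comp_id_eq {C : Type u₁} [Category.{v₁} C] {X Y : C} {f g : X ⟶ Y}
    (h : f ≫ 𝟙 Y = 𝟙 X ≫ g) : f = g := by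
  rwa [Category.comp_id, Category.id_comp] at h

theorem Alg.simple_map_operad {X Y : Cosimp (Alg D)} (f : X ⟶ Y) (l : ℕ+) :
    (Alg.toOperad ⋙ Operad.eval l).map ((Alg.simple s).map f) =
      s.map (Functor.whiskerRight f (Alg.toOperad ⋙ Operad.eval l)) :=
  eq_of_comp_id_eq ((simpleEvalIso Alg.toStr (Alg.simpleIso s) (some l)).hom.naturality f)

theorem Alg.simple_map_forget {X Y : Cosimp (Alg D)} (f : X ⟶ Y) :
    Alg.forget.map ((Alg.simple s).map f) = s.map (Functor.whiskerRight f Alg.forget) :=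
  eq_of_comp_id_eq ((simpleEvalIso Alg.toStr (Alg.simpleIso s) none).hom.naturality f)

theorem map_eq_id {C : Type u₁} [Category.{v₁} C] {K : Type u₂} [Category.{v₂} K]
    (F : (K ⥤ C) ⥤ D) {X : K ⥤ C} {f : X ⟶ X} (h : ∀ k, f.app k = 𝟙 (X.obj k)) :
    F.map f = 𝟙 (F.obj X) :=
  (congrArg F.map (NatTrans.ext (funext h))).trans (F.map_id X)

theorem comp_map_eq {C : Type u₁} [Category.{v₁} C] {K : Type u₂} [Category.{v₂} K]
    (F : (K ⥤ C) ⥤ D) {P : D} {X : K ⥤ C} {l : P ⟶ F.obj X} {f : X ⟶ X}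
    (h : ∀ k, f.app k = 𝟙 (X.obj k)) : l ≫ F.map f = l := by
  rw [map_eq_id F h, Category.comp_id]

section
variable (lam : 𝟭 D ⟶ Functor.const SimplexCategory ⋙ s) [NatTrans.IsMonoidal lam]

theorem Alg.lam_operad (X : Alg D) (l : ℕ+) :
    (Alg.toOperad ⋙ Operad.eval l).map
      ((liftLam Alg.toStr (Alg.simpleIso s) (lamStr lam)).app X) = lam.app (X.operad.obj l) := by
  have key {P : D} {X : Cosimp D} {f g : P ⟶ s.obj X} {c : X ⟶ X} (hc : ∀ n, c.app n = 𝟙 _)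
      (h : f ≫ 𝟙 _ ≫ s.map c = g) : f = g := by
    rwa [map_eq_id s hc, Category.comp_id, Category.comp_id] at h
  exact key (fun _ => rfl) (liftLam_eval Alg.toStr (Alg.simpleIso s) lam (some l) X)

theorem Alg.lam_forget (X : Alg D) :
    Alg.forget.map ((liftLam Alg.toStr (Alg.simpleIso s) (lamStr lam)).app X) =
      lam.app X.alg.obj := by
  have key {P : D} {X : Cosimp D} {f g : P ⟶ s.obj X} {c : X ⟶ X} (hc : ∀ n, c.app n = 𝟙 _)
      (h : f ≫ 𝟙 _ ≫ s.map c = g) : f = g := by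
    rwa [map_eq_id s hc, Category.comp_id, Category.comp_id] at h
  exact key (fun _ => rfl) (liftLam_eval Alg.toStr (Alg.simpleIso s) lam none X)

variable {P : Operad D}

/-- λ, being monoidal, is a homomorphism from `P` to the simple of the constant operad `P`, and that
is the operad underlying the simple of the cosimplicial algebra. -/
theorem OperadAlgebra.isHom_lam (A : Cosimp (OperadAlgebra P)) :
    IsHom P.ops ((levelOps (OperadAlgebra.strDiagram A)).map s).operadPart
      fun l => lam.app (P.obj l) := by
  have h := ((lamStr lam).app (Operad.toStr.obj P)).isHom
  exact h.congr fun l => comp_map_eq s fun _ => rfl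

/-- The morphism `λ_P` to the simple of a constant operad. -/
noncomputable def OperadAlgebra.operadLam (A : Cosimp (OperadAlgebra P)) :
    P ⟶ ((Alg.simple s).obj (A ⋙ OperadAlgebra.toAlg P)).operad :=
  Operad.homMk (OperadAlgebra.isHom_lam s lam A)

/-- The simple of a cosimplicial algebra over a fixed operad. -/
noncomputable def OperadAlgebra.simpleObj (A : Cosimp (OperadAlgebra P)) : OperadAlgebra P :=
  OperadAlgebra.restrict ((Alg.simple s).obj (A ⋙ OperadAlgebra.toAlg P))
    (OperadAlgebra.operadLam s lam A)

/-- The canonical morphism from the simple for a fixed operad to the one for variable operads. -/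
noncomputable def OperadAlgebra.simpleComparison (A : Cosimp (OperadAlgebra P)) :
    (OperadAlgebra.toAlg P).obj (OperadAlgebra.simpleObj s lam A) ⟶
      (Alg.simple s).obj (A ⋙ OperadAlgebra.toAlg P) :=
  OperadAlgebra.restrictMap _ _

/-- A morphism of cosimplicial algebras over `P` is the identity on operads, so its simple lies over
the identity and the composite still lies over λ. -/
theorem OperadAlgebra.simpleMap_operad {A B : Cosimp (OperadAlgebra P)} (f : A ⟶ B) (l : ℕ+) :
    (Alg.toOperad ⋙ Operad.eval l).map (OperadAlgebra.simpleComparison s lam A ≫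
      (Alg.simple s).map (Functor.whiskerRight f (OperadAlgebra.toAlg P))) =
        lam.app (P.obj l) :=
  (congrArg (lam.app (P.obj l) ≫ ·) (Alg.simple_map_operad s _ l)).trans
    (comp_map_eq s fun _ => rfl)

theorem OperadAlgebra.simpleMap_forget {A B : Cosimp (OperadAlgebra P)} (f : A ⟶ B) :
    Alg.forget.map (OperadAlgebra.simpleComparison s lam A ≫
      (Alg.simple s).map (Functor.whiskerRight f (OperadAlgebra.toAlg P))) =
        s.map (Functor.whiskerRight f (OperadAlgebra.forget P)) :=
  (Category.id_comp _).trans (Alg.simple_map_forget s _)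

/-- The simple functor on cosimplicial algebras over a fixed operad. -/
noncomputable def OperadAlgebra.simple : Cosimp (OperadAlgebra P) ⥤ OperadAlgebra P where
  obj A := OperadAlgebra.simpleObj s lam A
  map f := OperadAlgebra.restrictLift _ _ (OperadAlgebra.simpleMap_forget s lam f)
    (OperadAlgebra.simpleMap_operad s lam f)
  map_id A := OperadAlgebra.Hom.ext (s.map_id (A ⋙ OperadAlgebra.forget P))
  map_comp f g := OperadAlgebra.Hom.ext (s.map_comp
    (Functor.whiskerRight f (OperadAlgebra.forget P))
    (Functor.whiskerRight g (OperadAlgebra.forget P)))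

theorem OperadAlgebra.simpleComparison_naturality {A B : Cosimp (OperadAlgebra P)} (f : A ⟶ B) :
    (OperadAlgebra.toAlg P).map ((OperadAlgebra.simple s lam).map f) ≫
        OperadAlgebra.simpleComparison s lam B =
      OperadAlgebra.simpleComparison s lam A ≫
        (Alg.simple s).map (Functor.whiskerRight f (OperadAlgebra.toAlg P)) :=
  Alg.Hom.ext
    (Operad.Hom.ext (funext fun l => (Category.id_comp (lam.app (P.obj l))).trans
      (OperadAlgebra.simpleMap_operad s lam f l).symm))
    ((Category.comp_id (s.map (Functor.whiskerRight f (OperadAlgebra.forget P)))).trans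
      (OperadAlgebra.simpleMap_forget s lam f).symm)

/-- The transformation `λ` for algebras over a fixed operad. -/
noncomputable def OperadAlgebra.lamTrans :
    𝟭 (OperadAlgebra P) ⟶ Functor.const SimplexCategory ⋙ OperadAlgebra.simple s lam where
  app A := OperadAlgebra.restrictLift
    ((liftLam Alg.toStr (Alg.simpleIso s) (lamStr lam)).app ((OperadAlgebra.toAlg P).obj A) ≫
      (Alg.simple s).map (constComparisonInv (OperadAlgebra.toAlg P) A)) (lam.app A.obj)
    (by
      have key {Q : D} {X : Cosimp D} {f g : Q ⟶ s.obj X} {c : s.obj X ⟶ s.obj X} {c' : X ⟶ X}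
          (hf : f = g) (hc : c = s.map c') (hc' : ∀ n, c'.app n = 𝟙 _) : f ≫ c = g := by
        rw [hf, hc, comp_map_eq s hc']
      exact key (Alg.lam_forget s lam ((OperadAlgebra.toAlg P).obj A))
        (Alg.simple_map_forget s _) fun _ => rfl)
    fun l => by
      have key {Q : D} {X : Cosimp D} {f g : Q ⟶ s.obj X} {c : s.obj X ⟶ s.obj X} {c' : X ⟶ X}
          (hf : f = g) (hc : c = s.map c') (hc' : ∀ n, c'.app n = 𝟙 _) : f ≫ c = g := by
        rw [hf, hc, comp_map_eq s hc']
      exact key (Alg.lam_operad s lam ((OperadAlgebra.toAlg P).obj A) l)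
        (Alg.simple_map_operad s _ l) fun _ => rfl
  naturality A B f := OperadAlgebra.Hom.ext (lam.naturality ((OperadAlgebra.forget P).map f))

end

section
variable {s} (lam : 𝟭 D ⟶ Functor.const SimplexCategory ⋙ s) [NatTrans.IsMonoidal lam]
  (mu : (Functor.whiskeringRight SimplexCategory _ _).obj s ⋙ s ⟶ diagonal ⋙ s)
  [NatTrans.IsMonoidal mu]
  {P : Operad D}

/-- The comparison of the level-wise simples of a bicosimplicial algebra. -/
noncomputable def OperadAlgebra.levelSimpleComparison (Z : Cosimp (Cosimp (OperadAlgebra P))) :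
    (Z ⋙ OperadAlgebra.simple s lam) ⋙ OperadAlgebra.toAlg P ⟶
      (Z ⋙ (Functor.whiskeringRight SimplexCategory _ _).obj (OperadAlgebra.toAlg P)) ⋙
        Alg.simple s where
  app n := OperadAlgebra.simpleComparison s lam (Z.obj n)
  naturality _ _ f := OperadAlgebra.simpleComparison_naturality s lam (Z.map f)

/-- The morphism which induces the transformation `μ` for algebras over a fixed operad. -/
noncomputable def OperadAlgebra.muComparison (Z : Cosimp (Cosimp (OperadAlgebra P))) :
    (OperadAlgebra.toAlg P).obj
        ((OperadAlgebra.simple s lam).obj (Z ⋙ OperadAlgebra.simple s lam)) ⟶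
      (Alg.simple s).obj (diagonal.obj Z ⋙ OperadAlgebra.toAlg P) :=
  OperadAlgebra.simpleComparison s lam (Z ⋙ OperadAlgebra.simple s lam) ≫
    (Alg.simple s).map (OperadAlgebra.levelSimpleComparison lam Z) ≫
      (liftMu Alg.toStr (Alg.simpleIso s) (muStr mu)).app
          (Z ⋙ (Functor.whiskeringRight SimplexCategory _ _).obj (OperadAlgebra.toAlg P)) ≫
        (Alg.simple s).map (diagonalComparisonInv (OperadAlgebra.toAlg P) Z)

/-- Restriction does not change underlying objects, so all ingredients other than μ are identities
there. -/
theorem OperadAlgebra.muComparison_forget (Z : Cosimp (Cosimp (OperadAlgebra P))) :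
    Alg.forget.map (OperadAlgebra.muComparison lam mu Z) =
      mu.app (Z ⋙ (Functor.whiskeringRight SimplexCategory _ _).obj (OperadAlgebra.forget P)) := by
  have key {X Y W V : Cosimp D} {a : s.obj X ⟶ s.obj Y} {a' : X ⟶ Y} {x : s.obj Y ⟶ s.obj W}
      {d : W ⟶ V} {b : Y ⟶ X} {m : s.obj X ⟶ s.obj V} {e : s.obj W ⟶ s.obj V} {e' : W ⟶ V}
      (ha : a = s.map a') (hx : x ≫ 𝟙 _ ≫ s.map d = 𝟙 _ ≫ s.map b ≫ m) (he : e = s.map e')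
      (hab : ∀ n, a'.app n ≫ b.app n = 𝟙 _) (hde : ∀ n, d.app n = e'.app n) :
      𝟙 _ ≫ a ≫ x ≫ e = m := by
    have h₁ : a' ≫ b = 𝟙 _ := NatTrans.ext (funext hab)
    have h₂ : d = e' := NatTrans.ext (funext hde)
    rw [Category.id_comp, Category.id_comp, h₂] at hx
    rw [ha, he, hx, Category.id_comp, ← s.map_comp_assoc, h₁, s.map_id, Category.id_comp]
  exact key (Alg.simple_map_forget s _) (liftMu_eval Alg.toStr (Alg.simpleIso s) mu none
    (Z ⋙ (Functor.whiskeringRight SimplexCategory _ _).obj (OperadAlgebra.toAlg P)))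
    (Alg.simple_map_forget s _) (fun _ => Category.comp_id _) fun _ => rfl

/-- Applying λ inside the simple after λ is, by naturality, the same as applying λ to the simple;
the compatibility `hlm` of λ with μ then removes the second λ. -/
theorem lam_map_lam_mu (hlm : ∀ X : Cosimp D, lam.app (s.obj X) ≫ s.map (constSimpleTo s X) ≫
      mu.app ((Functor.const SimplexCategory).obj X) ≫ s.map (diagonalConst X) = 𝟙 _)
    (X : D) :
    lam.app X ≫ s.map ((Functor.const SimplexCategory).map (lam.app X) ≫
      constSimpleTo s ((Functor.const SimplexCategory).obj X)) ≫
        mu.app ((Functor.const SimplexCategory).obj ((Functor.const SimplexCategory).obj X)) ≫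
          s.map (diagonalConst ((Functor.const SimplexCategory).obj X)) = lam.app X := by
  have h := lam.naturality (lam.app X)
  simp only [Functor.id_map, Functor.comp_map] at h
  rw [s.map_comp, Category.assoc, ← reassoc_of% h]
  exact (congrArg (lam.app X ≫ ·) (hlm _)).trans (Category.comp_id _)

/-- The double simple is an algebra over `P` through two applications of λ, and the simple of the
diagonal through a single one. By `lam_map_lam_mu`, μ carries one to the other, so it respects the
action of `P`. -/
theorem OperadAlgebra.muComparison_operad (hlm : ∀ X : Cosimp D, lam.app (s.obj X) ≫ s.map (constSimpleTo s X) ≫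
      mu.app ((Functor.const SimplexCategory).obj X) ≫ s.map (diagonalConst X) = 𝟙 _)
    (Z : Cosimp (Cosimp (OperadAlgebra P))) (l : ℕ+) :
    (Alg.toOperad ⋙ Operad.eval l).map (OperadAlgebra.muComparison lam mu Z) =
      lam.app (P.obj l) := by
  have key {Q : D} {C X Y V W : Cosimp D} {L : Q ⟶ s.obj C} {a : s.obj C ⟶ s.obj Y} {a' : C ⟶ Y}
      {x : s.obj Y ⟶ s.obj W} {d : W ⟶ V} {b : Y ⟶ X} {m : s.obj X ⟶ s.obj V}
      {e : s.obj W ⟶ s.obj C} {e' : W ⟶ C} {c : C ⟶ X} {d' : V ⟶ C}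
      (ha : a = s.map a') (hx : x ≫ 𝟙 _ ≫ s.map d = 𝟙 _ ≫ s.map b ≫ m) (he : e = s.map e')
      (hab : ∀ n, a'.app n ≫ b.app n = c.app n) (hde : ∀ n, d.app n ≫ d'.app n = e'.app n)
      (h : L ≫ s.map c ≫ m ≫ s.map d' = L) : L ≫ a ≫ x ≫ e = L := by
    have h₁ : a' ≫ b = c := NatTrans.ext (funext hab)
    have h₂ : d ≫ d' = e' := NatTrans.ext (funext hde)
    rw [Category.id_comp, Category.id_comp] at hx
    rw [ha, he, ← h₂, s.map_comp, reassoc_of% hx, ← s.map_comp_assoc, h₁, h]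
  exact key (Alg.simple_map_operad s _ l) (liftMu_eval Alg.toStr (Alg.simpleIso s) mu (some l)
    (Z ⋙ (Functor.whiskeringRight SimplexCategory _ _).obj (OperadAlgebra.toAlg P)))
    (Alg.simple_map_operad s _ l) (fun _ => rfl) (fun _ => Category.comp_id _)
    (lam_map_lam_mu lam mu hlm (P.obj l))

/-- The transformation `μ` for algebras over a fixed operad. -/
noncomputable def OperadAlgebra.muTrans (hlm : ∀ X : Cosimp D, lam.app (s.obj X) ≫ s.map (constSimpleTo s X) ≫
      mu.app ((Functor.const SimplexCategory).obj X) ≫ s.map (diagonalConst X) = 𝟙 _) :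
    (Functor.whiskeringRight SimplexCategory _ _).obj (OperadAlgebra.simple (P := P) s lam) ⋙
      OperadAlgebra.simple s lam ⟶ diagonal ⋙ OperadAlgebra.simple s lam where
  app Z := OperadAlgebra.restrictLift _ _ (OperadAlgebra.muComparison_forget lam mu Z)
    (OperadAlgebra.muComparison_operad lam mu hlm Z)
  naturality _ _ f := OperadAlgebra.Hom.ext (mu.naturality (Functor.whiskerRight f
    ((Functor.whiskeringRight SimplexCategory _ _).obj (OperadAlgebra.forget P))))

end

end FiberSimple

/-! ### The descent structure on algebras over a fixed operad. -/

section FiberDescent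
variable {D : Type u} [Category.{v} D] [MonoidalCategory D] [SymmetricCategory D]

/-- The simple functor on algebras over a fixed operad is computed on underlying objects. -/
noncomputable def OperadAlgebra.simpleForgetIso (s : Cosimp D ⥤ D) [s.LaxBraided]
    (lam : 𝟭 D ⟶ Functor.const SimplexCategory ⋙ s) [NatTrans.IsMonoidal lam] (P : Operad D) :
    OperadAlgebra.simple s lam ⋙ OperadAlgebra.forget P ≅
      (Functor.whiskeringRight SimplexCategory _ _).obj (OperadAlgebra.forget P) ⋙ s :=
  Iso.refl _

theorem OperadAlgebra.simple_act (s : Cosimp D ⥤ D) [s.LaxBraided]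
    (lam : 𝟭 D ⟶ Functor.const SimplexCategory ⋙ s) [NatTrans.IsMonoidal lam] {P : Operad D}
    (A : Cosimp (OperadAlgebra P)) (l : ℕ+) :
    ((OperadAlgebra.simple s lam).obj A).act l ≫ 𝟙 (s.obj (A ⋙ OperadAlgebra.forget P)) =
      (lam.app (P.obj l) ⊗ₘ tensorFinMap fun _ => 𝟙 (s.obj (A ⋙ OperadAlgebra.forget P))) ≫
        kunneth s _ _ ≫ s.map (levelOperadAlgebraAct A l) := by
  have key {X Y Z V W : D} {g : X ⟶ Y} {q : Z ⟶ Z} (hq : q = 𝟙 Z) {a : Y ⊗ Z ⟶ W}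
      {k : Y ⊗ Z ⟶ V} {m : V ⟶ W} (h : a = k ≫ m) :
      ((g ▷ Z) ≫ a) ≫ 𝟙 W = (g ⊗ₘ q) ≫ k ≫ m := by
    rw [hq, tensorHom_id, Category.comp_id, h]
  exact key (tensorFinMap_id _) (Alg.laxImage_act s (A ⋙ OperadAlgebra.toAlg P) l)

theorem exists_operadAlgebraDescentLift (𝔰 : MonoidalDescentStructure D) (P : Operad D)
    [HasProducts.{w} D] [HasFilteredColimitsOfSize.{w, w} D]
    (hD : ∀ A : D, PreservesFilteredColimitsOfSize.{w, w} (tensorLeft A)) :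
    ∃ 𝔰' : DescentStructure (OperadAlgebra P),
      Nonempty (OperadAlgebraDescentLift.{w} 𝔰 P 𝔰') := by
  let := 𝔰.simpleLax
  have := 𝔰.lam_monoidal
  have := 𝔰.mu_monoidal
  have key₁ {Q : D} {X : Cosimp D} {f : Q ⟶ 𝔰.simple.obj X} {c : X ⟶ X}
      (hc : ∀ n, c.app n = 𝟙 _) : f ≫ 𝟙 _ ≫ 𝔰.simple.map c = f := by
    rw [Category.id_comp, comp_map_eq 𝔰.simple hc]
  have key₂ {X Y : Cosimp D} {f : 𝔰.simple.obj X ⟶ 𝔰.simple.obj Y} {a : X ⟶ X} {c : Y ⟶ Y}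
      (ha : ∀ n, a.app n = 𝟙 _) (hc : ∀ n, c.app n = 𝟙 _) :
      f ≫ 𝟙 _ ≫ 𝔰.simple.map c = 𝟙 _ ≫ 𝔰.simple.map a ≫ f := by
    rw [key₁ hc, map_eq_id 𝔰.simple ha, Category.id_comp, Category.id_comp]
  exact ⟨_, ⟨{ transferDescentLift 𝔰.toDescentStructure (OperadAlgebra.forgetfulFamily hD)
      (lam := OperadAlgebra.lamTrans 𝔰.simple 𝔰.lam)
      (mu := OperadAlgebra.muTrans 𝔰.lam 𝔰.mu 𝔰.lam_mu)
      (fun _ => OperadAlgebra.simpleForgetIso 𝔰.simple 𝔰.lam P)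
      (fun _ _ => key₁ fun _ => rfl) (fun _ _ => key₂ (fun _ => rfl) fun _ => rfl) with
    act := OperadAlgebra.simple_act 𝔰.simple 𝔰.lam }⟩⟩

end FiberDescent

end GodementOperads

theorem theorem3p1p4 {C : Type w} [SmallCategory C] (J : GrothendieckTopology C) {ι : Type w}
    (pts : ι → GrothendieckTopology.Point.{w} J) {D : Type u} [Category.{v} D]
    [MonoidalCategory D] [SymmetricCategory D] (𝔰 : GodementOperads.MonoidalDescentStructure D)
    (hG3 : ∀ A : D, PreservesFilteredColimitsOfSize.{w, w} (tensorLeft A))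
    (h : GodementOperads.Compatible J pts 𝔰.toDescentStructure) :
    (∃ 𝔰' : GodementOperads.DescentStructure (GodementOperads.Operad D),
      Nonempty (GodementOperads.OperadDescentLift.{w} 𝔰 𝔰') ∧
        GodementOperads.Compatible J pts 𝔰') ∧
    (∃ 𝔰' : GodementOperads.DescentStructure (GodementOperads.Alg D),
      Nonempty (GodementOperads.AlgDescentLift.{w} 𝔰 𝔰') ∧
        GodementOperads.Compatible J pts 𝔰') ∧
    ∀ P : GodementOperads.Operad D,
      ∃ 𝔰' : GodementOperads.DescentStructure (GodementOperads.OperadAlgebra P),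
        Nonempty (GodementOperads.OperadAlgebraDescentLift.{w} 𝔰 P 𝔰') ∧
          GodementOperads.Compatible J pts 𝔰' := by
  have := h.hasProducts
  have := h.hasFilteredColimits
  refine ⟨?_, ?_, fun P => ?_⟩
  · obtain ⟨𝔰', ⟨L⟩⟩ := GodementOperads.exists_operadDescentLift 𝔰 hG3
    exact ⟨𝔰', ⟨L⟩, L.compatible (GodementOperads.Operad.forgetfulFamily hG3) h⟩
  · obtain ⟨𝔰', ⟨L⟩⟩ := GodementOperads.exists_algDescentLift 𝔰 hG3
    exact ⟨𝔰', ⟨L⟩, L.compatible (GodementOperads.Alg.forgetfulFamily hG3) h⟩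
  · obtain ⟨𝔰', ⟨L⟩⟩ := GodementOperads.exists_operadAlgebraDescentLift 𝔰 P hG3
    exact ⟨𝔰', ⟨L⟩, L.compatible (GodementOperads.OperadAlgebra.forgetfulFamily hG3) h⟩
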